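/- **Parameters.** Let $\lambda,\lambda_u,W,P_b,P_u,\sigma^2,C_0,\alpha_L,\alpha_N,\beta,\Gamma_{cs},\Gamma_{ra},\tau_{cs},\tau_{ra},T>0$, let $M,N,N_{pa}\ge 1$ be integers with $N\mid M$, and let $h:[0,\infty)\to[0,1]$ be measurable. The initial access protocol is one of four, with $(M_{cs},N_{cs},M_{ra},N_{ra})=(M,N,M,1)$ (baseline), $(M,N,1,1)$ (fast RA), $(m_{cs},N,M,1)$ with $N\le m_{cs}\le M$, $N\mid m_{cs}$ (fast CS), or $(M,1,1,N)$ (omni RX). Put $K=\max(M_{cs},N_{cs})$, $q=K/N$, $\ell_L(r)=\beta r^{\alpha_L}$, $\ell_N(r)=\beta r^{\alpha_N}$. A link of length $r$ is LOS (path loss $\ell_L(r)$) with probability $h(r)$ and NLOS (path loss $\ell_N(r)$) otherwise, independently over links. A user beam of width $\theta<2\pi$ has main lobe gain $G(\theta)=\frac{2\pi}{\theta}\frac{\gamma}{\gamma+1}$ and side lobe gain $g(\theta)=\frac{2\pi}{2\pi-\theta}\frac1{\gamma+1}$ with $\gamma=\frac{2\pi}{C_0(2\pi-\theta)}$, and $G(2\pi)=1$,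 $g(2\pi)=0$. Write $G=G(2\pi/N)$, $g=g(2\pi/N)$. A base station (BS) that sweeps $k$ beams has main lobe gain $k$ and side lobe gain $0$. All fading variables are independent and exponential of mean one. The typical user is at the origin of $\mathbb R^2$, which is divided into the $K$ sectors $\{\text{angle}\in[2\pi (j-1)/K,2\pi j/K)\}$. **Cell search.** BSs form a Poisson process of intensity $\lambda$. A sector is detected if the SINR of its BS of smallest path loss (interference from the other BSs of the sector, noise $\sigma^2/(P_bM_{cs}G(2\pi/N_{cs}))$, all signals normalized by the common transmit power and gains) is at least $\Gamma_{cs}$. Cell search succeeds if some sector is detected. The tagged BS $x_0$ is the BS of smallest path loss $Z_0$ among those so detected. Let $\hat P$ be the probability that cell search succeeds. **Random access.** The typical user sends one of $N_{pa}$ preambles, chosen uniformly. The other users form a Poisson process of intensity $\lambda_u$, independent of the BSs; each takes part independently with probability $\hat P$ and chooses its preamble uniformly. A participant interferes at $x_0$ if it has the preamble of the typical user and lies in the same of the $M_{ra}$ sectors centred at $x_0$ (receive gain $M_{ra}$). It transmits in one of the $N$ beams, which is uniform and independent, except that with omni RX it is the beam of the typical user; its gain is $G$ if that beam covers $x_0$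 and $g$ otherwise. The typical user has gain $G$, transmit powers are $P_u$ and the noise is $\sigma^2$. The number of other users that try to associate with $x_0$ is taken to be an independent Poisson variable of mean $1.28\,\lambda_u\hat P/\lambda$, with independent uniform preambles and receive beams among $N_{pa}$ and $M_{ra}$; there is a collision if one of them agrees with the typical user in both. Initial access succeeds if cell search does, there is no collision, and the preamble SINR at $x_0$ is at least $\Gamma_{ra}$. Let $\eta_{IA}$ be the probability of this. **Data phase.** The useful signal is $P_bMGF_0/Z_0$ with $F_0$ a fresh fading variable, and the noise is $\sigma^2$. Given the outcome of the initial access, the potentially interfering BSs are taken to be an independent Poisson process of intensity $\lambda$ with fresh fading and blockage, from which the points of path loss at most $Z_0$ in detected sectors are removed. Each of them transmits in an independent uniform beam among $M$ and is received only if the beam covers the origin, with gain $MG$ or $Mg$ according as it lies in the user beam (of width $2\pi/N$) that contains $x_0$ or not. Let $P_{DL}(\Gamma)=\mathbb P(\mathrm{SINR}_{DL}\ge\Gamma\mid\text{initial access succeeds})$. The number of other users connected to $x_0$ is taken to be Poisson of mean $1.28\lambda_u\eta_{IA}/\lambda$, and the average scheduling probability $\eta_s$ is the inverse of one plus the mean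 of that number. The average user-perceived downlink throughput is $$\bar R=\Bigl(1-\min\bigl(\tfrac{M_{cs}N_{cs}\tau_{cs}+M_{ra}N_{ra}\tau_{ra}}{T},1\bigr)\Bigr)\,\eta_{IA}\,\mathbb E\bigl[\eta_s W\log_2(1+\mathrm{SINR}_{DL})\bigm|\text{initial access succeeds}\bigr].$$ **Functions.** With $e^{-\infty}=0$, $\ell_L^{-1}(z)=(z/\beta)^{1/\alpha_L}$ and $\ell_N^{-1}(z)=(z/\beta)^{1/\alpha_N}$, let $$V(z,t,\nu)=\exp\Bigl\{-2\pi\nu\Bigl(\int_{\ell_L^{-1}(z)}^\infty\frac{tz\,h(r)\,r\,dr}{tz+\ell_L(r)}+\int_{\ell_N^{-1}(z)}^\infty\frac{tz(1-h(r))\,r\,dr}{tz+\ell_N(r)}\Bigr)\Bigr\},$$ and let $U(z,t,\nu)$ be the same with both lower limits replaced by $0$. Let $$f(z)=\frac{2\pi\lambda}{K}\Bigl[\tfrac{1}{\alpha_L}\beta^{-2/\alpha_L}z^{2/\alpha_L-1}h(\ell_L^{-1}(z))+\tfrac1{\alpha_N}\beta^{-2/\alpha_N}z^{2/\alpha_N-1}\bigl(1-h(\ell_N^{-1}(z))\bigr)\Bigr]\exp\Bigl\{-\frac{2\pi\lambda}{K}\Bigl(\int_0^{\ell_L^{-1}(z)}h(r)r\,dr+\int_0^{\ell_N^{-1}(z)}(1-h(r))r\,dr\Bigr)\Bigr\},$$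 $\tilde P(z)=\exp\bigl(-\frac{\Gamma_{cs}z\sigma^2}{P_bM_{cs}G(2\pi/N_{cs})}\bigr)V(z,\Gamma_{cs},\lambda/K)$, $P(z)=\int_z^\infty\tilde P(y)f(y)\,dy$, $P=P(0)$, $\hat P_*=1-(1-P)^K$, $P_{co}=\exp\bigl(-\frac{1.28\lambda_u\hat P_*}{\lambda N_{pa}M_{ra}}\bigr)$, $$P_{ra}(z)=\exp\Bigl(-\frac{\Gamma_{ra}z\sigma^2}{P_uM_{ra}G}\Bigr)U\Bigl(z,\Gamma_{ra},\frac{\lambda_u\hat P_*}{NM_{ra}N_{pa}}\Bigr)U\Bigl(z,\frac gG\Gamma_{ra},\bigl(1-\tfrac1N\bigr)\frac{\lambda_u\hat P_*}{M_{ra}N_{pa}}\Bigr).$$ **Theorem 3.** The initial access success probability is $$\eta_{IA}=\int_0^\infty K\,(P(z)+1-P)^{K-1}\tilde P(z)\,P_{co}\,P_{ra}(z)\,f(z)\,dz .$$ For all $\Gamma\ge0$, with $\nu=\lambda/(MK)$ (and both sides read as $0$ if $\eta_{IA}=0$), $$P_{DL}(\Gamma)=\frac1{\eta_{IA}}\int_0^\infty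 e^{-\frac{\Gamma z\sigma^2}{P_bMG}}K\bigl[V(z,\Gamma,\nu)P(z)+U(z,\Gamma,\nu)(1-P)\bigr]^{q-1}\bigl[P(z)V(z,\tfrac gG\Gamma,\nu)+(1-P)U(z,\tfrac gG\Gamma,\nu)\bigr]^{K-q}V(z,\Gamma,\nu)\tilde P(z)P_{ra}(z)P_{co}f(z)\,dz .$$ The conditional mean rate is finite, and the average user-perceived downlink throughput is $$\bar R=\max\Bigl(0,1-\frac{M_{cs}N_{cs}\tau_{cs}+M_{ra}N_{ra}\tau_{ra}}{T}\Bigr)\times\frac{\eta_{IA}}{1+1.28\,\lambda_u\eta_{IA}/\lambda}\times\int_0^\infty\frac{W}{\ln 2}\,\frac{P_{DL}(\Gamma)}{1+\Gamma}\,d\Gamma ,$$ where the last integral converges. -/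

import Mathlib

open MeasureTheory ProbabilityTheory
open scoped ENNReal

noncomputable section

namespace InitialAccess

/-! ## System parameters -/

/-- The four initial access protocols. In `fastCS m` the base stations sweep `m` wide beams during
cell search. -/
inductive Protocol where
  | baseline
  | fastRA
  | fastCS (m : ℕ)
  | omniRX

/-- The deterministic parameters of the network (all powers, gains and thresholds in linear scale),
with the standing assumptions on them. -/
structure Params where
  /-- the initial access protocol in use -/
  protocol : Protocol
  /-- intensity of the base stations -/
  lam : ℝ
  /-- intensity of the users -/
  lamU : ℝ
  /-- system bandwidth -/
  W : ℝ
  /-- base station transmit power -/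
  Pb : ℝ
  /-- user transmit power -/
  Pu : ℝ
  /-- total thermal noise power (sigma squared) -/
  noise : ℝ
  /-- constant of the user antenna pattern -/
  C0 : ℝ
  /-- number of antennas and of beam directions of a base station -/
  M : ℕ
  /-- number of antennas and of beam directions of a user -/
  N : ℕ
  /-- number of random access preambles -/
  Npa : ℕ
  /-- LOS path loss exponent -/
  alphaL : ℝ
  /-- NLOS path loss exponent -/
  alphaN : ℝ
  /-- path loss at reference distance one -/
  beta : ℝ
  /-- SINR threshold of cell search -/
  Gcs : ℝ
  /-- SINR threshold of random access -/
  Gra : ℝ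
  /-- duration of a synchronization signal -/
  tauCs : ℝ
  /-- duration of a random access preamble -/
  tauRa : ℝ
  /-- period of an initial access cycle -/
  T : ℝ
  /-- probability that a link of a given length is LOS -/
  h : ℝ → ℝ
  lam_pos : 0 < lam
  lamU_pos : 0 < lamU
  W_pos : 0 < W
  Pb_pos : 0 < Pb
  Pu_pos : 0 < Pu
  noise_pos : 0 < noise
  C0_pos : 0 < C0
  M_pos : 0 < M
  N_pos : 0 < N
  N_dvd_M : N ∣ M
  Npa_pos : 0 < Npa
  alphaL_pos : 0 < alphaL
  alphaN_pos : 0 < alphaN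
  beta_pos : 0 < beta
  Gcs_pos : 0 < Gcs
  Gra_pos : 0 < Gra
  tauCs_pos : 0 < tauCs
  tauRa_pos : 0 < tauRa
  T_pos : 0 < T
  h_measurable : Measurable h
  h_mem : ∀ r, 0 ≤ r → h r ∈ Set.Icc (0 : ℝ) 1
  /-- the number of wide beams lies between `N` and `M`, and a user beam consists of a whole number
  of the resulting sectors -/
  fastCS_beams : ∀ m, protocol = Protocol.fastCS m → N ≤ m ∧ m ≤ M ∧ N ∣ m

namespace Params

variable (p : Params)

/-- Number of base station beams swept in cell search. -/
def Mcs : ℕ :=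
  match p.protocol with
  | .baseline => p.M
  | .fastRA => p.M
  | .fastCS m => m
  | .omniRX => p.M

/-- Number of user beams swept in cell search. -/
def Ncs : ℕ :=
  match p.protocol with
  | .baseline => p.N
  | .fastRA => p.N
  | .fastCS _ => p.N
  | .omniRX => 1

/-- Number of base station beams swept in random access. -/
def Mra : ℕ :=
  match p.protocol with
  | .baseline => p.M
  | .fastRA => 1
  | .fastCS _ => p.M
  | .omniRX => 1

/-- Number of user beams swept in random access. -/
def Nra : ℕ :=
  match p.protocol with
  | .baseline => 1
  | .fastRA => 1
  | .fastCS _ => 1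
  | .omniRX => p.N

/-- Number of base station sectors seen by the typical user in cell search. -/
def Kcs : ℕ := max p.Mcs p.Ncs

/-- Number of base station sectors in a main lobe of the user. -/
def q : ℕ := p.Kcs / p.N

/-- Front-back power ratio of a user beam of width `θ`. -/
def gam (θ : ℝ) : ℝ := 2 * Real.pi / (p.C0 * (2 * Real.pi - θ))

/-- Main lobe gain of a user beam of width `θ`. An omnidirectional beam has gain one
(infinite front-back ratio). -/
def mainGain (θ : ℝ) : ℝ :=
  if θ = 2 * Real.pi then 1 else 2 * Real.pi / θ * (p.gam θ / (p.gam θ + 1))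

/-- Side lobe gain of a user beam of width `θ`. An omnidirectional beam has no side lobe. -/
def sideGain (θ : ℝ) : ℝ :=
  if θ = 2 * Real.pi then 0
  else 2 * Real.pi / (2 * Real.pi - θ) * (1 / (p.gam θ + 1))

/-- Main lobe gain of the user beams of width `2 * π / N`. -/
def GN : ℝ := p.mainGain (2 * Real.pi / p.N)

/-- Side lobe gain of the user beams of width `2 * π / N`. -/
def gN : ℝ := p.sideGain (2 * Real.pi / p.N)

/-- LOS path loss at distance `r`, in linear scale. -/
def lossL (r : ℝ) : ℝ := p.beta * r ^ p.alphaL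

/-- NLOS path loss at distance `r`, in linear scale. -/
def lossN (r : ℝ) : ℝ := p.beta * r ^ p.alphaN

/-- Path loss of a link of length `r` whose LOS mark is `v`. For `v` uniform on `[0, 1]` the link is
LOS with probability `h r`. -/
def linkLoss (v r : ℝ) : ℝ := if v < p.h r then p.lossL r else p.lossN r

/-- Mean area of the association cell of the tagged base station. -/
def cellArea : ℝ := 1.28 / p.lam

/-- Total duration of initial access in a cycle. -/
def overhead : ℝ := p.Mcs * p.Ncs * p.tauCs + p.Mra * p.Nra * p.tauRa

/-- The initial access overhead, as a fraction of the cycle. -/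
def etaTO : ℝ := min (p.overhead / p.T) 1

end Params

/-! ## Sectors and marked Poisson processes in the plane `ℂ` -/

/-- The angle of `v`, in `[0, 2 * π)`. -/
def angle (v : ℂ) : ℝ := if 0 ≤ v.arg then v.arg else v.arg + 2 * Real.pi

/-- The index `j < K` with angle of `v` in `[2 * π * j / K, 2 * π * (j + 1) / K)`. -/
def sectorIdx (K : ℕ) (v : ℂ) : ℕ := ⌊angle v / (2 * Real.pi / K)⌋₊

/-- Number of points of the sequence `X` in `B`. -/
def pointCount {Ω : Type*} (X : ℕ → Ω → ℂ) (B : Set ℂ) (ω : Ω) : ℕ∞ := {i | X i ω ∈ B}.encard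

/-- The Poisson law of mean `m`. -/
def poissonLaw (m : ℝ) : Measure ℕ := poissonMeasure m.toNNReal

/-- The uniform law on `[0, 1]`. -/
def unifLaw : Measure ℝ := volume.restrict (Set.Icc 0 1)

/-- The uniform law on `{0, ..., n - 1}`. -/
def unifFin (n : ℕ) : Measure (Fin n) := uniformOn Set.univ

/-- The points `X i` form a homogeneous Poisson point process of intensity `lam` in the plane. -/
structure IsPoissonProcess {Ω : Type*} [MeasurableSpace Ω] (μ : Measure Ω) (X : ℕ → Ω → ℂ)
    (lam : ℝ) : Prop where
  measurable : ∀ i, Measurable (X i)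
  count_law : ∀ B : Set ℂ, MeasurableSet B → volume B ≠ ⊤ → ∀ k : ℕ,
    μ {ω | pointCount X B ω = k} = poissonLaw (lam * (volume B).toReal) {k}
  count_indep : ∀ (n : ℕ) (B : Fin n → Set ℂ), (∀ j, MeasurableSet (B j)) →
    Pairwise (fun i j => Disjoint (B i) (B j)) → iIndepFun (fun j => pointCount X (B j)) μ

/-- The random variables `X i` are independent with law `ν`. -/
structure IsIID {Ω 𝓜 : Type*} [MeasurableSpace Ω] [MeasurableSpace 𝓜] (μ : Measure Ω)
    (X : ℕ → Ω → 𝓜) (ν : Measure 𝓜) : Prop where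
  measurable : ∀ i, Measurable (X i)
  law : ∀ i, μ.map (X i) = ν
  indep : iIndepFun X μ

/-- The points `X i` form a homogeneous Poisson point process of intensity `lam`, whose points carry
independent marks of law `ν`. -/
structure IsMarkedPoisson {Ω 𝓜 : Type*} [MeasurableSpace Ω] [MeasurableSpace 𝓜] (μ : Measure Ω)
    (X : ℕ → Ω → ℂ) (mark : ℕ → Ω → 𝓜) (lam : ℝ) (ν : Measure 𝓜) : Prop where
  points : IsPoissonProcess μ X lam
  marks : IsIID μ mark ν
  indep : IndepFun (fun ω i => X i ω) (fun ω i => mark i ω) μ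

/-! ## The network, seen from the typical user at the origin -/

/-- The random elements of the network in one initial access cycle. -/
structure Network (p : Params) (Ω : Type*) where
  /-- base stations: position, LOS mark of the link to the typical user, fading in cell search -/
  bsPos : ℕ → Ω → ℂ
  bsLos : ℕ → Ω → ℝ
  bsFading : ℕ → Ω → ℝ
  /-- other users: position, LOS mark of the link to the tagged base station, fading, mark deciding
  whether cell search succeeded, preamble, and beam direction found in cell search -/
  userPos : ℕ → Ω → ℂ
  userLos : ℕ → Ω → ℝ
  userFading : ℕ → Ω → ℝ
  userActive : ℕ → Ω → ℝ
  userPreamble : ℕ → Ω → Fin p.Npa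
  userBeam : ℕ → Ω → Fin p.N
  /-- field of the interfering base stations in the data phase: position, LOS mark, fading, and
  beam direction in use -/
  dlPos : ℕ → Ω → ℂ
  dlLos : ℕ → Ω → ℝ
  dlFading : ℕ → Ω → ℝ
  dlBeam : ℕ → Ω → Fin p.M
  /-- typical user: fading in random access, fading in the data phase, preamble -/
  raFading0 : Ω → ℝ
  dlFading0 : Ω → ℝ
  preamble0 : Ω → Fin p.Npa
  /-- the number of other users that try to associate with the tagged base station, with their
  preambles and the base station beams under which they are received -/
  contenders : Ω → ℕ
  contPreamble : ℕ → Ω → Fin p.Npa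
  contBeam : ℕ → Ω → Fin p.Mra
  /-- number of other users connected to the tagged base station in the data phase -/
  load : Ω → ℕ

namespace Network

variable {p : Params} {Ω : Type*} (S : Network p Ω)

/-! ### Cell search -/

/-- Path loss from base station `i` to the typical user. -/
def bsLoss (i : ℕ) (ω : Ω) : ℝ := p.linkLoss (S.bsLos i ω) ‖S.bsPos i ω‖

/-- The base station sector that contains base station `i`. -/
def bsSector (i : ℕ) (ω : Ω) : ℕ := sectorIdx p.Kcs (S.bsPos i ω)

open Classical in
/-- SINR of the synchronization signal of base station `i` (beams aligned). The other base stations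
of the same sector interfere. -/
def syncSINR (i : ℕ) (ω : Ω) : ℝ≥0∞ :=
  ENNReal.ofReal (S.bsFading i ω / S.bsLoss i ω) /
    ((∑' k, if k ≠ i ∧ S.bsSector k ω = S.bsSector i ω then
        ENNReal.ofReal (S.bsFading k ω / S.bsLoss k ω) else 0) +
      ENNReal.ofReal (p.noise / (p.Pb * p.Mcs * p.mainGain (2 * Real.pi / p.Ncs))))

/-- Base station `i` has the smallest path loss in its sector and it is detected. -/
def Detects (i : ℕ) (ω : Ω) : Prop :=
  (∀ k, S.bsSector k ω = S.bsSector i ω → S.bsLoss i ω ≤ S.bsLoss k ω) ∧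
    ENNReal.ofReal p.Gcs ≤ S.syncSINR i ω

/-- Sector `j` is detected. -/
def SectorDetected (j : ℕ) (ω : Ω) : Prop := ∃ i, S.bsSector i ω = j ∧ S.Detects i ω

/-- Cell search is successful: at least one sector is detected. -/
def csSuccess : Set Ω := {ω | ∃ i, S.Detects i ω}

/-- The index of the tagged base station: the one of smallest path loss among the detected ones
(ties have probability zero). Only meaningful if cell search is successful. -/
def tagged (ω : Ω) : ℕ :=
  sInf {i | S.Detects i ω ∧ ∀ k, S.Detects k ω → S.bsLoss i ω ≤ S.bsLoss k ω}

/-- Position of the tagged base station. -/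
def x0 (ω : Ω) : ℂ := S.bsPos (S.tagged ω) ω

/-- Path loss between the typical user and the tagged base station. -/
def Z0 (ω : Ω) : ℝ := S.bsLoss (S.tagged ω) ω

variable [MeasurableSpace Ω] (μ : Measure Ω)

/-- Success probability of cell search. -/
def csSuccessProb : ℝ := μ.real S.csSuccess

/-! ### Random access -/

/-- Path loss from user `i` to the tagged base station. -/
def userLoss (i : ℕ) (ω : Ω) : ℝ := p.linkLoss (S.userLos i ω) ‖S.userPos i ω - S.x0 ω‖

/-- User `i` interferes with the preamble of the typical user: it takes part in random access (which
happens with the success probability of cell search), uses the same preamble, and lies in the same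
receive beam of the tagged base station. -/
def RaInterferes (i : ℕ) (ω : Ω) : Prop :=
  S.userActive i ω < S.csSuccessProb μ ∧ S.userPreamble i ω = S.preamble0 ω ∧
    sectorIdx p.Mra (S.userPos i ω - S.x0 ω) = sectorIdx p.Mra (-S.x0 ω)

/-- The beam in which user `i` transmits while the beams of the typical user and of the tagged base
station are aligned: with the omni RX protocol all users sweep synchronously; otherwise a user
transmits in the direction that it found in cell search. -/
def userTxBeam (i : ℕ) (ω : Ω) : ℕ :=
  match p.protocol with
  | .omniRX => sectorIdx p.N (S.x0 ω)
  | _ => S.userBeam i ω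

/-- Antenna gain of user `i` towards the tagged base station. -/
def userGain (i : ℕ) (ω : Ω) : ℝ :=
  if sectorIdx p.N (S.x0 ω - S.userPos i ω) = S.userTxBeam i ω then p.GN else p.gN

open Classical in
/-- SINR of the preamble of the typical user at the tagged base station. -/
def preambleSINR (ω : Ω) : ℝ≥0∞ :=
  ENNReal.ofReal (S.raFading0 ω * (p.Mra * p.GN) / S.Z0 ω) /
    ((∑' i, if S.RaInterferes μ i ω then
        ENNReal.ofReal (S.userFading i ω * (p.Mra * S.userGain i ω) / S.userLoss i ω) else 0) +
      ENNReal.ofReal (p.noise / p.Pu))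

/-- No other user that tries to associate with the tagged base station collides with the typical
user: same preamble, received under the same beam. -/
def NoCollision (ω : Ω) : Prop :=
  ∀ i < S.contenders ω, ¬ (S.contPreamble i ω = S.preamble0 ω ∧
    (S.contBeam i ω : ℕ) = sectorIdx p.Mra (-S.x0 ω))

/-- Initial access of the typical user is successful. -/
def iaSuccess : Set Ω :=
  {ω | ω ∈ S.csSuccess ∧ S.NoCollision ω ∧ ENNReal.ofReal p.Gra ≤ S.preambleSINR μ ω}

/-- Success probability of initial access. -/
def etaIA : ℝ := μ.real (S.iaSuccess μ)

/-! ### Data phase -/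

/-- Path loss from the interfering base station `k` to the typical user. -/
def dlLoss (k : ℕ) (ω : Ω) : ℝ := p.linkLoss (S.dlLos k ω) ‖S.dlPos k ω‖

/-- The base station `k` of the data phase field interferes: its beam covers the typical user, and,
if its sector was detected in cell search, its path loss exceeds that of the tagged base station. -/
def DlInterferes (k : ℕ) (ω : Ω) : Prop :=
  (S.dlBeam k ω : ℕ) = sectorIdx p.M (-S.dlPos k ω) ∧
    (S.SectorDetected (sectorIdx p.Kcs (S.dlPos k ω)) ω → S.Z0 ω < S.dlLoss k ω)

/-- Gain of the typical user, whose main lobe covers the tagged base station, towards the interfering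
base station `k`. -/
def dlGain (k : ℕ) (ω : Ω) : ℝ :=
  if sectorIdx p.N (S.dlPos k ω) = sectorIdx p.N (S.x0 ω) then p.GN else p.gN

open Classical in
/-- SINR of the typical user in the data phase. -/
def dlSINR (ω : Ω) : ℝ≥0∞ :=
  ENNReal.ofReal (p.Pb * p.M * p.GN * S.dlFading0 ω / S.Z0 ω) /
    ((∑' k, if S.DlInterferes k ω then
        ENNReal.ofReal (p.Pb * p.M * S.dlGain k ω * S.dlFading k ω / S.dlLoss k ω) else 0) +
      ENNReal.ofReal p.noise)

/-- CCDF of the data phase SINR given successful initial access. -/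
def PDL (Γ : ℝ) : ℝ := (μ[|S.iaSuccess μ]).real {ω | ENNReal.ofReal Γ ≤ S.dlSINR ω}

/-- Average scheduling probability: the inverse of the mean number of users connected to the tagged
base station, including the typical user. -/
def etaS : ℝ := 1 / ∫ ω, (1 + (S.load ω : ℝ)) ∂μ

/-- Downlink rate of the typical user, once it is connected. -/
def rate (ω : Ω) : ℝ := S.etaS μ * (p.W * Real.logb 2 (1 + (S.dlSINR ω).toReal))

/-- The average user-perceived downlink throughput. -/
def avgUPT : ℝ := (1 - p.etaTO) * S.etaIA μ * ∫ ω, S.rate μ ω ∂(μ[|S.iaSuccess μ])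

/-! ### The law of the network -/

/-- The base stations with their marks. -/
def bs (ω : Ω) (i : ℕ) : ℂ × ℝ × ℝ := (S.bsPos i ω, S.bsLos i ω, S.bsFading i ω)

/-- The marks of user `i`. -/
def userMark (i : ℕ) (ω : Ω) : ℝ × ℝ × ℝ × Fin p.Npa × Fin p.N :=
  (S.userLos i ω, S.userFading i ω, S.userActive i ω, S.userPreamble i ω, S.userBeam i ω)

/-- The users with their marks. -/
def users (ω : Ω) (i : ℕ) : ℂ × ℝ × ℝ × ℝ × Fin p.Npa × Fin p.N := (S.userPos i ω, S.userMark i ω)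

/-- The marks of the interfering base station `k`. -/
def dlMark (k : ℕ) (ω : Ω) : ℝ × ℝ × Fin p.M := (S.dlLos k ω, S.dlFading k ω, S.dlBeam k ω)

/-- The interfering base stations of the data phase with their marks. -/
def dl (ω : Ω) (k : ℕ) : ℂ × ℝ × ℝ × Fin p.M := (S.dlPos k ω, S.dlMark k ω)

/-- The fading variables and the preamble of the typical user. -/
def typical (ω : Ω) : ℝ × ℝ × Fin p.Npa := (S.raFading0 ω, S.dlFading0 ω, S.preamble0 ω)

/-- The preamble and the beam of contender `i`. -/
def contMark (i : ℕ) (ω : Ω) : Fin p.Npa × Fin p.Mra := (S.contPreamble i ω, S.contBeam i ω)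

/-- The contenders. -/
def cont (ω : Ω) : ℕ × (ℕ → Fin p.Npa × Fin p.Mra) := (S.contenders ω, fun i => S.contMark i ω)

/-- The distribution of the network. -/
structure HasLaw : Prop where
  /-- base stations: a Poisson process; independent blockage and Rayleigh fading -/
  bs_law : IsMarkedPoisson μ S.bsPos (fun i ω => (S.bsLos i ω, S.bsFading i ω)) p.lam
    (unifLaw.prod (expMeasure 1))
  /-- users: a Poisson process; independent blockage, Rayleigh fading, thinning, uniform preambles
  and uniform beam directions -/
  user_law : IsMarkedPoisson μ S.userPos S.userMark p.lamU
    (unifLaw.prod ((expMeasure 1).prod (unifLaw.prod ((unifFin p.Npa).prod (unifFin p.N)))))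
  /-- interfering base stations of the data phase: as for the base stations, all transmitting in
  uniform beam directions -/
  dl_law : IsMarkedPoisson μ S.dlPos S.dlMark p.lam
    (unifLaw.prod ((expMeasure 1).prod (unifFin p.M)))
  typical_measurable : Measurable S.typical
  typical_law : μ.map S.typical = (expMeasure 1).prod ((expMeasure 1).prod (unifFin p.Npa))
  /-- contenders: a Poisson process, of the intensity of the users that succeeded in cell search, on
  the mean cell area of the tagged base station; uniform preambles and beams -/
  contenders_measurable : Measurable S.contenders
  contenders_law : μ.map S.contenders = poissonLaw (p.lamU * S.csSuccessProb μ * p.cellArea)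
  cont_marks : IsIID μ S.contMark ((unifFin p.Npa).prod (unifFin p.Mra))
  cont_indep : IndepFun S.contenders (fun ω i => S.contMark i ω) μ
  /-- connected users: a Poisson process, of the intensity of the users that succeeded in initial
  access, on the mean cell area of the tagged base station -/
  load_measurable : Measurable S.load
  load_law : μ.map S.load = poissonLaw (p.lamU * S.etaIA μ * p.cellArea)
  /-- the five groups of random elements above are mutually independent -/
  indep : iIndep ![MeasurableSpace.comap S.bs inferInstance,
    MeasurableSpace.comap S.users inferInstance, MeasurableSpace.comap S.dl inferInstance,
    MeasurableSpace.comap S.typical inferInstance, MeasurableSpace.comap S.cont inferInstance] μ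

end Network

/-! ## The closed-form expressions -/

/-- `exp (-x)`, with `exp (-∞) = 0`. -/
def expNeg (x : ℝ≥0∞) : ℝ := if x = ⊤ then 0 else Real.exp (-x.toReal)

namespace Params

variable (p : Params)

/-- The distance at which the LOS path loss is `z`. -/
def invL (z : ℝ) : ℝ := (z / p.beta) ^ (1 / p.alphaL)

/-- The distance at which the NLOS path loss is `z`. -/
def invN (z : ℝ) : ℝ := (z / p.beta) ^ (1 / p.alphaN)

/-- Interference integral over LOS links longer than `a` and NLOS links longer than `b`. -/
def interf (z T a b : ℝ) : ℝ≥0∞ :=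
  (∫⁻ r in Set.Ioi a, ENNReal.ofReal (T * z * p.h r * r / (T * z + p.lossL r))) +
    ∫⁻ r in Set.Ioi b, ENNReal.ofReal (T * z * (1 - p.h r) * r / (T * z + p.lossN r))

/-- Laplace functional of the interference from the links of path loss greater than `z`. -/
def V (z T l : ℝ) : ℝ :=
  expNeg (ENNReal.ofReal (2 * Real.pi * l) * p.interf z T (p.invL z) (p.invN z))

/-- Laplace functional of the interference from all links. -/
def U (z T l : ℝ) : ℝ := expNeg (ENNReal.ofReal (2 * Real.pi * l) * p.interf z T 0 0)

/-- Density of the minimum path loss in a base station sector. -/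
def fZ1 (z : ℝ) : ℝ :=
  let c : ℝ := 2 * Real.pi * p.lam / p.Kcs
  let eL : ℝ := Real.exp (-c * ∫ r in Set.Ioc 0 (p.invL z), p.h r * r)
  let eN : ℝ := Real.exp (-c * ∫ r in Set.Ioc 0 (p.invN z), (1 - p.h r) * r)
  c * (1 / p.alphaL) * (1 / p.beta) ^ (2 / p.alphaL) * z ^ (2 / p.alphaL - 1) * p.h (p.invL z)
      * eL * eN +
    c * (1 / p.alphaN) * (1 / p.beta) ^ (2 / p.alphaN) * z ^ (2 / p.alphaN - 1)
      * (1 - p.h (p.invN z)) * eN * eL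

/-- Detection probability of a sector whose minimum path loss is `z`. -/
def Ptilde (z : ℝ) : ℝ :=
  Real.exp (-(p.Gcs * z * p.noise / (p.Pb * p.Mcs * p.mainGain (2 * Real.pi / p.Ncs)))) *
    p.V z p.Gcs (p.lam / p.Kcs)

/-- Probability that a sector is detected and that its minimum path loss is at least `z0`. -/
def Pbeyond (z0 : ℝ) : ℝ := ∫ z in Set.Ioi z0, p.Ptilde z * p.fZ1 z

/-- Detection probability of a sector. -/
def Pdet : ℝ := ∫ z in Set.Ioi (0 : ℝ), p.Ptilde z * p.fZ1 z

/-- Success probability of cell search. -/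
def Phat : ℝ := 1 - (1 - p.Pdet) ^ p.Kcs

/-- Probability of no preamble collision. -/
def Pco : ℝ := Real.exp (-(1.28 * p.lamU * p.Phat / (p.lam * p.Npa * p.Mra)))

/-- Probability that the preamble is received, if the path loss to the tagged base station is `z`. -/
def Pra (z : ℝ) : ℝ :=
  Real.exp (-(p.Gra * z * p.noise / (p.Pu * p.Mra * p.GN))) *
    p.U z p.Gra (p.lamU * p.Phat / (p.N * p.Mra * p.Npa)) *
    p.U z (p.gN / p.GN * p.Gra) ((1 - 1 / p.N) * (p.lamU * p.Phat / (p.Mra * p.Npa)))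

/-- Success probability of initial access, in closed form. -/
def etaIAFormula : ℝ :=
  ∫ z in Set.Ioi (0 : ℝ), p.Kcs * (p.Pbeyond z + 1 - p.Pdet) ^ (p.Kcs - 1) * p.Ptilde z * p.Pco *
    p.Pra z * p.fZ1 z

/-- CCDF of the data phase SINR given successful initial access, in closed form. -/
def PDLFormula (Γ : ℝ) : ℝ :=
  let l : ℝ := p.lam / (p.M * p.Kcs)
  1 / p.etaIAFormula * ∫ z in Set.Ioi (0 : ℝ),
    Real.exp (-(Γ * z * p.noise / (p.Pb * p.M * p.GN))) * p.Kcs *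
      (p.V z Γ l * p.Pbeyond z + p.U z Γ l * (1 - p.Pdet)) ^ (p.q - 1) *
      (p.Pbeyond z * p.V z (p.gN / p.GN * Γ) l +
        (1 - p.Pdet) * p.U z (p.gN / p.GN * Γ) l) ^ (p.Kcs - p.q) *
      p.V z Γ l * p.Ptilde z * p.Pra z * p.Pco * p.fZ1 z

end Params

end InitialAccess

end

noncomputable section
set_option linter.unusedSectionVars false
namespace InitialAccess
open Filter Topology

/-! ## The function `exp (-x)` on `[0, ∞]` -/

/-- `exp (-x)` as a function from `[0, ∞]` to itself. -/
def eN (x : ℝ≥0∞) : ℝ≥0∞ := ENNReal.ofReal (expNeg x)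

lemma expNeg_nonneg (x : ℝ≥0∞) : 0 ≤ expNeg x := by
  unfold expNeg; split_ifs <;> positivity

lemma expNeg_le_one (x : ℝ≥0∞) : expNeg x ≤ 1 := by
  unfold expNeg; split_ifs
  · norm_num
  · simp

@[simp] lemma eN_zero : eN 0 = 1 := by simp [eN, expNeg]

@[simp] lemma eN_top : eN ⊤ = 0 := by simp [eN, expNeg]

lemma eN_le_one (x : ℝ≥0∞) : eN x ≤ 1 := by
  simpa [eN] using expNeg_le_one x

lemma eN_ne_top (x : ℝ≥0∞) : eN x ≠ ⊤ := ENNReal.ofReal_ne_top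

lemma eN_ofReal {x : ℝ} (hx : 0 ≤ x) : eN (ENNReal.ofReal x) = ENNReal.ofReal (Real.exp (-x)) := by
  simp [eN, expNeg, hx]

lemma eN_pos {x : ℝ≥0∞} (hx : x ≠ ⊤) : 0 < eN x := by
  simp [eN, expNeg, hx, Real.exp_pos]

lemma eN_add (x y : ℝ≥0∞) : eN (x + y) = eN x * eN y := by
  rcases eq_or_ne x ⊤ with rfl | hx
  · simp
  rcases eq_or_ne y ⊤ with rfl | hy
  · simp
  rw [eN, eN, eN, ← ENNReal.ofReal_mul (expNeg_nonneg _)]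
  simp [expNeg, hx, hy, ENNReal.toReal_add hx hy, ← Real.exp_add, add_comm]

lemma eN_antitone : Antitone eN := by
  intro x y hxy
  obtain ⟨z, rfl⟩ := exists_add_of_le hxy
  rw [eN_add]
  exact mul_le_of_le_one_right' (eN_le_one z)

lemma continuous_eN : Continuous eN := by
  have : eN = fun x : ℝ≥0∞ => EReal.exp (-(x : EReal)) := by
    funext x
    induction x with
    | top => simp
    | coe x =>
      have hx : (0 : ℝ) ≤ x := x.coe_nonneg
      rw [← ENNReal.ofReal_coe_nnreal, eN_ofReal hx, EReal.coe_ennreal_ofReal,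
        max_eq_left hx, ← EReal.coe_neg, EReal.exp_coe]
  rw [this]
  exact ENNReal.continuous_exp.comp (continuous_neg.comp continuous_coe_ennreal_ereal)

@[fun_prop] lemma measurable_eN : Measurable eN := continuous_eN.measurable

lemma eN_iSup {ι : Sort*} [Nonempty ι] (f : ι → ℝ≥0∞) : eN (⨆ i, f i) = ⨅ i, eN (f i) :=
  eN_antitone.map_ciSup_of_continuousAt continuous_eN.continuousAt

lemma eN_sum {ι : Type*} (s : Finset ι) (f : ι → ℝ≥0∞) :
    eN (∑ i ∈ s, f i) = ∏ i ∈ s, eN (f i) := by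
  classical
  induction s using Finset.induction_on with
  | empty => simp
  | insert a s ha ih => rw [Finset.sum_insert ha, Finset.prod_insert ha, eN_add, ih]

lemma eN_tsum (f : ℕ → ℝ≥0∞) : eN (∑' i, f i) = ⨅ n, ∏ i ∈ Finset.range n, eN (f i) := by
  rw [ENNReal.tsum_eq_iSup_nat, eN_iSup]
  simp_rw [eN_sum]

lemma antitone_prod_eN (f : ℕ → ℝ≥0∞) : Antitone fun n => ∏ i ∈ Finset.range n, eN (f i) := by
  refine antitone_nat_of_succ_le fun n => ?_
  rw [Finset.prod_range_succ]
  exact mul_le_of_le_one_right' (eN_le_one _)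

lemma exists_eN_eq {u : ℝ≥0∞} (hu : u ≤ 1) :
    eN (if u = 0 then ⊤ else ENNReal.ofReal (-Real.log u.toReal)) = u := by
  split_ifs with h
  · simp [h]
  · have ht : u ≠ ⊤ := ne_top_of_le_ne_top ENNReal.one_ne_top hu
    have h1 : u.toReal ≤ 1 := by simpa using ENNReal.toReal_mono ENNReal.one_ne_top hu
    have h0 : 0 < u.toReal := ENNReal.toReal_pos h ht
    rw [eN_ofReal (by simpa using Real.log_nonpos h0.le h1), neg_neg, Real.exp_log h0,
      ENNReal.ofReal_toReal ht]

lemma one_sub_eN_add (x y : ℝ≥0∞) : 1 - eN (x + y) = (1 - eN x) + eN x * (1 - eN y) := by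
  rw [eN_add, ENNReal.mul_sub (fun _ _ => eN_ne_top x), mul_one,
    tsub_add_tsub_cancel (eN_le_one x) (mul_le_of_le_one_right' (eN_le_one y))]

/-- The difference quotients of `1 - exp (-t x)` in `t`. -/
def dq (n : ℕ) (x : ℝ≥0∞) : ℝ≥0∞ := 2 ^ n * (1 - eN (x / 2 ^ n))

@[fun_prop] lemma measurable_dq (n : ℕ) : Measurable (dq n) := by
  unfold dq; fun_prop

lemma dq_mono_right (n : ℕ) : Monotone (dq n) := by
  intro x y h
  exact mul_le_mul_right (tsub_le_tsub_left (eN_antitone (ENNReal.div_le_div_right h _)) _) _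

lemma dq_mono_left (x : ℝ≥0∞) : Monotone fun n => dq n x := by
  refine monotone_nat_of_le_succ fun n => ?_
  unfold dq
  set y := x / 2 ^ (n + 1) with hy
  have h2 : x / 2 ^ n = y + y := by
    rw [hy, pow_succ, ← two_mul, div_eq_mul_inv, div_eq_mul_inv, ENNReal.mul_inv (by simp) (by simp)]
    rw [mul_comm 2, mul_assoc, mul_assoc, ENNReal.inv_mul_cancel (by simp) (by simp), mul_one]
  rw [h2, one_sub_eN_add, pow_succ, mul_assoc]
  gcongr
  rw [two_mul]
  gcongr
  exact mul_le_of_le_one_left' (eN_le_one y)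

lemma dq_le (n : ℕ) (x : ℝ≥0∞) : dq n x ≤ x := by
  rcases eq_or_ne x ⊤ with rfl | hx
  · simp
  lift x to NNReal using hx
  have h2 : (x : ℝ≥0∞) / 2 ^ n = ENNReal.ofReal (x / 2 ^ n) := by
    rw [ENNReal.ofReal_div_of_pos (by positivity)]; simp
  rw [dq, h2, eN_ofReal (by positivity), ← ENNReal.ofReal_one,
    ← ENNReal.ofReal_sub _ (Real.exp_pos _).le]
  have : (2 : ℝ≥0∞) ^ n = ENNReal.ofReal (2 ^ n) := by simp
  rw [this, ← ENNReal.ofReal_mul (by positivity), ← ENNReal.ofReal_coe_nnreal]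
  apply ENNReal.ofReal_le_ofReal
  have := Real.one_sub_le_exp_neg ((x : ℝ) / 2 ^ n)
  calc (2 : ℝ) ^ n * (1 - Real.exp (-(x / 2 ^ n))) ≤ 2 ^ n * (x / 2 ^ n) := by gcongr; linarith
    _ = x := by field_simp

lemma iSup_dq (x : ℝ≥0∞) : ⨆ n, dq n x = x := by
  refine tendsto_nhds_unique (tendsto_atTop_iSup (dq_mono_left x)) ?_
  rcases eq_or_ne x ⊤ with rfl | hx
  · have : (fun n => dq n ⊤) = fun n => (2 : ℝ≥0∞) ^ n := by
      funext n; simp [dq, ENNReal.top_div]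
    rw [this]
    exact ENNReal.tendsto_pow_atTop_nhds_top_iff.2 (by norm_num)
  lift x to NNReal using hx
  have hlow : ∀ n, ENNReal.ofReal (x / (1 + x / 2 ^ n)) ≤ dq n x := by
    intro n
    have h2 : (x : ℝ≥0∞) / 2 ^ n = ENNReal.ofReal (x / 2 ^ n) := by
      rw [ENNReal.ofReal_div_of_pos (by positivity)]; simp
    rw [dq, h2, eN_ofReal (by positivity), ← ENNReal.ofReal_one,
      ← ENNReal.ofReal_sub _ (Real.exp_pos _).le]
    have : (2 : ℝ≥0∞) ^ n = ENNReal.ofReal (2 ^ n) := by simp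
    rw [this, ← ENNReal.ofReal_mul (by positivity)]
    apply ENNReal.ofReal_le_ofReal
    set y : ℝ := x / 2 ^ n with hy
    have hy0 : 0 ≤ y := by positivity
    have hx : (x : ℝ) = 2 ^ n * y := by rw [hy]; field_simp
    rw [hx, mul_div_assoc]
    gcongr
    have h1 := Real.add_one_le_exp y
    rw [Real.exp_neg, div_le_iff₀ (by positivity)]
    have : (Real.exp y)⁻¹ ≤ (1 + y)⁻¹ := by gcongr; linarith
    have h3 : (1 + y)⁻¹ * (1 + y) = 1 := inv_mul_cancel₀ (by positivity)
    nlinarith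
  refine tendsto_of_tendsto_of_tendsto_of_le_of_le ?_ tendsto_const_nhds hlow (fun n => dq_le n x)
  rw [← ENNReal.ofReal_coe_nnreal (p := x)]
  refine (ENNReal.continuous_ofReal.tendsto _).comp ?_
  have h0 : Tendsto (fun n : ℕ => (x : ℝ) / 2 ^ n) atTop (𝓝 0) :=
    tendsto_const_nhds.div_atTop (tendsto_pow_atTop_atTop_of_one_lt (by norm_num))
  have := (tendsto_const_nhds (x := (x : ℝ))).div (tendsto_const_nhds (x := (1 : ℝ)).add h0)
    (by norm_num)
  simpa [Pi.div_def] using this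

lemma iSup_dq_iSup {x : ℕ → ℝ≥0∞} (hx : Monotone x) : ⨆ n, dq n (x n) = ⨆ n, x n := by
  apply le_antisymm
  · exact iSup_mono fun n => dq_le n _
  · refine iSup_le fun m => ?_
    rw [← iSup_dq (x m)]
    refine iSup_le fun n => ?_
    refine le_trans ?_ (le_iSup _ (max m n))
    exact (dq_mono_left _ (le_max_right m n)).trans (dq_mono_right _ (hx (le_max_left m n)))

/-! ## Laplace functionals of Poisson processes -/

lemma tsum_iSup_of_monotone {ι : Type*} {f : ℕ → ι → ℝ≥0∞} (hf : Monotone f) :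
    ∑' i, ⨆ n, f n i = ⨆ n, ∑' i, f n i := by
  let _ : MeasurableSpace ι := ⊤
  have : MeasurableSingletonClass ι := ⟨fun _ => trivial⟩
  simp_rw [← lintegral_count]
  exact lintegral_iSup (fun n => measurable_from_top) hf

lemma tsum_iInf_of_antitone {ι : Type*} {f : ℕ → ι → ℝ≥0∞} (hf : Antitone f)
    (h0 : ∑' i, f 0 i ≠ ⊤) : ∑' i, ⨅ n, f n i = ⨅ n, ∑' i, f n i := by
  let _ : MeasurableSpace ι := ⊤
  have : MeasurableSingletonClass ι := ⟨fun _ => trivial⟩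
  simp_rw [← lintegral_count] at h0 ⊢
  exact lintegral_iInf (fun n => measurable_from_top) hf h0

lemma one_sub_eN_mono {x y : ℝ≥0∞} (h : x ≤ y) : 1 - eN x ≤ 1 - eN y :=
  tsub_le_tsub_left (eN_antitone h) _

/-- Laplace functionals are continuous along increasing sequences. -/
lemma eN_lintegral_iSup {E : Type*} [MeasurableSpace E] (Λ : Measure E) {g : ℕ → E → ℝ≥0∞}
    (hg : ∀ n, Measurable (g n)) (hmono : Monotone g) :
    eN (∫⁻ x, (1 - eN (⨆ n, g n x)) ∂Λ) = ⨅ n, eN (∫⁻ x, (1 - eN (g n x)) ∂Λ) := by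
  simp_rw [eN_iSup, ENNReal.sub_iInf]
  rw [lintegral_iSup (fun n => by have := hg n; fun_prop)
    (fun m n h x => one_sub_eN_mono (hmono h x)), eN_iSup]

section Points

variable {Ω : Type*} [MeasurableSpace Ω] {μ : Measure Ω} [IsProbabilityMeasure μ]

lemma lintegral_indepFun {α β : Type*} [MeasurableSpace α] [MeasurableSpace β] {Y : Ω → α}
    {Z : Ω → β} (h : IndepFun Y Z μ) (hY : Measurable Y) (hZ : Measurable Z)
    {F : α → β → ℝ≥0∞} (hF : Measurable (Function.uncurry F)) :
    ∫⁻ ω, F (Y ω) (Z ω) ∂μ = ∫⁻ ω, ∫⁻ ω', F (Y ω) (Z ω') ∂μ ∂μ := by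
  have h1 := (indepFun_iff_map_prod_eq_prod_map_map hY.aemeasurable hZ.aemeasurable).1 h
  have : IsProbabilityMeasure (μ.map Z) := Measure.isProbabilityMeasure_map hZ.aemeasurable
  have h2 : ∫⁻ ω, F (Y ω) (Z ω) ∂μ =
      ∫⁻ p, Function.uncurry F p ∂(μ.map fun ω => (Y ω, Z ω)) :=
    (lintegral_map hF (hY.prodMk hZ)).symm
  rw [h2, h1, lintegral_prod _ hF.aemeasurable, lintegral_map hF.lintegral_prod_right' hY]
  refine lintegral_congr fun ω => ?_
  exact lintegral_map (hF.comp measurable_prodMk_left) hZ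

lemma tsum_indicator_eq_pointCount (X : ℕ → Ω → ℂ) (B : Set ℂ) (ω : Ω) :
    ∑' i, B.indicator 1 (X i ω) = ((pointCount X B ω : ℕ∞) : ℝ≥0∞) := by
  rw [pointCount, ← ENNReal.tsum_set_one, tsum_subtype {i | X i ω ∈ B} fun _ => (1 : ℝ≥0∞)]
  rfl

lemma measurable_pointCount {X : ℕ → Ω → ℂ} (hX : ∀ i, Measurable (X i)) {B : Set ℂ}
    (hB : MeasurableSet B) : Measurable (pointCount X B) := by
  have h : Measurable fun ω => ((pointCount X B ω : ℕ∞) : ℝ≥0∞) := by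
    simp_rw [← tsum_indicator_eq_pointCount]
    exact Measurable.tsum fun i => (measurable_one.indicator hB).comp (hX i)
  refine measurable_to_countable' fun k => ?_
  have : pointCount X B ⁻¹' {k} = (fun ω => ((pointCount X B ω : ℕ∞) : ℝ≥0∞)) ⁻¹' {(k : ℝ≥0∞)} := by
    ext ω; simp
  rw [this]
  exact h (measurableSet_singleton _)

lemma lintegral_pow_poissonLaw {m u : ℝ} (hm : 0 ≤ m) (hu : 0 ≤ u) :
    ∫⁻ k, ENNReal.ofReal u ^ k ∂(poissonLaw m) = ENNReal.ofReal (Real.exp (-(m * (1 - u)))) := by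
  rw [lintegral_countable']
  have h1 : ∀ k : ℕ, ENNReal.ofReal u ^ k * poissonLaw m {k} =
      ENNReal.ofReal (Real.exp (-m) * ((u * m) ^ k / k.factorial)) := by
    intro k
    rw [poissonLaw, poissonMeasure_singleton, ← ENNReal.ofReal_pow hu,
      ← ENNReal.ofReal_mul (by positivity), Real.coe_toNNReal m hm]
    congr 1; rw [mul_pow]; ring
  simp_rw [h1]
  have h2 : HasSum (fun k : ℕ => Real.exp (-m) * ((u * m) ^ k / k.factorial))
      (Real.exp (-m) * Real.exp (u * m)) := by
    have := NormedSpace.expSeries_div_hasSum_exp (u * m)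
    rw [← Real.exp_eq_exp_ℝ] at this
    exact this.mul_left _
  rw [← ENNReal.ofReal_tsum_of_nonneg (fun k => by positivity) h2.summable, h2.tsum_eq,
    ← Real.exp_add]
  congr 2; ring

lemma eN_mul_natCast (c : ℝ≥0∞) (k : ℕ) : eN (c * k) = eN c ^ k := by
  induction k with
  | zero => simp
  | succ k ih => rw [Nat.cast_succ, mul_add, mul_one, eN_add, ih, pow_succ]

lemma lintegral_eN_poisson {n : Ω → ℕ∞} (hn : Measurable n) {m : ℝ} (hm : 0 ≤ m)
    (h : ∀ k : ℕ, μ {ω | n ω = k} = poissonLaw m {k}) (c : ℝ≥0∞) :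
    ∫⁻ ω, eN (c * (n ω : ℝ≥0∞)) ∂μ = eN (ENNReal.ofReal m * (1 - eN c)) := by
  have : IsProbabilityMeasure (poissonLaw m) := by unfold poissonLaw; infer_instance
  have hmeas : Measurable fun k : ℕ => (k : ℕ∞) := measurable_from_top
  have hp : IsProbabilityMeasure (μ.map n) := Measure.isProbabilityMeasure_map hn.aemeasurable
  have hp' : IsProbabilityMeasure ((poissonLaw m).map fun k : ℕ => (k : ℕ∞)) :=
    Measure.isProbabilityMeasure_map hmeas.aemeasurable
  have hnat : ∀ k : ℕ, μ.map n {(k : ℕ∞)} = (poissonLaw m).map (fun k : ℕ => (k : ℕ∞)) {(k : ℕ∞)} := by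
    intro k
    rw [Measure.map_apply hn (measurableSet_singleton _),
      Measure.map_apply hmeas (measurableSet_singleton _)]
    have : (fun k : ℕ => (k : ℕ∞)) ⁻¹' {(k : ℕ∞)} = {k} := by ext j; simp
    rw [this, ← h k]; rfl
  have hrange : Set.range (fun k : ℕ => (k : ℕ∞)) = {⊤}ᶜ := by
    ext x; induction x with
    | top => simp
    | coe k => simp
  have hU : ∀ ρ : Measure ℕ∞, ρ {⊤}ᶜ = ∑' k : ℕ, ρ {(k : ℕ∞)} := by
    intro ρ
    rw [← hrange, ← Set.iUnion_singleton_eq_range]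
    exact measure_iUnion (fun i j hij => by simpa using hij) fun _ => measurableSet_singleton _
  have hlaw : μ.map n = (poissonLaw m).map fun k : ℕ => (k : ℕ∞) := by
    refine Measure.ext_of_singleton fun a => ?_
    induction a with
    | coe k => exact hnat k
    | top =>
      have h1 := prob_compl_eq_one_sub (μ := μ.map n) (measurableSet_singleton (⊤ : ℕ∞)).compl
      have h2 := prob_compl_eq_one_sub (μ := (poissonLaw m).map fun k : ℕ => (k : ℕ∞))
        (measurableSet_singleton (⊤ : ℕ∞)).compl
      rw [compl_compl] at h1 h2
      rw [h1, h2, hU, hU]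
      simp_rw [hnat]
  have h3 : ∫⁻ ω, eN (c * (n ω : ℝ≥0∞)) ∂μ = ∫⁻ k, eN (c * ((k : ℕ∞) : ℝ≥0∞)) ∂(μ.map n) :=
    (lintegral_map (f := fun k : ℕ∞ => eN (c * (k : ℝ≥0∞))) measurable_from_top hn).symm
  rw [h3, hlaw, lintegral_map measurable_from_top hmeas]
  have h4 : ∀ k : ℕ, eN (c * (((k : ℕ∞)) : ℝ≥0∞)) = ENNReal.ofReal (expNeg c) ^ k := by
    intro k; rw [ENat.toENNReal_coe, eN_mul_natCast]; rfl
  simp_rw [h4]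
  rw [lintegral_pow_poissonLaw hm (expNeg_nonneg c)]
  have h5 : 1 - eN c = ENNReal.ofReal (1 - expNeg c) := by
    rw [eN, ENNReal.ofReal_sub _ (expNeg_nonneg c), ENNReal.ofReal_one]
  rw [h5, ← ENNReal.ofReal_mul hm, eN_ofReal (mul_nonneg hm (sub_nonneg.2 (expNeg_le_one c)))]

lemma eN_sum_indicator {E κ : Type*} [Fintype κ] {B : κ → Set E}
    (hd : Pairwise (Function.onFun Disjoint B)) (c : κ → ℝ≥0∞) (x : E) :
    1 - eN (∑ j, c j * (B j).indicator 1 x) = ∑ j, (1 - eN (c j)) * (B j).indicator 1 x := by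
  by_cases h : ∃ j, x ∈ B j
  · obtain ⟨j, hj⟩ := h
    have h0 : ∀ k, k ≠ j → (B k).indicator (1 : E → ℝ≥0∞) x = 0 := fun k hk =>
      Set.indicator_of_notMem (fun hx => (Set.disjoint_left.1 (hd hk) hx hj)) _
    rw [Finset.sum_eq_single j (fun k _ hk => by rw [h0 k hk, mul_zero]) (by simp),
      Finset.sum_eq_single j (fun k _ hk => by rw [h0 k hk, mul_zero]) (by simp)]
    simp [hj]
  · push Not at h
    simp [Set.indicator_of_notMem (h _)]

lemma IsPoissonProcess.lintegral_eN_simple {X : ℕ → Ω → ℂ} {lam : ℝ} (hX : IsPoissonProcess μ X lam)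
    (hlam : 0 ≤ lam) {n : ℕ} (c : Fin n → ℝ≥0∞) (B : Fin n → Set ℂ)
    (hB : ∀ j, MeasurableSet (B j)) (hvol : ∀ j, volume (B j) ≠ ⊤)
    (hd : Pairwise (Function.onFun Disjoint B)) :
    ∫⁻ ω, eN (∑' i, ∑ j, c j * (B j).indicator 1 (X i ω)) ∂μ =
      eN (ENNReal.ofReal lam * ∫⁻ x, (1 - eN (∑ j, c j * (B j).indicator 1 x))) := by
  have h1 : ∀ ω, ∑' i, ∑ j, c j * (B j).indicator 1 (X i ω) =
      ∑ j, c j * ((pointCount X (B j) ω : ℕ∞) : ℝ≥0∞) := by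
    intro ω
    rw [Summable.tsum_finsetSum fun _ _ => ENNReal.summable]
    refine Finset.sum_congr rfl fun j _ => ?_
    rw [ENNReal.tsum_mul_left, tsum_indicator_eq_pointCount]
  have hm : ∀ j, Measurable (pointCount X (B j)) := fun j => measurable_pointCount hX.measurable (hB j)
  simp_rw [h1, eN_sum_indicator hd, eN_sum]
  have hi := (hX.count_indep n B hB hd).comp (fun j (k : ℕ∞) => eN (c j * (k : ℝ≥0∞)))
    (fun j => measurable_from_top)
  have h2 := lintegral_prod_eq_prod_lintegral_of_indepFun Finset.univ _ hi
    (fun j => measurable_from_top.comp (hm j))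
  simp only [Function.comp_def] at h2
  rw [h2, lintegral_finsetSum _ fun j _ => (measurable_one.indicator (hB j)).const_mul _,
    Finset.mul_sum, eN_sum]
  refine Finset.prod_congr rfl fun j _ => ?_
  rw [lintegral_eN_poisson (hm j) (by positivity) (hX.count_law (B j) (hB j) (hvol j)),
    lintegral_const_mul _ (measurable_one.indicator (hB j)), lintegral_indicator_one (hB j),
    ENNReal.ofReal_mul hlam, ENNReal.ofReal_toReal (hvol j), mul_comm (1 - _), mul_assoc]

/-- The Laplace functional of a Poisson process. -/
theorem IsPoissonProcess.lintegral_eN {X : ℕ → Ω → ℂ} {lam : ℝ} (hX : IsPoissonProcess μ X lam)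
    (hlam : 0 ≤ lam) {g : ℂ → ℝ≥0∞} (hg : Measurable g) :
    ∫⁻ ω, eN (∑' i, g (X i ω)) ∂μ = eN (ENNReal.ofReal lam * ∫⁻ x, (1 - eN (g x))) := by
  let f : ℕ → ℂ → ℝ≥0∞ := fun n => (Metric.ball 0 n).indicator (SimpleFunc.eapprox g n)
  have hfm : ∀ n, Measurable (f n) := fun n =>
    (SimpleFunc.measurable _).indicator measurableSet_ball
  have hfmono : Monotone f := by
    intro m n hmn x
    refine (Set.indicator_le_indicator (SimpleFunc.monotone_eapprox g hmn x)).trans ?_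
    exact Set.indicator_le_indicator_of_subset (Metric.ball_subset_ball (by exact_mod_cast hmn))
      (fun _ => zero_le) x
  have hfsup : ∀ x, ⨆ n, f n x = g x := by
    intro x
    rw [← SimpleFunc.iSup_eapprox_apply hg x]
    apply le_antisymm
    · exact iSup_mono fun n => Set.indicator_le_self _ _ x
    · refine iSup_le fun n => ?_
      obtain ⟨N, hN⟩ := exists_nat_gt ‖x‖
      refine le_trans ?_ (le_iSup _ (max n N))
      have : x ∈ Metric.ball (0 : ℂ) ((max n N : ℕ) : ℝ) := by
        simp only [mem_ball_zero_iff, Nat.cast_max, lt_max_iff]; exact Or.inr hN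
      simp only [f, Set.indicator_of_mem this]
      exact SimpleFunc.monotone_eapprox g (le_max_left n N) x
  have hsimple : ∀ n, ∫⁻ ω, eN (∑' i, f n (X i ω)) ∂μ =
      eN (ENNReal.ofReal lam * ∫⁻ x, (1 - eN (f n x))) := by
    intro n
    set φ := SimpleFunc.eapprox g n
    let e := φ.range.equivFin.symm
    let c : Fin φ.range.card → ℝ≥0∞ := fun j => (e j : ℝ≥0∞)
    let B : Fin φ.range.card → Set ℂ := fun j => φ ⁻¹' {c j} ∩ Metric.ball 0 n
    have hrep : ∀ x, f n x = ∑ j, c j * (B j).indicator 1 x := by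
      intro x
      let j0 : Fin φ.range.card := e.symm ⟨φ x, φ.mem_range_self x⟩
      have hj0 : c j0 = φ x := by simp [c, j0]
      rw [Finset.sum_eq_single j0]
      · by_cases hx : x ∈ Metric.ball (0 : ℂ) n
        · have : x ∈ B j0 := ⟨hj0.symm, hx⟩
          simp only [f, Set.indicator_of_mem hx, Set.indicator_of_mem this, Pi.one_apply, mul_one, hj0]
          rfl
        · have : x ∉ B j0 := fun h => hx h.2
          simp only [f, Set.indicator_of_notMem hx, Set.indicator_of_notMem this, mul_zero]
      · intro j _ hj
        have : x ∉ B j := fun h => hj (e.injective (Subtype.ext (by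
          have := h.1.symm.trans hj0.symm
          exact this)))
        simp [Set.indicator_of_notMem this]
      · simp
    simp_rw [hrep]
    refine hX.lintegral_eN_simple hlam c B (fun j => (φ.measurableSet_fiber _).inter measurableSet_ball)
      (fun j => measure_ne_top_of_subset Set.inter_subset_right measure_ball_lt_top.ne) ?_
    intro j k hjk
    refine Set.disjoint_left.2 fun x hx hx' => hjk (e.injective (Subtype.ext ?_))
    exact hx.1.symm.trans hx'.1
  have hX' := hX.measurable
  have h1 : ∀ ω, eN (∑' i, g (X i ω)) = ⨅ n, eN (∑' i, f n (X i ω)) := by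
    intro ω
    simp_rw [← hfsup]
    rw [tsum_iSup_of_monotone (f := fun n i => f n (X i ω)) (fun m n h i => hfmono h _), eN_iSup]
  simp_rw [h1]
  rw [lintegral_iInf]
  · simp_rw [hsimple, ← lintegral_const_mul' _ _ ENNReal.ofReal_ne_top]
    have := eN_lintegral_iSup (ENNReal.ofReal lam • (volume : Measure ℂ)) hfm hfmono
    simp_rw [hfsup, lintegral_smul_measure, smul_eq_mul] at this
    simp_rw [lintegral_const_mul' _ _ ENNReal.ofReal_ne_top]
    exact this.symm
  · intro n
    exact measurable_eN.comp (Measurable.tsum fun i => (hfm n).comp (hX' i))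
  · intro m n h ω
    exact eN_antitone (ENNReal.tsum_le_tsum fun i => hfmono h _)
  · refine ne_top_of_le_ne_top ENNReal.one_ne_top ?_
    calc _ ≤ ∫⁻ _, 1 ∂μ := lintegral_mono fun _ => eN_le_one _
      _ = 1 := by simp

/-- The intensity measure of a marked Poisson process. -/
def markedIntensity {𝓜 : Type*} [MeasurableSpace 𝓜] (lam : ℝ) (ν : Measure 𝓜) : Measure (ℂ × 𝓜) :=
  (ENNReal.ofReal lam • (volume : Measure ℂ)).prod ν

instance {𝓜 : Type*} [MeasurableSpace 𝓜] (lam : ℝ) (ν : Measure 𝓜) [SigmaFinite ν] :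
    SigmaFinite (markedIntensity lam ν) := by
  unfold markedIntensity
  have : SigmaFinite (ENNReal.ofReal lam • (volume : Measure ℂ)) :=
    inferInstanceAs (SigmaFinite (lam.toNNReal • (volume : Measure ℂ)))
  infer_instance

lemma lintegral_markedIntensity {𝓜 : Type*} [MeasurableSpace 𝓜] (lam : ℝ) (ν : Measure 𝓜)
    [SFinite ν] {F : ℂ × 𝓜 → ℝ≥0∞} (hF : Measurable F) :
    ∫⁻ y, F y ∂(markedIntensity lam ν) = ENNReal.ofReal lam * ∫⁻ x, ∫⁻ m, F (x, m) ∂ν := by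
  rw [markedIntensity, lintegral_prod _ hF.aemeasurable, lintegral_smul_measure, smul_eq_mul]

variable {𝓜 : Type*} [MeasurableSpace 𝓜] {ν : Measure 𝓜} [IsProbabilityMeasure ν]
  {X : ℕ → Ω → ℂ} {mark : ℕ → Ω → 𝓜} {lam : ℝ}

lemma IsMarkedPoisson.measurable_point (h : IsMarkedPoisson μ X mark lam ν) (i : ℕ) :
    Measurable fun ω => (X i ω, mark i ω) :=
  (h.points.measurable i).prodMk (h.marks.measurable i)

/-- The Laplace functional of a marked Poisson process. -/
theorem IsMarkedPoisson.lintegral_eN (h : IsMarkedPoisson μ X mark lam ν) (hlam : 0 ≤ lam)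
    {g : ℂ × 𝓜 → ℝ≥0∞} (hg : Measurable g) :
    ∫⁻ ω, eN (∑' i, g (X i ω, mark i ω)) ∂μ =
      eN (∫⁻ y, (1 - eN (g y)) ∂(markedIntensity lam ν)) := by
  let a : ℂ → ℝ≥0∞ := fun x => ∫⁻ m, eN (g (x, m)) ∂ν
  have hgm : Measurable fun y => eN (g y) := measurable_eN.comp hg
  have ha : Measurable a := hgm.lintegral_prod_right'
  have ha1 : ∀ x, a x ≤ 1 := fun x => by
    calc a x ≤ ∫⁻ _, 1 ∂ν := lintegral_mono fun _ => eN_le_one _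
      _ = 1 := by simp
  let G : ℂ → ℝ≥0∞ := fun x => if a x = 0 then ⊤ else ENNReal.ofReal (-Real.log (a x).toReal)
  have hG : Measurable G := Measurable.ite (ha (measurableSet_singleton 0)) measurable_const
    (by fun_prop)
  have hGa : ∀ x, eN (G x) = a x := fun x => exists_eN_eq (ha1 x)
  have hX := h.points.measurable
  have hmk := h.marks.measurable
  have hfin : ∀ n, ∫⁻ ω, ∏ i ∈ Finset.range n, eN (g (X i ω, mark i ω)) ∂μ =
      ∫⁻ ω, ∏ i ∈ Finset.range n, eN (G (X i ω)) ∂μ := by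
    intro n
    have h1 := lintegral_indepFun h.indep (measurable_pi_lambda _ hX) (measurable_pi_lambda _ hmk)
      (F := fun x m => ∏ i ∈ Finset.range n, eN (g (x i, m i)))
      (Finset.measurable_prod _ fun i _ => hgm.comp
        (((measurable_pi_apply i).comp measurable_fst).prodMk
          ((measurable_pi_apply i).comp measurable_snd)))
    rw [h1]
    refine lintegral_congr fun ω => ?_
    have hi := h.marks.indep.comp (fun i m => eN (g (X i ω, m)))
      (fun i => hgm.comp measurable_prodMk_left)
    have h2 := lintegral_prod_eq_prod_lintegral_of_indepFun (Finset.range n) _ hi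
      (fun i => (hgm.comp measurable_prodMk_left).comp (hmk i))
    simp only [Function.comp_def] at h2
    rw [h2]
    refine Finset.prod_congr rfl fun i _ => ?_
    rw [hGa]
    simp only [a]
    rw [← h.marks.law i]
    exact (lintegral_map (f := fun m => eN (g (X i ω, m)))
      (hgm.comp measurable_prodMk_left) (hmk i)).symm
  have hbound : ∀ f : Ω → ℕ → ℝ≥0∞, ∫⁻ ω, ∏ i ∈ Finset.range 0, eN (f ω i) ∂μ ≠ ⊤ := by
    intro f; simp
  have hL := h.points.lintegral_eN hlam hG
  simp_rw [eN_tsum] at hL ⊢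
  have hm1 : ∀ n, Measurable fun ω => ∏ i ∈ Finset.range n, eN (g (X i ω, mark i ω)) := fun n =>
    Finset.measurable_prod _ fun i _ => hgm.comp (h.measurable_point i)
  have hm2 : ∀ n, Measurable fun ω => ∏ i ∈ Finset.range n, eN (G (X i ω)) := fun n =>
    Finset.measurable_prod _ fun i _ => measurable_eN.comp (hG.comp (hX i))
  rw [lintegral_iInf hm1 (fun m n hmn ω => antitone_prod_eN _ hmn) (hbound _)]
  rw [lintegral_iInf hm2 (fun m n hmn ω => antitone_prod_eN _ hmn) (hbound _)] at hL
  simp_rw [hfin, hL]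
  rw [lintegral_markedIntensity lam ν (F := fun y => 1 - eN (g y)) (measurable_const.sub hgm)]
  congr 2
  refine lintegral_congr fun x => ?_
  have hgx : Measurable fun m => eN (g (x, m)) := hgm.comp measurable_prodMk_left
  rw [hGa, lintegral_sub hgx]
  · simp [a]
  · exact ne_top_of_le_ne_top ENNReal.one_ne_top (ha1 x)
  · exact Eventually.of_forall fun _ => eN_le_one _

end Points

/-! ## Campbell and Mecke formulas for marked Poisson processes -/

section Mecke

variable {Ω : Type*} [MeasurableSpace Ω] {μ : Measure Ω} [IsProbabilityMeasure μ]
variable {𝓜 : Type*} [MeasurableSpace 𝓜] {ν : Measure 𝓜} [IsProbabilityMeasure ν]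
  {X : ℕ → Ω → ℂ} {mark : ℕ → Ω → 𝓜} {lam : ℝ}

lemma lintegral_le_one {f : Ω → ℝ≥0∞} (hf : ∀ ω, f ω ≤ 1) : ∫⁻ ω, f ω ∂μ ≤ 1 :=
  calc ∫⁻ ω, f ω ∂μ ≤ ∫⁻ _, 1 ∂μ := lintegral_mono hf
    _ = 1 := by simp

lemma IsMarkedPoisson.measurable_tsum (h : IsMarkedPoisson μ X mark lam ν) {g : ℂ × 𝓜 → ℝ≥0∞}
    (hg : Measurable g) : Measurable fun ω => ∑' i, g (X i ω, mark i ω) :=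
  Measurable.tsum fun i => hg.comp (h.measurable_point i)

lemma IsMarkedPoisson.lintegral_eN_mul_dq (h : IsMarkedPoisson μ X mark lam ν) (hlam : 0 ≤ lam)
    {g φ : ℂ × 𝓜 → ℝ≥0∞} (hg : Measurable g) (hφ : Measurable φ) (n : ℕ) :
    ∫⁻ ω, eN (∑' i, g (X i ω, mark i ω)) * dq n (∑' i, φ (X i ω, mark i ω)) ∂μ =
      eN (∫⁻ y, (1 - eN (g y)) ∂(markedIntensity lam ν)) *
        dq n (∫⁻ y, eN (g y) * dq n (φ y) ∂(markedIntensity lam ν)) := by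
  have h2 : (2 : ℝ≥0∞) ^ n ≠ ⊤ := by simp
  have h20 : (2 : ℝ≥0∞) ^ n ≠ 0 := by simp
  have hsplit : ∀ a b : ℝ≥0∞, eN a * dq n b = 2 ^ n * (eN a - eN (a + b / 2 ^ n)) := by
    intro a b
    rw [dq, eN_add, mul_left_comm, ENNReal.mul_sub (fun _ _ => eN_ne_top a), mul_one]
  have hsum : ∀ ω, ∑' i, g (X i ω, mark i ω) + (∑' i, φ (X i ω, mark i ω)) / 2 ^ n =
      ∑' i, (fun y => g y + φ y / 2 ^ n) (X i ω, mark i ω) := by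
    intro ω
    simp_rw [div_eq_mul_inv]
    rw [← ENNReal.tsum_mul_right, ENNReal.tsum_add]
  have hgφ : Measurable fun y => g y + φ y / 2 ^ n := by fun_prop
  have hm2 : Measurable fun ω => eN (∑' i, (fun y => g y + φ y / 2 ^ n) (X i ω, mark i ω)) :=
    measurable_eN.comp (h.measurable_tsum hgφ)
  rw [lintegral_congr fun ω => hsplit _ _, hsplit]
  simp_rw [hsum]
  rw [lintegral_const_mul' _ _ h2, lintegral_sub hm2]
  rotate_left
  · exact ne_top_of_le_ne_top ENNReal.one_ne_top (lintegral_le_one fun _ => eN_le_one _)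
  · exact Eventually.of_forall fun ω => eN_antitone (ENNReal.tsum_le_tsum fun i => le_self_add)
  rw [h.lintegral_eN hlam hg, h.lintegral_eN hlam hgφ]
  simp_rw [one_sub_eN_add]
  rw [lintegral_add_left (by fun_prop)]
  congr 3
  have hdq : ∀ y, eN (g y) * dq n (φ y) = 2 ^ n * (eN (g y) * (1 - eN (φ y / 2 ^ n))) := by
    intro y; rw [dq, mul_left_comm]
  simp_rw [hdq]
  rw [lintegral_const_mul' _ _ h2, mul_comm, ENNReal.mul_div_cancel_right h20 h2]

/-- Campbell's formula under an exponential change of measure. -/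
theorem IsMarkedPoisson.lintegral_eN_mul_tsum (h : IsMarkedPoisson μ X mark lam ν) (hlam : 0 ≤ lam)
    {g φ : ℂ × 𝓜 → ℝ≥0∞} (hg : Measurable g) (hφ : Measurable φ) :
    ∫⁻ ω, eN (∑' i, g (X i ω, mark i ω)) * ∑' i, φ (X i ω, mark i ω) ∂μ =
      eN (∫⁻ y, (1 - eN (g y)) ∂(markedIntensity lam ν)) *
        ∫⁻ y, eN (g y) * φ y ∂(markedIntensity lam ν) := by
  have h1 := fun n => h.lintegral_eN_mul_dq hlam hg hφ n
  have hmg := measurable_eN.comp (h.measurable_tsum hg)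
  have hmφ := h.measurable_tsum hφ
  have hl : ∫⁻ ω, eN (∑' i, g (X i ω, mark i ω)) * ∑' i, φ (X i ω, mark i ω) ∂μ =
      ⨆ n, ∫⁻ ω, eN (∑' i, g (X i ω, mark i ω)) * dq n (∑' i, φ (X i ω, mark i ω)) ∂μ := by
    rw [← lintegral_iSup]
    · refine lintegral_congr fun ω => ?_
      rw [← ENNReal.mul_iSup, iSup_dq]
    · exact fun n => hmg.mul ((measurable_dq n).comp hmφ)
    · intro m n hmn ω
      exact mul_le_mul_right (dq_mono_left _ hmn) _
  have hmono : Monotone fun n => ∫⁻ y, eN (g y) * dq n (φ y) ∂(markedIntensity lam ν) :=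
    fun m n hmn => lintegral_mono fun y => mul_le_mul_right (dq_mono_left _ hmn) _
  rw [hl]
  simp_rw [h1]
  rw [← ENNReal.mul_iSup, iSup_dq_iSup hmono, ← lintegral_iSup]
  · congr 1
    refine lintegral_congr fun y => ?_
    rw [← ENNReal.mul_iSup, iSup_dq]
  · intro n; fun_prop
  · intro m n hmn y
    exact mul_le_mul_right (dq_mono_left _ hmn) _

theorem IsMarkedPoisson.lintegral_tsum (h : IsMarkedPoisson μ X mark lam ν) (hlam : 0 ≤ lam)
    {φ : ℂ × 𝓜 → ℝ≥0∞} (hφ : Measurable φ) :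
    ∫⁻ ω, ∑' i, φ (X i ω, mark i ω) ∂μ = ∫⁻ y, φ y ∂(markedIntensity lam ν) := by
  simpa using h.lintegral_eN_mul_tsum hlam (g := fun _ => 0) measurable_const hφ

/-- Mecke's formula for the Laplace functional of the other points. -/
theorem IsMarkedPoisson.mecke (h : IsMarkedPoisson μ X mark lam ν) (hlam : 0 ≤ lam)
    {g φ : ℂ × 𝓜 → ℝ≥0∞} (hg : Measurable g) (hφ : Measurable φ) (hgφ : ∀ y, g y = ⊤ → φ y = 0) :
    ∫⁻ ω, ∑' i, φ (X i ω, mark i ω) * eN (∑' k, if k = i then 0 else g (X k ω, mark k ω)) ∂μ =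
      eN (∫⁻ y, (1 - eN (g y)) ∂(markedIntensity lam ν)) *
        ∫⁻ y, φ y ∂(markedIntensity lam ν) := by
  have h1 : ∀ y, eN (g y) * (φ y * (eN (g y))⁻¹) = φ y := by
    intro y
    by_cases hy : g y = ⊤
    · simp [hgφ y hy]
    · rw [mul_comm, mul_assoc, ENNReal.inv_mul_cancel (eN_pos hy).ne' (eN_ne_top _), mul_one]
  have h2 := h.lintegral_eN_mul_tsum hlam hg (φ := fun y => φ y * (eN (g y))⁻¹) (by fun_prop)
  simp_rw [h1] at h2
  rw [← h2]
  refine lintegral_congr fun ω => ?_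
  rw [← ENNReal.tsum_mul_left]
  refine tsum_congr fun i => ?_
  rw [ENNReal.tsum_eq_add_tsum_ite (f := fun k => g (X k ω, mark k ω)) i, eN_add,
    mul_right_comm, h1]
  congr!

/-- Mecke's formula, where the functional of the other points depends on a discrete label. -/
theorem IsMarkedPoisson.mecke_label (h : IsMarkedPoisson μ X mark lam ν) (hlam : 0 ≤ lam)
    {c : ℂ × 𝓜 → ℕ} (hc : Measurable c) {g : ℕ → ℂ × 𝓜 → ℝ≥0∞} (hg : ∀ n, Measurable (g n))
    {φ : ℂ × 𝓜 → ℝ≥0∞} (hφ : Measurable φ) (hgφ : ∀ y, g (c y) y = ⊤ → φ y = 0) :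
    ∫⁻ ω, ∑' i, φ (X i ω, mark i ω) *
        eN (∑' k, if k = i then 0 else g (c (X i ω, mark i ω)) (X k ω, mark k ω)) ∂μ =
      ∫⁻ y, φ y * eN (∫⁻ y', (1 - eN (g (c y) y')) ∂(markedIntensity lam ν))
        ∂(markedIntensity lam ν) := by
  let φm : ℕ → ℂ × 𝓜 → ℝ≥0∞ := fun m y => if c y = m then φ y else 0
  have hφm : ∀ m, Measurable (φm m) := fun m =>
    Measurable.ite (hc (measurableSet_singleton m)) hφ measurable_const
  have hsum : ∀ (y : ℂ × 𝓜) (F : ℕ → ℝ≥0∞), ∑' m, φm m y * F m = φ y * F (c y) := by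
    intro y F
    rw [tsum_eq_single (c y)]
    · simp [φm]
    · intro m hm; simp [φm, hm.symm]
  have h1 : ∀ ω, ∑' i, φ (X i ω, mark i ω) *
        eN (∑' k, if k = i then 0 else g (c (X i ω, mark i ω)) (X k ω, mark k ω)) =
      ∑' m, ∑' i, φm m (X i ω, mark i ω) *
        eN (∑' k, if k = i then 0 else g m (X k ω, mark k ω)) := by
    intro ω
    rw [ENNReal.tsum_comm]
    refine tsum_congr fun i => ?_
    rw [hsum _ fun m => eN (∑' k, if k = i then 0 else g m (X k ω, mark k ω))]
  have hmeas : ∀ m i, Measurable fun ω => φm m (X i ω, mark i ω) *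
        eN (∑' k, if k = i then 0 else g m (X k ω, mark k ω)) := by
    intro m i
    refine ((hφm m).comp (h.measurable_point i)).mul (measurable_eN.comp (Measurable.tsum fun k => ?_))
    split_ifs
    · exact measurable_const
    · exact (hg m).comp (h.measurable_point k)
  simp_rw [h1]
  rw [MeasureTheory.lintegral_tsum fun m => (Measurable.tsum fun i => hmeas m i).aemeasurable]
  have h2 : ∀ m, ∫⁻ ω, ∑' i, φm m (X i ω, mark i ω) *
        eN (∑' k, if k = i then 0 else g m (X k ω, mark k ω)) ∂μ =
      ∫⁻ y, φm m y * eN (∫⁻ y', (1 - eN (g m y')) ∂(markedIntensity lam ν))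
        ∂(markedIntensity lam ν) := by
    intro m
    rw [h.mecke hlam (hg m) (hφm m), lintegral_mul_const _ (hφm m), mul_comm]
    intro y hy
    simp only [φm]
    split_ifs with hm
    · exact hgφ y (hm ▸ hy)
    · rfl
  simp_rw [h2]
  rw [← MeasureTheory.lintegral_tsum fun m => ((hφm m).mul_const _).aemeasurable]
  refine lintegral_congr fun y => ?_
  exact hsum y _

lemma IsMarkedPoisson.ae_finite (h : IsMarkedPoisson μ X mark lam ν) (hlam : 0 ≤ lam)
    {f : ℂ × 𝓜 → ℝ} (hf : Measurable f)
    (hfin : ∀ t, markedIntensity lam ν {y | f y ≤ t} ≠ ⊤) :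
    ∀ᵐ ω ∂μ, ∀ t, {i | f (X i ω, mark i ω) ≤ t}.Finite := by
  have h1 : ∀ᵐ ω ∂μ, ∀ n : ℕ, {i | f (X i ω, mark i ω) ≤ n}.Finite := by
    rw [ae_all_iff]
    intro n
    have hs : MeasurableSet {y : ℂ × 𝓜 | f y ≤ n} := measurableSet_le hf measurable_const
    have hi := h.lintegral_tsum hlam (φ := Set.indicator {y | f y ≤ n} 1) (measurable_one.indicator hs)
    rw [lintegral_indicator_one hs] at hi
    have := ae_lt_top (h.measurable_tsum (measurable_one.indicator hs)) (hi ▸ hfin n)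
    filter_upwards [this] with ω hω
    have h2 : ∑' i, Set.indicator {y | f y ≤ n} (1 : ℂ × 𝓜 → ℝ≥0∞) (X i ω, mark i ω) =
        ({i | f (X i ω, mark i ω) ≤ n}.encard : ℝ≥0∞) := by
      rw [← ENNReal.tsum_set_one, tsum_subtype {i | f (X i ω, mark i ω) ≤ n} fun _ => (1 : ℝ≥0∞)]
      rfl
    rw [h2] at hω
    rw [← Set.encard_lt_top_iff]
    simpa using hω
  filter_upwards [h1] with ω hω t
  obtain ⟨n, hn⟩ := exists_nat_ge t
  exact (hω n).subset fun i hi => le_trans hi hn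

/-- Almost surely, a function with a diffuse law takes distinct values at the points. -/
theorem IsMarkedPoisson.ae_injective (h : IsMarkedPoisson μ X mark lam ν) (hlam : 0 ≤ lam)
    {f : ℂ × 𝓜 → ℝ} (hf : Measurable f) (hf0 : ∀ y, 0 ≤ f y)
    (hfin : ∀ t, markedIntensity lam ν {y | f y ≤ t} ≠ ⊤)
    (hdiff : ∀ t, markedIntensity lam ν {y | f y = t} = 0) :
    ∀ᵐ ω ∂μ, Function.Injective fun i => f (X i ω, mark i ω) := by
  classical
  set Λ := markedIntensity lam ν with hΛ
  have key : ∀ t : ℕ, ∀ᵐ ω ∂μ, ∀ i, f (X i ω, mark i ω) ≤ t →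
      ¬ ∃ k, k ≠ i ∧ f (X k ω, mark k ω) = f (X i ω, mark i ω) := by
    intro t
    let φ : ℂ × 𝓜 → ℝ≥0∞ := Set.indicator {y | f y ≤ t} 1
    have hφs : MeasurableSet {y : ℂ × 𝓜 | f y ≤ t} := measurableSet_le hf measurable_const
    have hφ : Measurable φ := measurable_one.indicator hφs
    have hφfin : ∫⁻ y, φ y ∂Λ ≠ ⊤ := by
      rw [lintegral_indicator_one hφs]; exact hfin t
    let c : ℕ → ℂ × 𝓜 → ℕ := fun n y => ⌊2 ^ n * f y⌋₊
    have hc : ∀ n, Measurable (c n) := fun n => (hf.const_mul _).nat_floor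
    let g : ℕ → ℕ → ℂ × 𝓜 → ℝ≥0∞ := fun n m => Set.indicator {y | c n y = m} 1
    have hgs : ∀ n m, MeasurableSet {y : ℂ × 𝓜 | c n y = m} := fun n m =>
      hc n (measurableSet_singleton m)
    have hg : ∀ n m, Measurable (g n m) := fun n m => measurable_one.indicator (hgs n m)
    let tie : ℕ → Ω → ℝ≥0∞ := fun i ω =>
      if ∃ k, k ≠ i ∧ f (X k ω, mark k ω) = f (X i ω, mark i ω) then 1 else 0
    have htie : ∀ i, Measurable (tie i) := by
      intro i
      refine Measurable.ite ?_ measurable_const measurable_const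
      have : {ω | ∃ k, k ≠ i ∧ f (X k ω, mark k ω) = f (X i ω, mark i ω)} =
          ⋃ k, {ω | k ≠ i ∧ f (X k ω, mark k ω) = f (X i ω, mark i ω)} := by ext; simp
      rw [this]
      refine MeasurableSet.iUnion fun k => ?_
      exact (MeasurableSet.const _).inter (measurableSet_eq_fun (hf.comp (h.measurable_point k))
        (hf.comp (h.measurable_point i)))
    have hbound : ∀ n i ω, eN (∑' k, if k = i then 0 else g n (c n (X i ω, mark i ω)) (X k ω, mark k ω)) +
        (1 - eN 1) * tie i ω ≤ 1 := by
      intro n i ω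
      simp only [tie]
      split_ifs with hk
      · obtain ⟨k, hki, hk⟩ := hk
        have h1 : 1 ≤ ∑' k, if k = i then 0 else g n (c n (X i ω, mark i ω)) (X k ω, mark k ω) := by
          refine le_trans ?_ (ENNReal.le_tsum k)
          have : c n (X k ω, mark k ω) = c n (X i ω, mark i ω) := by simp only [c, hk]
          simp [hki, g, this]
        rw [mul_one]
        calc _ ≤ eN 1 + (1 - eN 1) := by gcongr; exact eN_antitone h1
          _ = 1 := add_tsub_cancel_of_le (eN_le_one 1)
      · simpa using eN_le_one _
    have hmk : ∀ n, ∫⁻ y, φ y * eN (∫⁻ y', (1 - eN (g n (c n y) y')) ∂Λ) ∂Λ +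
        (1 - eN 1) * ∫⁻ ω, ∑' i, φ (X i ω, mark i ω) * tie i ω ∂μ ≤ ∫⁻ y, φ y ∂Λ := by
      intro n
      rw [hΛ, ← h.mecke_label hlam (hc n) (hg n) hφ, ← h.lintegral_tsum hlam hφ,
        ← lintegral_const_mul, ← lintegral_add_right]
      · refine lintegral_mono fun ω => ?_
        simp only
        rw [← ENNReal.tsum_mul_left, ← ENNReal.tsum_add]
        refine ENNReal.tsum_le_tsum fun i => ?_
        rw [mul_left_comm, ← mul_add]
        exact mul_le_of_le_one_right' (hbound n i ω)
      · exact (Measurable.tsum fun i => (hφ.comp (h.measurable_point i)).mul (htie i)).const_mul _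
      · exact Measurable.tsum fun i => (hφ.comp (h.measurable_point i)).mul (htie i)
      · intro y hy
        simp only [g, Set.indicator_apply] at hy
        split_ifs at hy <;> simp at hy
    have hslice : ∀ n y, ∫⁻ y', (1 - eN (g n (c n y) y')) ∂Λ = (1 - eN 1) * Λ {y' | c n y' = c n y} := by
      intro n y
      have : ∀ y', 1 - eN (g n (c n y) y') = Set.indicator {y' | c n y' = c n y} (fun _ => 1 - eN 1) y' := by
        intro y'
        simp only [g, Set.indicator_apply]
        split_ifs <;> simp
      simp_rw [this]
      rw [lintegral_indicator_const (hgs n _)]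
    have hanti : ∀ y, Antitone fun n => {y' | c n y' = c n y} := by
      intro y
      refine antitone_nat_of_succ_le fun n y' hy' => ?_
      have hdiv : ∀ y, c n y = c (n + 1) y / 2 := by
        intro y
        simp only [c]
        rw [← Nat.floor_div_ofNat]
        congr 1
        rw [pow_succ]
        ring
      change c n y' = c n y
      rw [hdiv, hdiv, show c (n + 1) y' = c (n + 1) y from hy']
    have hlim : ∀ y, ⨆ n, eN ((1 - eN 1) * Λ {y' | c n y' = c n y}) = 1 := by
      intro y
      have hinter : ⋂ n, {y' | c n y' = c n y} ⊆ {y' | f y' = f y} := by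
        intro y' hy'
        rw [Set.mem_iInter] at hy'
        have hle : ∀ n : ℕ, |f y' - f y| ≤ (1 / 2) ^ n := by
          intro n
          have hn : (c n y' : ℝ) = c n y := by exact_mod_cast hy' n
          have a1 := Nat.floor_le (mul_nonneg (pow_nonneg zero_le_two n) (hf0 y'))
          have a2 := Nat.lt_floor_add_one (2 ^ n * f y')
          have b1 := Nat.floor_le (mul_nonneg (pow_nonneg zero_le_two n) (hf0 y))
          have b2 := Nat.lt_floor_add_one (2 ^ n * f y)
          simp only [c] at hn
          rw [hn] at a1 a2
          have hp : (0 : ℝ) < 2 ^ n := by positivity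
          have : |f y' - f y| * 2 ^ n ≤ 1 := by
            rw [← abs_of_pos hp, ← abs_mul, abs_le]
            constructor <;> nlinarith
          rw [one_div, inv_pow, ← one_div, le_div_iff₀ hp]
          exact this
        have h0 : |f y' - f y| ≤ 0 := ge_of_tendsto'
          (tendsto_pow_atTop_nhds_zero_of_lt_one (by norm_num) (by norm_num)) hle
        exact sub_eq_zero.1 (abs_eq_zero.1 (le_antisymm h0 (abs_nonneg _)))
      have ht := tendsto_measure_iInter_atTop (μ := Λ)
        (fun n => (hgs n (c n y)).nullMeasurableSet) (hanti y) ⟨0, by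
          refine measure_ne_top_of_subset ?_ (hfin (f y + 1))
          intro y' hy'
          have hy'' : ⌊2 ^ 0 * f y'⌋₊ = ⌊2 ^ 0 * f y⌋₊ := hy'
          simp only [pow_zero, one_mul] at hy''
          have a2 := Nat.lt_floor_add_one (f y')
          have b1 := Nat.floor_le (hf0 y)
          rw [hy''] at a2
          change f y' ≤ f y + 1; linarith⟩
      rw [measure_mono_null hinter (hdiff _)] at ht
      have ht2 : Tendsto (fun n => eN ((1 - eN 1) * Λ {y' | c n y' = c n y})) atTop (𝓝 1) := by
        have h3 := ENNReal.Tendsto.const_mul (a := 1 - eN 1) ht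
          (Or.inr (ne_top_of_le_ne_top ENNReal.one_ne_top tsub_le_self))
        rw [mul_zero] at h3
        have := (continuous_eN.tendsto 0).comp h3
        rwa [eN_zero] at this
      refine tendsto_nhds_unique (tendsto_atTop_iSup ?_) ht2
      intro m n hmn
      exact eN_antitone (mul_le_mul_right (measure_mono (hanti y hmn)) _)
    have hsup : ∫⁻ y, φ y ∂Λ = ⨆ n, ∫⁻ y, φ y * eN (∫⁻ y', (1 - eN (g n (c n y) y')) ∂Λ) ∂Λ := by
      simp_rw [hslice]
      rw [← lintegral_iSup]
      · refine lintegral_congr fun y => ?_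
        rw [← ENNReal.mul_iSup, hlim, mul_one]
      · intro n
        refine hφ.mul (measurable_eN.comp (Measurable.const_mul ?_ _))
        exact (measurable_from_top (f := fun m : ℕ => Λ {y' | c n y' = m})).comp (hc n)
      · intro m n hmn y
        exact mul_le_mul_right (eN_antitone (mul_le_mul_right (measure_mono (hanti y hmn)) _)) _
    have hzero : (1 - eN 1) * ∫⁻ ω, ∑' i, φ (X i ω, mark i ω) * tie i ω ∂μ = 0 := by
      have h3 : ∫⁻ y, φ y ∂Λ + (1 - eN 1) * ∫⁻ ω, ∑' i, φ (X i ω, mark i ω) * tie i ω ∂μ ≤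
          ∫⁻ y, φ y ∂Λ := by
        nth_rewrite 1 [hsup]
        rw [ENNReal.iSup_add]
        exact iSup_le hmk
      have h4 : ∫⁻ y, φ y ∂Λ + (1 - eN 1) * ∫⁻ ω, ∑' i, φ (X i ω, mark i ω) * tie i ω ∂μ ≤
          ∫⁻ y, φ y ∂Λ + 0 := by simpa using h3
      exact le_antisymm ((ENNReal.add_le_add_iff_left hφfin).1 h4) zero_le
    have hpos : 1 - eN 1 ≠ 0 := by
      rw [← ENNReal.ofReal_one, eN_ofReal zero_le_one, ← ENNReal.ofReal_sub _ (Real.exp_pos _).le]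
      simp
    have hz := (mul_eq_zero.1 hzero).resolve_left hpos
    have hmt : Measurable fun ω => ∑' i, φ (X i ω, mark i ω) * tie i ω := Measurable.tsum fun i =>
      (hφ.comp (h.measurable_point i)).mul (htie i)
    rw [lintegral_eq_zero_iff hmt] at hz
    filter_upwards [hz] with ω hω i hi hk
    have := ENNReal.tsum_eq_zero.1 hω i
    simp [φ, tie, hi, hk] at this
  rw [← ae_all_iff] at key
  filter_upwards [key] with ω hω i k hik
  by_contra hne
  obtain ⟨n, hn⟩ := exists_nat_ge (f (X k ω, mark k ω))
  exact hω n k hn ⟨i, hne, hik⟩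

end Mecke

section Mecke

variable {Ω : Type*} [MeasurableSpace Ω] {μ : Measure Ω} [IsProbabilityMeasure μ]
variable {𝓜 : Type*} [MeasurableSpace 𝓜] {ν : Measure 𝓜} [IsProbabilityMeasure ν]
  {X : ℕ → Ω → ℂ} {mark : ℕ → Ω → 𝓜} {lam : ℝ}

/-- The dyadic approximation of `z` from below. -/
def dyadicFloor (n : ℕ) (z : ℝ) : ℝ := ⌊2 ^ n * z⌋₊ / 2 ^ n

lemma measurable_dyadicFloor (n : ℕ) : Measurable (dyadicFloor n) := by
  unfold dyadicFloor
  exact (((measurable_from_top (f := fun k : ℕ => (k : ℝ))).comp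
    (measurable_id.const_mul _).nat_floor)).div_const _

lemma dyadicFloor_nonneg (n : ℕ) (z : ℝ) : 0 ≤ dyadicFloor n z := by
  unfold dyadicFloor; positivity

lemma dyadicFloor_le (n : ℕ) {z : ℝ} (hz : 0 ≤ z) : dyadicFloor n z ≤ z := by
  rw [dyadicFloor, div_le_iff₀ (by positivity), mul_comm]
  exact Nat.floor_le (by positivity)

lemma dyadicFloor_mono (z : ℝ) : Monotone fun n => dyadicFloor n z := by
  refine monotone_nat_of_le_succ fun n => ?_
  have h : ⌊2 ^ n * z⌋₊ = ⌊2 ^ (n + 1) * z⌋₊ / 2 := by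
    rw [← Nat.floor_div_ofNat]
    congr 1
    rw [pow_succ]
    ring
  rw [dyadicFloor, dyadicFloor, div_le_div_iff₀ (by positivity) (by positivity), h, pow_succ,
    ← mul_assoc, mul_right_comm]
  gcongr
  exact_mod_cast Nat.div_mul_le_self _ 2

lemma tendsto_dyadicFloor {z : ℝ} (hz : 0 ≤ z) :
    Tendsto (fun n => dyadicFloor n z) atTop (𝓝 z) := by
  have h0 : Tendsto (fun n : ℕ => z - (1 / 2) ^ n) atTop (𝓝 z) := by
    simpa using (tendsto_const_nhds (x := z)).sub
      (tendsto_pow_atTop_nhds_zero_of_lt_one (r := (1 / 2 : ℝ)) (by norm_num) (by norm_num))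
  refine tendsto_of_tendsto_of_tendsto_of_le_of_le h0 tendsto_const_nhds (fun n => ?_)
    (fun n => dyadicFloor_le n hz)
  have := Nat.lt_floor_add_one (2 ^ n * z)
  have hp : (0 : ℝ) < 2 ^ n := by positivity
  change z - (1 / 2) ^ n ≤ ⌊2 ^ n * z⌋₊ / 2 ^ n
  rw [le_div_iff₀ hp, sub_mul, one_div, inv_pow, inv_mul_cancel₀ hp.ne']
  linarith

/-- Mecke's formula, where the functional of the other points depends on a real label in a monotone,
left continuous way. -/
theorem IsMarkedPoisson.mecke_mono (h : IsMarkedPoisson μ X mark lam ν) (hlam : 0 ≤ lam)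
    {f : ℂ × 𝓜 → ℝ} (hf : Measurable f) (hf0 : ∀ y, 0 ≤ f y) {g : ℝ → ℂ × 𝓜 → ℝ≥0∞}
    (hg : Measurable (Function.uncurry g)) (hmono : ∀ a b y, 0 ≤ a → a ≤ b → g a y ≤ g b y)
    (hcont : ∀ z y, 0 ≤ z → ⨆ n, g (dyadicFloor n z) y = g z y)
    {φ : ℂ × 𝓜 → ℝ≥0∞} (hφ : Measurable φ) (hφfin : ∫⁻ y, φ y ∂(markedIntensity lam ν) ≠ ⊤)
    (hφtop : ∀ y, φ y ≠ ⊤) (hgφ : ∀ y, g (f y) y = ⊤ → φ y = 0) :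
    ∫⁻ ω, ∑' i, φ (X i ω, mark i ω) *
        eN (∑' k, if k = i then 0 else g (f (X i ω, mark i ω)) (X k ω, mark k ω)) ∂μ =
      ∫⁻ y, φ y * eN (∫⁻ y', (1 - eN (g (f y) y')) ∂(markedIntensity lam ν))
        ∂(markedIntensity lam ν) := by
  set Λ := markedIntensity lam ν with hΛ
  have hgm : ∀ z, Measurable (g z) := fun z => hg.comp measurable_prodMk_left
  have hstep : ∀ n, ∫⁻ ω, ∑' i, φ (X i ω, mark i ω) * eN (∑' k, if k = i then 0 else
        g (dyadicFloor n (f (X i ω, mark i ω))) (X k ω, mark k ω)) ∂μ =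
      ∫⁻ y, φ y * eN (∫⁻ y', (1 - eN (g (dyadicFloor n (f y)) y')) ∂Λ) ∂Λ := by
    intro n
    refine h.mecke_label hlam (c := fun y => ⌊2 ^ n * f y⌋₊) (hf.const_mul _).nat_floor
      (g := fun m => g (m / 2 ^ n)) (fun m => hgm _) hφ (fun y hy => hgφ y ?_)
    refine top_unique (hy ▸ ?_)
    exact hmono _ _ _ (dyadicFloor_nonneg n _) (dyadicFloor_le n (hf0 y))
  have hgle : ∀ m n z y, 0 ≤ z → m ≤ n → g (dyadicFloor m z) y ≤ g (dyadicFloor n z) y :=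
    fun m n z y hz hmn => hmono _ _ _ (dyadicFloor_nonneg m z) (dyadicFloor_mono z hmn)
  let A : ℕ → ℕ → Ω → ℝ≥0∞ := fun n i ω => φ (X i ω, mark i ω) * eN (∑' k, if k = i then 0 else
        g (dyadicFloor n (f (X i ω, mark i ω))) (X k ω, mark k ω))
  have hAm : ∀ n i, Measurable (A n i) := by
    intro n i
    refine (hφ.comp (h.measurable_point i)).mul (measurable_eN.comp (Measurable.tsum fun k => ?_))
    split_ifs
    · exact measurable_const
    · exact hg.comp ((((measurable_dyadicFloor n).comp hf).comp (h.measurable_point i)).prodMk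
        (h.measurable_point k))
  have hAanti : ∀ i ω, Antitone fun n => A n i ω := by
    intro i ω m n hmn
    refine mul_le_mul_right (eN_antitone (ENNReal.tsum_le_tsum fun k => ?_)) _
    split_ifs
    · exact le_rfl
    · exact hgle _ _ _ _ (hf0 _) hmn
  have hAinf : ∀ i ω, ⨅ n, A n i ω = φ (X i ω, mark i ω) *
        eN (∑' k, if k = i then 0 else g (f (X i ω, mark i ω)) (X k ω, mark k ω)) := by
    intro i ω
    have h1 : ∀ k, (if k = i then 0 else g (f (X i ω, mark i ω)) (X k ω, mark k ω)) =
        ⨆ n, if k = i then 0 else g (dyadicFloor n (f (X i ω, mark i ω))) (X k ω, mark k ω) := by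
      intro k
      split_ifs
      · simp
      · exact (hcont _ _ (hf0 _)).symm
    simp_rw [h1]
    rw [tsum_iSup_of_monotone, eN_iSup]
    · exact (ENNReal.mul_iInf fun hi => absurd hi (hφtop _)).symm
    · intro m n hmn k
      simp only
      split_ifs
      · exact le_rfl
      · exact hgle _ _ _ _ (hf0 _) hmn
  have hfin : ∀ᵐ ω ∂μ, ∑' i, φ (X i ω, mark i ω) < ⊤ :=
    ae_lt_top (h.measurable_tsum hφ) (by rwa [h.lintegral_tsum hlam hφ])
  have hA0 : ∀ ω, ∑' i, A 0 i ω ≤ ∑' i, φ (X i ω, mark i ω) := fun ω =>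
    ENNReal.tsum_le_tsum fun i => mul_le_of_le_one_right' (eN_le_one _)
  have hL : ∫⁻ ω, ∑' i, φ (X i ω, mark i ω) *
        eN (∑' k, if k = i then 0 else g (f (X i ω, mark i ω)) (X k ω, mark k ω)) ∂μ =
      ⨅ n, ∫⁻ ω, ∑' i, A n i ω ∂μ := by
    rw [← lintegral_iInf]
    · refine lintegral_congr_ae ?_
      filter_upwards [hfin] with ω hω
      rw [← tsum_iInf_of_antitone (f := fun n i => A n i ω) (fun m n hmn i => hAanti i ω hmn)
        (ne_top_of_le_ne_top hω.ne (hA0 ω))]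
      exact tsum_congr fun i => (hAinf i ω).symm
    · exact fun n => Measurable.tsum fun i => hAm n i
    · exact fun m n hmn ω => ENNReal.tsum_le_tsum fun i => hAanti i ω hmn
    · refine ne_top_of_le_ne_top ?_ (lintegral_mono hA0)
      rwa [h.lintegral_tsum hlam hφ]
  rw [hL]
  simp_rw [A, hstep]
  rw [← lintegral_iInf]
  · refine lintegral_congr fun y => ?_
    rw [← ENNReal.mul_iInf fun hi => absurd hi (hφtop _), ← eN_lintegral_iSup Λ (fun n => hgm _)
      (fun m n hmn y' => hgle _ _ _ _ (hf0 _) hmn)]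
    simp_rw [hcont _ _ (hf0 y)]
  · intro n
    have hmeas : Measurable fun p : (ℂ × 𝓜) × (ℂ × 𝓜) => 1 - eN (g (dyadicFloor n (f p.1)) p.2) :=
      measurable_const.sub (measurable_eN.comp (hg.comp
        ((((measurable_dyadicFloor n).comp hf).comp measurable_fst).prodMk measurable_snd)))
    exact hφ.mul (measurable_eN.comp hmeas.lintegral_prod_right')
  · intro m n hmn y
    exact mul_le_mul_right (eN_antitone (lintegral_mono fun y' => one_sub_eN_mono
      (hgle _ _ _ _ (hf0 _) hmn))) _
  · exact ne_top_of_le_ne_top hφfin (lintegral_mono fun y => mul_le_of_le_one_right' (eN_le_one _))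

/-! ### Resampling a mark -/

lemma measurable_update_pair (i : ℕ) :
    Measurable fun q : (ℕ → 𝓜) × 𝓜 => Function.update q.1 i q.2 := by
  refine measurable_pi_lambda _ fun j => ?_
  by_cases hj : j = i
  · subst hj; simpa using measurable_snd
  · simp only [Function.update_of_ne hj]
    exact (measurable_pi_apply j).comp measurable_fst

lemma map_update_infinitePi (ν : Measure 𝓜) [IsProbabilityMeasure ν] (i : ℕ) :
    ((Measure.infinitePi fun _ : ℕ => ν).prod ν).map (fun q => Function.update q.1 i q.2) =
      Measure.infinitePi fun _ : ℕ => ν := by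
  have hm := measurable_update_pair (𝓜 := 𝓜) i
  refine Measure.eq_infinitePi _ fun s t ht => ?_
  rw [Measure.map_apply hm (MeasurableSet.pi s.countable_toSet fun j _ => ht j)]
  by_cases hi : i ∈ s
  · have : (fun q : (ℕ → 𝓜) × 𝓜 => Function.update q.1 i q.2) ⁻¹' Set.pi s t =
        (Set.pi (s.erase i : Finset ℕ) t) ×ˢ t i := by
      ext q
      simp only [Set.mem_preimage, Set.mem_pi, Set.mem_prod, Finset.mem_coe, Finset.mem_erase]
      constructor
      · intro h
        refine ⟨fun j hj => ?_, by simpa using h i hi⟩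
        simpa [hj.1] using h j hj.2
      · rintro ⟨h1, h2⟩ j hj
        by_cases hji : j = i
        · subst hji; simpa using h2
        · simpa [hji] using h1 j ⟨hji, hj⟩
    rw [this, Measure.prod_prod, Measure.infinitePi_pi _ fun j _ => ht j, mul_comm,
      Finset.mul_prod_erase s (fun j => ν (t j)) hi]
  · have : (fun q : (ℕ → 𝓜) × 𝓜 => Function.update q.1 i q.2) ⁻¹' Set.pi s t =
        (Set.pi s t) ×ˢ Set.univ := by
      ext q
      simp only [Set.mem_preimage, Set.mem_pi, Set.mem_prod, Finset.mem_coe, Set.mem_univ, and_true]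
      refine forall₂_congr fun j hj => ?_
      have : j ≠ i := fun h => hi (h ▸ hj)
      simp [this]
    rw [this, Measure.prod_prod, Measure.infinitePi_pi _ fun j _ => ht j, measure_univ, mul_one]

/-- Replacing the mark of one point by an independent copy does not change the law. -/
theorem IsMarkedPoisson.lintegral_update (h : IsMarkedPoisson μ X mark lam ν)
    {H : (ℕ → ℂ) → (ℕ → 𝓜) → ℝ≥0∞} (hH : Measurable (Function.uncurry H)) (i : ℕ) :
    ∫⁻ ω, H (fun k => X k ω) (fun k => mark k ω) ∂μ =
      ∫⁻ ω, ∫⁻ y, H (fun k => X k ω) (Function.update (fun k => mark k ω) i y) ∂ν ∂μ := by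
  have hX := measurable_pi_lambda (fun ω k => X k ω) h.points.measurable
  have hmk := measurable_pi_lambda (fun ω k => mark k ω) h.marks.measurable
  have hlaw : μ.map (fun ω k => mark k ω) = Measure.infinitePi fun _ : ℕ => ν := by
    rw [(iIndepFun_iff_map_fun_eq_infinitePi_map h.marks.measurable).1 h.marks.indep]
    simp_rw [h.marks.law]
  have hm := measurable_update_pair (𝓜 := 𝓜) i
  have hH2 : Measurable fun q : ((ℕ → ℂ) × (ℕ → 𝓜)) × 𝓜 => H q.1.1 (Function.update q.1.2 i q.2) :=
    hH.comp ((measurable_fst.comp measurable_fst).prodMk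
      (hm.comp ((measurable_snd.comp measurable_fst).prodMk measurable_snd)))
  rw [lintegral_indepFun h.indep hX hmk hH, lintegral_indepFun h.indep hX hmk
    (F := fun x m => ∫⁻ y, H x (Function.update m i y) ∂ν) hH2.lintegral_prod_right']
  refine lintegral_congr fun ω => ?_
  have hHx : Measurable (H fun k => X k ω) := hH.comp measurable_prodMk_left
  have hHy : Measurable fun q : (ℕ → 𝓜) × 𝓜 => H (fun k => X k ω) (Function.update q.1 i q.2) :=
    hHx.comp hm
  calc ∫⁻ ω', H (fun k => X k ω) (fun k => mark k ω') ∂μ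
      = ∫⁻ m, H (fun k => X k ω) m ∂(μ.map fun ω k => mark k ω) := (lintegral_map hHx hmk).symm
    _ = ∫⁻ q, H (fun k => X k ω) (Function.update q.1 i q.2)
          ∂((Measure.infinitePi fun _ : ℕ => ν).prod ν) := by
        rw [hlaw, ← map_update_infinitePi ν i, lintegral_map hHx hm, map_update_infinitePi ν i]
    _ = ∫⁻ m, ∫⁻ y, H (fun k => X k ω) (Function.update m i y) ∂ν ∂(μ.map fun ω k => mark k ω) := by
        rw [lintegral_prod _ hHy.aemeasurable, hlaw]
    _ = _ := lintegral_map hHy.lintegral_prod_right' hmk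

end Mecke

/-! ## Sectors and link losses -/

lemma measurable_angle : Measurable angle := by
  unfold angle
  exact Measurable.ite (measurableSet_le measurable_const Complex.measurable_arg)
    Complex.measurable_arg (Complex.measurable_arg.add_const _)

lemma measurable_sectorIdx (K : ℕ) : Measurable (sectorIdx K) :=
  (measurable_angle.div_const _).nat_floor

lemma angle_nonneg (v : ℂ) : 0 ≤ angle v := by
  unfold angle
  split_ifs with h
  · exact h
  · linarith [Complex.neg_pi_lt_arg v, Real.pi_pos]

lemma angle_lt (v : ℂ) : angle v < 2 * Real.pi := by
  unfold angle
  split_ifs with h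
  · linarith [Complex.arg_le_pi v, Real.pi_pos]
  · linarith

lemma sectorIdx_lt {K : ℕ} (hK : 0 < K) (v : ℂ) : sectorIdx K v < K := by
  unfold sectorIdx
  have hK' : (0 : ℝ) < K := by exact_mod_cast hK
  rw [Nat.floor_lt (by have := angle_nonneg v; positivity), div_lt_iff₀ (by positivity)]
  calc angle v < 2 * Real.pi := angle_lt v
    _ = K * (2 * Real.pi / K) := by field_simp

lemma sectorIdx_div {K N : ℕ} (hK : 0 < K) (hN : 0 < N) (h : N ∣ K) (v : ℂ) :
    sectorIdx N v = sectorIdx K v / (K / N) := by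
  obtain ⟨q, rfl⟩ := h
  have hq : 0 < q := Nat.pos_of_mul_pos_left hK
  rw [Nat.mul_div_cancel_left _ hN]
  unfold sectorIdx
  rw [← Nat.floor_div_natCast]
  congr 1
  have : (N : ℝ) ≠ 0 := by exact_mod_cast hN.ne'
  have : (q : ℝ) ≠ 0 := by exact_mod_cast hq.ne'
  push_cast
  field_simp

lemma volume_sector_angles {K : ℕ} (hK : 0 < K) {j : ℕ} (hj : j < K) :
    volume ({θ : ℝ | ⌊(if 0 ≤ θ then θ else θ + 2 * Real.pi) / (2 * Real.pi / K)⌋₊ = j} ∩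
      Set.Ioo (-Real.pi) Real.pi) = ENNReal.ofReal (2 * Real.pi / K) := by
  have hK' : (0 : ℝ) < K := by exact_mod_cast hK
  have hπ := Real.pi_pos
  set w : ℝ := 2 * Real.pi / K with hw
  have hw0 : 0 < w := by positivity
  set I : Set ℝ := Set.Ico (j * w) ((j + 1) * w) with hI
  have hfl : ∀ a : ℝ, 0 ≤ a → (⌊a / w⌋₊ = j ↔ a ∈ I) := by
    intro a ha
    rw [Nat.floor_eq_iff (by positivity), le_div_iff₀ hw0, div_lt_iff₀ hw0]
    rfl
  have hI0 : I ⊆ Set.Ico 0 (2 * Real.pi) := by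
    intro a ha
    refine ⟨le_trans (by positivity) ha.1, lt_of_lt_of_le ha.2 ?_⟩
    have h1 : ((j : ℝ) + 1) ≤ K := by exact_mod_cast hj
    calc ((j : ℝ) + 1) * w ≤ K * w := by gcongr
      _ = 2 * Real.pi := by rw [hw]; field_simp
  have hset : {θ : ℝ | ⌊(if 0 ≤ θ then θ else θ + 2 * Real.pi) / w⌋₊ = j} ∩
      Set.Ioo (-Real.pi) Real.pi =
      (I ∩ Set.Iio Real.pi) ∪ (fun θ => θ + 2 * Real.pi) ⁻¹' (I ∩ Set.Ioi Real.pi) := by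
    ext θ
    simp only [Set.mem_inter_iff, Set.mem_union, Set.mem_preimage, Set.mem_Iio, Set.mem_Ioi,
      Set.mem_Ioo]
    constructor
    · rintro ⟨h1, h2, h3⟩
      change ⌊(if 0 ≤ θ then θ else θ + 2 * Real.pi) / w⌋₊ = j at h1
      split_ifs at h1 with h0
      · exact Or.inl ⟨(hfl _ h0).1 h1, h3⟩
      · exact Or.inr ⟨(hfl _ (by linarith)).1 h1, by linarith⟩
    · rintro (⟨h1, h2⟩ | ⟨h1, h2⟩)
      · have h0 := (hI0 h1).1
        refine ⟨?_, by linarith, h2⟩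
        change ⌊(if 0 ≤ θ then θ else θ + 2 * Real.pi) / w⌋₊ = j
        rw [if_pos h0]; exact (hfl _ h0).2 h1
      · have h0 := (hI0 h1).2
        refine ⟨?_, by linarith, by linarith⟩
        change ⌊(if 0 ≤ θ then θ else θ + 2 * Real.pi) / w⌋₊ = j
        rw [if_neg (by linarith)]; exact (hfl _ (by linarith)).2 h1
  rw [hset, measure_union _ (by
    exact (measurableSet_Ico.inter measurableSet_Ioi).preimage (measurable_id.add_const _)),
    measure_preimage_add_right]
  · have h1 : volume (I ∩ Set.Ioi Real.pi) = volume (I \ Set.Iio Real.pi) := by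
      rw [Set.sdiff_eq, Set.compl_Iio]
      refine measure_congr (ae_eq_set_inter (ae_eq_refl I) Ioi_ae_eq_Ici)
    rw [h1, measure_inter_add_sdiff _ measurableSet_Iio, hI, Real.volume_Ico]
    congr 1; ring
  · refine Set.disjoint_left.2 fun θ h1 h2 => ?_
    have h3 := (hI0 h1.1).1
    have h4 := (hI0 h2.1).2
    simp only at h4
    linarith

/-- Integrals of radial functions over a sector. -/
lemma lintegral_sector {K : ℕ} (hK : 0 < K) {j : ℕ} (hj : j < K) {F : ℝ → ℝ≥0∞} (hF : Measurable F) :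
    ∫⁻ x : ℂ, (if sectorIdx K x = j then F ‖x‖ else 0) =
      ENNReal.ofReal (2 * Real.pi / K) * ∫⁻ r in Set.Ioi 0, F r * ENNReal.ofReal r := by
  rw [← Complex.lintegral_comp_polarCoord_symm]
  set A : Set ℝ := {θ : ℝ | ⌊(if 0 ≤ θ then θ else θ + 2 * Real.pi) / (2 * Real.pi / K)⌋₊ = j} with hA
  have hAm : MeasurableSet A := by
    have : Measurable fun θ : ℝ => ⌊(if 0 ≤ θ then θ else θ + 2 * Real.pi) / (2 * Real.pi / K)⌋₊ :=
      ((Measurable.ite measurableSet_Ici measurable_id (measurable_id.add_const _)).div_const _).nat_floor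
    exact this (measurableSet_singleton j)
  have h1 : ∀ q ∈ polarCoord.target, ENNReal.ofReal q.1 •
      (if sectorIdx K (Complex.polarCoord.symm q) = j then F ‖Complex.polarCoord.symm q‖ else 0) =
      (F q.1 * ENNReal.ofReal q.1) * A.indicator 1 q.2 := by
    rintro ⟨r, θ⟩ hq
    rw [polarCoord_target] at hq
    obtain ⟨hr, hθ⟩ := hq
    simp only [Set.mem_Ioi] at hr
    have harg : (Complex.polarCoord.symm (r, θ)).arg = θ := by
      rw [Complex.polarCoord_symm_apply]
      have := Complex.arg_mul_cos_add_sin_mul_I hr ⟨hθ.1, hθ.2.le⟩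
      simpa using this
    have hnorm : ‖Complex.polarCoord.symm (r, θ)‖ = r := by
      rw [Complex.norm_polarCoord_symm]; exact abs_of_pos hr
    have hsec : sectorIdx K (Complex.polarCoord.symm (r, θ)) = j ↔ θ ∈ A := by
      unfold sectorIdx angle
      rw [harg]; rfl
    rw [hnorm]
    by_cases h : θ ∈ A
    · rw [if_pos (hsec.2 h), Set.indicator_of_mem h]
      simp [mul_comm]
    · rw [if_neg (fun h' => h (hsec.1 h')), Set.indicator_of_notMem h]
      simp
  rw [setLIntegral_congr_fun polarCoord.open_target.measurableSet h1, polarCoord_target,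
    Measure.volume_eq_prod, ← Measure.prod_restrict, lintegral_prod_mul (f := fun r => F r * ENNReal.ofReal r)
      (g := A.indicator 1) (by fun_prop) ((measurable_one.indicator hAm).aemeasurable), lintegral_indicator_one hAm,
    Measure.restrict_apply hAm, volume_sector_angles hK hj, mul_comm]

lemma unifLaw_Iio {a : ℝ} (ha : a ∈ Set.Icc (0 : ℝ) 1) :
    unifLaw (Set.Iio a) = ENNReal.ofReal a := by
  rw [unifLaw, Measure.restrict_apply measurableSet_Iio]
  have : Set.Iio a ∩ Set.Icc 0 1 = Set.Ico 0 a := by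
    ext x; simp only [Set.mem_inter_iff, Set.mem_Iio, Set.mem_Icc, Set.mem_Ico]
    constructor
    · rintro ⟨h1, h2, h3⟩; exact ⟨h2, h1⟩
    · rintro ⟨h1, h2⟩; exact ⟨h2, h1, h2.le.trans ha.2⟩
  rw [this]; simp

instance : IsProbabilityMeasure unifLaw := ⟨by simp [unifLaw]⟩

lemma lintegral_unifLaw_ite {a : ℝ} (ha : a ∈ Set.Icc (0 : ℝ) 1) (c d : ℝ≥0∞) :
    ∫⁻ v, (if v < a then c else d) ∂unifLaw = ENNReal.ofReal a * c + ENNReal.ofReal (1 - a) * d := by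
  have h1 : ∀ v : ℝ, (if v < a then c else d) =
      (Set.Iio a).indicator (fun _ => c) v + (Set.Iio a)ᶜ.indicator (fun _ => d) v := by
    intro v
    by_cases hv : v < a
    · simp [hv]
    · simp [hv, not_lt.1 hv]
  simp_rw [h1]
  rw [lintegral_add_left (measurable_const.indicator measurableSet_Iio),
    lintegral_indicator_const measurableSet_Iio, lintegral_indicator_const measurableSet_Iio.compl,
    prob_compl_eq_one_sub measurableSet_Iio, unifLaw_Iio ha, ENNReal.ofReal_sub _ ha.1,
    ENNReal.ofReal_one, mul_comm c, mul_comm d]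

namespace Params

variable (p : Params)

/-- Integral of a function of the path loss over all distances, with respect to `r dr`. -/
def rad (φ : ℝ → ℝ≥0∞) : ℝ≥0∞ :=
  ∫⁻ r in Set.Ioi 0, (ENNReal.ofReal (p.h r) * φ (p.lossL r) +
    ENNReal.ofReal (1 - p.h r) * φ (p.lossN r)) * ENNReal.ofReal r

@[fun_prop] lemma measurable_h : Measurable p.h := p.h_measurable

@[fun_prop] lemma measurable_lossL : Measurable p.lossL := by
  unfold lossL; fun_prop

@[fun_prop] lemma measurable_lossN : Measurable p.lossN := by
  unfold lossN; fun_prop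

@[fun_prop] lemma measurable_invL : Measurable p.invL := by
  unfold invL; fun_prop

@[fun_prop] lemma measurable_invN : Measurable p.invN := by
  unfold invN; fun_prop

lemma measurable_linkLoss : Measurable fun q : ℝ × ℝ => p.linkLoss q.1 q.2 := by
  unfold linkLoss
  exact Measurable.ite (measurableSet_lt measurable_fst (p.h_measurable.comp measurable_snd))
    (p.measurable_lossL.comp measurable_snd) (p.measurable_lossN.comp measurable_snd)

lemma lossL_nonneg {r : ℝ} (hr : 0 ≤ r) : 0 ≤ p.lossL r := by
  have := p.beta_pos; unfold lossL; positivity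

lemma lossN_nonneg {r : ℝ} (hr : 0 ≤ r) : 0 ≤ p.lossN r := by
  have := p.beta_pos; unfold lossN; positivity

lemma lossL_pos {r : ℝ} (hr : 0 < r) : 0 < p.lossL r := by
  have := p.beta_pos; unfold lossL; positivity

lemma lossN_pos {r : ℝ} (hr : 0 < r) : 0 < p.lossN r := by
  have := p.beta_pos; unfold lossN; positivity

lemma linkLoss_nonneg (v : ℝ) {r : ℝ} (hr : 0 ≤ r) : 0 ≤ p.linkLoss v r := by
  unfold linkLoss; split_ifs
  · exact p.lossL_nonneg hr
  · exact p.lossN_nonneg hr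

lemma invL_pos {z : ℝ} (hz : 0 < z) : 0 < p.invL z := by
  have := p.beta_pos; unfold invL; positivity

lemma invN_pos {z : ℝ} (hz : 0 < z) : 0 < p.invN z := by
  have := p.beta_pos; unfold invN; positivity

lemma power_lt_iff {α β z r : ℝ} (hα : 0 < α) (hβ : 0 < β) (hz : 0 ≤ z) (hr : 0 ≤ r) :
    z < β * r ^ α ↔ (z / β) ^ (1 / α) < r := by
  rw [one_div, Real.rpow_inv_lt_iff_of_pos (by positivity) hr hα, div_lt_iff₀' hβ]

lemma lt_lossL_iff {z r : ℝ} (hz : 0 ≤ z) (hr : 0 ≤ r) : z < p.lossL r ↔ p.invL z < r :=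
  power_lt_iff p.alphaL_pos p.beta_pos hz hr

lemma lt_lossN_iff {z r : ℝ} (hz : 0 ≤ z) (hr : 0 ≤ r) : z < p.lossN r ↔ p.invN z < r :=
  power_lt_iff p.alphaN_pos p.beta_pos hz hr

lemma lintegral_unifLaw_linkLoss (φ : ℝ → ℝ≥0∞) {r : ℝ} (hr : 0 ≤ r) :
    ∫⁻ v, φ (p.linkLoss v r) ∂unifLaw =
      ENNReal.ofReal (p.h r) * φ (p.lossL r) + ENNReal.ofReal (1 - p.h r) * φ (p.lossN r) := by
  rw [← lintegral_unifLaw_ite (p.h_mem r hr)]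
  refine lintegral_congr fun v => ?_
  unfold linkLoss; split_ifs <;> rfl

/-- Integral of a function of the path loss over the links in a sector. -/
lemma lintegral_sector_linkLoss {K : ℕ} (hK : 0 < K) {j : ℕ} (hj : j < K) {φ : ℝ → ℝ≥0∞}
    (hφ : Measurable φ) :
    ∫⁻ x : ℂ, ∫⁻ v, (if sectorIdx K x = j then φ (p.linkLoss v ‖x‖) else 0) ∂unifLaw =
      ENNReal.ofReal (2 * Real.pi / K) * p.rad φ := by
  rw [rad, ← lintegral_sector hK hj (by fun_prop)]
  refine lintegral_congr fun x => ?_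
  split_ifs
  · exact p.lintegral_unifLaw_linkLoss φ (norm_nonneg x)
  · simp

lemma rad_add {φ ψ : ℝ → ℝ≥0∞} (hφ : Measurable φ) :
    p.rad (fun l => φ l + ψ l) = p.rad φ + p.rad ψ := by
  unfold rad
  rw [← lintegral_add_left (by fun_prop)]
  refine lintegral_congr fun r => ?_
  ring

lemma rad_const_mul {φ : ℝ → ℝ≥0∞} {c : ℝ≥0∞} (hc : c ≠ ⊤) :
    p.rad (fun l => c * φ l) = c * p.rad φ := by
  unfold rad
  rw [← lintegral_const_mul' _ _ hc]
  refine lintegral_congr fun r => ?_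
  ring

lemma rad_mono {φ ψ : ℝ → ℝ≥0∞} (h : ∀ l, 0 < l → φ l ≤ ψ l) : p.rad φ ≤ p.rad ψ := by
  unfold rad
  refine setLIntegral_mono' measurableSet_Ioi fun r hr => ?_
  gcongr
  · exact h _ (p.lossL_pos hr)
  · exact h _ (p.lossN_pos hr)

lemma rad_congr_of_ne {φ ψ : ℝ → ℝ≥0∞} {z : ℝ} (h : ∀ l, 0 < l → l ≠ z → φ l = ψ l) :
    p.rad φ = p.rad ψ := by
  unfold rad
  by_cases hz : 0 ≤ z
  · have hL : ∀ᵐ r : ℝ, r ≠ p.invL z := by simp [ae_iff]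
    have hN : ∀ᵐ r : ℝ, r ≠ p.invN z := by simp [ae_iff]
    rw [← ae_restrict_iff' measurableSet_Ioi |>.2 ?_ |> lintegral_congr_ae]
    filter_upwards [hL, hN] with r h1 h2 hr
    have hr : 0 < r := hr
    have key : ∀ {α : ℝ}, 0 < α → p.beta * r ^ α = z → r = (z / p.beta) ^ (1 / α) := by
      intro α hα hh
      rw [← hh, mul_div_cancel_left₀ _ p.beta_pos.ne', ← Real.rpow_mul hr.le,
        mul_one_div_cancel hα.ne', Real.rpow_one]
    rw [h _ (p.lossL_pos hr) fun hh => h1 (key p.alphaL_pos hh),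
      h _ (p.lossN_pos hr) fun hh => h2 (key p.alphaN_pos hh)]
  · refine setLIntegral_congr_fun measurableSet_Ioi fun r hr => ?_
    have h0 : ∀ l, 0 < l → l ≠ z := fun l hl hh => hz (hh ▸ hl.le)
    rw [h _ (p.lossL_pos hr) (h0 _ (p.lossL_pos hr)), h _ (p.lossN_pos hr) (h0 _ (p.lossN_pos hr))]

/-- The Laplace kernel of the interference from a link of path loss `l`. -/
def kern (z T l : ℝ) : ℝ≥0∞ := ENNReal.ofReal (T * z / (T * z + l))

lemma ofReal_mul_kern {z T l r a : ℝ} (hz : 0 < z) (hT : 0 ≤ T) (hl : 0 < l)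
    (ha : a ∈ Set.Icc (0 : ℝ) 1) :
    ENNReal.ofReal (T * z * a * r / (T * z + l)) =
      ENNReal.ofReal a * kern z T l * ENNReal.ofReal r := by
  have : 0 ≤ T * z / (T * z + l) := by positivity
  rw [kern, ← ENNReal.ofReal_mul ha.1, ← ENNReal.ofReal_mul (mul_nonneg ha.1 this)]
  congr 1
  ring

lemma interf_eq {z T a b : ℝ} (hz : 0 < z) (hT : 0 ≤ T) (ha : 0 ≤ a) (hb : 0 ≤ b) :
    p.interf z T a b = ∫⁻ r in Set.Ioi 0,
      (ENNReal.ofReal (p.h r) * (if a < r then kern z T (p.lossL r) else 0) +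
        ENNReal.ofReal (1 - p.h r) * (if b < r then kern z T (p.lossN r) else 0)) *
          ENNReal.ofReal r := by
  have key : ∀ (f : ℝ → ℝ≥0∞) (c : ℝ), 0 ≤ c → ∫⁻ r in Set.Ioi c, f r =
      ∫⁻ r in Set.Ioi 0, if c < r then f r else 0 := by
    intro f c hc
    have : ∀ r, (if c < r then f r else 0) = (Set.Ioi c).indicator f r := by
      intro r; simp [Set.indicator_apply]
    simp_rw [this]
    rw [setLIntegral_indicator measurableSet_Ioi, Set.inter_eq_left.2 (Set.Ioi_subset_Ioi hc)]
  rw [interf, key _ a ha, key _ b hb, ← lintegral_add_left]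
  · refine setLIntegral_congr_fun measurableSet_Ioi fun r hr => ?_
    have hr : 0 < r := hr
    have h1 := p.h_mem r hr.le
    rw [ofReal_mul_kern hz hT (p.lossL_pos hr) h1, ofReal_mul_kern hz hT (p.lossN_pos hr)
      ⟨by linarith [h1.2], by linarith [h1.1]⟩]
    split_ifs <;> ring
  · exact Measurable.ite measurableSet_Ioi (by fun_prop) measurable_const

lemma interf_zero {z T : ℝ} (hz : 0 < z) (hT : 0 ≤ T) : p.interf z T 0 0 = p.rad (kern z T) := by
  rw [p.interf_eq hz hT le_rfl le_rfl]
  refine setLIntegral_congr_fun measurableSet_Ioi fun r hr => ?_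
  have hr : 0 < r := hr
  simp only [hr, if_true]

lemma interf_inv {z T : ℝ} (hz : 0 < z) (hT : 0 ≤ T) :
    p.interf z T (p.invL z) (p.invN z) = p.rad (fun l => if z < l then kern z T l else 0) := by
  rw [p.interf_eq hz hT (p.invL_pos hz).le (p.invN_pos hz).le]
  refine setLIntegral_congr_fun measurableSet_Ioi fun r hr => ?_
  have hr : 0 < r := hr
  simp only [p.lt_lossL_iff hz.le hr.le, p.lt_lossN_iff hz.le hr.le]

lemma ofReal_V {z T : ℝ} (hz : 0 < z) (hT : 0 ≤ T) (l : ℝ) :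
    ENNReal.ofReal (p.V z T l) = eN (ENNReal.ofReal (2 * Real.pi * l) *
      p.rad (fun l => if z < l then kern z T l else 0)) := by
  rw [V, p.interf_inv hz hT]; rfl

lemma ofReal_U {z T : ℝ} (hz : 0 < z) (hT : 0 ≤ T) (l : ℝ) :
    ENNReal.ofReal (p.U z T l) = eN (ENNReal.ofReal (2 * Real.pi * l) * p.rad (kern z T)) := by
  rw [U, p.interf_zero hz hT]; rfl

/-- The density of the mean number of links in a sector with respect to the path loss. -/
def lossDensity (z : ℝ) : ℝ :=
  (1 / p.alphaL) * (1 / p.beta) ^ (2 / p.alphaL) * z ^ (2 / p.alphaL - 1) * p.h (p.invL z) +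
    (1 / p.alphaN) * (1 / p.beta) ^ (2 / p.alphaN) * z ^ (2 / p.alphaN - 1) * (1 - p.h (p.invN z))

@[fun_prop] lemma measurable_lossDensity : Measurable p.lossDensity := by
  unfold lossDensity
  have := p.h_measurable.comp p.measurable_invL
  have := p.h_measurable.comp p.measurable_invN
  simp only [Function.comp_def] at *
  fun_prop

lemma lintegral_power {α β : ℝ} (hα : 0 < α) (hβ : 0 < β) {a : ℝ → ℝ} (ha : ∀ r, 0 ≤ r → 0 ≤ a r)
    (φ : ℝ → ℝ≥0∞) :
    ∫⁻ r in Set.Ioi 0, ENNReal.ofReal (a r) * φ (β * r ^ α) * ENNReal.ofReal r =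
      ∫⁻ z in Set.Ioi 0, φ z * ENNReal.ofReal
        ((1 / α) * (1 / β) ^ (2 / α) * z ^ (2 / α - 1) * a ((z / β) ^ (1 / α))) := by
  have himage : (fun z : ℝ => (z / β) ^ (1 / α)) '' Set.Ioi 0 = Set.Ioi 0 := by
    ext r
    simp only [Set.mem_image, Set.mem_Ioi]
    constructor
    · rintro ⟨z, hz, rfl⟩; positivity
    · intro hr
      refine ⟨β * r ^ α, by positivity, ?_⟩
      rw [mul_div_cancel_left₀ _ hβ.ne', ← Real.rpow_mul hr.le, mul_one_div_cancel hα.ne',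
        Real.rpow_one]
  have hinv : ∀ z : ℝ, 0 < z → β * ((z / β) ^ (1 / α)) ^ α = z := by
    intro z hz
    rw [← Real.rpow_mul (by positivity), one_div_mul_cancel hα.ne', Real.rpow_one]
    field_simp
  have hinj : Set.InjOn (fun z : ℝ => (z / β) ^ (1 / α)) (Set.Ioi 0) := by
    intro z hz w hw h
    have := congrArg (fun r => β * r ^ α) h
    simpa only [hinv z hz, hinv w hw] using this
  have hder : ∀ z ∈ Set.Ioi (0 : ℝ), HasDerivWithinAt (fun z : ℝ => (z / β) ^ (1 / α))
      (1 / β * (1 / α) * (z / β) ^ (1 / α - 1)) (Set.Ioi 0) z := by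
    intro z hz
    have hz : 0 < z := hz
    have h1 : HasDerivAt (fun z : ℝ => z / β) (1 / β) z := (hasDerivAt_id z).div_const β
    exact (h1.rpow_const (Or.inl (by positivity))).hasDerivWithinAt
  have := lintegral_image_eq_lintegral_abs_deriv_mul measurableSet_Ioi hder hinj
    (fun r => ENNReal.ofReal (a r) * φ (β * r ^ α) * ENNReal.ofReal r)
  rw [himage] at this
  rw [this]
  refine setLIntegral_congr_fun measurableSet_Ioi fun z hz => ?_
  have hz : 0 < z := hz
  have hr : 0 < (z / β) ^ (1 / α) := by positivity
  have hcomm : ∀ A B C D : ℝ≥0∞, A * (B * C * D) = C * (A * (B * D)) := by intros; ring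
  rw [hinv z hz, abs_of_pos (by positivity), hcomm]
  congr 1
  rw [← ENNReal.ofReal_mul (ha _ hr.le), ← ENNReal.ofReal_mul (by positivity)]
  congr 1
  have h2 : (1 / β) * (z / β) ^ (1 / α - 1) * (z / β) ^ (1 / α) =
      (1 / β) ^ (2 / α) * z ^ (2 / α - 1) := by
    rw [mul_assoc, ← Real.rpow_add (by positivity), show 1 / α - 1 + 1 / α = 2 / α - 1 by ring,
      div_eq_mul_one_div z, Real.mul_rpow hz.le (by positivity), Real.rpow_sub_one (x := 1 / β) (by positivity)]
    field_simp
  calc _ = (1 / α) * ((1 / β) * (z / β) ^ (1 / α - 1) * (z / β) ^ (1 / α)) * a ((z / β) ^ (1 / α)) := by ring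
    _ = _ := by rw [h2]; ring

/-- Change of variables from distance to path loss. -/
lemma rad_eq_lintegral {φ : ℝ → ℝ≥0∞} (hφ : Measurable φ) :
    p.rad φ = ∫⁻ z in Set.Ioi 0, φ z * ENNReal.ofReal (p.lossDensity z) := by
  have hL := lintegral_power p.alphaL_pos p.beta_pos (a := p.h) (fun r hr => (p.h_mem r hr).1) φ
  have hN := lintegral_power p.alphaN_pos p.beta_pos (a := fun r => 1 - p.h r)
    (fun r hr => by linarith [(p.h_mem r hr).2]) φ
  unfold rad
  simp_rw [add_mul]
  rw [lintegral_add_left (by fun_prop)]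
  unfold lossL lossN
  rw [hL, hN, ← lintegral_add_left]
  · refine setLIntegral_congr_fun measurableSet_Ioi fun z hz => ?_
    have hz : 0 < z := hz
    have := p.beta_pos
    have := p.alphaL_pos
    have := p.alphaN_pos
    have h1 := (p.h_mem _ (p.invL_pos hz).le).1
    have h2 : 0 ≤ 1 - p.h (p.invN z) := by linarith [(p.h_mem _ (p.invN_pos hz).le).2]
    simp only [lossDensity]
    rw [ENNReal.ofReal_add (by positivity) (by positivity), mul_add]
    rfl
  · fun_prop

lemma rad_lt {z : ℝ} (hz : 0 < z) :
    p.rad (fun l => if l < z then 1 else 0) =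
      ENNReal.ofReal ((∫ r in Set.Ioc 0 (p.invL z), p.h r * r) +
        ∫ r in Set.Ioc 0 (p.invN z), (1 - p.h r) * r) := by
  have key : ∀ (a : ℝ → ℝ) (c : ℝ), Measurable a → (∀ r, 0 ≤ r → a r ∈ Set.Icc (0 : ℝ) 1) → 0 < c →
      ENNReal.ofReal (∫ r in Set.Ioc 0 c, a r * r) =
        ∫⁻ r in Set.Ioi 0, ENNReal.ofReal (a r) * (if r ≤ c then 1 else 0) * ENNReal.ofReal r := by
    intro a c ha ha1 hc
    have hind : ∀ r, ENNReal.ofReal (a r) * (if r ≤ c then 1 else 0) * ENNReal.ofReal r =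
        (Set.Iic c).indicator (fun r => ENNReal.ofReal (a r) * ENNReal.ofReal r) r := by
      intro r; by_cases hr : r ≤ c <;> simp [hr]
    simp_rw [hind]
    rw [setLIntegral_indicator measurableSet_Iic, Set.inter_comm, Set.Ioi_inter_Iic,
      ofReal_integral_eq_lintegral_ofReal]
    · exact setLIntegral_congr_fun measurableSet_Ioc fun r hr =>
        ENNReal.ofReal_mul (ha1 r hr.1.le).1
    · refine Measure.integrableOn_of_bounded (M := c) (by simp) (by fun_prop) ?_
      rw [ae_restrict_iff' measurableSet_Ioc]
      refine Eventually.of_forall fun r hr => ?_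
      have h1 := ha1 r hr.1.le
      rw [Real.norm_of_nonneg (mul_nonneg h1.1 hr.1.le)]
      calc a r * r ≤ 1 * r := mul_le_mul_of_nonneg_right h1.2 hr.1.le
        _ ≤ c := by linarith [hr.2]
    · rw [EventuallyLE, ae_restrict_iff' measurableSet_Ioc]
      exact Eventually.of_forall fun r hr => mul_nonneg (ha1 r hr.1.le).1 hr.1.le
  have hI : ∀ (a : ℝ → ℝ) (c : ℝ), (∀ r, 0 ≤ r → a r ∈ Set.Icc (0 : ℝ) 1) →
      0 ≤ ∫ r in Set.Ioc 0 c, a r * r := by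
    intro a c ha1
    refine setIntegral_nonneg measurableSet_Ioc fun r hr => mul_nonneg (ha1 r hr.1.le).1 hr.1.le
  have hN1 : ∀ r, 0 ≤ r → (1 - p.h r) ∈ Set.Icc (0 : ℝ) 1 := fun r hr =>
    ⟨by linarith [(p.h_mem r hr).2], by linarith [(p.h_mem r hr).1]⟩
  have hne : p.rad (fun l => if l < z then 1 else 0) = p.rad (fun l => if l ≤ z then 1 else 0) :=
    p.rad_congr_of_ne (z := z) fun l _ hl => by simp [le_iff_lt_or_eq, hl]
  rw [hne, ENNReal.ofReal_add (hI _ _ p.h_mem) (hI _ _ hN1), key _ _ p.h_measurable p.h_mem (p.invL_pos hz),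
    key (fun r => 1 - p.h r) _ (by fun_prop) hN1 (p.invN_pos hz), rad, ← lintegral_add_left]
  · refine setLIntegral_congr_fun measurableSet_Ioi fun r hr => ?_
    have hr : 0 < r := hr
    simp only [← not_lt, p.lt_lossL_iff hz.le hr.le, p.lt_lossN_iff hz.le hr.le]
    ring
  · exact ((Measurable.ennreal_ofReal p.h_measurable).mul
      (Measurable.ite measurableSet_Iic measurable_const measurable_const)).mul (by fun_prop)

lemma Mcs_pos : 0 < p.Mcs := by
  unfold Mcs
  split
  · exact p.M_pos
  · exact p.M_pos
  · rename_i m h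
    exact p.N_pos.trans_le (p.fastCS_beams m h).1
  · exact p.M_pos

lemma Kcs_pos : 0 < p.Kcs := lt_max_of_lt_left p.Mcs_pos

lemma ofReal_fZ1 {z : ℝ} (hz : 0 < z) :
    ENNReal.ofReal (p.fZ1 z) = ENNReal.ofReal (2 * Real.pi * p.lam / p.Kcs) *
      (eN (ENNReal.ofReal (2 * Real.pi * p.lam / p.Kcs) * p.rad (fun l => if l < z then 1 else 0)) *
        ENNReal.ofReal (p.lossDensity z)) := by
  have hK : (0 : ℝ) < p.Kcs := by exact_mod_cast p.Kcs_pos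
  have hl := p.lam_pos
  have hc : 0 ≤ 2 * Real.pi * p.lam / p.Kcs := by positivity
  have hI : ∀ (a : ℝ → ℝ) (c : ℝ), (∀ r, 0 ≤ r → 0 ≤ a r) → 0 ≤ ∫ r in Set.Ioc 0 c, a r * r := by
    intro a c ha1
    refine setIntegral_nonneg measurableSet_Ioc fun r hr => mul_nonneg (ha1 r hr.1.le) hr.1.le
  have h1 := hI p.h (p.invL z) fun r hr => (p.h_mem r hr).1
  have h2 := hI (fun r => 1 - p.h r) (p.invN z) fun r hr => by linarith [(p.h_mem r hr).2]
  rw [p.rad_lt hz, ← ENNReal.ofReal_mul hc, eN_ofReal (by positivity), ← ENNReal.ofReal_mul (by positivity),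
    ← ENNReal.ofReal_mul hc]
  congr 1
  rw [fZ1, mul_add, neg_add, Real.exp_add, lossDensity]
  simp only [neg_mul]
  ring

end Params

/-! ## The exponential law -/

instance : IsProbabilityMeasure (expMeasure 1) := isProbabilityMeasure_expMeasure one_pos

lemma lintegral_expMeasure (f : ℝ → ℝ≥0∞) (hf : Measurable f) :
    ∫⁻ x, f x ∂(expMeasure 1) = ∫⁻ x in Set.Ioi 0, ENNReal.ofReal (Real.exp (-x)) * f x := by
  have hpdf : Measurable (exponentialPDF 1) := (measurable_exponentialPDFReal 1).ennreal_ofReal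
  have h1 : expMeasure 1 = volume.withDensity (exponentialPDF 1) := rfl
  have h2 : ∀ x, exponentialPDF 1 x * f x =
      (Set.Ici 0).indicator (fun x => ENNReal.ofReal (Real.exp (-x)) * f x) x := by
    intro x
    by_cases hx : 0 ≤ x
    · rw [exponentialPDF_of_nonneg hx]; simp [hx]
    · rw [exponentialPDF_of_neg (not_le.1 hx)]; simp [hx]
  rw [h1, lintegral_withDensity_eq_lintegral_mul _ hpdf hf]
  simp only [Pi.mul_apply, h2]
  rw [lintegral_indicator measurableSet_Ici]
  exact setLIntegral_congr Ioi_ae_eq_Ici.symm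

lemma lintegral_ofReal_exp_Ioi {c : ℝ} (hc : 0 < c) (a : ℝ) :
    ∫⁻ x in Set.Ioi a, ENNReal.ofReal (Real.exp (-c * x)) =
      ENNReal.ofReal (Real.exp (-c * a) / c) := by
  rw [← ofReal_integral_eq_lintegral_ofReal (integrableOn_exp_mul_Ioi (by linarith) a)
    (Eventually.of_forall fun x => (Real.exp_pos _).le), integral_exp_mul_Ioi (by linarith)]
  congr 1
  rw [neg_div_neg_eq]

/-- The tail of the exponential law. -/
lemma expMeasure_tail (s : ℝ≥0∞) :
    ∫⁻ x, (if s ≤ ENNReal.ofReal x then 1 else 0) ∂(expMeasure 1) = eN s := by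
  rcases eq_or_ne s ⊤ with rfl | hs
  · simp
  obtain ⟨t, ht, rfl⟩ : ∃ t : ℝ, 0 ≤ t ∧ s = ENNReal.ofReal t :=
    ⟨s.toReal, ENNReal.toReal_nonneg, (ENNReal.ofReal_toReal hs).symm⟩
  rw [lintegral_expMeasure _ (Measurable.ite (measurableSet_le measurable_const
    ENNReal.measurable_ofReal) measurable_const measurable_const), eN_ofReal ht]
  have h1 : ∀ x ∈ Set.Ioi (0 : ℝ), ENNReal.ofReal (Real.exp (-x)) *
      (if ENNReal.ofReal t ≤ ENNReal.ofReal x then 1 else 0) =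
      (Set.Ici t).indicator (fun x => ENNReal.ofReal (Real.exp (-1 * x))) x := by
    intro x hx
    have hx : 0 < x := hx
    by_cases h : t ≤ x
    · simp [h, ENNReal.ofReal_le_ofReal h]
    · simp [ENNReal.ofReal_le_ofReal_iff hx.le, h]
  rw [setLIntegral_congr_fun measurableSet_Ioi h1, setLIntegral_indicator measurableSet_Ici]
  have h2 : (Set.Ici t ∩ Set.Ioi 0 : Set ℝ) =ᵐ[volume] Set.Ioi t := by
    have : (Set.Ici t ∩ Set.Ioi 0 : Set ℝ) =ᵐ[volume] (Set.Ioi t ∩ Set.Ici 0 : Set ℝ) :=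
      ae_eq_set_inter Ioi_ae_eq_Ici.symm Ioi_ae_eq_Ici
    have hsub : (Set.Ioi t ∩ Set.Ici 0 : Set ℝ) = Set.Ioi t :=
      Set.inter_eq_left.2 fun x hx => ht.trans (le_of_lt hx)
    rwa [hsub] at this
  rw [setLIntegral_congr h2, lintegral_ofReal_exp_Ioi one_pos]
  simp

lemma expMeasure_tail_mul {c : ℝ} (hc : 0 < c) (s : ℝ≥0∞) :
    ∫⁻ x, (if s ≤ ENNReal.ofReal (x * c) then 1 else 0) ∂(expMeasure 1) =
      eN (s * ENNReal.ofReal c⁻¹) := by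
  rw [← expMeasure_tail]
  refine lintegral_congr fun x => ?_
  have : s ≤ ENNReal.ofReal (x * c) ↔ s * ENNReal.ofReal c⁻¹ ≤ ENNReal.ofReal x := by
    rw [ENNReal.ofReal_mul' hc.le, ENNReal.ofReal_inv_of_pos hc, ← div_eq_mul_inv,
      ENNReal.div_le_iff (by simpa using hc) ENNReal.ofReal_ne_top]
  simp only [this]

lemma lintegral_one_sub_eN_expMeasure {c : ℝ} (hc : 0 ≤ c) :
    ∫⁻ x, (1 - eN (ENNReal.ofReal c * ENNReal.ofReal x)) ∂(expMeasure 1) =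
      ENNReal.ofReal (c / (c + 1)) := by
  have h1 : ∫⁻ x, eN (ENNReal.ofReal c * ENNReal.ofReal x) ∂(expMeasure 1) =
      ENNReal.ofReal (1 / (c + 1)) := by
    rw [lintegral_expMeasure _ (by fun_prop)]
    have h2 : ∀ x ∈ Set.Ioi (0 : ℝ), ENNReal.ofReal (Real.exp (-x)) *
        eN (ENNReal.ofReal c * ENNReal.ofReal x) = ENNReal.ofReal (Real.exp (-(c + 1) * x)) := by
      intro x hx
      have hx : 0 < x := hx
      rw [← ENNReal.ofReal_mul hc, eN_ofReal (by positivity), ← ENNReal.ofReal_mul (Real.exp_pos _).le,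
        ← Real.exp_add]
      congr 2; ring
    rw [setLIntegral_congr_fun measurableSet_Ioi h2, lintegral_ofReal_exp_Ioi (by linarith)]
    simp
  rw [lintegral_sub (by fun_prop), h1]
  · rw [lintegral_const, measure_univ, mul_one, ← ENNReal.ofReal_one,
      ← ENNReal.ofReal_sub _ (by positivity)]
    congr 1
    field_simp
    ring
  · rw [h1]; exact ENNReal.ofReal_ne_top
  · exact Eventually.of_forall fun _ => eN_le_one _

/-! ## Cell search as a function of the base station sequence -/

namespace Params

variable (p : Params)

lemma gain_main_pos {n : ℕ} (hn : 0 < n) : 0 < p.mainGain (2 * Real.pi / n) := by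
  have hn' : (0 : ℝ) < n := by exact_mod_cast hn
  have hπ := Real.pi_pos
  have hC := p.C0_pos
  unfold mainGain
  split_ifs with h
  · exact one_pos
  · have h1 : 2 * Real.pi / n < 2 * Real.pi := by
      refine lt_of_le_of_ne ?_ h
      rw [div_le_iff₀ hn']
      have : (1 : ℝ) ≤ n := by exact_mod_cast hn
      nlinarith
    have h2 : 0 < 2 * Real.pi - 2 * Real.pi / n := by linarith
    have h3 : 0 < p.gam (2 * Real.pi / n) := by unfold gam; positivity
    positivity

lemma GN_pos : 0 < p.GN := p.gain_main_pos p.N_pos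

lemma gN_nonneg : 0 ≤ p.gN := by
  have hn' : (0 : ℝ) < p.N := by exact_mod_cast p.N_pos
  have hπ := Real.pi_pos
  have hC := p.C0_pos
  unfold gN sideGain
  split_ifs with h
  · exact le_rfl
  · have h1 : 2 * Real.pi / p.N < 2 * Real.pi := by
      refine lt_of_le_of_ne ?_ h
      rw [div_le_iff₀ hn']
      have : (1 : ℝ) ≤ p.N := by exact_mod_cast p.N_pos
      nlinarith
    have h2 : 0 < 2 * Real.pi - 2 * Real.pi / p.N := by linarith
    have h3 : 0 < p.gam (2 * Real.pi / p.N) := by unfold gam; positivity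
    positivity

lemma Ncs_pos : 0 < p.Ncs := by
  unfold Ncs
  split
  · exact p.N_pos
  · exact p.N_pos
  · exact p.N_pos
  · exact one_pos

/-- The normalized noise in cell search. -/
def csNoise : ℝ := p.noise / (p.Pb * p.Mcs * p.mainGain (2 * Real.pi / p.Ncs))

lemma csNoise_pos : 0 < p.csNoise := by
  have h1 := p.noise_pos
  have h2 := p.Pb_pos
  have h3 : (0 : ℝ) < p.Mcs := by exact_mod_cast p.Mcs_pos
  have h4 := p.gain_main_pos p.Ncs_pos
  unfold csNoise; positivity

/-- Path loss of a base station with given position and marks. -/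
def loss (y : ℂ × ℝ × ℝ) : ℝ := p.linkLoss y.2.1 ‖y.1‖

/-- Received power from a base station with given position and marks. -/
def rcv (y : ℂ × ℝ × ℝ) : ℝ≥0∞ := ENNReal.ofReal (y.2.2 / p.loss y)

@[fun_prop] lemma measurable_loss : Measurable p.loss :=
  p.measurable_linkLoss.comp ((measurable_fst.comp measurable_snd).prodMk (measurable_norm.comp measurable_fst))

@[fun_prop] lemma measurable_rcv : Measurable p.rcv := by
  unfold rcv
  exact ((measurable_snd.comp measurable_snd).div p.measurable_loss).ennreal_ofReal

lemma loss_nonneg (y : ℂ × ℝ × ℝ) : 0 ≤ p.loss y := p.linkLoss_nonneg _ (norm_nonneg _)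

/-- The base station sector of a point. -/
def sec (y : ℂ × ℝ × ℝ) : ℕ := sectorIdx p.Kcs y.1

@[fun_prop] lemma measurable_sec : Measurable p.sec := (measurable_sectorIdx _).comp measurable_fst

lemma sec_lt (y : ℂ × ℝ × ℝ) : p.sec y < p.Kcs := sectorIdx_lt p.Kcs_pos _

/-- Interference at base station `i` from its sector. -/
def itf (b : ℕ → ℂ × ℝ × ℝ) (i : ℕ) : ℝ≥0∞ :=
  ∑' k, if k ≠ i ∧ p.sec (b k) = p.sec (b i) then p.rcv (b k) else 0

/-- Base station `i` has the smallest path loss in its sector and it is detected. -/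
def Det (b : ℕ → ℂ × ℝ × ℝ) (i : ℕ) : Prop :=
  (∀ k, p.sec (b k) = p.sec (b i) → p.loss (b i) ≤ p.loss (b k)) ∧
    ENNReal.ofReal p.Gcs ≤ p.rcv (b i) / (p.itf b i + ENNReal.ofReal p.csNoise)

lemma Det_iff_le (b : ℕ → ℂ × ℝ × ℝ) (i : ℕ) : p.Det b i ↔
    (∀ k, p.sec (b k) = p.sec (b i) → p.loss (b i) ≤ p.loss (b k)) ∧
      ENNReal.ofReal p.Gcs * (p.itf b i + ENNReal.ofReal p.csNoise) ≤ p.rcv (b i) := by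
  unfold Det
  rw [ENNReal.le_div_iff_mul_le]
  · left
    have := p.csNoise_pos
    simp [this]
  · right; exact ENNReal.ofReal_ne_top

lemma measurable_itf (i : ℕ) : Measurable fun b : ℕ → ℂ × ℝ × ℝ => p.itf b i := by
  unfold itf
  refine Measurable.tsum fun k => ?_
  refine Measurable.ite ((MeasurableSet.const _).inter ?_) (p.measurable_rcv.comp (measurable_pi_apply k))
    measurable_const
  exact measurableSet_eq_fun (p.measurable_sec.comp (measurable_pi_apply k))
    (p.measurable_sec.comp (measurable_pi_apply i))

lemma measurableSet_Det (i : ℕ) : MeasurableSet {b | p.Det b i} := by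
  have hs := fun k => p.measurable_sec.comp (measurable_pi_apply (X := fun _ : ℕ => ℂ × ℝ × ℝ) k)
  have hl := fun k => p.measurable_loss.comp (measurable_pi_apply (X := fun _ : ℕ => ℂ × ℝ × ℝ) k)
  have : {b : ℕ → ℂ × ℝ × ℝ | ∀ k, p.sec (b k) = p.sec (b i) → p.loss (b i) ≤ p.loss (b k)} =
      ⋂ k, ({b | p.sec (b k) = p.sec (b i)}ᶜ ∪ {b | p.loss (b i) ≤ p.loss (b k)}) := by
    ext b; simp [imp_iff_not_or]
  have hset : {b | p.Det b i} =
      {b | ∀ k, p.sec (b k) = p.sec (b i) → p.loss (b i) ≤ p.loss (b k)} ∩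
        {b | ENNReal.ofReal p.Gcs ≤ p.rcv (b i) / (p.itf b i + ENNReal.ofReal p.csNoise)} := rfl
  rw [hset, this]
  refine MeasurableSet.inter (MeasurableSet.iInter fun k =>
    (measurableSet_eq_fun (hs k) (hs i)).compl.union (measurableSet_le (hl i) (hl k)))
    (measurableSet_le measurable_const
      ((p.measurable_rcv.comp (measurable_pi_apply i)).div ((p.measurable_itf i).add_const _)))

end Params

namespace Params

variable (p : Params)

lemma measurable_rad {α : Type*} [MeasurableSpace α] {φ : α → ℝ → ℝ≥0∞}
    (hφ : Measurable (Function.uncurry φ)) : Measurable fun a => p.rad (φ a) := by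
  unfold rad
  refine Measurable.lintegral_prod_right'
    (f := fun q : α × ℝ => (ENNReal.ofReal (p.h q.2) * φ q.1 (p.lossL q.2) +
      ENNReal.ofReal (1 - p.h q.2) * φ q.1 (p.lossN q.2)) * ENNReal.ofReal q.2) ?_
  have h1 : Measurable fun q : α × ℝ => φ q.1 (p.lossL q.2) :=
    hφ.comp (measurable_fst.prodMk (p.measurable_lossL.comp measurable_snd))
  have h2 : Measurable fun q : α × ℝ => φ q.1 (p.lossN q.2) :=
    hφ.comp (measurable_fst.prodMk (p.measurable_lossN.comp measurable_snd))
  have h3 : Measurable fun q : α × ℝ => p.h q.2 := p.h_measurable.comp measurable_snd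
  fun_prop

/-- Minus the logarithm of the probability that a base station with the marks `y` in sector `s` does
not prevent the detection of a base station of path loss `z` in that sector. -/
def obst (s : ℕ) (z : ℝ) (y : ℂ × ℝ × ℝ) : ℝ≥0∞ :=
  if p.sec y = s then
    (if p.loss y < z then ⊤ else ENNReal.ofReal p.Gcs * ENNReal.ofReal z * p.rcv y) else 0

/-- Interference from the base stations other than `i` in sector `s`. -/
def itfSec (b : ℕ → ℂ × ℝ × ℝ) (i s : ℕ) : ℝ≥0∞ :=
  ∑' k, if k ≠ i ∧ p.sec (b k) = s then p.rcv (b k) else 0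

lemma tsum_obst_eq (b : ℕ → ℂ × ℝ × ℝ) (i s : ℕ) {z : ℝ}
    (h : ∀ k, k ≠ i → p.sec (b k) = s → z ≤ p.loss (b k)) :
    ∑' k, (if k = i then 0 else p.obst s z (b k)) =
      ENNReal.ofReal p.Gcs * ENNReal.ofReal z * p.itfSec b i s := by
  rw [itfSec, ← ENNReal.tsum_mul_left]
  refine tsum_congr fun k => ?_
  by_cases hk : k = i
  · simp [hk]
  · by_cases hs : p.sec (b k) = s
    · simp [hk, obst, hs, h k hk hs]
    · simp [hk, obst, hs]

lemma tsum_obst_eq_top (b : ℕ → ℂ × ℝ × ℝ) (i s : ℕ) {z : ℝ}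
    (h : ¬ ∀ k, k ≠ i → p.sec (b k) = s → z ≤ p.loss (b k)) :
    ∑' k, (if k = i then 0 else p.obst s z (b k)) = ⊤ := by
  push Not at h
  obtain ⟨k, hk, hs, hz⟩ := h
  exact ENNReal.tsum_eq_top_of_eq_top ⟨k, by simp [hk, obst, hs, hz]⟩

lemma Det_iff_itfSec (b : ℕ → ℂ × ℝ × ℝ) (i : ℕ) : p.Det b i ↔
    (∀ k, k ≠ i → p.sec (b k) = p.sec (b i) → p.loss (b i) ≤ p.loss (b k)) ∧
      ENNReal.ofReal p.Gcs * (p.itfSec b i (p.sec (b i)) + ENNReal.ofReal p.csNoise) ≤ p.rcv (b i) := by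
  rw [Det_iff_le]
  refine and_congr_left fun _ => ⟨fun h k _ hs => h k hs, fun h k hs => ?_⟩
  by_cases hk : k = i
  · rw [hk]
  · exact h k hk hs

/-- Detection probability of a base station given all but its fading. -/
lemma lintegral_detection (b : ℕ → ℂ × ℝ × ℝ) (i s : ℕ) {z : ℝ} (hz : 0 < z) :
    ∫⁻ f, {f : ℝ | (∀ k, k ≠ i → p.sec (b k) = s → z ≤ p.loss (b k)) ∧
        ENNReal.ofReal p.Gcs * (p.itfSec b i s + ENNReal.ofReal p.csNoise) ≤
          ENNReal.ofReal (f / z)}.indicator (1 : ℝ → ℝ≥0∞) f ∂(expMeasure 1) =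
      eN (ENNReal.ofReal (p.Gcs * z * p.csNoise)) *
        eN (∑' k, if k = i then 0 else p.obst s z (b k)) := by
  have hG := p.Gcs_pos
  by_cases h : ∀ k, k ≠ i → p.sec (b k) = s → z ≤ p.loss (b k)
  · have hc : ∀ f : ℝ, {f : ℝ | (∀ k, k ≠ i → p.sec (b k) = s → z ≤ p.loss (b k)) ∧
        ENNReal.ofReal p.Gcs * (p.itfSec b i s + ENNReal.ofReal p.csNoise) ≤
          ENNReal.ofReal (f / z)}.indicator (1 : ℝ → ℝ≥0∞) f =
        if ENNReal.ofReal p.Gcs * (p.itfSec b i s + ENNReal.ofReal p.csNoise) ≤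
          ENNReal.ofReal (f * z⁻¹) then 1 else 0 := by
      intro f
      rw [← div_eq_mul_inv]
      split_ifs with hf
      · rw [Set.indicator_of_mem]
        · rfl
        · exact ⟨h, hf⟩
      · rw [Set.indicator_of_notMem]
        exact fun hf' => hf hf'.2
    rw [lintegral_congr hc, expMeasure_tail_mul (inv_pos.2 hz), inv_inv, p.tsum_obst_eq b i s h, ← eN_add]
    congr 1
    rw [mul_assoc p.Gcs, ENNReal.ofReal_mul hG.le, ENNReal.ofReal_mul hz.le]
    ring
  · rw [p.tsum_obst_eq_top b i s h, eN_top, mul_zero]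
    refine (lintegral_congr fun f => ?_).trans lintegral_zero
    exact Set.indicator_of_notMem (fun hf => h hf.1) _

lemma itfSec_update (b : ℕ → ℂ × ℝ × ℝ) (i s : ℕ) (y : ℂ × ℝ × ℝ) :
    p.itfSec (Function.update b i y) i s = p.itfSec b i s := by
  refine tsum_congr fun k => ?_
  by_cases hk : k = i
  · simp [hk]
  · simp [hk]

lemma tsum_update_ite (b : ℕ → ℂ × ℝ × ℝ) (i : ℕ) (y : ℂ × ℝ × ℝ) (g : ℂ × ℝ × ℝ → ℝ≥0∞) :
    ∑' k, (if k = i then 0 else g (Function.update b i y k)) = ∑' k, if k = i then 0 else g (b k) := by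
  refine tsum_congr fun k => ?_
  by_cases hk : k = i
  · simp [hk]
  · simp [hk]

@[fun_prop] lemma measurable_obst (s : ℕ) :
    Measurable fun q : ℝ × (ℂ × ℝ × ℝ) => p.obst s q.1 q.2 := by
  unfold obst
  have hsnd : Measurable (Prod.snd : ℝ × (ℂ × ℝ × ℝ) → ℂ × ℝ × ℝ) := measurable_snd
  refine Measurable.ite ((p.measurable_sec.comp hsnd) (measurableSet_singleton s)) ?_
    measurable_const
  refine Measurable.ite (measurableSet_lt (p.measurable_loss.comp hsnd) measurable_fst)
    measurable_const ?_
  have : Measurable fun a : ℝ × (ℂ × ℝ × ℝ) => p.rcv a.2 := p.measurable_rcv.comp hsnd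
  fun_prop

lemma obst_mono (s : ℕ) {z w : ℝ} (y : ℂ × ℝ × ℝ) (h : z ≤ w) : p.obst s z y ≤ p.obst s w y := by
  unfold obst
  split_ifs with h1 h2 h3 h4
  · exact le_rfl
  · exact absurd (h2.trans_le h) h3
  · exact le_top
  · gcongr
  · exact le_rfl

lemma iSup_obst_dyadicFloor (s : ℕ) {z : ℝ} (y : ℂ × ℝ × ℝ) (hz : 0 ≤ z) :
    ⨆ n, p.obst s (dyadicFloor n z) y = p.obst s z y := by
  refine le_antisymm (iSup_le fun n => p.obst_mono s y (dyadicFloor_le n hz)) ?_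
  by_cases hs : p.sec y = s
  · by_cases hl : p.loss y < z
    · obtain ⟨n, hn⟩ := ((tendsto_dyadicFloor hz).eventually_const_lt hl).exists
      refine le_trans ?_ (le_iSup _ n)
      simp [obst, hs, hn]
    · have h1 : ∀ n, p.obst s (dyadicFloor n z) y =
          ENNReal.ofReal p.Gcs * ENNReal.ofReal (dyadicFloor n z) * p.rcv y := by
        intro n
        have : ¬ p.loss y < dyadicFloor n z := fun h => hl (h.trans_le (dyadicFloor_le n hz))
        simp [obst, hs, this]
      simp_rw [h1]
      rw [← ENNReal.iSup_mul, ← ENNReal.mul_iSup]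
      have h2 : ⨆ n, ENNReal.ofReal (dyadicFloor n z) = ENNReal.ofReal z :=
        tendsto_nhds_unique (tendsto_atTop_iSup fun m n hmn =>
          ENNReal.ofReal_le_ofReal (dyadicFloor_mono z hmn))
          ((ENNReal.continuous_ofReal.tendsto z).comp (tendsto_dyadicFloor hz))
      rw [h2]
      simp [obst, hs, hl]
  · simp [obst, hs]

/-- Normalizing constant of the path loss intensity in a sector. -/
def cSec : ℝ := 2 * Real.pi * p.lam / p.Kcs

/-- The intensity of the base stations with their marks. -/
abbrev bsIntensity : Measure (ℂ × ℝ × ℝ) := markedIntensity p.lam (unifLaw.prod (expMeasure 1))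

/-- Integral of a function of path loss and fading over the base stations of a sector. -/
lemma lintegral_bsIntensity_sec {s : ℕ} (hs : s < p.Kcs) {F : ℝ → ℝ → ℝ≥0∞}
    (hF : Measurable (Function.uncurry F)) :
    ∫⁻ y, (if p.sec y = s then F (p.loss y) y.2.2 else 0) ∂p.bsIntensity =
      ENNReal.ofReal p.cSec * p.rad (fun l => ∫⁻ f, F l f ∂(expMeasure 1)) := by
  have hm : Measurable fun y : ℂ × ℝ × ℝ => if p.sec y = s then F (p.loss y) y.2.2 else 0 :=
    Measurable.ite (p.measurable_sec (measurableSet_singleton s))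
      (hF.comp (p.measurable_loss.prodMk (measurable_snd.comp measurable_snd))) measurable_const
  rw [lintegral_markedIntensity _ _ hm]
  have h1 : ∀ x : ℂ, ∫⁻ m, (if p.sec (x, m) = s then F (p.loss (x, m)) m.2 else 0)
      ∂(unifLaw.prod (expMeasure 1)) = ∫⁻ v, (if sectorIdx p.Kcs x = s then
        (fun l => ∫⁻ f, F l f ∂(expMeasure 1)) (p.linkLoss v ‖x‖) else 0) ∂unifLaw := by
    intro x
    have hmx : Measurable fun m : ℝ × ℝ =>
        if p.sec (x, m) = s then F (p.loss (x, m)) m.2 else 0 := hm.comp measurable_prodMk_left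
    rw [lintegral_prod _ hmx.aemeasurable]
    refine lintegral_congr fun v => ?_
    have e : ∀ f, p.sec (x, v, f) = sectorIdx p.Kcs x := fun f => rfl
    have e' : ∀ f, p.loss (x, v, f) = p.linkLoss v ‖x‖ := fun f => rfl
    simp_rw [e, e']
    split_ifs
    · rfl
    · simp
  rw [lintegral_congr h1, p.lintegral_sector_linkLoss p.Kcs_pos hs
    (φ := fun l => ∫⁻ f, F l f ∂(expMeasure 1)) hF.lintegral_prod_right', ← mul_assoc,
    ← ENNReal.ofReal_mul p.lam_pos.le]
  congr 2
  unfold cSec; ring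

lemma lintegral_obst {s : ℕ} (hs : s < p.Kcs) {z : ℝ} (hz : 0 < z) :
    eN (∫⁻ y, (1 - eN (p.obst s z y)) ∂p.bsIntensity) =
      eN (ENNReal.ofReal p.cSec * p.rad (fun l => if l < z then 1 else 0)) *
        ENNReal.ofReal (p.V z p.Gcs (p.lam / p.Kcs)) := by
  have hG := p.Gcs_pos
  have h1 : ∀ y, 1 - eN (p.obst s z y) = if p.sec y = s then
      (fun l f => if l < z then (1 : ℝ≥0∞) else
        1 - eN (ENNReal.ofReal p.Gcs * ENNReal.ofReal z * ENNReal.ofReal (f / l))) (p.loss y) y.2.2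
      else 0 := by
    intro y
    simp only [obst, rcv]
    split_ifs <;> simp
  rw [lintegral_congr h1, p.lintegral_bsIntensity_sec hs (F := fun l f =>
    if l < z then (1 : ℝ≥0∞) else
        1 - eN (ENNReal.ofReal p.Gcs * ENNReal.ofReal z * ENNReal.ofReal (f / l)))]
  rotate_left
  · refine Measurable.ite (measurableSet_lt measurable_fst measurable_const) measurable_const ?_
    have : Measurable fun q : ℝ × ℝ => q.2 / q.1 := measurable_snd.div measurable_fst
    fun_prop
  have h2 : p.rad (fun l => ∫⁻ f, (if l < z then (1 : ℝ≥0∞) else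
      1 - eN (ENNReal.ofReal p.Gcs * ENNReal.ofReal z * ENNReal.ofReal (f / l))) ∂(expMeasure 1)) =
      p.rad (fun l => (if l < z then 1 else 0) + if z < l then kern z p.Gcs l else 0) := by
    refine p.rad_congr_of_ne (z := z) fun l hl hlz => ?_
    rcases lt_or_gt_of_ne hlz with h | h
    · simp [h, not_lt.2 h.le]
    · simp only [not_lt.2 h.le, h, if_false, if_true, zero_add]
      have h3 : ∀ f, ENNReal.ofReal p.Gcs * ENNReal.ofReal z * ENNReal.ofReal (f / l) =
          ENNReal.ofReal (p.Gcs * z / l) * ENNReal.ofReal f := by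
        intro f
        have hGz : 0 ≤ p.Gcs * z := by positivity
        rw [← ENNReal.ofReal_mul hG.le, ← ENNReal.ofReal_mul hGz,
          ← ENNReal.ofReal_mul (by positivity)]
        congr 1; ring
      simp_rw [h3]
      rw [lintegral_one_sub_eN_expMeasure (by positivity), kern]
      congr 1
      field_simp
  rw [h2, p.rad_add (Measurable.ite measurableSet_Iio measurable_const measurable_const), mul_add,
    eN_add, p.ofReal_V hz hG.le]
  congr 4
  unfold cSec; ring

end Params

section BaseStations

variable (p : Params) {Ω : Type*} [MeasurableSpace Ω] {μ : Measure Ω} [IsProbabilityMeasure μ]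
  {X : ℕ → Ω → ℂ} {mark : ℕ → Ω → ℝ × ℝ}

lemma ofReal_Ptilde {z : ℝ} (hz : 0 < z) :
    ENNReal.ofReal (p.Ptilde z) = eN (ENNReal.ofReal (p.Gcs * z * p.csNoise)) *
      ENNReal.ofReal (p.V z p.Gcs (p.lam / p.Kcs)) := by
  have h1 := p.Gcs_pos
  have h2 := p.csNoise_pos
  rw [Params.Ptilde, ENNReal.ofReal_mul (Real.exp_pos _).le, eN_ofReal (by positivity)]
  congr 4
  unfold Params.csNoise; ring

end BaseStations

namespace Params

variable (p : Params)

lemma measurable_obst_comp {α : Type*} [MeasurableSpace α] (s : ℕ) {f : α → ℝ}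
    {g : α → ℂ × ℝ × ℝ} (hf : Measurable f) (hg : Measurable g) :
    Measurable fun a => p.obst s (f a) (g a) := by
  have h := (p.measurable_obst s).comp (hf.prodMk hg)
  exact h

/-- Point `i` lies in sector `s`, has a path loss in `B` and is detected. -/
def detSet (s : ℕ) (B : Set ℝ) (i : ℕ) : Set (ℕ → ℂ × ℝ × ℝ) :=
  {b | p.sec (b i) = s ∧ p.loss (b i) ∈ B ∧ p.Det b i}

lemma measurableSet_detSet (s : ℕ) {B : Set ℝ} (hB : MeasurableSet B) (i : ℕ) :
    MeasurableSet (p.detSet s B i) := by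
  have e : p.detSet s B i = (fun b : ℕ → ℂ × ℝ × ℝ => p.sec (b i)) ⁻¹' {s} ∩
      ((fun b : ℕ → ℂ × ℝ × ℝ => p.loss (b i)) ⁻¹' B ∩ {b | p.Det b i}) := rfl
  rw [e]
  exact ((p.measurable_sec.comp (measurable_pi_apply i)) (measurableSet_singleton s)).inter
    (((p.measurable_loss.comp (measurable_pi_apply i)) hB).inter (p.measurableSet_Det i))

/-- Probability that the noise does not prevent the detection of `y`, if `y` lies in sector `s` and
has a path loss in `B`. -/
def detWeight (s : ℕ) (B : Set ℝ) (y : ℂ × ℝ × ℝ) : ℝ≥0∞ :=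
  if p.sec y = s then
    B.indicator (fun l => eN (ENNReal.ofReal (p.Gcs * l * p.csNoise))) (p.loss y) else 0

lemma measurable_eN_noise {B : Set ℝ} (hB : MeasurableSet B) :
    Measurable (B.indicator fun l => eN (ENNReal.ofReal (p.Gcs * l * p.csNoise))) :=
  Measurable.indicator (by fun_prop) hB

lemma measurable_detWeight (s : ℕ) {B : Set ℝ} (hB : MeasurableSet B) :
    Measurable (p.detWeight s B) :=
  Measurable.ite (p.measurable_sec (measurableSet_singleton s))
    ((p.measurable_eN_noise hB).comp p.measurable_loss) measurable_const

lemma detWeight_le_one (s : ℕ) (B : Set ℝ) (y : ℂ × ℝ × ℝ) : p.detWeight s B y ≤ 1 := by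
  unfold detWeight
  split_ifs
  · exact Set.indicator_le_self' (fun _ _ => zero_le) _ |>.trans (eN_le_one _)
  · exact zero_le

lemma update_mem_detSet {b : ℕ → ℂ × ℝ × ℝ} {i s : ℕ} {B : Set ℝ} {y : ℂ × ℝ × ℝ}
    (hs : p.sec y = s) (hB : p.loss y ∈ B) : Function.update b i y ∈ p.detSet s B i ↔
      (∀ k, k ≠ i → p.sec (b k) = s → p.loss y ≤ p.loss (b k)) ∧
        ENNReal.ofReal p.Gcs * (p.itfSec b i s + ENNReal.ofReal p.csNoise) ≤ p.rcv y := by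
  have h1 : Function.update b i y ∈ p.detSet s B i ↔ p.sec y = s ∧ p.loss y ∈ B ∧
      p.Det (Function.update b i y) i := by
    simp [detSet]
  rw [h1, p.Det_iff_itfSec, Function.update_self, p.itfSec_update, hs]
  simp only [hB, true_and]
  refine and_congr_left fun _ => forall₂_congr fun k hk => ?_
  simp [hk]

/-- Detection probability of point `i` when its fading is resampled. -/
lemma lintegral_detSet_update (b : ℕ → ℂ × ℝ × ℝ) (i s : ℕ) {B : Set ℝ} (hB0 : ∀ z ∈ B, 0 < z)
    (x : ℂ) (v : ℝ) :
    ∫⁻ f, (p.detSet s B i).indicator (1 : (ℕ → ℂ × ℝ × ℝ) → ℝ≥0∞)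
        (Function.update b i (x, v, f)) ∂(expMeasure 1) =
      p.detWeight s B (x, v, 0) *
        eN (∑' k, if k = i then 0 else p.obst s (p.linkLoss v ‖x‖) (b k)) := by
  by_cases hc : sectorIdx p.Kcs x = s ∧ p.linkLoss v ‖x‖ ∈ B
  · obtain ⟨hc1, hc2⟩ := hc
    have hφv : p.detWeight s B (x, v, 0) =
        eN (ENNReal.ofReal (p.Gcs * p.linkLoss v ‖x‖ * p.csNoise)) := by
      have e1 : p.sec (x, v, 0) = s := hc1
      have e2 : p.loss (x, v, 0) = p.linkLoss v ‖x‖ := rfl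
      rw [detWeight, if_pos e1, e2, Set.indicator_of_mem hc2]
    rw [hφv, ← p.lintegral_detection b i s (hB0 _ hc2)]
    refine lintegral_congr fun f => ?_
    have hiff := p.update_mem_detSet (b := b) (i := i) (y := (x, v, f)) hc1 hc2
    by_cases hm : Function.update b i (x, v, f) ∈ p.detSet s B i
    · rw [Set.indicator_of_mem hm, Set.indicator_of_mem]
      · rfl
      · exact hiff.1 hm
    · rw [Set.indicator_of_notMem hm, Set.indicator_of_notMem]
      exact fun h => hm (hiff.2 h)
  · have hφv : p.detWeight s B (x, v, 0) = 0 := by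
      unfold detWeight
      split_ifs with h1
      · exact Set.indicator_of_notMem (fun h2 => hc ⟨h1, h2⟩) _
      · rfl
    rw [hφv, zero_mul]
    refine (lintegral_congr fun f => ?_).trans lintegral_zero
    refine Set.indicator_of_notMem (fun hmem => hc ?_) _
    have h1 : p.sec (Function.update b i (x, v, f) i) = s := hmem.1
    have h2 : p.loss (Function.update b i (x, v, f) i) ∈ B := hmem.2.1
    rw [Function.update_self] at h1 h2
    exact ⟨h1, h2⟩

end Params

section BaseStations

variable (p : Params) {Ω : Type*} [MeasurableSpace Ω] {μ : Measure Ω} [IsProbabilityMeasure μ]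
  {X : ℕ → Ω → ℂ} {mark : ℕ → Ω → ℝ × ℝ}

lemma measurable_zip {𝓜 : Type*} [MeasurableSpace 𝓜] :
    Measurable fun q : (ℕ → ℂ) × (ℕ → 𝓜) => fun k => (q.1 k, q.2 k) :=
  measurable_pi_lambda _ fun k => ((measurable_pi_apply k).comp measurable_fst).prodMk
    ((measurable_pi_apply k).comp measurable_snd)

lemma zip_update {𝓜 : Type*} (x : ℕ → ℂ) (m : ℕ → 𝓜) (i : ℕ) (y : 𝓜) :
    (fun k => (x k, Function.update m i y k)) =
      Function.update (fun k => (x k, m k)) i (x i, y) := by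
  funext k
  by_cases hk : k = i
  · subst hk; simp
  · simp [hk]

lemma IsMarkedPoisson.lintegral_zip_update {𝓜 : Type*} [MeasurableSpace 𝓜] {lam : ℝ}
    {ν : Measure 𝓜} [IsProbabilityMeasure ν] {mark : ℕ → Ω → 𝓜}
    (h : IsMarkedPoisson μ X mark lam ν) {G : (ℕ → ℂ × 𝓜) → ℝ≥0∞} (hG : Measurable G) (i : ℕ) :
    ∫⁻ ω, G (fun k => (X k ω, mark k ω)) ∂μ =
      ∫⁻ ω, ∫⁻ y, G (Function.update (fun k => (X k ω, mark k ω)) i (X i ω, y)) ∂ν ∂μ := by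
  have e := h.lintegral_update (H := fun x m => G fun k => (x k, m k)) (hG.comp measurable_zip) i
  rw [e]
  simp_rw [zip_update]

lemma IsMarkedPoisson.lintegral_zip_update_prod {𝓜 𝓛 : Type*} [MeasurableSpace 𝓜]
    [MeasurableSpace 𝓛] {lam : ℝ}
    {ν : Measure 𝓜} {ν' : Measure 𝓛} [IsProbabilityMeasure ν] [IsProbabilityMeasure ν']
    {mark : ℕ → Ω → 𝓜 × 𝓛}
    (h : IsMarkedPoisson μ X mark lam (ν.prod ν')) {G : (ℕ → ℂ × 𝓜 × 𝓛) → ℝ≥0∞}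
    (hG : Measurable G) (i : ℕ) :
    ∫⁻ ω, G (fun k => (X k ω, mark k ω)) ∂μ =
      ∫⁻ ω, ∫⁻ v, ∫⁻ f, G (Function.update (fun k => (X k ω, mark k ω)) i (X i ω, v, f))
        ∂ν' ∂ν ∂μ := by
  rw [h.lintegral_zip_update hG i]
  refine lintegral_congr fun ω => ?_
  have hU : Measurable fun y : 𝓜 × 𝓛 =>
      Function.update (fun k => (X k ω, mark k ω)) i (X i ω, y) := by
    refine measurable_pi_lambda _ fun k => ?_
    by_cases hk : k = i
    · subst hk; simp only [Function.update_self]; fun_prop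
    · simp only [Function.update_of_ne hk]; fun_prop
  have hm : Measurable fun y : 𝓜 × 𝓛 =>
      G (Function.update (fun k => (X k ω, mark k ω)) i (X i ω, y)) := hG.comp hU
  rw [lintegral_prod _ hm.aemeasurable]

/-- Conditional probability, given the base stations other than `i` and the position of `i`, that `i`
lies in sector `s`, has a path loss in `B` and is detected. -/
def detTerm (s : ℕ) (B : Set ℝ) (i : ℕ) (b : ℕ → ℂ × ℝ × ℝ) : ℝ≥0∞ :=
  p.detWeight s B (b i) * eN (∑' k, if k = i then 0 else p.obst s (p.loss (b i)) (b k))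

lemma measurable_detTerm (s : ℕ) {B : Set ℝ} (hB : MeasurableSet B) (i : ℕ) :
    Measurable (detTerm p s B i) := by
  unfold detTerm
  have h1 : ∀ k, Measurable fun b : ℕ → ℂ × ℝ × ℝ => b k := measurable_pi_apply
  have h2 : Measurable fun b : ℕ → ℂ × ℝ × ℝ => p.loss (b i) := p.measurable_loss.comp (h1 i)
  refine ((p.measurable_detWeight s hB).comp (h1 i)).mul
    (measurable_eN.comp (Measurable.tsum fun k => ?_))
  split_ifs
  · exact measurable_const
  · exact p.measurable_obst_comp s h2 (h1 k)

lemma lintegral_detSet (h : IsMarkedPoisson μ X mark p.lam (unifLaw.prod (expMeasure 1)))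
    (s : ℕ) {B : Set ℝ} (hB : MeasurableSet B) (hB0 : ∀ z ∈ B, 0 < z) (i : ℕ) :
    ∫⁻ ω, (p.detSet s B i).indicator (1 : (ℕ → ℂ × ℝ × ℝ) → ℝ≥0∞) (fun k => (X k ω, mark k ω)) ∂μ =
      ∫⁻ ω, detTerm p s B i (fun k => (X k ω, mark k ω)) ∂μ := by
  have hG : Measurable ((p.detSet s B i).indicator (1 : (ℕ → ℂ × ℝ × ℝ) → ℝ≥0∞)) :=
    Measurable.indicator measurable_one (p.measurableSet_detSet s hB i)
  refine (h.lintegral_zip_update_prod hG i).trans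
    (.trans ?_ (h.lintegral_zip_update_prod (measurable_detTerm p s hB i) i).symm)
  refine lintegral_congr fun ω => lintegral_congr fun v => ?_
  rw [p.lintegral_detSet_update _ i s hB0]
  have hr : ∀ f : ℝ, detTerm p s B i (Function.update (fun k => (X k ω, mark k ω)) i (X i ω, v, f)) =
      p.detWeight s B (X i ω, v, 0) *
        eN (∑' k, if k = i then 0 else p.obst s (p.linkLoss v ‖X i ω‖) (X k ω, mark k ω)) := by
    intro f
    rw [detTerm, Params.tsum_update_ite, Function.update_self]
    rfl
  rw [lintegral_congr hr, lintegral_const, measure_univ, mul_one]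

lemma lintegral_detWeight_ne_top {s : ℕ} (hs : s < p.Kcs) {B : Set ℝ} (hB : MeasurableSet B)
    {R : ℝ} (hBR : B ⊆ Set.Ioc 0 R) : ∫⁻ y, p.detWeight s B y ∂p.bsIntensity ≠ ⊤ := by
  have hΛφ := p.lintegral_bsIntensity_sec hs (F := fun l (_ : ℝ) =>
    B.indicator (fun l => eN (ENNReal.ofReal (p.Gcs * l * p.csNoise))) l)
      ((p.measurable_eN_noise hB).comp measurable_fst)
  have e : ∫⁻ y, p.detWeight s B y ∂p.bsIntensity = _ := hΛφ
  rw [e]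
  refine ENNReal.mul_ne_top ENNReal.ofReal_ne_top ?_
  have hR : p.rad (fun l => if l < |R| + 1 then 1 else 0) ≠ ⊤ := by
    rw [p.rad_lt (by positivity)]; exact ENNReal.ofReal_ne_top
  refine ne_top_of_le_ne_top hR (p.rad_mono fun l _ => ?_)
  rw [lintegral_const, measure_univ, mul_one]
  by_cases h1 : l ∈ B
  · rw [Set.indicator_of_mem h1,
      if_pos (lt_of_le_of_lt ((hBR h1).2.trans (le_abs_self R)) (lt_add_one _))]
    exact eN_le_one _
  · rw [Set.indicator_of_notMem h1]
    exact zero_le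

lemma lintegral_detWeight_mul {s : ℕ} (hs : s < p.Kcs) {B : Set ℝ} (hB : MeasurableSet B)
    (hB0 : ∀ z ∈ B, 0 < z) :
    ∫⁻ y, p.detWeight s B y * eN (∫⁻ y', (1 - eN (p.obst s (p.loss y) y')) ∂p.bsIntensity)
      ∂p.bsIntensity = ∫⁻ z in B, ENNReal.ofReal (p.Ptilde z) * ENNReal.ofReal (p.fZ1 z) := by
  set ψ : ℝ → ℝ≥0∞ := B.indicator fun l => eN (ENNReal.ofReal (p.Gcs * l * p.csNoise)) *
    eN (∫⁻ y', (1 - eN (p.obst s l y')) ∂p.bsIntensity) with hψdef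
  have hcongr : ∀ y, p.detWeight s B y *
      eN (∫⁻ y', (1 - eN (p.obst s (p.loss y) y')) ∂p.bsIntensity) =
      if p.sec y = s then (fun l (_ : ℝ) => ψ l) (p.loss y) y.2.2 else 0 := by
    intro y
    simp only [Params.detWeight]
    split_ifs
    · by_cases hy : p.loss y ∈ B
      · simp only [hψdef, Set.indicator_of_mem hy]
      · simp only [hψdef, Set.indicator_of_notMem hy, zero_mul]
    · exact zero_mul _
  have hJ : Measurable fun l => eN (∫⁻ y', (1 - eN (p.obst s l y')) ∂p.bsIntensity) := by
    refine measurable_eN.comp (Measurable.lintegral_prod_right' (f := fun q : ℝ × (ℂ × ℝ × ℝ) =>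
      1 - eN (p.obst s q.1 q.2)) ?_)
    exact measurable_const.sub (measurable_eN.comp (p.measurable_obst s))
  have hψ : Measurable ψ :=
    Measurable.indicator ((by fun_prop : Measurable fun l =>
      eN (ENNReal.ofReal (p.Gcs * l * p.csNoise))).mul hJ) hB
  have hψ2 : Measurable (Function.uncurry fun l (_ : ℝ) => ψ l) := hψ.comp measurable_fst
  rw [lintegral_congr hcongr, p.lintegral_bsIntensity_sec hs hψ2]
  simp only [lintegral_const, measure_univ, mul_one]
  rw [p.rad_eq_lintegral hψ, ← lintegral_const_mul' _ _ ENNReal.ofReal_ne_top]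
  have hfinal : ∀ z ∈ Set.Ioi (0 : ℝ), ENNReal.ofReal p.cSec *
      (ψ z * ENNReal.ofReal (p.lossDensity z)) =
      B.indicator (fun z => ENNReal.ofReal (p.Ptilde z) * ENNReal.ofReal (p.fZ1 z)) z := by
    intro z hz
    by_cases hzB : z ∈ B
    · rw [hψdef, Set.indicator_of_mem hzB, Set.indicator_of_mem hzB, p.lintegral_obst hs hz,
        ofReal_Ptilde p hz, p.ofReal_fZ1 hz]
      unfold Params.cSec
      ring
    · simp [hψdef, hzB]
  rw [setLIntegral_congr_fun measurableSet_Ioi hfinal, setLIntegral_indicator hB,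
    Set.inter_eq_left.2 (show B ⊆ Set.Ioi 0 from hB0)]

theorem lintegral_tsum_detSet (h : IsMarkedPoisson μ X mark p.lam (unifLaw.prod (expMeasure 1)))
    {s : ℕ} (hs : s < p.Kcs) {B : Set ℝ} (hB : MeasurableSet B) {R : ℝ} (hBR : B ⊆ Set.Ioc 0 R) :
    ∫⁻ ω, ∑' i, (p.detSet s B i).indicator (1 : (ℕ → ℂ × ℝ × ℝ) → ℝ≥0∞)
        (fun k => (X k ω, mark k ω)) ∂μ =
      ∫⁻ z in B, ENNReal.ofReal (p.Ptilde z) * ENNReal.ofReal (p.fZ1 z) := by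
  have hB0 : ∀ z ∈ B, 0 < z := fun z hz => (hBR hz).1
  have hpt : Measurable fun ω k => (X k ω, mark k ω) := measurable_pi_lambda _ h.measurable_point
  have hmA : ∀ i, Measurable fun ω =>
      (p.detSet s B i).indicator (1 : (ℕ → ℂ × ℝ × ℝ) → ℝ≥0∞) (fun k => (X k ω, mark k ω)) := by
    intro i
    have hG : Measurable ((p.detSet s B i).indicator (1 : (ℕ → ℂ × ℝ × ℝ) → ℝ≥0∞)) :=
      Measurable.indicator measurable_one (p.measurableSet_detSet s hB i)
    exact hG.comp hpt
  rw [lintegral_tsum fun i => (hmA i).aemeasurable]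
  simp_rw [lintegral_detSet p h s hB hB0]
  have hmW : ∀ i, Measurable fun ω => detTerm p s B i fun k => (X k ω, mark k ω) :=
    fun i => (measurable_detTerm p s hB i).comp hpt
  rw [← lintegral_tsum fun i => (hmW i).aemeasurable, ← lintegral_detWeight_mul p hs hB hB0]
  unfold detTerm
  refine h.mecke_mono p.lam_pos.le p.measurable_loss p.loss_nonneg (g := p.obst s) ?_
    (fun a c y _ hac => p.obst_mono s y hac) (fun z y hz => p.iSup_obst_dyadicFloor s y hz)
    (p.measurable_detWeight s hB) (lintegral_detWeight_ne_top p hs hB hBR)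
    (fun y => ne_top_of_le_ne_top ENNReal.one_ne_top (p.detWeight_le_one s B y)) ?_
  · rw [Function.uncurry_def]; exact p.measurable_obst s
  intro y hy
  exfalso
  revert hy
  simp only [Params.obst, lt_irrefl, if_false]
  split_ifs
  · exact ENNReal.mul_ne_top (ENNReal.mul_ne_top ENNReal.ofReal_ne_top
      ENNReal.ofReal_ne_top) ENNReal.ofReal_ne_top
  · exact ENNReal.zero_ne_top

end BaseStations

/-! ## Restrictions of a marked Poisson process to disjoint sets are independent -/

section Void

variable {E : Type*} [MeasurableSpace E]

/-- The event that no point lies in `B`. -/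
def voidEvent (B : Set E) : Set (ℕ → E) := {b | ∀ i, b i ∉ B}

/-- The sigma-algebra generated by the void events of subsets of `S`. -/
@[reducible] def voidSigma (S : Set E) : MeasurableSpace (ℕ → E) :=
  MeasurableSpace.generateFrom {A | ∃ B ⊆ S, MeasurableSet B ∧ A = voidEvent B}

lemma measurableSet_voidEvent_voidSigma {S B : Set E} (hBS : B ⊆ S) (hB : MeasurableSet B) :
    MeasurableSet[voidSigma S] (voidEvent B) :=
  MeasurableSpace.measurableSet_generateFrom ⟨B, hBS, hB, rfl⟩

lemma measurableSet_voidEvent {B : Set E} (hB : MeasurableSet B) :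
    MeasurableSet (voidEvent B) := by
  have e : voidEvent B = ⋂ i : ℕ, (fun b : ℕ → E => b i) ⁻¹' Bᶜ := by
    ext b; simp [voidEvent]
  rw [e]
  exact MeasurableSet.iInter fun i => measurable_pi_apply i hB.compl

lemma voidSigma_le (S : Set E) : voidSigma S ≤ MeasurableSpace.pi := by
  refine MeasurableSpace.generateFrom_le ?_
  rintro A ⟨B, -, hB, rfl⟩
  exact measurableSet_voidEvent hB

lemma measurable_voidSigma_iSup {S : Set E} {g : E → ℝ≥0∞} (hg : Measurable g)
    (hS : ∀ y, y ∉ S → g y = 0) : Measurable[voidSigma S] fun b : ℕ → E => ⨆ i, g (b i) := by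
  refine @measurable_of_Ioi _ _ _ _ _ (voidSigma S) _ _ _ _ fun a => ?_
  have e : (fun b : ℕ → E => ⨆ i, g (b i)) ⁻¹' Set.Ioi a = (voidEvent (g ⁻¹' Set.Ioi a))ᶜ := by
    ext b
    simp [voidEvent, lt_iSup_iff]
  rw [e]
  refine @MeasurableSet.compl _ _ (voidSigma S) (measurableSet_voidEvent_voidSigma ?_
    (hg measurableSet_Ioi))
  intro y hy
  by_contra h
  have : a < g y := hy
  rw [hS y h] at this
  exact not_lt_zero this

lemma measurable_voidSigma_iInf {S : Set E} {g : E → ℝ≥0∞} (hg : Measurable g)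
    (hS : ∀ y, y ∉ S → g y = ⊤) : Measurable[voidSigma S] fun b : ℕ → E => ⨅ i, g (b i) := by
  refine @measurable_of_Iio _ _ _ _ _ (voidSigma S) _ _ _ _ fun a => ?_
  have e : (fun b : ℕ → E => ⨅ i, g (b i)) ⁻¹' Set.Iio a = (voidEvent (g ⁻¹' Set.Iio a))ᶜ := by
    ext b
    simp [voidEvent, iInf_lt_iff]
  rw [e]
  refine @MeasurableSet.compl _ _ (voidSigma S) (measurableSet_voidEvent_voidSigma ?_
    (hg measurableSet_Iio))
  intro y hy
  by_contra h
  have : g y < a := hy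
  rw [hS y h] at this
  exact not_top_lt this

variable {Ω : Type*} [MeasurableSpace Ω] {μ : Measure Ω} [IsProbabilityMeasure μ]
  {𝓜 : Type*} [MeasurableSpace 𝓜] {ν : Measure 𝓜} [IsProbabilityMeasure ν]
  {X : ℕ → Ω → ℂ} {mark : ℕ → Ω → 𝓜} {lam : ℝ}

lemma IsMarkedPoisson.measurable_points (h : IsMarkedPoisson μ X mark lam ν) :
    Measurable fun ω k => (X k ω, mark k ω) := measurable_pi_lambda _ h.measurable_point

lemma IsMarkedPoisson.measure_voidEvent (h : IsMarkedPoisson μ X mark lam ν) (hlam : 0 ≤ lam)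
    {B : Set (ℂ × 𝓜)} (hB : MeasurableSet B) :
    μ.map (fun ω k => (X k ω, mark k ω)) (voidEvent B) = eN (markedIntensity lam ν B) := by
  rw [Measure.map_apply h.measurable_points (measurableSet_voidEvent hB)]
  have hg : Measurable (B.indicator fun _ => (⊤ : ℝ≥0∞)) := measurable_const.indicator hB
  have h1 := h.lintegral_eN hlam hg
  have h2 : ∀ y, 1 - eN (B.indicator (fun _ => (⊤ : ℝ≥0∞)) y) = B.indicator 1 y := by
    intro y
    by_cases hy : y ∈ B <;> simp [hy]
  simp_rw [h2] at h1
  rw [lintegral_indicator_one hB] at h1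
  have hms : MeasurableSet ((fun ω k => (X k ω, mark k ω)) ⁻¹' voidEvent B) :=
    h.measurable_points (measurableSet_voidEvent hB)
  rw [← h1, ← lintegral_indicator_one hms]
  refine lintegral_congr fun ω => ?_
  by_cases hω : ω ∈ (fun ω k => (X k ω, mark k ω)) ⁻¹' voidEvent B
  · have h3 : ∀ i, (X i ω, mark i ω) ∉ B := hω
    rw [Set.indicator_of_mem hω]
    simp [h3]
  · rw [Set.indicator_of_notMem hω]
    have h3 : ∃ i, (X i ω, mark i ω) ∈ B := by
      by_contra hcon
      push Not at hcon
      exact hω hcon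
    obtain ⟨i, hi⟩ := h3
    rw [ENNReal.tsum_eq_top_of_eq_top ⟨i, by simp [hi]⟩, eN_top]

theorem IsMarkedPoisson.iIndep_voidSigma (h : IsMarkedPoisson μ X mark lam ν) (hlam : 0 ≤ lam)
    {ι : Type*} {S : ι → Set (ℂ × 𝓜)} (hS : Pairwise (Function.onFun Disjoint S)) :
    iIndep (fun j => voidSigma (S j)) (μ.map fun ω k => (X k ω, mark k ω)) := by
  classical
  have hpt := h.measurable_points
  have : IsProbabilityMeasure (μ.map fun ω k => (X k ω, mark k ω)) :=
    Measure.isProbabilityMeasure_map hpt.aemeasurable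
  refine iIndepSets.iIndep (fun j => voidSigma_le _)
    (fun j => {A | ∃ B ⊆ S j, MeasurableSet B ∧ A = voidEvent B}) ?_ (fun j => rfl) ?_
  · rintro j _ ⟨B, hBS, hB, rfl⟩ _ ⟨C, hCS, hC, rfl⟩ -
    refine ⟨B ∪ C, Set.union_subset hBS hCS, hB.union hC, ?_⟩
    ext b
    simp only [voidEvent, Set.mem_inter_iff, Set.mem_ofPred_eq, Set.mem_union, not_or, forall_and]
  · rw [iIndepSets_iff]
    intro s f hf
    choose! B hBS hB hfB using hf
    have e : ⋂ i ∈ s, f i = voidEvent (⋃ i ∈ s, B i) := by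
      ext b
      simp only [Set.mem_iInter, voidEvent, Set.mem_ofPred_eq, Set.mem_iUnion, not_exists]
      constructor
      · intro hb k i hi
        have := hb i hi
        rw [hfB i hi] at this
        exact this k
      · intro hb i hi
        rw [hfB i hi]
        exact fun k => hb k i hi
    rw [e, h.measure_voidEvent hlam (Finset.measurableSet_biUnion s hB),
      measure_biUnion_finset _ hB, eN_sum]
    · refine Finset.prod_congr rfl fun i hi => ?_
      rw [hfB i hi, h.measure_voidEvent hlam (hB i hi)]
    · intro i hi j hj hij
      exact Set.disjoint_of_subset (hBS i hi) (hBS j hj) (hS hij)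

end Void

lemma measurable_iSup_tsum {α : Type*} [MeasurableSpace α] {f : ℕ → ℕ → α → ℝ≥0∞}
    (hf : ∀ n m, Measurable (f n m)) : Measurable fun a => ⨆ n, ∑' m, f n m a :=
  Measurable.iSup fun n => Measurable.tsum fun m => hf n m

lemma measurable_indicator_toReal {α : Type*} [MeasurableSpace α] {s : Set α} {f : α → ℝ≥0∞}
    (hs : MeasurableSet s) (hf : Measurable f) : Measurable (s.indicator fun a => (f a).toReal) :=
  hf.ennreal_toReal.indicator hs

lemma measurableSet_threshold {α : Type*} [MeasurableSpace α] {f g : α → ℝ≥0∞}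
    {h : ℚ → α → ℝ≥0∞} {c d e : ℝ≥0∞} (hf : Measurable f) (hg : Measurable g)
    (hh : ∀ t, Measurable (h t)) :
    MeasurableSet ({a | f a < ⊤} ∩ ⋂ t : ℚ, ({a | ENNReal.ofReal (t : ℝ) ≤ f a} ∪
      {a | c * (g a + e) ≤ d * h t a})) :=
  (measurableSet_lt hf measurable_const).inter (MeasurableSet.iInter fun t =>
    (measurableSet_le measurable_const hf).union
      (measurableSet_le ((hg.add_const _).const_mul _) ((hh t).const_mul _)))

namespace Params

variable (p : Params)

/-- The base stations have positive, distinct path losses without finite accumulation points. -/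
structure Generic (b : ℕ → ℂ × ℝ × ℝ) : Prop where
  injective : Function.Injective fun i => p.loss (b i)
  finite : ∀ t, {i | p.loss (b i) ≤ t}.Finite
  pos : ∀ i, 0 < p.loss (b i)

/-- The points of sector `s`. -/
def sectorSet (s : ℕ) : Set (ℂ × ℝ × ℝ) := {y | p.sec y = s}

/-- The smallest path loss in sector `s`. -/
def zmin (s : ℕ) (b : ℕ → ℂ × ℝ × ℝ) : ℝ≥0∞ :=
  ⨅ i, if p.sec (b i) = s then ENNReal.ofReal (p.loss (b i)) else ⊤

/-- The largest received power in sector `s` from base stations of path loss below `t`. -/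
def maxRcv (s : ℕ) (t : ℝ) (b : ℕ → ℂ × ℝ × ℝ) : ℝ≥0∞ :=
  ⨆ i, if p.sec (b i) = s ∧ p.loss (b i) < t then p.rcv (b i) else 0

/-- Lower approximation of the total power received in sector `s`. -/
def sliceRcv (s n : ℕ) (b : ℕ → ℂ × ℝ × ℝ) : ℝ≥0∞ :=
  ∑' m : ℕ, ⨆ i, if p.sec (b i) = s ∧ ⌊2 ^ n * p.loss (b i)⌋₊ = m then p.rcv (b i) else 0

/-- The total power received in sector `s`, for generic base stations. -/
def totRcv (s : ℕ) (b : ℕ → ℂ × ℝ × ℝ) : ℝ≥0∞ := ⨆ n, p.sliceRcv s n b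

/-- The event that sector `s` is detected, for generic base stations. -/
def detected (s : ℕ) : Set (ℕ → ℂ × ℝ × ℝ) :=
  {b | p.zmin s b < ⊤} ∩ ⋂ t : ℚ, ({b | ENNReal.ofReal (t : ℝ) ≤ p.zmin s b} ∪
    {b | ENNReal.ofReal p.Gcs * (p.totRcv s b + ENNReal.ofReal p.csNoise) ≤
      (1 + ENNReal.ofReal p.Gcs) * p.maxRcv s t b})

/-- The path loss of the detected base station of sector `s`, or zero if there is none. -/
def W0 (s : ℕ) (b : ℕ → ℂ × ℝ × ℝ) : ℝ :=
  (p.detected s).indicator (fun b => (p.zmin s b).toReal) b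

section Measurability

lemma measurable_zmin (s : ℕ) : Measurable[voidSigma (p.sectorSet s)] (p.zmin s) := by
  have h : Measurable fun y => if p.sec y = s then ENNReal.ofReal (p.loss y) else ⊤ :=
    Measurable.ite (p.measurable_sec (measurableSet_singleton s))
      p.measurable_loss.ennreal_ofReal measurable_const
  exact measurable_voidSigma_iInf h fun y hy => if_neg hy

lemma measurable_maxRcv (s : ℕ) (t : ℝ) :
    Measurable[voidSigma (p.sectorSet s)] (p.maxRcv s t) := by
  have h : Measurable fun y => if p.sec y = s ∧ p.loss y < t then p.rcv y else 0 :=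
    Measurable.ite ((p.measurable_sec (measurableSet_singleton s)).inter
      (measurableSet_lt p.measurable_loss measurable_const)) p.measurable_rcv measurable_const
  exact measurable_voidSigma_iSup h fun y hy => if_neg fun h => hy h.1

lemma measurable_totRcv (s : ℕ) : Measurable[voidSigma (p.sectorSet s)] (p.totRcv s) := by
  have h : ∀ n m : ℕ, Measurable fun y =>
      if p.sec y = s ∧ ⌊2 ^ n * p.loss y⌋₊ = m then p.rcv y else 0 := by
    intro n m
    have h1 : Measurable fun y => ⌊2 ^ n * p.loss y⌋₊ := (p.measurable_loss.const_mul _).nat_floor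
    exact Measurable.ite ((p.measurable_sec (measurableSet_singleton s)).inter
      (h1 (measurableSet_singleton m))) p.measurable_rcv measurable_const
  unfold totRcv sliceRcv
  exact @measurable_iSup_tsum _ (voidSigma (p.sectorSet s)) _ fun n m =>
    measurable_voidSigma_iSup (h n m) fun y hy => if_neg fun h => hy h.1

lemma measurableSet_detected (s : ℕ) :
    MeasurableSet[voidSigma (p.sectorSet s)] (p.detected s) := by
  exact @measurableSet_threshold _ (voidSigma (p.sectorSet s)) _ _ _ _ _ _
    (p.measurable_zmin s) (p.measurable_totRcv s) fun t => p.measurable_maxRcv s t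

lemma measurable_W0_voidSigma (s : ℕ) : Measurable[voidSigma (p.sectorSet s)] (p.W0 s) := by
  unfold W0
  exact @measurable_indicator_toReal _ (voidSigma (p.sectorSet s)) _ _
    (p.measurableSet_detected s) (p.measurable_zmin s)

@[fun_prop] lemma measurable_W0 (s : ℕ) : Measurable (p.W0 s) :=
  (p.measurable_W0_voidSigma s).mono (voidSigma_le _) le_rfl

end Measurability

variable {p} {b : ℕ → ℂ × ℝ × ℝ}

lemma Generic.totRcv_eq (hb : p.Generic b) (s : ℕ) :
    p.totRcv s b = ∑' i, if p.sec (b i) = s then p.rcv (b i) else 0 := by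
  refine le_antisymm (iSup_le fun n => ?_) ?_
  · calc p.sliceRcv s n b
        ≤ ∑' m : ℕ, ∑' i, if p.sec (b i) = s ∧ ⌊2 ^ n * p.loss (b i)⌋₊ = m
            then p.rcv (b i) else 0 :=
          ENNReal.tsum_le_tsum fun m => iSup_le fun i => ENNReal.le_tsum
            (f := fun i => if p.sec (b i) = s ∧ ⌊2 ^ n * p.loss (b i)⌋₊ = m
            then p.rcv (b i) else 0) i
      _ = ∑' i, ∑' m : ℕ, if p.sec (b i) = s ∧ ⌊2 ^ n * p.loss (b i)⌋₊ = m
            then p.rcv (b i) else 0 := ENNReal.tsum_comm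
      _ = ∑' i, if p.sec (b i) = s then p.rcv (b i) else 0 := by
          refine tsum_congr fun i => ?_
          by_cases hi : p.sec (b i) = s
          · simp [hi]
          · simp [hi]
      _ ≤ _ := le_rfl
  · rw [ENNReal.tsum_eq_iSup_sum]
    refine iSup_le fun F => ?_
    have hev : ∀ᶠ n : ℕ in atTop, ∀ q ∈ F ×ˢ F, q.1 ≠ q.2 →
        ⌊2 ^ n * p.loss (b q.1)⌋₊ ≠ ⌊2 ^ n * p.loss (b q.2)⌋₊ := by
      rw [Filter.eventually_all_finset]
      rintro ⟨i, j⟩ -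
      by_cases hij : i = j
      · exact Filter.Eventually.of_forall fun n h => absurd hij h
      have hne : p.loss (b i) ≠ p.loss (b j) := fun h => hij (hb.injective h)
      have h1 := (tendsto_dyadicFloor (p.loss_nonneg (b i))).sub
        (tendsto_dyadicFloor (p.loss_nonneg (b j)))
      filter_upwards [h1.eventually_ne (sub_ne_zero.2 hne)] with n hn _ heq
      refine hn (sub_eq_zero.2 ?_)
      simp only [dyadicFloor, heq]
    obtain ⟨n, hn⟩ := hev.exists
    have hinj : Set.InjOn (fun i => ⌊2 ^ n * p.loss (b i)⌋₊) F := by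
      intro i hi j hj hij
      by_contra hne
      exact hn (i, j) (Finset.mk_mem_product hi hj) hne hij
    refine le_trans ?_ (le_iSup _ n)
    unfold sliceRcv
    refine le_trans ?_ (ENNReal.sum_le_tsum (F.image fun i => ⌊2 ^ n * p.loss (b i)⌋₊))
    rw [Finset.sum_image hinj]
    refine Finset.sum_le_sum fun i _ => ?_
    refine le_trans ?_ (le_iSup _ i)
    simp

lemma Generic.zmin_eq (_ : p.Generic b) {i : ℕ}
    (hi : ∀ k, p.sec (b k) = p.sec (b i) → p.loss (b i) ≤ p.loss (b k)) :
    p.zmin (p.sec (b i)) b = ENNReal.ofReal (p.loss (b i)) := by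
  refine le_antisymm (iInf_le_of_le i (by simp)) (le_iInf fun k => ?_)
  split_ifs with h
  · exact ENNReal.ofReal_le_ofReal (hi k h)
  · exact le_top

lemma Generic.exists_min (hb : p.Generic b) {s : ℕ} (h : p.zmin s b < ⊤) :
    ∃ i, p.sec (b i) = s ∧ ∀ k, p.sec (b k) = s → p.loss (b i) ≤ p.loss (b k) := by
  obtain ⟨j, hj⟩ := iInf_lt_iff.1 h
  have hjs : p.sec (b j) = s := by
    by_contra hne
    simp [hne] at hj
  have hfin : {i | p.sec (b i) = s ∧ p.loss (b i) ≤ p.loss (b j)}.Finite :=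
    (hb.finite (p.loss (b j))).subset fun i hi => hi.2
  obtain ⟨i, hi, hmin⟩ := hfin.exists_minimalFor (fun i => p.loss (b i)) _ ⟨j, hjs, le_rfl⟩
  refine ⟨i, hi.1, fun k hk => ?_⟩
  by_contra hlt
  push Not at hlt
  exact absurd (hmin ⟨hk, hlt.le.trans hi.2⟩ hlt.le) (not_le.2 hlt)

/-- Beyond its nearest point, a sector is empty for a while. -/
lemma Generic.exists_gap (hb : p.Generic b) (i : ℕ) :
    ∃ t : ℚ, p.loss (b i) < t ∧ ∀ k, p.loss (b i) ≤ p.loss (b k) → p.loss (b k) < t → k = i := by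
  have hF := hb.finite (p.loss (b i) + 1)
  have hev : ∀ᶠ t : ℝ in 𝓝[>] p.loss (b i), ∀ k ∈ {k | p.loss (b k) ≤ p.loss (b i) + 1},
      p.loss (b i) ≤ p.loss (b k) → p.loss (b k) < t → k = i := by
    rw [Filter.eventually_all_finite hF]
    intro k _
    by_cases hk : p.loss (b i) < p.loss (b k)
    · filter_upwards [Ioo_mem_nhdsGT hk] with t ht _ h
      exact absurd h (not_lt.2 ht.2.le)
    · refine Filter.Eventually.of_forall fun t h1 _ => hb.injective (le_antisymm (not_lt.1 hk) h1)
  obtain ⟨t, ht, ht1⟩ := (hev.and (Ioo_mem_nhdsGT (lt_add_one (p.loss (b i))))).exists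
  obtain ⟨r, hr1, hr2⟩ := exists_rat_btwn ht1.1
  exact ⟨r, hr1, fun k h1 h2 => ht k (h2.le.trans (hr2.le.trans ht1.2.le)) h1 (h2.trans hr2)⟩

lemma totRcv_eq_add (hb : p.Generic b) (i : ℕ) :
    p.totRcv (p.sec (b i)) b = p.rcv (b i) + p.itf b i := by
  rw [hb.totRcv_eq, ENNReal.tsum_eq_add_tsum_ite i, if_pos rfl, itf]
  congr 1
  refine tsum_congr fun k => ?_
  by_cases hk : k = i
  · simp [hk]
  · simp [hk]

lemma rcv_ne_top (y : ℂ × ℝ × ℝ) : p.rcv y ≠ ⊤ := ENNReal.ofReal_ne_top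

lemma det_le_iff (hb : p.Generic b) (i : ℕ) :
    ENNReal.ofReal p.Gcs * (p.totRcv (p.sec (b i)) b + ENNReal.ofReal p.csNoise) ≤
      (1 + ENNReal.ofReal p.Gcs) * p.rcv (b i) ↔
    ENNReal.ofReal p.Gcs * (p.itf b i + ENNReal.ofReal p.csNoise) ≤ p.rcv (b i) := by
  rw [totRcv_eq_add hb, add_assoc, mul_add, add_mul, one_mul, add_comm (p.rcv (b i))]
  exact ENNReal.add_le_add_iff_left (ENNReal.mul_ne_top ENNReal.ofReal_ne_top (rcv_ne_top _))

lemma Generic.mem_detected_of_Det (hb : p.Generic b) {i : ℕ} (hi : p.Det b i) :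
    b ∈ p.detected (p.sec (b i)) := by
  rw [Det_iff_le] at hi
  refine ⟨?_, Set.mem_iInter.2 fun t => ?_⟩
  · change p.zmin _ b < ⊤
    rw [hb.zmin_eq hi.1]
    exact ENNReal.ofReal_lt_top
  · by_cases ht : ENNReal.ofReal (t : ℝ) ≤ p.zmin (p.sec (b i)) b
    · exact Or.inl ht
    · right
      rw [hb.zmin_eq hi.1, not_le] at ht
      have hlt : p.loss (b i) < t := (ENNReal.ofReal_lt_ofReal_iff_of_nonneg (p.loss_nonneg _)).1 ht
      change _ ≤ (1 + ENNReal.ofReal p.Gcs) * p.maxRcv _ t b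
      refine ((det_le_iff hb i).2 hi.2).trans ?_
      gcongr
      refine le_trans ?_ (le_iSup _ i)
      simp [hlt]

lemma Generic.W0_of_Det (hb : p.Generic b) {i : ℕ} (hi : p.Det b i) :
    p.W0 (p.sec (b i)) b = p.loss (b i) := by
  rw [W0, Set.indicator_of_mem (hb.mem_detected_of_Det hi), hb.zmin_eq hi.1,
    ENNReal.toReal_ofReal (p.loss_nonneg _)]

lemma Generic.exists_Det (hb : p.Generic b) {s : ℕ} (h : b ∈ p.detected s) :
    ∃ i, p.sec (b i) = s ∧ p.Det b i := by
  obtain ⟨i, his, hmin⟩ := hb.exists_min h.1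
  refine ⟨i, his, ?_⟩
  subst his
  rw [Det_iff_le]
  refine ⟨hmin, ?_⟩
  rw [← det_le_iff hb]
  obtain ⟨t, ht, hgap⟩ := hb.exists_gap i
  rcases Set.mem_iInter.1 h.2 t with h1 | h1
  · change _ ≤ p.zmin _ b at h1
    rw [hb.zmin_eq hmin] at h1
    exact absurd h1 (not_le.2 ((ENNReal.ofReal_lt_ofReal_iff_of_nonneg (p.loss_nonneg _)).2 ht))
  · refine le_trans h1 ?_
    gcongr
    refine iSup_le fun k => ?_
    split_ifs with hk
    · rw [hgap k (hmin k hk.1) hk.2]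
    · exact zero_le

lemma W0_nonneg (s : ℕ) (b : ℕ → ℂ × ℝ × ℝ) : 0 ≤ p.W0 s b :=
  Set.indicator_nonneg (fun _ _ => ENNReal.toReal_nonneg) _

lemma Generic.W0_pos_iff (hb : p.Generic b) (s : ℕ) :
    0 < p.W0 s b ↔ ∃ i, p.sec (b i) = s ∧ p.Det b i := by
  constructor
  · intro h
    by_cases hs : b ∈ p.detected s
    · exact hb.exists_Det hs
    · rw [W0, Set.indicator_of_notMem hs] at h
      exact absurd h (lt_irrefl _)
  · rintro ⟨i, rfl, hi⟩
    rw [hb.W0_of_Det hi]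
    exact hb.pos i

/-- At most one base station of a sector is detected. -/
lemma Generic.Det_unique (hb : p.Generic b) {i j : ℕ} (hi : p.Det b i) (hj : p.Det b j)
    (hs : p.sec (b i) = p.sec (b j)) : i = j :=
  hb.injective (le_antisymm (hi.1 j hs.symm) (hj.1 i hs))

/-- The indicator of the path loss of the detected base station, as a sum over base stations. -/
lemma Generic.tsum_detSet (hb : p.Generic b) (s : ℕ) {B : Set ℝ} (hB : ∀ z ∈ B, 0 < z) :
    ∑' i, (p.detSet s B i).indicator (1 : (ℕ → ℂ × ℝ × ℝ) → ℝ≥0∞) b =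
      B.indicator 1 (p.W0 s b) := by
  by_cases h : p.W0 s b ∈ B
  · obtain ⟨i, his, hi⟩ := (hb.W0_pos_iff s).1 (hB _ h)
    have hW := hb.W0_of_Det hi
    rw [his] at hW
    rw [Set.indicator_of_mem h, tsum_eq_single i, Set.indicator_of_mem]
    · rfl
    · exact ⟨his, hW ▸ h, hi⟩
    · intro k hk
      refine Set.indicator_of_notMem (fun hmem => hk ?_) _
      exact hb.Det_unique hmem.2.2 hi (hmem.1.trans his.symm)
  · rw [Set.indicator_of_notMem h, ENNReal.tsum_eq_zero]
    intro i
    refine Set.indicator_of_notMem (fun hmem => h ?_) _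
    have := hb.W0_of_Det hmem.2.2
    rw [hmem.1] at this
    rw [this]
    exact hmem.2.1

end Params

namespace Params

variable (p : Params)

lemma V_nonneg (z T l : ℝ) : 0 ≤ p.V z T l := expNeg_nonneg _
lemma U_nonneg (z T l : ℝ) : 0 ≤ p.U z T l := expNeg_nonneg _
lemma V_le_one (z T l : ℝ) : p.V z T l ≤ 1 := expNeg_le_one _
lemma U_le_one (z T l : ℝ) : p.U z T l ≤ 1 := expNeg_le_one _

lemma measurable_kern₂ (T : ℝ) : Measurable fun q : ℝ × ℝ => kern q.1 T q.2 := by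
  unfold kern; fun_prop

lemma aemeasurable_of_ofReal {f : ℝ → ℝ} {g : ℝ → ℝ≥0∞} (hg : Measurable g)
    (h : ∀ z, 0 < z → ENNReal.ofReal (f z) = g z) (h0 : ∀ z, 0 < z → 0 ≤ f z) :
    AEMeasurable f (volume.restrict (Set.Ioi 0)) := by
  refine hg.ennreal_toReal.aemeasurable.congr ?_
  filter_upwards [ae_restrict_mem measurableSet_Ioi] with z hz
  rw [← h z hz, ENNReal.toReal_ofReal (h0 z hz)]

lemma aemeasurable_V {T : ℝ} (hT : 0 ≤ T) (l : ℝ) :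
    AEMeasurable (fun z => p.V z T l) (volume.restrict (Set.Ioi 0)) := by
  refine aemeasurable_of_ofReal (measurable_eN.comp (measurable_const.mul
    (p.measurable_rad (φ := fun z l => if z < l then kern z T l else 0) ?_)))
    (fun z hz => p.ofReal_V hz hT l) fun z _ => p.V_nonneg _ _ _
  exact Measurable.ite (measurableSet_lt measurable_fst measurable_snd) (measurable_kern₂ T)
    measurable_const

lemma aemeasurable_U {T : ℝ} (hT : 0 ≤ T) (l : ℝ) :
    AEMeasurable (fun z => p.U z T l) (volume.restrict (Set.Ioi 0)) := by
  refine aemeasurable_of_ofReal (measurable_eN.comp (measurable_const.mul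
    (p.measurable_rad (φ := fun z l => kern z T l) ?_)))
    (fun z hz => p.ofReal_U hz hT l) fun z _ => p.U_nonneg _ _ _
  exact measurable_kern₂ T

lemma Ptilde_nonneg (z : ℝ) : 0 ≤ p.Ptilde z := mul_nonneg (Real.exp_pos _).le (p.V_nonneg _ _ _)

lemma Ptilde_le_one {z : ℝ} (hz : 0 ≤ z) : p.Ptilde z ≤ 1 := by
  refine mul_le_one₀ ?_ (p.V_nonneg _ _ _) (p.V_le_one _ _ _)
  rw [Real.exp_le_one_iff, neg_nonpos]
  have h1 := p.csNoise_pos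
  have h2 := p.Gcs_pos
  have : p.Gcs * z * p.noise / (p.Pb * p.Mcs * p.mainGain (2 * Real.pi / p.Ncs)) =
    p.Gcs * z * p.csNoise := by unfold csNoise; ring
  rw [this]; positivity

lemma aemeasurable_Ptilde : AEMeasurable p.Ptilde (volume.restrict (Set.Ioi 0)) := by
  unfold Ptilde
  exact (Measurable.aemeasurable (by fun_prop)).mul (p.aemeasurable_V p.Gcs_pos.le _)

lemma fZ1_nonneg {z : ℝ} (hz : 0 < z) : 0 ≤ p.fZ1 z := by
  have hL := p.h_mem _ (p.invL_pos hz).le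
  have hN := p.h_mem _ (p.invN_pos hz).le
  have h1 := p.lam_pos
  have h2 := p.alphaL_pos
  have h3 := p.alphaN_pos
  have h4 := p.beta_pos
  have h5 : 0 ≤ 1 - p.h (p.invN z) := by linarith [hN.2]
  have h6 := hL.1
  unfold fZ1
  positivity

lemma aemeasurable_fZ1 : AEMeasurable p.fZ1 (volume.restrict (Set.Ioi 0)) := by
  have hm : Measurable fun z => p.rad (fun l => if l < z then 1 else 0) :=
    p.measurable_rad (φ := fun z l => if l < z then 1 else 0)
      (Measurable.ite (measurableSet_lt measurable_snd measurable_fst) measurable_const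
        measurable_const)
  exact aemeasurable_of_ofReal (by fun_prop) (fun z hz => p.ofReal_fZ1 hz)
    fun z hz => p.fZ1_nonneg hz

/-- Density of the path loss of the detected base station of a sector. -/
def detDensity (z : ℝ) : ℝ≥0∞ := ENNReal.ofReal (p.Ptilde z) * ENNReal.ofReal (p.fZ1 z)

lemma aemeasurable_detDensity : AEMeasurable p.detDensity (volume.restrict (Set.Ioi 0)) :=
  p.aemeasurable_Ptilde.ennreal_ofReal.mul p.aemeasurable_fZ1.ennreal_ofReal

lemma lintegral_bsIntensity_loss {φ : ℝ → ℝ≥0∞} (hφ : Measurable φ) :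
    ∫⁻ y, φ (p.loss y) ∂p.bsIntensity = ENNReal.ofReal (2 * Real.pi * p.lam) * p.rad φ := by
  have hm : Measurable fun y => φ (p.loss y) := hφ.comp p.measurable_loss
  rw [lintegral_markedIntensity _ _ hm]
  have h1 : ∀ x : ℂ, ∫⁻ m, φ (p.loss (x, m)) ∂(unifLaw.prod (expMeasure 1)) =
      ∫⁻ v, (if sectorIdx 1 x = 0 then φ (p.linkLoss v ‖x‖) else 0) ∂unifLaw := by
    intro x
    have hmx : Measurable fun m : ℝ × ℝ => φ (p.loss (x, m)) := hm.comp measurable_prodMk_left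
    rw [lintegral_prod _ hmx.aemeasurable]
    refine lintegral_congr fun v => ?_
    have e' : ∀ f, p.loss (x, v, f) = p.linkLoss v ‖x‖ := fun f => rfl
    have e0 : sectorIdx 1 x = 0 := Nat.lt_one_iff.1 (sectorIdx_lt one_pos x)
    simp_rw [e', e0]
    simp
  rw [lintegral_congr h1, p.lintegral_sector_linkLoss one_pos one_pos hφ, ← mul_assoc,
    ← ENNReal.ofReal_mul p.lam_pos.le]
  congr 2
  push_cast; ring

lemma bsIntensity_loss {B : Set ℝ} (hB : MeasurableSet B) :
    p.bsIntensity {y | p.loss y ∈ B} =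
      ENNReal.ofReal (2 * Real.pi * p.lam) * p.rad (B.indicator 1) := by
  rw [← p.lintegral_bsIntensity_loss (measurable_one.indicator hB), ← lintegral_indicator_one]
  · rfl
  · exact p.measurable_loss hB

end Params

section BaseStations

variable (p : Params) {Ω : Type*} [MeasurableSpace Ω] {μ : Measure Ω} [IsProbabilityMeasure μ]
  {X : ℕ → Ω → ℂ} {mark : ℕ → Ω → ℝ × ℝ}

lemma rad_zero : p.rad (fun _ => 0) = 0 := by simp [Params.rad]

theorem ae_generic (h : IsMarkedPoisson μ X mark p.lam (unifLaw.prod (expMeasure 1))) :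
    ∀ᵐ ω ∂μ, p.Generic fun k => (X k ω, mark k ω) := by
  have hsing : ∀ t, p.bsIntensity {y | p.loss y = t} = 0 := by
    intro t
    have h1 := p.bsIntensity_loss (measurableSet_singleton t)
    have h2 : p.rad (Set.indicator {t} 1) = 0 := by
      rw [← rad_zero p]
      exact p.rad_congr_of_ne (z := t) fun l _ hl => Set.indicator_of_notMem (show l ∉ ({t} : Set ℝ) from hl) _
    rw [h2, mul_zero] at h1
    exact h1
  have hfin : ∀ t, p.bsIntensity {y | p.loss y ≤ t} ≠ ⊤ := by
    intro t
    have h1 := p.bsIntensity_loss (measurableSet_Iic (a := t))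
    have h2 : p.rad (Set.indicator (Set.Iic t) 1) ≤ p.rad (fun l => if l < |t| + 1 then 1 else 0) := by
      refine p.rad_mono fun l _ => ?_
      by_cases hl : l ≤ t
      · rw [if_pos (lt_of_le_of_lt (hl.trans (le_abs_self t)) (lt_add_one _))]
        exact Set.indicator_le_self' (fun _ _ => zero_le) _
      · rw [Set.indicator_of_notMem (by simpa using hl)]
        exact zero_le
    rw [p.rad_lt (by positivity)] at h2
    have h3 : p.bsIntensity {y | p.loss y ≤ t} = _ := h1
    rw [h3]
    exact ENNReal.mul_ne_top ENNReal.ofReal_ne_top (ne_top_of_le_ne_top ENNReal.ofReal_ne_top h2)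
  have hpos : ∀ᵐ ω ∂μ, ∀ i, 0 < p.loss (X i ω, mark i ω) := by
    have hms : MeasurableSet {y | p.loss y = 0} := p.measurable_loss (measurableSet_singleton 0)
    have h1 := h.lintegral_tsum p.lam_pos.le (φ := {y | p.loss y = 0}.indicator 1)
      (measurable_one.indicator hms)
    rw [lintegral_indicator_one hms, hsing, lintegral_eq_zero_iff
      (h.measurable_tsum (measurable_one.indicator hms))] at h1
    filter_upwards [h1] with ω hω i
    have h2 := ENNReal.tsum_eq_zero.1 hω i
    by_contra hcon
    have h3 : (X i ω, mark i ω) ∈ {y | p.loss y = 0} :=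
      le_antisymm (not_lt.1 hcon) (p.loss_nonneg _)
    rw [Set.indicator_of_mem h3] at h2
    exact one_ne_zero h2
  filter_upwards [h.ae_injective p.lam_pos.le p.measurable_loss p.loss_nonneg hfin hsing,
    h.ae_finite p.lam_pos.le p.measurable_loss hfin, hpos] with ω h1 h2 h3
  exact ⟨h1, h2, h3⟩

lemma measurable_W0_points (h : IsMarkedPoisson μ X mark p.lam (unifLaw.prod (expMeasure 1)))
    (s : ℕ) : Measurable fun ω => p.W0 s fun k => (X k ω, mark k ω) :=
  (p.measurable_W0 s).comp h.measurable_points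

lemma map_W0_apply_pos (h : IsMarkedPoisson μ X mark p.lam (unifLaw.prod (expMeasure 1)))
    {s : ℕ} (hs : s < p.Kcs) {B : Set ℝ} (hB : MeasurableSet B) (hB0 : B ⊆ Set.Ioi 0) :
    μ.map (fun ω => p.W0 s fun k => (X k ω, mark k ω)) B = ∫⁻ z in B, p.detDensity z := by
  have hbdd : ∀ n : ℕ, μ.map (fun ω => p.W0 s fun k => (X k ω, mark k ω)) (B ∩ Set.Iic n) =
      volume.withDensity p.detDensity (B ∩ Set.Iic n) := by
    intro n
    have hBn : MeasurableSet (B ∩ Set.Iic (n : ℝ)) := hB.inter measurableSet_Iic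
    have h1 := lintegral_tsum_detSet p h hs hBn (R := n) fun z hz => ⟨hB0 hz.1, hz.2⟩
    rw [withDensity_apply _ hBn]
    refine Eq.trans ?_ h1
    rw [← lintegral_indicator_one hBn, lintegral_map (measurable_one.indicator hBn)
      (measurable_W0_points p h s)]
    refine lintegral_congr_ae ?_
    filter_upwards [ae_generic p h] with ω hω
    exact (hω.tsum_detSet s fun z hz => hB0 hz.1).symm
  have hU : ⋃ n : ℕ, B ∩ Set.Iic (n : ℝ) = B := by
    rw [← Set.inter_iUnion]
    refine Set.inter_eq_left.2 fun z _ => Set.mem_iUnion.2 ?_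
    obtain ⟨n, hn⟩ := exists_nat_ge z
    exact ⟨n, hn⟩
  have hmono : Monotone fun n : ℕ => B ∩ Set.Iic (n : ℝ) := fun m n hmn =>
    Set.inter_subset_inter_right _ (Set.Iic_subset_Iic.2 (by exact_mod_cast hmn))
  rw [← withDensity_apply _ hB]
  conv_lhs => rw [← hU]
  conv_rhs => rw [← hU]
  rw [hmono.measure_iUnion, hmono.measure_iUnion]
  simp_rw [hbdd]

end BaseStations

section Independence

variable {Ω : Type*} [MeasurableSpace Ω] {μ : Measure Ω} [IsProbabilityMeasure μ]

/-- Integration of a product of functions of one and of another of several independent variables. -/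
lemma lintegral_mul_prod_of_iIndepFun {W : ℕ → Ω → ℝ} (hW : iIndepFun W μ)
    (hWm : ∀ k, Measurable (W k)) {j : ℕ} {s : Finset ℕ} (hj : j ∉ s) {A : ℝ → ℝ≥0∞}
    (hA : Measurable A) {φ : ℕ → ℝ → ℝ → ℝ≥0∞} (hφ : ∀ k, Measurable (Function.uncurry (φ k))) :
    ∫⁻ ω, A (W j ω) * ∏ k ∈ s, φ k (W j ω) (W k ω) ∂μ =
      ∫⁻ z, A z * ∏ k ∈ s, (∫⁻ w, φ k z w ∂(μ.map (W k))) ∂(μ.map (W j)) := by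
  have hφz : ∀ k z, Measurable (φ k z) := fun k z => (hφ k).comp measurable_prodMk_left
  have h1 : IndepFun (W j) (fun ω (k : s) => W k ω) μ := by
    have h2 := hW.indepFun_finset {j} s (Finset.disjoint_singleton_left.2 hj) hWm
    exact h2.comp (φ := fun v : ({j} : Finset ℕ) → ℝ => v ⟨j, Finset.mem_singleton_self j⟩)
      (measurable_pi_apply _) measurable_id
  have hF : Measurable (Function.uncurry fun (z : ℝ) (v : s → ℝ) =>
      A z * ∏ k ∈ s.attach, φ k z (v k)) := by
    refine (hA.comp measurable_fst).mul (Finset.measurable_prod _ fun k _ => ?_)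
    exact (hφ k).comp (measurable_fst.prodMk ((measurable_pi_apply k).comp measurable_snd))
  have h3 := lintegral_indepFun h1 (hWm j) (measurable_pi_lambda _ fun k : s => hWm k) hF
  have e : ∀ ω, A (W j ω) * ∏ k ∈ s, φ k (W j ω) (W k ω) =
      A (W j ω) * ∏ k ∈ s.attach, φ k (W j ω) (W k ω) := by
    intro ω
    rw [Finset.prod_attach s fun k => φ k (W j ω) (W k ω)]
  rw [lintegral_congr e]
  refine h3.trans ?_
  have hG : Measurable fun z => A z * ∏ k ∈ s, (∫⁻ w, φ k z w ∂(μ.map (W k))) := by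
    refine hA.mul (Finset.measurable_prod _ fun k _ => ?_)
    have : IsProbabilityMeasure (μ.map (W k)) :=
      Measure.isProbabilityMeasure_map (hWm k).aemeasurable
    exact Measurable.lintegral_prod_right' (hφ k)
  rw [lintegral_map hG (hWm j)]
  refine lintegral_congr fun ω => ?_
  have e2 : ∀ ω', A (W j ω) * ∏ k ∈ s.attach, φ k (W j ω) (W k ω') =
      A (W j ω) * ∏ k ∈ s, φ k (W j ω) (W k ω') := by
    intro ω'
    rw [Finset.prod_attach s fun k => φ k (W j ω) (W k ω')]
  have hm : Measurable fun ω' => ∏ k ∈ s, φ k (W j ω) (W k ω') :=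
    Finset.measurable_prod _ fun k _ => (hφz k (W j ω)).comp (hWm k)
  rw [lintegral_congr e2, lintegral_const_mul _ hm,
    lintegral_prod_eq_prod_lintegral_of_indepFun s (fun k ω' => φ k (W j ω) (W k ω'))
      (hW.comp _ fun k => hφz k (W j ω)) fun k => (hφz k (W j ω)).comp (hWm k)]
  congr 1
  exact Finset.prod_congr rfl fun k _ => (lintegral_map (hφz k _) (hWm k)).symm

lemma iIndepFun_comp_of_map {ι E : Type*} [MeasurableSpace E] {f : Ω → E} (hf : Measurable f)
    {g : ι → E → ℝ} (hg : ∀ i, Measurable (g i)) (h : iIndepFun g (μ.map f)) :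
    iIndepFun (fun i ω => g i (f ω)) μ := by
  rw [iIndepFun_iff_measure_inter_preimage_eq_mul] at h ⊢
  intro S sets hs
  have h1 := h S hs
  rw [Measure.map_apply hf (Finset.measurableSet_biInter _ fun i hi => hg i (hs i hi))] at h1
  have h2 : ∏ i ∈ S, μ.map f (g i ⁻¹' sets i) = ∏ i ∈ S, μ ((fun ω => g i (f ω)) ⁻¹' sets i) :=
    Finset.prod_congr rfl fun i hi => Measure.map_apply hf (hg i (hs i hi))
  rw [h2] at h1
  rw [← h1]
  congr 1
  ext ω
  simp

end Independence

section BaseStations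

variable (p : Params) {Ω : Type*} [MeasurableSpace Ω] {μ : Measure Ω} [IsProbabilityMeasure μ]
  {X : ℕ → Ω → ℂ} {mark : ℕ → Ω → ℝ × ℝ}

theorem iIndepFun_W0 (h : IsMarkedPoisson μ X mark p.lam (unifLaw.prod (expMeasure 1))) :
    iIndepFun (fun s ω => p.W0 s fun k => (X k ω, mark k ω)) μ := by
  have hd : Pairwise (Function.onFun Disjoint p.sectorSet) := by
    intro s t hst
    refine Set.disjoint_left.2 fun y hy hy' => hst ?_
    exact (show p.sec y = s from hy).symm.trans hy'
  have h1 := h.iIndep_voidSigma p.lam_pos.le hd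
  have h2 : iIndepFun (fun s => p.W0 s) (μ.map fun ω k => (X k ω, mark k ω)) := by
    rw [iIndepFun_iff_iIndep]
    refine iIndep_of_iIndep_of_le h1 fun s => ?_
    exact Measurable.comap_le (p.measurable_W0_voidSigma s)
  exact iIndepFun_comp_of_map h.measurable_points p.measurable_W0 h2

lemma Params.lintegral_detDensity_le
    (h : IsMarkedPoisson μ X mark p.lam (unifLaw.prod (expMeasure 1))) :
    ∫⁻ z in Set.Ioi 0, p.detDensity z ≤ 1 := by
  rw [← map_W0_apply_pos p h p.Kcs_pos measurableSet_Ioi subset_rfl]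
  have := Measure.isProbabilityMeasure_map (measurable_W0_points p h 0).aemeasurable (μ := μ)
  exact prob_le_one

lemma ofReal_Pbeyond (h : IsMarkedPoisson μ X mark p.lam (unifLaw.prod (expMeasure 1)))
    {z : ℝ} (hz : 0 ≤ z) : ENNReal.ofReal (p.Pbeyond z) = ∫⁻ w in Set.Ioi z, p.detDensity w := by
  have hsub : volume.restrict (Set.Ioi z) ≤ volume.restrict (Set.Ioi 0) :=
    Measure.restrict_mono (Set.Ioi_subset_Ioi hz) le_rfl
  have hnn : ∀ᵐ w ∂(volume.restrict (Set.Ioi z)), 0 ≤ p.Ptilde w * p.fZ1 w := by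
    filter_upwards [ae_restrict_mem measurableSet_Ioi] with w hw
    exact mul_nonneg (p.Ptilde_nonneg _) (p.fZ1_nonneg (hz.trans_lt hw))
  have hm : AEMeasurable (fun w => p.Ptilde w * p.fZ1 w) (volume.restrict (Set.Ioi z)) :=
    (p.aemeasurable_Ptilde.mul p.aemeasurable_fZ1).mono_measure hsub
  have he : ∀ w, ENNReal.ofReal (p.Ptilde w * p.fZ1 w) = p.detDensity w := fun w =>
    ENNReal.ofReal_mul (p.Ptilde_nonneg w)
  rw [Params.Pbeyond, ofReal_integral_eq_lintegral_ofReal _ hnn]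
  · simp_rw [he]
  · refine (lintegral_ofReal_ne_top_iff_integrable hm.aestronglyMeasurable hnn).1 ?_
    simp_rw [he]
    exact ne_top_of_le_ne_top ENNReal.one_ne_top ((lintegral_mono' hsub le_rfl).trans
      (p.lintegral_detDensity_le h))

lemma Params.Pbeyond_zero : p.Pbeyond 0 = p.Pdet := rfl

lemma Params.Pbeyond_nonneg {z : ℝ} (hz : 0 ≤ z) : 0 ≤ p.Pbeyond z :=
  setIntegral_nonneg measurableSet_Ioi fun _ hw =>
    mul_nonneg (p.Ptilde_nonneg _) (p.fZ1_nonneg (lt_of_le_of_lt hz hw))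

lemma Pdet_le_one (h : IsMarkedPoisson μ X mark p.lam (unifLaw.prod (expMeasure 1))) :
    p.Pdet ≤ 1 := by
  have h1 := ofReal_Pbeyond p h le_rfl
  rw [p.Pbeyond_zero] at h1
  exact ENNReal.ofReal_le_one.1 (h1.trans_le (p.lintegral_detDensity_le h))

lemma map_W0_apply_zero (h : IsMarkedPoisson μ X mark p.lam (unifLaw.prod (expMeasure 1)))
    {s : ℕ} (hs : s < p.Kcs) :
    μ.map (fun ω => p.W0 s fun k => (X k ω, mark k ω)) {0} = ENNReal.ofReal (1 - p.Pdet) := by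
  have hP := Measure.isProbabilityMeasure_map (measurable_W0_points p h s).aemeasurable (μ := μ)
  have h1 := map_W0_apply_pos p h hs measurableSet_Ioi subset_rfl
  rw [← ofReal_Pbeyond p h le_rfl, p.Pbeyond_zero] at h1
  have h2 := prob_compl_eq_one_sub (μ := μ.map fun ω => p.W0 s fun k => (X k ω, mark k ω))
    (measurableSet_Ioi (a := (0 : ℝ)))
  rw [h1, Set.compl_Ioi, ← ENNReal.ofReal_one, ← ENNReal.ofReal_sub _ (show 0 ≤ p.Pdet from p.Pbeyond_nonneg le_rfl)] at h2
  rw [← h2, Measure.map_apply (measurable_W0_points p h s) (measurableSet_singleton 0),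
    Measure.map_apply (measurable_W0_points p h s) measurableSet_Iic]
  congr 1
  ext ω
  exact ⟨fun h => le_of_eq h, fun h => le_antisymm h (Params.W0_nonneg _ _)⟩

lemma map_W0_restrict (h : IsMarkedPoisson μ X mark p.lam (unifLaw.prod (expMeasure 1)))
    {s : ℕ} (hs : s < p.Kcs) :
    (μ.map fun ω => p.W0 s fun k => (X k ω, mark k ω)).restrict (Set.Ioi 0) =
      (volume.restrict (Set.Ioi 0)).withDensity p.detDensity := by
  ext B hB
  rw [Measure.restrict_apply hB, map_W0_apply_pos p h hs (hB.inter measurableSet_Ioi)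
    Set.inter_subset_right, withDensity_apply _ hB, Measure.restrict_restrict hB]

/-- Expectation of a functional of the detected base stations, decomposed according to the sector of
the one of smallest path loss. -/
theorem lintegral_sectors (h : IsMarkedPoisson μ X mark p.lam (unifLaw.prod (expMeasure 1)))
    {A : ℝ → ℝ≥0∞} (hA : Measurable A) {u v : ℕ → ℝ → ℝ≥0∞} (hu : ∀ k, Measurable (u k))
    (hv : ∀ k, Measurable (v k)) {j : ℕ} (hj : j < p.Kcs) :
    ∫⁻ ω, (Set.Ioi 0).indicator A (p.W0 j fun k => (X k ω, mark k ω)) *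
      ∏ k ∈ (Finset.range p.Kcs).erase j,
        ((if p.W0 k (fun k => (X k ω, mark k ω)) = 0
          then u k (p.W0 j fun k => (X k ω, mark k ω)) else 0) +
        (if p.W0 j (fun k => (X k ω, mark k ω)) < p.W0 k (fun k => (X k ω, mark k ω))
          then v k (p.W0 j fun k => (X k ω, mark k ω)) else 0)) ∂μ =
      ∫⁻ z in Set.Ioi 0, A z * (∏ k ∈ (Finset.range p.Kcs).erase j,
        (ENNReal.ofReal (1 - p.Pdet) * u k z + ENNReal.ofReal (p.Pbeyond z) * v k z)) *
          p.detDensity z := by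
  have hA' : Measurable ((Set.Ioi (0 : ℝ)).indicator A) := hA.indicator measurableSet_Ioi
  have hφ : ∀ k, Measurable (Function.uncurry fun z w : ℝ =>
      (if w = 0 then u k z else 0) + if z < w then v k z else 0) := by
    intro k
    exact (Measurable.ite (measurableSet_eq_fun measurable_snd measurable_const)
      ((hu k).comp measurable_fst) measurable_const).add
      (Measurable.ite (measurableSet_lt measurable_fst measurable_snd)
      ((hv k).comp measurable_fst) measurable_const)
  have h1 := lintegral_mul_prod_of_iIndepFun (iIndepFun_W0 p h) (measurable_W0_points p h)
    (Finset.notMem_erase j (Finset.range p.Kcs)) hA'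
    (φ := fun k z w => (if w = 0 then u k z else 0) + if z < w then v k z else 0) hφ
  refine h1.trans ?_
  have hG : Measurable fun z => A z * ∏ k ∈ (Finset.range p.Kcs).erase j,
      ∫⁻ w, ((if w = 0 then u k z else 0) + if z < w then v k z else 0)
        ∂(μ.map fun ω => p.W0 k fun k => (X k ω, mark k ω)) := by
    refine hA.mul (Finset.measurable_prod _ fun k _ => ?_)
    have := Measure.isProbabilityMeasure_map (measurable_W0_points p h k).aemeasurable (μ := μ)
    exact Measurable.lintegral_prod_right' (hφ k)
  have h2 : ∀ z, (Set.Ioi (0 : ℝ)).indicator A z * ∏ k ∈ (Finset.range p.Kcs).erase j,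
      ∫⁻ w, ((if w = 0 then u k z else 0) + if z < w then v k z else 0)
        ∂(μ.map fun ω => p.W0 k fun k => (X k ω, mark k ω)) =
      (Set.Ioi (0 : ℝ)).indicator (fun z => A z * ∏ k ∈ (Finset.range p.Kcs).erase j,
      ∫⁻ w, ((if w = 0 then u k z else 0) + if z < w then v k z else 0)
        ∂(μ.map fun ω => p.W0 k fun k => (X k ω, mark k ω))) z := by
    intro z
    rw [Set.indicator_mul_left]
  rw [lintegral_congr h2, lintegral_indicator measurableSet_Ioi, map_W0_restrict p h hj,
    lintegral_withDensity_eq_lintegral_mul₀ p.aemeasurable_detDensity hG.aemeasurable]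
  refine setLIntegral_congr_fun measurableSet_Ioi fun z hz => ?_
  have hz : 0 < z := hz
  rw [Pi.mul_apply, mul_comm]
  congr 2
  refine Finset.prod_congr rfl fun k hk => ?_
  have hkK : k < p.Kcs := Finset.mem_range.1 (Finset.mem_of_mem_erase hk)
  have i1 : ∀ w : ℝ, (if w = 0 then u k z else 0) = ({0} : Set ℝ).indicator (fun _ => u k z) w := by
    intro w
    by_cases hw : w = 0
    · subst hw; simp
    · rw [if_neg hw, Set.indicator_of_notMem (show w ∉ ({0} : Set ℝ) from hw)]
  have i2 : ∀ w : ℝ, (if z < w then v k z else 0) = (Set.Ioi z).indicator (fun _ => v k z) w := by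
    intro w
    by_cases hw : z < w
    · rw [if_pos hw, Set.indicator_of_mem (show w ∈ Set.Ioi z from hw)]
    · rw [if_neg hw, Set.indicator_of_notMem (show w ∉ Set.Ioi z from hw)]
  simp_rw [i1, i2]
  rw [lintegral_add_left (measurable_const.indicator (measurableSet_singleton 0)),
    lintegral_indicator_const (measurableSet_singleton 0),
    lintegral_indicator_const measurableSet_Ioi, map_W0_apply_zero p h hkK,
    map_W0_apply_pos p h hkK measurableSet_Ioi (Set.Ioi_subset_Ioi hz.le),
    ← ofReal_Pbeyond p h hz.le, mul_comm, mul_comm (v k z)]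

end BaseStations

lemma lintegral_unifFin {n : ℕ} (hn : 0 < n) (F : Fin n → ℝ≥0∞) :
    ∫⁻ i, F i ∂(unifFin n) = ENNReal.ofReal (1 / n) * ∑ i, F i := by
  have h1 : unifFin n = (Measure.count (Set.univ : Set (Fin n)))⁻¹ • (Measure.count : Measure (Fin n)) := by
    rw [unifFin, uniformOn, ProbabilityTheory.cond, Measure.restrict_univ]
  rw [h1, lintegral_smul_measure, lintegral_count, tsum_fintype, smul_eq_mul, Measure.count_univ]
  congr 1
  rw [one_div, ENNReal.ofReal_inv_of_pos (by exact_mod_cast hn)]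
  simp

lemma isProbabilityMeasure_unifFin {n : ℕ} (hn : 0 < n) : IsProbabilityMeasure (unifFin n) := by
  have : Nonempty (Fin n) := ⟨⟨0, hn⟩⟩
  unfold unifFin
  exact isProbabilityMeasure_uniformOn Set.finite_univ Set.univ_nonempty

lemma sum_fin_eq_ite {n : ℕ} {s : ℕ} (hs : s < n) (A B : ℝ≥0∞) :
    ∑ b : Fin n, (if s = (b : ℕ) then A else B) = A + ENNReal.ofReal (n - 1) * B := by
  rw [← Finset.add_sum_erase _ _ (Finset.mem_univ (⟨s, hs⟩ : Fin n)), if_pos rfl]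
  congr 1
  rw [Finset.sum_congr rfl (g := fun _ => B)]
  · rw [Finset.sum_const, Finset.card_erase_of_mem (Finset.mem_univ _), Finset.card_univ,
      Fintype.card_fin, nsmul_eq_mul]
    have e : (n : ℝ) - 1 = ((n - 1 : ℕ) : ℝ) := by
      rw [Nat.cast_sub (by omega : 1 ≤ n), Nat.cast_one]
    rw [e, ENNReal.ofReal_natCast]
  · intro b hb
    rw [if_neg]
    intro h
    exact Finset.ne_of_mem_erase hb (Fin.ext h.symm)

namespace Params

variable (p : Params)

lemma Mra_pos : 0 < p.Mra := by
  unfold Mra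
  split <;> first | exact p.M_pos | exact one_pos

lemma N_dvd_Kcs : p.N ∣ p.Kcs := by
  have hle := Nat.le_of_dvd p.M_pos p.N_dvd_M
  have h1 := p.M_pos
  cases hp : p.protocol with
  | baseline =>
    have : p.Kcs = p.M := by simp [Kcs, Mcs, Ncs, hp, hle]
    rw [this]; exact p.N_dvd_M
  | fastRA =>
    have : p.Kcs = p.M := by simp [Kcs, Mcs, Ncs, hp, hle]
    rw [this]; exact p.N_dvd_M
  | fastCS m =>
    have h2 := p.fastCS_beams m hp
    have : p.Kcs = m := by simp [Kcs, Mcs, Ncs, hp, h2.1]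
    rw [this]; exact h2.2.2
  | omniRX =>
    have : p.Kcs = p.M := by simp [Kcs, Mcs, Ncs, hp]; omega
    rw [this]; exact p.N_dvd_M

/-- Integral over all links of a function of sector and path loss. -/
lemma lintegral_plane_linkLoss {K : ℕ} (hK : 0 < K) {φ : ℕ → ℝ → ℝ≥0∞}
    (hφ : ∀ k, Measurable (φ k)) :
    ∫⁻ x : ℂ, ∫⁻ v, φ (sectorIdx K x) (p.linkLoss v ‖x‖) ∂unifLaw =
      ∑ k ∈ Finset.range K, ENNReal.ofReal (2 * Real.pi / K) * p.rad (φ k) := by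
  have hm : ∀ k, Measurable fun q : ℂ × ℝ =>
      if sectorIdx K q.1 = k then φ k (p.linkLoss q.2 ‖q.1‖) else 0 := by
    intro k
    have h1 : Measurable fun q : ℂ × ℝ => p.linkLoss q.2 ‖q.1‖ :=
      p.measurable_linkLoss.comp (measurable_snd.prodMk measurable_fst.norm)
    exact Measurable.ite ((measurable_sectorIdx K).comp measurable_fst (measurableSet_singleton k))
      ((hφ k).comp h1) measurable_const
  have h1 : ∀ x : ℂ, ∀ v, φ (sectorIdx K x) (p.linkLoss v ‖x‖) = ∑ k ∈ Finset.range K,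
      if sectorIdx K x = k then φ k (p.linkLoss v ‖x‖) else 0 := by
    intro x v
    rw [Finset.sum_ite_eq, if_pos (Finset.mem_range.2 (sectorIdx_lt hK x))]
  have hmx : ∀ k x, Measurable fun v : ℝ =>
      if sectorIdx K x = k then φ k (p.linkLoss v ‖x‖) else 0 :=
    fun k x => (hm k).comp measurable_prodMk_left
  simp_rw [h1]
  have h2 : ∀ x : ℂ, ∫⁻ v, ∑ k ∈ Finset.range K,
      (if sectorIdx K x = k then φ k (p.linkLoss v ‖x‖) else 0) ∂unifLaw =
      ∑ k ∈ Finset.range K, ∫⁻ v,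
      (if sectorIdx K x = k then φ k (p.linkLoss v ‖x‖) else 0) ∂unifLaw :=
    fun x => lintegral_finsetSum _ fun k _ => hmx k x
  simp_rw [h2]
  rw [lintegral_finsetSum _ fun k _ => (hm k).lintegral_prod_right']
  exact Finset.sum_congr rfl fun k hk => p.lintegral_sector_linkLoss hK (Finset.mem_range.1 hk) (hφ k)

/-- Laplace exponent of one interferer of path loss `l` and relative gain `c` at threshold `T`. -/
def expo (z T c l : ℝ) : ℝ≥0∞ :=
  ∫⁻ f, (1 - eN (ENNReal.ofReal (T * z * (c * f / l)))) ∂(expMeasure 1)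

@[fun_prop] lemma measurable_expo (z T c : ℝ) : Measurable (expo z T c) := by
  unfold expo
  refine Measurable.lintegral_prod_right' (f := fun q : ℝ × ℝ =>
    1 - eN (ENNReal.ofReal (T * z * (c * q.2 / q.1)))) ?_
  fun_prop

lemma expo_eq_kern {z T c l : ℝ} (hz : 0 < z) (hT : 0 ≤ T) (hc : 0 ≤ c) (hl : 0 < l) :
    expo z T c l = kern z (c * T) l := by
  have h : ∀ f, ENNReal.ofReal (T * z * (c * f / l)) =
      ENNReal.ofReal (c * T * z / l) * ENNReal.ofReal f := by
    intro f
    rw [← ENNReal.ofReal_mul (by positivity)]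
    congr 1; ring
  unfold expo
  simp_rw [h]
  rw [lintegral_one_sub_eN_expMeasure (by positivity), kern]
  congr 1
  field_simp

lemma rad_congr {φ ψ : ℝ → ℝ≥0∞} (h : ∀ l, 0 < l → φ l = ψ l) : p.rad φ = p.rad ψ :=
  le_antisymm (p.rad_mono fun l hl => (h l hl).le) (p.rad_mono fun l hl => (h l hl).ge)

lemma rad_expo {z T c : ℝ} (hz : 0 < z) (hT : 0 ≤ T) (hc : 0 ≤ c) :
    p.rad (expo z T c) = p.rad (kern z (c * T)) :=
  p.rad_congr fun _ hl => expo_eq_kern hz hT hc hl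

end Params

namespace Params

variable (p : Params)

lemma measurable_linkLoss_comp {α : Type*} [MeasurableSpace α] {f g : α → ℝ} (hf : Measurable f)
    (hg : Measurable g) : Measurable fun a => p.linkLoss (f a) (g a) := by
  have h := p.measurable_linkLoss.comp (hf.prodMk hg)
  exact h

/-- The law of the marks of a user. -/
abbrev userLaw : Measure (ℝ × ℝ × ℝ × Fin p.Npa × Fin p.N) :=
  unifLaw.prod ((expMeasure 1).prod (unifLaw.prod ((unifFin p.Npa).prod (unifFin p.N))))

instance : IsProbabilityMeasure (unifFin p.Npa) := isProbabilityMeasure_unifFin p.Npa_pos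
instance : IsProbabilityMeasure (unifFin p.N) := isProbabilityMeasure_unifFin p.N_pos
instance : IsProbabilityMeasure (unifFin p.M) := isProbabilityMeasure_unifFin p.M_pos
instance : IsProbabilityMeasure (unifFin p.Mra) := isProbabilityMeasure_unifFin p.Mra_pos

/-- A user with its marks. -/
abbrev User : Type := ℂ × ℝ × ℝ × ℝ × Fin p.Npa × Fin p.N

variable {p}

/-- A user with the preamble `k` and found by a station at `x` in the receive beam of the origin. -/
def RaInt (a : ℝ) (x : ℂ) (k : Fin p.Npa) (y : p.User) : Prop :=
  y.2.2.2.1 < a ∧ y.2.2.2.2.1 = k ∧ sectorIdx p.Mra (y.1 - x) = sectorIdx p.Mra (-x)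

/-- The transmit beam of a user, for a tagged base station at `x`. -/
def raBeam (x : ℂ) (y : p.User) : ℕ :=
  match p.protocol with
  | .omniRX => sectorIdx p.N x
  | _ => y.2.2.2.2.2

/-- The gain of a user towards a base station at `x`. -/
def raGain (x : ℂ) (y : p.User) : ℝ :=
  if sectorIdx p.N (x - y.1) = raBeam x y then p.GN else p.gN

open Classical in
/-- Received power from a user at a base station at `x`. -/
def raTerm (a : ℝ) (x : ℂ) (k : Fin p.Npa) (y : p.User) : ℝ≥0∞ :=
  if RaInt a x k y then
    ENNReal.ofReal (y.2.2.1 * (p.Mra * raGain x y) / p.linkLoss y.2.1 ‖y.1 - x‖) else 0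

/-- Parameters of the users' interference. -/
abbrev RaPar (p : Params) : Type := (ℂ × Fin p.Npa) × p.User

lemma measurableSet_RaInt (a : ℝ) : MeasurableSet {q : RaPar p | RaInt a q.1.1 q.1.2 q.2} := by
  have h1 : Measurable fun q : RaPar p => sectorIdx p.Mra (q.2.1 - q.1.1) :=
    (measurable_sectorIdx _).comp (by fun_prop)
  have h2 : Measurable fun q : RaPar p => sectorIdx p.Mra (-q.1.1) :=
    (measurable_sectorIdx _).comp (by fun_prop)
  have h3 : Measurable fun q : RaPar p => q.2.2.2.2.1 := by fun_prop
  have h4 : Measurable fun q : RaPar p => q.2.2.2.2.2.1 := by fun_prop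
  have h5 : Measurable fun q : RaPar p => q.1.2 := by fun_prop
  exact (measurableSet_lt h3 measurable_const).inter
    ((measurableSet_eq_fun h4 h5).inter (measurableSet_eq_fun h1 h2))

lemma measurable_raGain : Measurable fun q : ℂ × p.User => raGain q.1 q.2 := by
  have h1 : Measurable fun q : ℂ × p.User => sectorIdx p.N (q.1 - q.2.1) :=
    (measurable_sectorIdx _).comp (by fun_prop)
  have h2 : Measurable fun q : ℂ × p.User => raBeam q.1 q.2 := by
    unfold raBeam
    cases p.protocol with
    | omniRX => exact (measurable_sectorIdx _).comp measurable_fst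
    | baseline | fastRA | fastCS m =>
      exact (measurable_of_finite (fun i : Fin p.N => (i : ℕ))).comp (by fun_prop)
  exact Measurable.ite (measurableSet_eq_fun h1 h2) measurable_const measurable_const

lemma measurable_raTerm (a : ℝ) : Measurable fun q : RaPar p => raTerm a q.1.1 q.1.2 q.2 := by
  have h1 : Measurable fun q : RaPar p => p.linkLoss q.2.2.1 ‖q.2.1 - q.1.1‖ :=
    p.measurable_linkLoss_comp (by fun_prop) (by fun_prop)
  have h2 : Measurable fun q : RaPar p => raGain q.1.1 q.2 := by
    have h4 : Measurable fun q : RaPar p => (q.1.1, q.2) := by fun_prop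
    have h5 := measurable_raGain.comp h4
    exact h5
  have h3 : Measurable fun q : RaPar p => q.2.2.2.1 := by fun_prop
  unfold raTerm
  exact Measurable.ite (measurableSet_RaInt a)
    ((h3.mul (h2.const_mul _)).div h1).ennreal_ofReal measurable_const

/-- Integration over the active users with a given preamble. -/
lemma lintegral_users {a : ℝ} (ha : a ∈ Set.Icc (0 : ℝ) 1) (k : Fin p.Npa)
    {H : ℂ → ℝ → ℝ → Fin p.N → ℝ≥0∞}
    (hH : Measurable fun q : ℂ × ℝ × ℝ × Fin p.N => H q.1 q.2.1 q.2.2.1 q.2.2.2) :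
    ∫⁻ y, (if y.2.2.2.1 < a ∧ y.2.2.2.2.1 = k then H y.1 y.2.1 y.2.2.1 y.2.2.2.2.2 else 0)
        ∂(markedIntensity p.lamU p.userLaw) =
      ENNReal.ofReal (p.lamU * (a / p.Npa)) * ∫⁻ x, ∫⁻ v, ENNReal.ofReal (1 / p.N) *
        ∑ b, ∫⁻ f, H x v f b ∂(expMeasure 1) ∂unifLaw := by
  have hmH : Measurable fun y : p.User => H y.1 y.2.1 y.2.2.1 y.2.2.2.2.2 :=
    hH.comp (g := fun q : ℂ × ℝ × ℝ × Fin p.N => H q.1 q.2.1 q.2.2.1 q.2.2.2)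
      (f := fun y : p.User => (y.1, y.2.1, y.2.2.1, y.2.2.2.2.2)) (by fun_prop)
  have hm : Measurable fun y : p.User =>
      if y.2.2.2.1 < a ∧ y.2.2.2.2.1 = k then H y.1 y.2.1 y.2.2.1 y.2.2.2.2.2 else 0 := by
    have h3 : Measurable fun y : p.User => y.2.2.2.1 := by fun_prop
    have h4 : Measurable fun y : p.User => y.2.2.2.2.1 := by fun_prop
    exact Measurable.ite ((measurableSet_lt h3 measurable_const).inter
      (h4 (measurableSet_singleton k))) hmH measurable_const
  rw [lintegral_markedIntensity _ _ hm, ENNReal.ofReal_mul p.lamU_pos.le, mul_assoc]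
  congr 1
  rw [← lintegral_const_mul' _ _ ENNReal.ofReal_ne_top]
  refine lintegral_congr fun x => ?_
  rw [← lintegral_const_mul' _ _ ENNReal.ofReal_ne_top]
  have hmx : Measurable fun m : ℝ × ℝ × ℝ × Fin p.Npa × Fin p.N =>
      if m.2.2.1 < a ∧ m.2.2.2.1 = k then H x m.1 m.2.1 m.2.2.2.2 else 0 :=
    hm.comp measurable_prodMk_left
  rw [lintegral_prod _ hmx.aemeasurable]
  refine lintegral_congr fun v => ?_
  have hmv : Measurable fun m : ℝ × ℝ × Fin p.Npa × Fin p.N =>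
      if m.2.1 < a ∧ m.2.2.1 = k then H x v m.1 m.2.2.2 else 0 :=
    hmx.comp measurable_prodMk_left
  rw [lintegral_prod _ hmv.aemeasurable]
  have hmf : ∀ f b, Measurable fun t : ℝ => if t < a then H x v f b else 0 := fun f b =>
    Measurable.ite measurableSet_Iio measurable_const measurable_const
  have hHf : ∀ b, Measurable fun f => H x v f b := fun b =>
    hH.comp (g := fun q : ℂ × ℝ × ℝ × Fin p.N => H q.1 q.2.1 q.2.2.1 q.2.2.2)
      (f := fun f : ℝ => (x, v, f, b)) (by fun_prop)
  have h1 : ∀ f, ∫⁻ m : ℝ × Fin p.Npa × Fin p.N,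
      (if m.1 < a ∧ m.2.1 = k then H x v f m.2.2 else 0)
        ∂(unifLaw.prod ((unifFin p.Npa).prod (unifFin p.N))) =
      ENNReal.ofReal (a / p.Npa) * (ENNReal.ofReal (1 / p.N) * ∑ b, H x v f b) := by
    intro f
    have hmm : Measurable fun m : ℝ × Fin p.Npa × Fin p.N =>
        if m.1 < a ∧ m.2.1 = k then H x v f m.2.2 else 0 := hmv.comp measurable_prodMk_left
    rw [lintegral_prod _ hmm.aemeasurable]
    have h2 : ∀ t : ℝ, ∫⁻ m : Fin p.Npa × Fin p.N,
        (if t < a ∧ m.1 = k then H x v f m.2 else 0) ∂((unifFin p.Npa).prod (unifFin p.N)) =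
        if t < a then
          ENNReal.ofReal (1 / p.Npa) * (ENNReal.ofReal (1 / p.N) * ∑ b, H x v f b) else 0 := by
      intro t
      rw [lintegral_prod _ (measurable_of_countable _).aemeasurable, lintegral_unifFin p.Npa_pos]
      simp_rw [lintegral_unifFin p.N_pos]
      by_cases ht : t < a
      · simp only [ht, true_and, if_true]
        congr 1
        rw [Finset.sum_eq_single k]
        · simp
        · intro i _ hi
          simp [hi]
        · intro hk
          exact absurd (Finset.mem_univ k) hk
      · simp [ht]
    simp only [h2]
    rw [lintegral_unifLaw_ite ha, mul_zero, add_zero, ← mul_assoc, ← ENNReal.ofReal_mul ha.1]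
    congr 2
    ring
  have h3 : ∀ f : ℝ, ∫⁻ m : ℝ × Fin p.Npa × Fin p.N,
      (if (f, m).2.1 < a ∧ (f, m).2.2.1 = k then H x v (f, m).1 (f, m).2.2.2 else 0)
        ∂(unifLaw.prod ((unifFin p.Npa).prod (unifFin p.N))) =
      ENNReal.ofReal (a / p.Npa) * (ENNReal.ofReal (1 / p.N) * ∑ b, H x v f b) := h1
  rw [lintegral_congr h3, lintegral_const_mul' _ _ ENNReal.ofReal_ne_top,
    lintegral_const_mul' _ _ ENNReal.ofReal_ne_top, lintegral_finsetSum _ fun b _ => hHf b]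

end Params

namespace Params

variable {p : Params}

lemma sum_ofReal_inv (c : ℝ≥0∞) : ENNReal.ofReal (1 / p.N) * ∑ _b : Fin p.N, c = c := by
  have hN : (0 : ℝ) < p.N := by exact_mod_cast p.N_pos
  rw [Finset.sum_const, Finset.card_univ, Fintype.card_fin, nsmul_eq_mul, ← mul_assoc,
    ← ENNReal.ofReal_natCast, ← ENNReal.ofReal_mul (by positivity), one_div,
    inv_mul_cancel₀ hN.ne', ENNReal.ofReal_one, one_mul]

/-- Relative gain of the users. -/
lemma raGain_div (x : ℂ) (y : p.User) :
    raGain x y / p.GN = if sectorIdx p.N (x - y.1) = raBeam x y then 1 else p.gN / p.GN := by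
  unfold raGain
  split_ifs
  · exact div_self p.GN_pos.ne'
  · rfl

lemma ite_eq_raTerm {z : ℝ} (hz : 0 < z) (a : ℝ) (x : ℂ) (k : Fin p.Npa) (y : p.User) :
    1 - eN (ENNReal.ofReal p.Gra * ENNReal.ofReal (z / (p.Mra * p.GN)) * raTerm a x k y) =
      if y.2.2.2.1 < a ∧ y.2.2.2.2.1 = k then
        (if sectorIdx p.Mra (y.1 - x) = sectorIdx p.Mra (-x) then
          1 - eN (ENNReal.ofReal (p.Gra * z * (raGain x (y.1, 0, 0, 0, k, y.2.2.2.2.2) / p.GN * y.2.2.1 /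
            p.linkLoss y.2.1 ‖y.1 - x‖))) else 0) else 0 := by
  have hG := p.Gra_pos
  have hc : (0 : ℝ) < p.Mra * p.GN := mul_pos (by exact_mod_cast p.Mra_pos) p.GN_pos
  by_cases h1 : y.2.2.2.1 < a ∧ y.2.2.2.2.1 = k
  · by_cases h2 : sectorIdx p.Mra (y.1 - x) = sectorIdx p.Mra (-x)
    · have hR : RaInt a x k y := ⟨h1.1, h1.2, h2⟩
      have hgain : raGain x y = raGain x (y.1, 0, 0, 0, k, y.2.2.2.2.2) := rfl
      rw [if_pos h1, if_pos h2, raTerm, if_pos hR, ← ENNReal.ofReal_mul hG.le,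
        ← ENNReal.ofReal_mul (by positivity), hgain]
      congr 3
      have hM : (p.Mra : ℝ) ≠ 0 := by exact_mod_cast p.Mra_pos.ne'
      field_simp
    · have hR : ¬ RaInt a x k y := fun h => h2 h.2.2
      rw [if_pos h1, if_neg h2, raTerm, if_neg hR, mul_zero, eN_zero, tsub_self]
  · have hR : ¬ RaInt a x k y := fun h => h1 ⟨h.1, h.2.1⟩
    rw [if_neg h1, raTerm, if_neg hR, mul_zero, eN_zero, tsub_self]

/-- Mean number of effective interferers, averaged over positions, blockage and beams. -/
lemma lintegral_raGain {z : ℝ} (hz : 0 < z) (x : ℂ) (k : Fin p.Npa) :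
    ∫⁻ x', ∫⁻ v, ENNReal.ofReal (1 / p.N) * ∑ b,
        (if sectorIdx p.Mra (x' - x) = sectorIdx p.Mra (-x) then
          expo z p.Gra (raGain x (x', 0, 0, 0, k, b) / p.GN) (p.linkLoss v ‖x' - x‖) else 0) ∂unifLaw =
      ENNReal.ofReal (2 * Real.pi / p.Mra) * (ENNReal.ofReal (1 / p.N) * p.rad (kern z p.Gra) +
        ENNReal.ofReal (1 - 1 / p.N) * p.rad (kern z (p.gN / p.GN * p.Gra))) := by
  have hN : (0 : ℝ) < p.N := by exact_mod_cast p.N_pos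
  have hN1 : (1 : ℝ) ≤ p.N := by exact_mod_cast p.N_pos
  have hG := p.Gra_pos
  have hr : 0 ≤ p.gN / p.GN := div_nonneg p.gN_nonneg p.GN_pos.le
  set φ₁ := expo z p.Gra 1
  set φ₂ := expo z p.Gra (p.gN / p.GN)
  have hφ₁ : Measurable φ₁ := measurable_expo _ _ _
  have hφ₂ : Measurable φ₂ := measurable_expo _ _ _
  have hr₁ : p.rad φ₁ = p.rad (kern z p.Gra) := by
    have := p.rad_expo hz hG.le zero_le_one
    rwa [one_mul] at this
  have hr₂ : p.rad φ₂ = p.rad (kern z (p.gN / p.GN * p.Gra)) := p.rad_expo hz hG.le hr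
  have hNN : ENNReal.ofReal (1 / p.N) * ENNReal.ofReal (p.N - 1) = ENNReal.ofReal (1 - 1 / p.N) := by
    rw [← ENNReal.ofReal_mul (by positivity)]
    congr 1
    field_simp
  by_cases hp : p.protocol = Protocol.omniRX
  · have hM : p.Mra = 1 := by simp [Mra, hp]
    have hb : ∀ y : p.User, raBeam x y = sectorIdx p.N x := by
      intro y; unfold raBeam; rw [hp]
    let φ : ℕ → ℝ → ℝ≥0∞ := fun s l => if s = sectorIdx p.N x then φ₁ l else φ₂ l
    have hφ : ∀ s, Measurable (φ s) := by
      intro s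
      by_cases hs : s = sectorIdx p.N x
      · simpa only [φ, hs, if_true] using hφ₁
      · simpa only [φ, hs, if_false] using hφ₂
    have h1 : ∀ x' : ℂ, ∀ v, ENNReal.ofReal (1 / p.N) * ∑ b,
        (if sectorIdx p.Mra (x' - x) = sectorIdx p.Mra (-x) then
          expo z p.Gra (raGain x (x', 0, 0, 0, k, b) / p.GN) (p.linkLoss v ‖x' - x‖) else 0) =
        φ (sectorIdx p.N (x - x')) (p.linkLoss v ‖x - x'‖) := by
      intro x' v
      have h2 : sectorIdx p.Mra (x' - x) = sectorIdx p.Mra (-x) := by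
        rw [hM, Nat.lt_one_iff.1 (sectorIdx_lt one_pos _), Nat.lt_one_iff.1 (sectorIdx_lt one_pos _)]
      simp_rw [raGain_div, hb, h2, if_true]
      rw [sum_ofReal_inv, norm_sub_rev]
      simp only [φ]
      split_ifs <;> rfl
    simp_rw [h1]
    rw [lintegral_sub_left_eq_self (fun w => ∫⁻ v, φ (sectorIdx p.N w) (p.linkLoss v ‖w‖) ∂unifLaw) x,
      p.lintegral_plane_linkLoss p.N_pos hφ, ← Finset.mul_sum,
      ← Finset.add_sum_erase _ _ (Finset.mem_range.2 (sectorIdx_lt p.N_pos x))]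
    have h3 : ∀ s ∈ (Finset.range p.N).erase (sectorIdx p.N x), p.rad (φ s) = p.rad φ₂ := by
      intro s hs
      have := Finset.ne_of_mem_erase hs
      simp only [φ, this, if_false]
    have h4 : p.rad (φ (sectorIdx p.N x)) = p.rad φ₁ := by
      simp only [φ, if_true]
    rw [Finset.sum_congr rfl h3, h4, Finset.sum_const, Finset.card_erase_of_mem
      (Finset.mem_range.2 (sectorIdx_lt p.N_pos x)), Finset.card_range, nsmul_eq_mul, hr₁, hr₂, hM,
      ← hNN]
    have e : ((p.N - 1 : ℕ) : ℝ≥0∞) = ENNReal.ofReal (p.N - 1) := by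
      have : (p.N : ℝ) - 1 = ((p.N - 1 : ℕ) : ℝ) := by
        rw [Nat.cast_sub p.N_pos, Nat.cast_one]
      rw [this, ENNReal.ofReal_natCast]
    have e2 : ENNReal.ofReal (2 * Real.pi / p.N) =
        ENNReal.ofReal (2 * Real.pi / (1 : ℕ)) * ENNReal.ofReal (1 / p.N) := by
      rw [← ENNReal.ofReal_mul (by positivity)]
      congr 1
      push_cast; ring
    rw [e, e2]
    ring
  · have hb : ∀ x' b, raBeam x ((x', 0, 0, 0, k, b) : p.User) = b := by
      intro x' b; unfold raBeam
      split
      · exact absurd ‹_› hp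
      · rfl
    let φ : ℝ → ℝ≥0∞ := fun l =>
      ENNReal.ofReal (1 / p.N) * φ₁ l + ENNReal.ofReal (1 - 1 / p.N) * φ₂ l
    have hφ : Measurable φ := (hφ₁.const_mul _).add (hφ₂.const_mul _)
    have h1 : ∀ x' : ℂ, ∀ v, ENNReal.ofReal (1 / p.N) * ∑ b,
        (if sectorIdx p.Mra (x' - x) = sectorIdx p.Mra (-x) then
          expo z p.Gra (raGain x (x', 0, 0, 0, k, b) / p.GN) (p.linkLoss v ‖x' - x‖) else 0) =
        if sectorIdx p.Mra (x' - x) = sectorIdx p.Mra (-x) then φ (p.linkLoss v ‖x' - x‖) else 0 := by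
      intro x' v
      split_ifs with h2
      · have h5 : ∀ b : Fin p.N, expo z p.Gra (raGain x (x', 0, 0, 0, k, b) / p.GN)
            (p.linkLoss v ‖x' - x‖) = if sectorIdx p.N (x - x') = (b : ℕ) then
              φ₁ (p.linkLoss v ‖x' - x‖) else φ₂ (p.linkLoss v ‖x' - x‖) := by
          intro b
          rw [raGain_div, hb]
          dsimp only
          split_ifs <;> rfl
        simp_rw [h5]
        rw [sum_fin_eq_ite (sectorIdx_lt p.N_pos _), mul_add, ← mul_assoc, hNN]
      · simp
    simp_rw [h1]
    rw [lintegral_sub_right_eq_self (fun w => ∫⁻ v, (if sectorIdx p.Mra w = sectorIdx p.Mra (-x)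
      then φ (p.linkLoss v ‖w‖) else 0) ∂unifLaw) x,
      p.lintegral_sector_linkLoss p.Mra_pos (sectorIdx_lt p.Mra_pos _) hφ,
      p.rad_add (hφ₁.const_mul _), p.rad_const_mul ENNReal.ofReal_ne_top,
      p.rad_const_mul ENNReal.ofReal_ne_top, hr₁, hr₂]

lemma lintegral_one_sub_eN_raTerm {z a : ℝ} (hz : 0 < z) (ha : a ∈ Set.Icc (0 : ℝ) 1) (x : ℂ)
    (k : Fin p.Npa) :
    ∫⁻ y, (1 - eN (ENNReal.ofReal p.Gra * ENNReal.ofReal (z / (p.Mra * p.GN)) * raTerm a x k y))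
        ∂(markedIntensity p.lamU p.userLaw) =
      ENNReal.ofReal (p.lamU * (a / p.Npa)) * (ENNReal.ofReal (2 * Real.pi / p.Mra) *
        (ENNReal.ofReal (1 / p.N) * p.rad (kern z p.Gra) +
        ENNReal.ofReal (1 - 1 / p.N) * p.rad (kern z (p.gN / p.GN * p.Gra)))) := by
  rw [← lintegral_raGain hz x k, lintegral_congr fun y => ite_eq_raTerm hz a x k y]
  have hm : Measurable fun q : ℂ × ℝ × ℝ × Fin p.N =>
      if sectorIdx p.Mra (q.1 - x) = sectorIdx p.Mra (-x) then
        1 - eN (ENNReal.ofReal (p.Gra * z * (raGain x ((q.1, 0, 0, 0, k, q.2.2.2) : p.User) / p.GN *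
          q.2.2.1 / p.linkLoss q.2.1 ‖q.1 - x‖))) else 0 := by
    have h1 : Measurable fun q : ℂ × ℝ × ℝ × Fin p.N => sectorIdx p.Mra (q.1 - x) :=
      (measurable_sectorIdx _).comp (by fun_prop)
    have h2 : Measurable fun q : ℂ × ℝ × ℝ × Fin p.N => p.linkLoss q.2.1 ‖q.1 - x‖ :=
      p.measurable_linkLoss_comp (by fun_prop) (by fun_prop)
    have h3 : Measurable fun q : ℂ × ℝ × ℝ × Fin p.N =>
        raGain x ((q.1, 0, 0, 0, k, q.2.2.2) : p.User) := by
      have h4 : Measurable fun q : ℂ × ℝ × ℝ × Fin p.N =>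
        (x, ((q.1, 0, 0, 0, k, q.2.2.2) : p.User)) := by fun_prop
      have h5 := measurable_raGain.comp h4
      exact h5
    have h4 : Measurable fun q : ℂ × ℝ × ℝ × Fin p.N => q.2.2.1 := by fun_prop
    exact Measurable.ite (h1 (measurableSet_singleton _)) (measurable_const.sub (measurable_eN.comp
      ((((h3.div_const _).mul h4).div h2).const_mul _).ennreal_ofReal)) measurable_const
  refine (lintegral_users ha k (H := fun x' v f b =>
    if sectorIdx p.Mra (x' - x) = sectorIdx p.Mra (-x) then
        1 - eN (ENNReal.ofReal (p.Gra * z * (raGain x ((x', 0, 0, 0, k, b) : p.User) / p.GN *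
          f / p.linkLoss v ‖x' - x‖))) else 0) hm).trans ?_
  congr 1
  refine lintegral_congr fun x' => lintegral_congr fun v => ?_
  congr 1
  refine Finset.sum_congr rfl fun b _ => ?_
  split_ifs
  · rfl
  · exact lintegral_zero

/-- Laplace functional of the interference of the users. -/
theorem lintegral_raTerm {Ω : Type*} [MeasurableSpace Ω] {μ : Measure Ω} [IsProbabilityMeasure μ]
    {X : ℕ → Ω → ℂ} {mark : ℕ → Ω → ℝ × ℝ × ℝ × Fin p.Npa × Fin p.N}
    (h : IsMarkedPoisson μ X mark p.lamU p.userLaw)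
    {z a : ℝ} (hz : 0 < z) (ha : a ∈ Set.Icc (0 : ℝ) 1) (x : ℂ) (k : Fin p.Npa) :
    ∫⁻ ω, eN (ENNReal.ofReal p.Gra * ENNReal.ofReal (z / (p.Mra * p.GN)) *
        ∑' i, raTerm a x k (X i ω, mark i ω)) ∂μ =
      ENNReal.ofReal (p.U z p.Gra (p.lamU * a / (p.N * p.Mra * p.Npa))) *
        ENNReal.ofReal (p.U z (p.gN / p.GN * p.Gra)
          ((1 - 1 / p.N) * (p.lamU * a / (p.Mra * p.Npa)))) := by
  have hN : (0 : ℝ) < p.N := by exact_mod_cast p.N_pos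
  have hN1 : (1 : ℝ) / p.N ≤ 1 := (div_le_one hN).2 (by exact_mod_cast p.N_pos)
  have hM : (0 : ℝ) < p.Mra := by exact_mod_cast p.Mra_pos
  have hNp : (0 : ℝ) < p.Npa := by exact_mod_cast p.Npa_pos
  have hG := p.Gra_pos
  have hlam := p.lamU_pos
  have ha0 := ha.1
  have hr : 0 ≤ p.gN / p.GN := div_nonneg p.gN_nonneg p.GN_pos.le
  have hmt : Measurable (raTerm a x k) := by
    have h4 : Measurable fun y : p.User => ((x, k), y) := by fun_prop
    have h5 := (measurable_raTerm a).comp h4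
    exact h5
  simp_rw [← ENNReal.tsum_mul_left]
  rw [h.lintegral_eN p.lamU_pos.le (g := fun y =>
    ENNReal.ofReal p.Gra * ENNReal.ofReal (z / (p.Mra * p.GN)) * raTerm a x k y)
    (hmt.const_mul _), lintegral_one_sub_eN_raTerm hz ha, p.ofReal_U hz hG.le,
    p.ofReal_U hz (by positivity), ← eN_add]
  congr 1
  have e1 : ENNReal.ofReal (2 * Real.pi * (p.lamU * a / (p.N * p.Mra * p.Npa))) =
      ENNReal.ofReal (p.lamU * (a / p.Npa)) * (ENNReal.ofReal (2 * Real.pi / p.Mra) *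
        ENNReal.ofReal (1 / p.N)) := by
    rw [← ENNReal.ofReal_mul (by positivity), ← ENNReal.ofReal_mul (by positivity)]
    congr 1; field_simp
  have e2 : ENNReal.ofReal (2 * Real.pi * ((1 - 1 / p.N) * (p.lamU * a / (p.Mra * p.Npa)))) =
      ENNReal.ofReal (p.lamU * (a / p.Npa)) * (ENNReal.ofReal (2 * Real.pi / p.Mra) *
        ENNReal.ofReal (1 - 1 / p.N)) := by
    rw [← ENNReal.ofReal_mul (by positivity), ← ENNReal.ofReal_mul (by positivity)]
    congr 1; field_simp
  rw [e1, e2]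
  ring

end Params

lemma unifFin_singleton {n : ℕ} (i : Fin n) : unifFin n {i} = ENNReal.ofReal (1 / n) := by
  rw [← lintegral_indicator_one (measurableSet_singleton i), lintegral_unifFin i.pos,
    Finset.sum_eq_single i]
  · simp
  · intro j _ hj
    exact Set.indicator_of_notMem (show j ∉ ({i} : Set (Fin n)) from hj) _
  · intro h
    exact absurd (Finset.mem_univ i) h

namespace Params

variable {p : Params}

/-- No contender collides with preamble `k` and receive beam `s`. -/
def NoCol (k : Fin p.Npa) (s : ℕ) (c : ℕ × (ℕ → Fin p.Npa × Fin p.Mra)) : Prop :=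
  ∀ i < c.1, ¬ ((c.2 i).1 = k ∧ ((c.2 i).2 : ℕ) = s)

lemma measurableSet_NoCol {α : Type*} [MeasurableSpace α] {k : α → Fin p.Npa} {s : α → ℕ}
    {c : α → ℕ × (ℕ → Fin p.Npa × Fin p.Mra)} (hk : Measurable k) (hs : Measurable s)
    (hc : Measurable c) : MeasurableSet {a | NoCol (k a) (s a) (c a)} := by
  have h : {a | NoCol (k a) (s a) (c a)} = ⋂ i : ℕ, ({a | i < (c a).1} ∩
      ({a | ((c a).2 i).1 = k a} ∩ {a | (((c a).2 i).2 : ℕ) = s a}))ᶜ := by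
    ext a
    simp only [NoCol, Set.mem_iInter, Set.mem_compl_iff, Set.mem_inter_iff, Set.mem_ofPred_eq,
      not_and]
  rw [h]
  have hi : ∀ i, Measurable fun a => (c a).2 i := fun i => (measurable_pi_apply i).comp hc.snd
  have hi2 : ∀ i, Measurable fun a => (((c a).2 i).2 : ℕ) := fun i =>
    (measurable_of_finite (fun i : Fin p.Mra => (i : ℕ))).comp (hi i).snd
  exact MeasurableSet.iInter fun i => ((measurableSet_lt measurable_const hc.fst).inter
    ((measurableSet_eq_fun (hi i).fst hk).inter (measurableSet_eq_fun (hi2 i) hs))).compl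

/-- Probability of no collision. -/
theorem lintegral_NoCol {Ω : Type*} [MeasurableSpace Ω] {μ : Measure Ω} [IsProbabilityMeasure μ]
    {n : Ω → ℕ} {mark : ℕ → Ω → Fin p.Npa × Fin p.Mra} {m : ℝ} (hm : 0 ≤ m) (hn : Measurable n)
    (hlaw : μ.map n = poissonLaw m) (hmark : IsIID μ mark ((unifFin p.Npa).prod (unifFin p.Mra)))
    (hind : IndepFun n (fun ω i => mark i ω) μ) (k : Fin p.Npa) {s : ℕ} (hs : s < p.Mra) :
    ∫⁻ ω, {c | NoCol k s c}.indicator (1 : ℕ × (ℕ → Fin p.Npa × Fin p.Mra) → ℝ≥0∞) (n ω, fun i => mark i ω) ∂μ =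
      ENNReal.ofReal (Real.exp (-(m * (1 / (p.Npa * p.Mra))))) := by
  classical
  have hN : (1 : ℝ) ≤ p.Npa := by exact_mod_cast p.Npa_pos
  have hM : (1 : ℝ) ≤ p.Mra := by exact_mod_cast p.Mra_pos
  let F : Fin p.Npa × Fin p.Mra → ℝ≥0∞ := ({(k, ⟨s, hs⟩)} : Set (Fin p.Npa × Fin p.Mra))ᶜ.indicator 1
  have hF : Measurable F := measurable_of_countable _
  have h1 : ∀ ω, {c | NoCol k s c}.indicator (1 : ℕ × (ℕ → Fin p.Npa × Fin p.Mra) → ℝ≥0∞) (n ω, fun i => mark i ω) =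
      ∏ i ∈ Finset.range (n ω), F (mark i ω) := by
    intro ω
    by_cases h : NoCol k s (n ω, fun i => mark i ω)
    · rw [Set.indicator_of_mem (show _ ∈ {c | NoCol k s c} from h), Finset.prod_eq_one]
      · rfl
      · intro i hi
        have hmem : mark i ω ∈ ({(k, ⟨s, hs⟩)} : Set (Fin p.Npa × Fin p.Mra))ᶜ := by
          intro he
          have he' : mark i ω = (k, ⟨s, hs⟩) := he
          refine h i (Finset.mem_range.1 hi) ⟨?_, ?_⟩
          · change (mark i ω).1 = k
            rw [he']
          · change ((mark i ω).2 : ℕ) = s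
            rw [he']
        exact Set.indicator_of_mem hmem _
    · rw [Set.indicator_of_notMem (show _ ∉ {c | NoCol k s c} from h)]
      unfold NoCol at h
      push Not at h
      obtain ⟨i, hi, h2, h3⟩ := h
      rw [Finset.prod_eq_zero (Finset.mem_range.2 hi)]
      have hmem : mark i ω ∉ ({(k, ⟨s, hs⟩)} : Set (Fin p.Npa × Fin p.Mra))ᶜ :=
        fun hne => hne (Prod.ext h2 (Fin.ext h3))
      exact Set.indicator_of_notMem hmem _
  rw [lintegral_congr h1]
  have hG : Measurable (Function.uncurry fun (j : ℕ) (v : ℕ → Fin p.Npa × Fin p.Mra) =>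
      ∏ i ∈ Finset.range j, F (v i)) :=
    measurable_from_prod_countable_right fun j => by
      have h := Finset.measurable_prod (Finset.range j)
        (f := fun i (v : ℕ → Fin p.Npa × Fin p.Mra) => F (v i))
        fun i _ => hF.comp (measurable_pi_apply i)
      exact h
  have h2 := lintegral_indepFun hind hn (measurable_pi_lambda _ hmark.measurable) hG
  refine h2.trans ?_
  have hq : ∀ i, ∫⁻ ω, F (mark i ω) ∂μ = ENNReal.ofReal (1 - 1 / (p.Npa * p.Mra)) := by
    intro i
    rw [← lintegral_map hF (hmark.measurable i), hmark.law,
      lintegral_indicator_one (measurableSet_singleton _).compl,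
      prob_compl_eq_one_sub (measurableSet_singleton _), ← Set.singleton_prod_singleton,
      Measure.prod_prod, unifFin_singleton, unifFin_singleton, ← ENNReal.ofReal_mul (by positivity),
      ← ENNReal.ofReal_one, ← ENNReal.ofReal_sub _ (by positivity)]
    congr 2
    field_simp
  have h3 : ∀ j : ℕ, ∫⁻ ω, ∏ i ∈ Finset.range j, F (mark i ω) ∂μ =
      ENNReal.ofReal (1 - 1 / (p.Npa * p.Mra)) ^ j := by
    intro j
    rw [lintegral_prod_eq_prod_lintegral_of_indepFun (Finset.range j) (fun i ω => F (mark i ω))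
      (hmark.indep.comp _ fun i => hF) fun i => hF.comp (hmark.measurable i)]
    simp_rw [hq]
    simp
  simp_rw [h3]
  rw [← lintegral_map (f := fun j : ℕ => ENNReal.ofReal (1 - 1 / (p.Npa * p.Mra)) ^ j)
    measurable_from_top hn, hlaw, lintegral_pow_poissonLaw hm]
  · congr 2
    ring
  · rw [sub_nonneg, div_le_one (by positivity)]
    nlinarith

variable (p) in
/-- An interfering base station of the data phase. -/
abbrev DlBS : Type := ℂ × ℝ × ℝ × Fin p.M

variable (p) in
/-- The law of the marks of the interfering base stations of the data phase. -/
abbrev dlLaw : Measure (ℝ × ℝ × Fin p.M) := unifLaw.prod ((expMeasure 1).prod (unifFin p.M))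

/-- The base station `y` interferes, if `D` are the detected sectors and the useful path loss is
`z`. -/
def DlInt (D : ℕ → Prop) (z : ℝ) (y : p.DlBS) : Prop :=
  (y.2.2.2 : ℕ) = sectorIdx p.M (-y.1) ∧
    (D (sectorIdx p.Kcs y.1) → z < p.linkLoss y.2.1 ‖y.1‖)

open Classical in
/-- Power received from the base station `y`. -/
def dlTerm (D : ℕ → Prop) (z : ℝ) (s : ℕ) (y : p.DlBS) : ℝ≥0∞ :=
  if DlInt D z y then ENNReal.ofReal (p.Pb * p.M * (if sectorIdx p.N y.1 = s then p.GN else p.gN) *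
    y.2.2.1 / p.linkLoss y.2.1 ‖y.1‖) else 0

lemma measurable_dlTerm {α : Type*} [MeasurableSpace α] {D : α → ℕ → Prop}
    (hD : ∀ k, MeasurableSet {a | D a k}) {z : α → ℝ} (hz : Measurable z) {s : α → ℕ}
    (hs : Measurable s) {y : α → p.DlBS} (hy : Measurable y) :
    Measurable fun a => dlTerm (D a) (z a) (s a) (y a) := by
  have hy1 : Measurable fun a => (y a).1 := hy.fst
  have h1 : Measurable fun a => p.linkLoss (y a).2.1 ‖(y a).1‖ :=
    p.measurable_linkLoss_comp hy.snd.fst hy1.norm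
  have h2 : Measurable fun a => sectorIdx p.N (y a).1 := (measurable_sectorIdx _).comp hy1
  have h3 : Measurable fun a => sectorIdx p.Kcs (y a).1 := (measurable_sectorIdx _).comp hy1
  have h4 : Measurable fun a => sectorIdx p.M (-(y a).1) := (measurable_sectorIdx _).comp hy1.neg
  have h5 : Measurable fun a => ((y a).2.2.2 : ℕ) :=
    (measurable_of_finite (fun i : Fin p.M => (i : ℕ))).comp hy.snd.snd.snd
  have hDs : MeasurableSet {a | D a (sectorIdx p.Kcs (y a).1)} := by
    have e : {a | D a (sectorIdx p.Kcs (y a).1)} =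
        ⋃ k : ℕ, ({a | sectorIdx p.Kcs (y a).1 = k} ∩ {a | D a k}) := by
      ext a
      simp
    rw [e]
    exact MeasurableSet.iUnion fun k => (h3 (measurableSet_singleton k)).inter (hD k)
  have hI : MeasurableSet {a | DlInt (D a) (z a) (y a)} := by
    have e : {a | DlInt (D a) (z a) (y a)} = {a | ((y a).2.2.2 : ℕ) = sectorIdx p.M (-(y a).1)} ∩
        ({a | D a (sectorIdx p.Kcs (y a).1)}ᶜ ∪ {a | z a < p.linkLoss (y a).2.1 ‖(y a).1‖}) := by
      ext a
      simp only [DlInt, Set.mem_inter_iff, Set.mem_ofPred_eq, Set.mem_union, Set.mem_compl_iff,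
        imp_iff_not_or]
    rw [e]
    exact (measurableSet_eq_fun h5 h4).inter (hDs.compl.union (measurableSet_lt hz h1))
  have hg : Measurable fun a => if sectorIdx p.N (y a).1 = s a then p.GN else p.gN :=
    Measurable.ite (measurableSet_eq_fun h2 hs) measurable_const measurable_const
  unfold dlTerm
  exact Measurable.ite hI (((hg.const_mul _).mul hy.snd.snd.fst).div h1).ennreal_ofReal
    measurable_const

/-- The threshold relative to the gain of the sector `k`, when `s` is the user beam in use. -/
def relT (Γ : ℝ) (s k : ℕ) : ℝ := if k / p.q = s then Γ else p.gN / p.GN * Γ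

lemma relT_nonneg {Γ : ℝ} (hΓ : 0 ≤ Γ) (s k : ℕ) : 0 ≤ p.relT Γ s k := by
  unfold relT
  split_ifs
  · exact hΓ
  · exact mul_nonneg (div_nonneg p.gN_nonneg p.GN_pos.le) hΓ

lemma one_sub_eN_dlTerm {Γ z : ℝ} (hΓ : 0 ≤ Γ) (hz : 0 < z) (D : ℕ → Prop) (s : ℕ)
    (y : p.DlBS) [Decidable (D (sectorIdx p.Kcs y.1) → z < p.linkLoss y.2.1 ‖y.1‖)] :
    1 - eN (ENNReal.ofReal Γ * ENNReal.ofReal (z / (p.Pb * p.M * p.GN)) * dlTerm D z s y) =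
      if sectorIdx p.M (-y.1) = (y.2.2.2 : ℕ) then
        (if D (sectorIdx p.Kcs y.1) → z < p.linkLoss y.2.1 ‖y.1‖ then
          1 - eN (ENNReal.ofReal (Γ * z * ((if sectorIdx p.N y.1 = s then 1 else p.gN / p.GN) *
            y.2.2.1 / p.linkLoss y.2.1 ‖y.1‖))) else 0) else 0 := by
  have hM : (0 : ℝ) < p.M := by exact_mod_cast p.M_pos
  have hP := p.Pb_pos
  have hG := p.GN_pos
  by_cases h1 : sectorIdx p.M (-y.1) = (y.2.2.2 : ℕ)
  · by_cases h2 : D (sectorIdx p.Kcs y.1) → z < p.linkLoss y.2.1 ‖y.1‖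
    · have hI : DlInt D z y := ⟨h1.symm, h2⟩
      have e : (if sectorIdx p.N y.1 = s then p.GN else p.gN) =
          p.GN * (if sectorIdx p.N y.1 = s then 1 else p.gN / p.GN) := by
        split_ifs
        · rw [mul_one]
        · rw [mul_div_cancel₀ _ hG.ne']
      rw [if_pos h1, if_pos h2, dlTerm, if_pos hI, e, ← ENNReal.ofReal_mul hΓ,
        ← ENNReal.ofReal_mul (by positivity)]
      congr 3
      field_simp
    · have hI : ¬ DlInt D z y := fun h => h2 h.2
      rw [if_pos h1, if_neg h2, dlTerm, if_neg hI, mul_zero, eN_zero, tsub_self]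
  · have hI : ¬ DlInt D z y := fun h => h1 h.1.symm
    rw [if_neg h1, dlTerm, if_neg hI, mul_zero, eN_zero, tsub_self]

open Classical in
lemma lintegral_one_sub_eN_dlTerm {Γ z : ℝ} (hΓ : 0 ≤ Γ) (hz : 0 < z) (D : ℕ → Prop) (s : ℕ) :
    ∫⁻ y, (1 - eN (ENNReal.ofReal Γ * ENNReal.ofReal (z / (p.Pb * p.M * p.GN)) * dlTerm D z s y))
        ∂(markedIntensity p.lam p.dlLaw) =
      ∑ k ∈ Finset.range p.Kcs, ENNReal.ofReal (2 * Real.pi * (p.lam / (p.M * p.Kcs))) *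
        p.rad (fun l => if D k → z < l then kern z (p.relT Γ s k) l else 0) := by
  have hM : (0 : ℝ) < p.M := by exact_mod_cast p.M_pos
  have hK : (0 : ℝ) < p.Kcs := by exact_mod_cast p.Kcs_pos
  have hlam := p.lam_pos
  have hr : 0 ≤ p.gN / p.GN := div_nonneg p.gN_nonneg p.GN_pos.le
  let c : ℕ → ℝ := fun k => if k / p.q = s then 1 else p.gN / p.GN
  have hc : ∀ k, 0 ≤ c k := by
    intro k
    simp only [c]
    split_ifs
    · exact zero_le_one
    · exact hr
  have hcT : ∀ k, c k * Γ = p.relT Γ s k := by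
    intro k
    simp only [c, relT]
    split_ifs
    · rw [one_mul]
    · rfl
  have hcN : ∀ x : ℂ, (if sectorIdx p.N x = s then 1 else p.gN / p.GN) = c (sectorIdx p.Kcs x) := by
    intro x
    rw [sectorIdx_div p.Kcs_pos p.N_pos p.N_dvd_Kcs x]
    rfl
  let φ : ℕ → ℝ → ℝ≥0∞ := fun k l => if D k → z < l then expo z Γ (c k) l else 0
  have hφ : ∀ k, Measurable (φ k) := by
    intro k
    have hs : MeasurableSet {l : ℝ | D k → z < l} := by
      by_cases hDk : D k
      · simp only [hDk, true_imp_iff]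
        exact measurableSet_Ioi
      · simp only [hDk, false_imp_iff]
        exact MeasurableSet.univ
    exact Measurable.ite hs (measurable_expo _ _ _) measurable_const
  have hm : Measurable fun y : p.DlBS =>
      1 - eN (ENNReal.ofReal Γ * ENNReal.ofReal (z / (p.Pb * p.M * p.GN)) * dlTerm D z s y) := by
    have h1 : Measurable fun y : p.DlBS => dlTerm D z s y :=
      measurable_dlTerm (D := fun _ => D) (z := fun _ => z) (s := fun _ => s) (y := fun y => y)
      (fun k => MeasurableSet.const _) measurable_const measurable_const measurable_id
    exact measurable_const.sub (measurable_eN.comp (h1.const_mul _))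
  rw [lintegral_markedIntensity _ _ hm]
  have h1 : ∀ x : ℂ, ∫⁻ m, (1 - eN (ENNReal.ofReal Γ * ENNReal.ofReal (z / (p.Pb * p.M * p.GN)) *
      dlTerm D z s (x, m))) ∂p.dlLaw = ENNReal.ofReal (1 / p.M) *
        ∫⁻ v, φ (sectorIdx p.Kcs x) (p.linkLoss v ‖x‖) ∂unifLaw := by
    intro x
    have hmx : Measurable fun m : ℝ × ℝ × Fin p.M => 1 - eN (ENNReal.ofReal Γ *
      ENNReal.ofReal (z / (p.Pb * p.M * p.GN)) * dlTerm D z s (x, m)) := hm.comp measurable_prodMk_left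
    rw [lintegral_prod _ hmx.aemeasurable, ← lintegral_const_mul' _ _ ENNReal.ofReal_ne_top]
    refine lintegral_congr fun v => ?_
    have hmv : Measurable fun m : ℝ × Fin p.M => 1 - eN (ENNReal.ofReal Γ *
      ENNReal.ofReal (z / (p.Pb * p.M * p.GN)) * dlTerm D z s (x, v, m)) :=
      hmx.comp measurable_prodMk_left
    rw [lintegral_prod _ hmv.aemeasurable]
    have h2 : ∀ f : ℝ, ∫⁻ b : Fin p.M, (1 - eN (ENNReal.ofReal Γ *
        ENNReal.ofReal (z / (p.Pb * p.M * p.GN)) * dlTerm D z s (x, v, f, b))) ∂(unifFin p.M) =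
        ENNReal.ofReal (1 / p.M) * (if D (sectorIdx p.Kcs x) → z < p.linkLoss v ‖x‖ then
          1 - eN (ENNReal.ofReal (Γ * z * (c (sectorIdx p.Kcs x) * f / p.linkLoss v ‖x‖))) else 0) := by
      intro f
      rw [lintegral_unifFin p.M_pos]
      have h4 : ∀ b : Fin p.M, 1 - eN (ENNReal.ofReal Γ *
          ENNReal.ofReal (z / (p.Pb * p.M * p.GN)) * dlTerm D z s (x, v, f, b)) =
          if sectorIdx p.M (-x) = (b : ℕ) then
            (if D (sectorIdx p.Kcs x) → z < p.linkLoss v ‖x‖ then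
              1 - eN (ENNReal.ofReal (Γ * z * (c (sectorIdx p.Kcs x) * f / p.linkLoss v ‖x‖)))
              else 0) else 0 := by
        intro b
        rw [← hcN]
        exact one_sub_eN_dlTerm hΓ hz D s (x, v, f, b)
      rw [Finset.sum_congr rfl fun b _ => h4 b, sum_fin_eq_ite (sectorIdx_lt p.M_pos _), mul_zero,
        add_zero]
    rw [lintegral_congr h2, lintegral_const_mul' _ _ ENNReal.ofReal_ne_top]
    congr 1
    by_cases h3 : D (sectorIdx p.Kcs x) → z < p.linkLoss v ‖x‖
    · simp only [φ, if_pos h3]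
      rfl
    · simp only [φ, if_neg h3, lintegral_zero]
  rw [lintegral_congr h1, lintegral_const_mul' _ _ ENNReal.ofReal_ne_top,
    p.lintegral_plane_linkLoss p.Kcs_pos hφ, Finset.mul_sum, Finset.mul_sum]
  refine Finset.sum_congr rfl fun k _ => ?_
  rw [← mul_assoc, ← mul_assoc, ← ENNReal.ofReal_mul hlam.le, ← ENNReal.ofReal_mul (by positivity)]
  congr 1
  · congr 1
    field_simp
  · refine p.rad_congr fun l hl => ?_
    simp only [φ]
    rw [expo_eq_kern hz hΓ (hc k) hl, hcT]

open Classical in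
/-- Laplace functional of the interference in the data phase. -/
theorem lintegral_dlTerm {Ω : Type*} [MeasurableSpace Ω] {μ : Measure Ω} [IsProbabilityMeasure μ]
    {X : ℕ → Ω → ℂ} {mark : ℕ → Ω → ℝ × ℝ × Fin p.M} (h : IsMarkedPoisson μ X mark p.lam p.dlLaw)
    {Γ z : ℝ} (hΓ : 0 ≤ Γ) (hz : 0 < z) (D : ℕ → Prop) (s : ℕ) :
    ∫⁻ ω, eN (ENNReal.ofReal Γ * ENNReal.ofReal (z / (p.Pb * p.M * p.GN)) *
        ∑' i, dlTerm D z s (X i ω, mark i ω)) ∂μ =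
      ∏ k ∈ Finset.range p.Kcs, if D k
        then ENNReal.ofReal (p.V z (p.relT Γ s k) (p.lam / (p.M * p.Kcs)))
        else ENNReal.ofReal (p.U z (p.relT Γ s k) (p.lam / (p.M * p.Kcs))) := by
  have hmt : Measurable fun y : p.DlBS => dlTerm D z s y :=
    measurable_dlTerm (D := fun _ => D) (z := fun _ => z) (s := fun _ => s) (y := fun y => y)
      (fun k => MeasurableSet.const _) measurable_const measurable_const measurable_id
  simp_rw [← ENNReal.tsum_mul_left]
  rw [h.lintegral_eN p.lam_pos.le (g := fun y =>
    ENNReal.ofReal Γ * ENNReal.ofReal (z / (p.Pb * p.M * p.GN)) * dlTerm D z s y)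
    (hmt.const_mul _), lintegral_one_sub_eN_dlTerm hΓ hz, eN_sum]
  refine Finset.prod_congr rfl fun k _ => ?_
  by_cases hk : D k
  · simp only [hk, true_imp_iff, if_true, p.ofReal_V hz (relT_nonneg hΓ s k)]
  · simp only [hk, false_imp_iff, if_true, if_false, p.ofReal_U hz (relT_nonneg hΓ s k)]

end Params

namespace Params

variable (p : Params)

/-- Base station `i` is detected and has the smallest path loss among the detected ones. -/
def Best (b : ℕ → ℂ × ℝ × ℝ) (i : ℕ) : Prop :=
  p.Det b i ∧ ∀ k, p.Det b k → p.loss (b i) ≤ p.loss (b k)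

/-- Index of the tagged base station. -/
def tag (b : ℕ → ℂ × ℝ × ℝ) : ℕ := sInf {i | p.Best b i}

/-- Position of the tagged base station. -/
def tagPos (b : ℕ → ℂ × ℝ × ℝ) : ℂ := (b (p.tag b)).1

/-- Path loss of the tagged base station. -/
def tagLoss (b : ℕ → ℂ × ℝ × ℝ) : ℝ := p.loss (b (p.tag b))

/-- Sector `s` is detected. -/
def SecDet (b : ℕ → ℂ × ℝ × ℝ) (s : ℕ) : Prop := ∃ i, p.sec (b i) = s ∧ p.Det b i

/-- Cell search is successful. -/
def csSet : Set (ℕ → ℂ × ℝ × ℝ) := {b | ∃ i, p.Det b i}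

lemma measurableSet_csSet : MeasurableSet p.csSet := by
  have e : p.csSet = ⋃ i, {b | p.Det b i} := by ext b; simp [csSet]
  rw [e]
  exact MeasurableSet.iUnion p.measurableSet_Det

lemma measurable_seq (i : ℕ) : Measurable fun b : ℕ → ℂ × ℝ × ℝ => b i := measurable_pi_apply i

lemma measurableSet_SecDet (s : ℕ) : MeasurableSet {b | p.SecDet b s} := by
  have e : {b | p.SecDet b s} =
      ⋃ i, ((fun b : ℕ → ℂ × ℝ × ℝ => p.sec (b i)) ⁻¹' {s} ∩ {b | p.Det b i}) := by
    ext b; simp [SecDet]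
  rw [e]
  exact MeasurableSet.iUnion fun i => ((p.measurable_sec.comp (measurable_seq i))
    (measurableSet_singleton s)).inter (p.measurableSet_Det i)

lemma measurableSet_Best (i : ℕ) : MeasurableSet {b | p.Best b i} := by
  have e : {b | p.Best b i} = {b | p.Det b i} ∩ ⋂ k : ℕ, ({b | p.Det b k}ᶜ ∪
      {b | p.loss (b i) ≤ p.loss (b k)}) := by
    ext b
    simp only [Best, Set.mem_ofPred_eq, Set.mem_inter_iff, Set.mem_iInter, Set.mem_union,
      Set.mem_compl_iff, imp_iff_not_or]
  have hl : ∀ i, Measurable fun b : ℕ → ℂ × ℝ × ℝ => p.loss (b i) := fun i =>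
    p.measurable_loss.comp (measurable_seq i)
  rw [e]
  exact (p.measurableSet_Det i).inter (MeasurableSet.iInter fun k =>
    (p.measurableSet_Det k).compl.union (measurableSet_le (hl i) (hl k)))

lemma tag_eq_iff (b : ℕ → ℂ × ℝ × ℝ) (n : ℕ) : p.tag b = n ↔
    (p.Best b n ∧ ∀ m < n, ¬ p.Best b m) ∨ (n = 0 ∧ ∀ m, ¬ p.Best b m) := by
  by_cases h : {i | p.Best b i}.Nonempty
  · constructor
    · rintro rfl
      exact Or.inl ⟨Nat.sInf_mem h, fun m hm => Nat.notMem_of_lt_sInf hm⟩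
    · rintro (⟨h1, h2⟩ | ⟨-, h2⟩)
      · refine le_antisymm (Nat.sInf_le h1) ?_
        by_contra hlt
        exact h2 _ (not_le.1 hlt) (Nat.sInf_mem h)
      · obtain ⟨i, hi⟩ := h
        exact absurd hi (h2 i)
  · have h0 : p.tag b = 0 := by
      rw [tag, Set.not_nonempty_iff_eq_empty.1 h, Nat.sInf_empty]
    have h1 : ∀ m, ¬ p.Best b m := fun m hm => h ⟨m, hm⟩
    rw [h0]
    constructor
    · rintro rfl
      exact Or.inr ⟨rfl, h1⟩
    · rintro (⟨h2, -⟩ | ⟨h2, -⟩)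
      · exact absurd h2 (h1 _)
      · exact h2.symm

lemma measurable_tag : Measurable p.tag := by
  refine measurable_to_countable' fun n => ?_
  have e : p.tag ⁻¹' {n} = ({b | p.Best b n} ∩ ⋂ m : ℕ, ⋂ _ : m < n, {b | p.Best b m}ᶜ) ∪
      (if n = 0 then ⋂ m : ℕ, {b | p.Best b m}ᶜ else ∅) := by
    ext b
    have h := p.tag_eq_iff b n
    by_cases hn : n = 0
    · simp only [hn, true_and] at h
      simp only [Set.mem_preimage, Set.mem_singleton_iff, hn, if_true, Set.mem_union,
        Set.mem_inter_iff, Set.mem_iInter, Set.mem_compl_iff, Set.mem_ofPred_eq]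
      exact h
    · simp only [hn, false_and, or_false] at h
      simp only [Set.mem_preimage, Set.mem_singleton_iff, hn, if_false, Set.union_empty,
        Set.mem_inter_iff, Set.mem_iInter, Set.mem_compl_iff, Set.mem_ofPred_eq]
      exact h
  rw [e]
  refine ((p.measurableSet_Best n).inter (MeasurableSet.iInter fun m => MeasurableSet.iInter fun _ =>
    (p.measurableSet_Best m).compl)).union ?_
  split_ifs
  · exact MeasurableSet.iInter fun m => (p.measurableSet_Best m).compl
  · exact MeasurableSet.empty

lemma measurable_tagged : Measurable fun b : ℕ → ℂ × ℝ × ℝ => b (p.tag b) := by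
  have h1 : Measurable fun q : ℕ × (ℕ → ℂ × ℝ × ℝ) => q.2 q.1 :=
    measurable_from_prod_countable_right fun n => measurable_seq n
  exact h1.comp (p.measurable_tag.prodMk measurable_id)

@[fun_prop] lemma measurable_tagPos : Measurable p.tagPos := measurable_fst.comp p.measurable_tagged

@[fun_prop] lemma measurable_tagLoss : Measurable p.tagLoss :=
  p.measurable_loss.comp p.measurable_tagged

variable {p} {b : ℕ → ℂ × ℝ × ℝ}

lemma Generic.exists_best (hb : p.Generic b) (h : b ∈ p.csSet) : ∃ i, p.Best b i := by
  obtain ⟨j, hj⟩ := h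
  have hfin : {i | p.Det b i ∧ p.loss (b i) ≤ p.loss (b j)}.Finite :=
    (hb.finite (p.loss (b j))).subset fun i hi => hi.2
  obtain ⟨i, hi, hmin⟩ := hfin.exists_minimalFor (fun i => p.loss (b i)) _ ⟨j, hj, le_rfl⟩
  refine ⟨i, hi.1, fun k hk => ?_⟩
  by_contra hlt
  push Not at hlt
  exact absurd (hmin ⟨hk, hlt.le.trans hi.2⟩ hlt.le) (not_le.2 hlt)

lemma Generic.best_tag (hb : p.Generic b) (h : b ∈ p.csSet) : p.Best b (p.tag b) :=
  Nat.sInf_mem (s := {i | p.Best b i}) (hb.exists_best h)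

/-- The sector of the tagged base station. -/
def tagSec (p : Params) (b : ℕ → ℂ × ℝ × ℝ) : ℕ := p.sec (b (p.tag b))

lemma tagSec_lt : p.tagSec b < p.Kcs := p.sec_lt _

lemma Generic.W0_tagSec (hb : p.Generic b) (h : b ∈ p.csSet) : p.W0 (p.tagSec b) b = p.tagLoss b :=
  hb.W0_of_Det (hb.best_tag h).1

lemma Generic.tagLoss_pos (hb : p.Generic b) : 0 < p.tagLoss b := hb.pos _

lemma Generic.secDet_iff (hb : p.Generic b) (s : ℕ) : p.SecDet b s ↔ 0 < p.W0 s b :=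
  (hb.W0_pos_iff s).symm

lemma Generic.tagLoss_lt (hb : p.Generic b) (h : b ∈ p.csSet) {s : ℕ} (hs : s ≠ p.tagSec b)
    (hW : 0 < p.W0 s b) : p.tagLoss b < p.W0 s b := by
  obtain ⟨i, rfl, hi⟩ := (hb.W0_pos_iff s).1 hW
  rw [hb.W0_of_Det hi]
  refine lt_of_le_of_ne ((hb.best_tag h).2 i hi) fun he => hs ?_
  have := hb.injective he
  rw [tagSec, this]

lemma Generic.mem_csSet_iff (hb : p.Generic b) :
    b ∈ p.csSet ↔ ∃ s ∈ Finset.range p.Kcs, 0 < p.W0 s b := by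
  constructor
  · rintro ⟨i, hi⟩
    exact ⟨p.sec (b i), Finset.mem_range.2 (p.sec_lt _), by rw [hb.W0_of_Det hi]; exact hb.pos i⟩
  · rintro ⟨s, -, hs⟩
    obtain ⟨i, -, hi⟩ := (hb.W0_pos_iff s).1 hs
    exact ⟨i, hi⟩

lemma Generic.sectorIdx_tagPos (_ : p.Generic b) : sectorIdx p.N (p.tagPos b) = p.tagSec b / p.q :=
  sectorIdx_div p.Kcs_pos p.N_pos p.N_dvd_Kcs _

/-- A functional of the tagged base station and the detected sectors, decomposed according to the
sector of the tagged base station. -/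
lemma Generic.sum_sectors (hb : p.Generic b) (u v : ℕ → ℕ → ℝ → ℝ≥0∞) (B : ℕ → ℝ → ℝ≥0∞)
    [∀ k, Decidable (p.SecDet b k)] [Decidable (b ∈ p.csSet)] :
    ∑ j ∈ Finset.range p.Kcs, (Set.Ioi 0).indicator (fun z => B j z * v j j z) (p.W0 j b) *
        ∏ k ∈ (Finset.range p.Kcs).erase j,
          ((if p.W0 k b = 0 then u j k (p.W0 j b) else 0) +
            (if p.W0 j b < p.W0 k b then v j k (p.W0 j b) else 0)) =
      if b ∈ p.csSet then B (p.tagSec b) (p.tagLoss b) * ∏ k ∈ Finset.range p.Kcs,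
        (if p.SecDet b k then v (p.tagSec b) k (p.tagLoss b) else u (p.tagSec b) k (p.tagLoss b))
      else 0 := by
  by_cases h : b ∈ p.csSet
  · have hj0 : p.tagSec b ∈ Finset.range p.Kcs := Finset.mem_range.2 tagSec_lt
    have hW := hb.W0_tagSec h
    have hpos := hb.tagLoss_pos
    rw [if_pos h, Finset.sum_eq_single (p.tagSec b)]
    · rw [hW, Set.indicator_of_mem (show p.tagLoss b ∈ Set.Ioi 0 from hpos),
        ← Finset.mul_prod_erase _ _ hj0, if_pos ((hb.secDet_iff _).2 (hW ▸ hpos)), mul_assoc]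
      congr 2
      refine Finset.prod_congr rfl fun k hk => ?_
      by_cases hk0 : p.W0 k b = 0
      · have h1 : ¬ p.SecDet b k := fun h2 => absurd hk0 ((hb.secDet_iff k).1 h2).ne'
        have h2 : ¬ p.tagLoss b < p.W0 k b := by rw [hk0]; exact not_lt.2 hpos.le
        rw [if_pos hk0, if_neg h1, if_neg h2, add_zero]
      · have h1 : 0 < p.W0 k b := lt_of_le_of_ne (W0_nonneg k b) (Ne.symm hk0)
        rw [if_neg hk0, if_pos ((hb.secDet_iff k).2 h1),
          if_pos (hb.tagLoss_lt h (Finset.ne_of_mem_erase hk) h1), zero_add]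
    · intro j _ hj
      by_cases hjpos : 0 < p.W0 j b
      · have h1 : p.tagSec b ∈ (Finset.range p.Kcs).erase j := Finset.mem_erase.2 ⟨hj.symm, hj0⟩
        rw [Finset.prod_eq_zero h1, mul_zero]
        have h2 := hb.tagLoss_lt h hj hjpos
        rw [hW, if_neg hpos.ne', if_neg (not_lt.2 h2.le), add_zero]
      · rw [Set.indicator_of_notMem (show p.W0 j b ∉ Set.Ioi 0 from hjpos), zero_mul]
    · intro hn
      exact absurd hj0 hn
  · rw [if_neg h]
    refine Finset.sum_eq_zero fun j hj => ?_
    have : ¬ 0 < p.W0 j b := fun hpos => h (hb.mem_csSet_iff.2 ⟨j, hj, hpos⟩)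
    rw [Set.indicator_of_notMem (show p.W0 j b ∉ Set.Ioi 0 from this), zero_mul]

end Params

section CellSearch

variable {p : Params} {Ω : Type*} [MeasurableSpace Ω] {μ : Measure Ω} [IsProbabilityMeasure μ]

/-- Success probability of cell search. -/
theorem csSuccessProb_eq {S : Network p Ω}
    (h : IsMarkedPoisson μ S.bsPos (fun i ω => (S.bsLos i ω, S.bsFading i ω)) p.lam
      (unifLaw.prod (expMeasure 1))) : S.csSuccessProb μ = p.Phat := by
  have hgen := ae_generic p h
  have hPle := Pdet_le_one p h
  have hP0 : 0 ≤ p.Pdet := p.Pbeyond_nonneg le_rfl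
  have hind := iIndepFun_W0 p h
  have hm := measurable_W0_points p h
  have hnot : μ (S.csSuccessᶜ) = ENNReal.ofReal ((1 - p.Pdet) ^ p.Kcs) := by
    have h1 : μ (⋂ s ∈ Finset.range p.Kcs,
        (fun ω => p.W0 s fun k => (S.bsPos k ω, S.bsLos k ω, S.bsFading k ω)) ⁻¹' {0}) =
        ∏ s ∈ Finset.range p.Kcs, ENNReal.ofReal (1 - p.Pdet) := by
      rw [(iIndepFun_iff_measure_inter_preimage_eq_mul.1 hind) (Finset.range p.Kcs)
        (sets := fun _ => {0}) fun s _ => measurableSet_singleton 0]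
      refine Finset.prod_congr rfl fun s hs => ?_
      rw [← map_W0_apply_zero p h (Finset.mem_range.1 hs),
        Measure.map_apply (hm s) (measurableSet_singleton 0)]
    rw [Finset.prod_const, Finset.card_range, ← ENNReal.ofReal_pow (by linarith)] at h1
    rw [← h1]
    refine measure_congr ?_
    filter_upwards [hgen] with ω hω
    refine propext ?_
    change ω ∉ S.csSuccess ↔ ω ∈ ⋂ s ∈ Finset.range p.Kcs, _
    have e : ω ∈ S.csSuccess ↔ S.bs ω ∈ p.csSet := Iff.rfl
    have hω' : p.Generic (S.bs ω) := hω
    rw [e, hω'.mem_csSet_iff]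
    simp only [Set.mem_iInter, Set.mem_preimage, Set.mem_singleton_iff, not_exists, not_and]
    refine forall₂_congr fun s _ => ?_
    have := Params.W0_nonneg (p := p) s (S.bs ω)
    exact ⟨fun h1 => le_antisymm (not_lt.1 h1) this, fun h1 h2 => h2.ne' h1⟩
  have hmeas : MeasurableSet S.csSuccess := by
    have := p.measurableSet_csSet.preimage h.measurable_points
    exact this
  have h2 := prob_compl_eq_one_sub (μ := μ) hmeas.compl
  rw [compl_compl, hnot, ← ENNReal.ofReal_one, ← ENNReal.ofReal_sub _ (by
    have : 0 ≤ 1 - p.Pdet := by linarith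
    positivity)] at h2
  rw [Network.csSuccessProb, measureReal_def, h2, ENNReal.toReal_ofReal]
  · rfl
  · rw [sub_nonneg]
    exact pow_le_one₀ (by linarith) (by linarith)

end CellSearch

open Classical in
/-- Indicator of a proposition. -/
def ind (P : Prop) : ℝ≥0∞ := if P then 1 else 0

lemma ind_of {P : Prop} (h : P) : ind P = 1 := if_pos h

lemma ind_of_not {P : Prop} (h : ¬ P) : ind P = 0 := if_neg h

lemma ind_and (P Q : Prop) : ind (P ∧ Q) = ind P * ind Q := by
  by_cases hP : P <;> by_cases hQ : Q <;> simp [ind, hP, hQ]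

lemma measurable_ind {α : Type*} [MeasurableSpace α] {P : α → Prop} (h : MeasurableSet {a | P a}) :
    Measurable fun a => ind (P a) := by
  classical
  have e : (fun a => ind (P a)) = {a | P a}.indicator 1 := by
    funext a
    by_cases ha : P a
    · rw [ind_of ha, Set.indicator_of_mem (show a ∈ {a | P a} from ha)]; rfl
    · rw [ind_of_not ha, Set.indicator_of_notMem (show a ∉ {a | P a} from ha)]
  rw [e]
  exact measurable_one.indicator h

lemma lintegral_ind {α : Type*} [MeasurableSpace α] {μ : Measure α} {P : α → Prop}
    (h : MeasurableSet {a | P a}) : ∫⁻ a, ind (P a) ∂μ = μ {a | P a} := by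
  rw [← lintegral_indicator_one h]
  refine lintegral_congr fun a => ?_
  by_cases ha : P a
  · rw [ind_of ha, Set.indicator_of_mem (show a ∈ {a | P a} from ha)]; rfl
  · rw [ind_of_not ha, Set.indicator_of_notMem (show a ∉ {a | P a} from ha)]

lemma lintegral_ind_exp {c : ℝ} (hc : 0 < c) (s : ℝ≥0∞) :
    ∫⁻ f, ind (s ≤ ENNReal.ofReal (f * c)) ∂(expMeasure 1) = eN (s * ENNReal.ofReal c⁻¹) := by
  rw [← expMeasure_tail_mul hc s]
  refine lintegral_congr fun f => ?_
  by_cases h : s ≤ ENNReal.ofReal (f * c)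
  · rw [ind_of h, if_pos h]
  · rw [ind_of_not h, if_neg h]

namespace Params

variable {p : Params}

lemma measurable_raTerm_comp {α : Type*} [MeasurableSpace α] (a : ℝ) {x : α → ℂ}
    {k : α → Fin p.Npa} {y : α → p.User} (hx : Measurable x) (hk : Measurable k)
    (hy : Measurable y) : Measurable fun t => raTerm a (x t) (k t) (y t) := by
  have h1 : Measurable fun t => ((x t, k t), y t) := (hx.prodMk hk).prodMk hy
  have h2 := (measurable_raTerm a).comp h1
  exact h2

/-- The preamble of the typical user is received with a sufficient SINR. -/
def RaPass (a : ℝ) (x : ℂ) (k : Fin p.Npa) (z f : ℝ) (u : ℕ → p.User) : Prop :=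
  ENNReal.ofReal p.Gra * ((∑' i, raTerm a x k (u i)) + ENNReal.ofReal (p.noise / p.Pu)) ≤
    ENNReal.ofReal (f * (p.Mra * p.GN) / z)

lemma measurableSet_RaPass {α : Type*} [MeasurableSpace α] (a : ℝ) {x : α → ℂ}
    {k : α → Fin p.Npa} {z f : α → ℝ} {u : α → ℕ → p.User} (hx : Measurable x) (hk : Measurable k)
    (hz : Measurable z) (hf : Measurable f) (hu : Measurable u) :
    MeasurableSet {t | RaPass a (x t) (k t) (z t) (f t) (u t)} := by
  have h1 : Measurable fun t => ∑' i, raTerm a (x t) (k t) (u t i) := Measurable.tsum fun i =>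
    measurable_raTerm_comp a hx hk ((measurable_pi_apply i).comp hu)
  have h2 : Measurable fun t => ENNReal.ofReal (f t * (p.Mra * p.GN) / z t) :=
    ((hf.mul_const _).div hz).ennreal_ofReal
  exact measurableSet_le ((h1.add_const _).const_mul _) h2

/-- The data signal is received with an SINR of at least `Γ`. -/
def DlPass (Γ : ℝ) (D : ℕ → Prop) (z : ℝ) (s : ℕ) (f : ℝ) (d : ℕ → p.DlBS) : Prop :=
  ENNReal.ofReal Γ * ((∑' i, dlTerm D z s (d i)) + ENNReal.ofReal p.noise) ≤
    ENNReal.ofReal (p.Pb * p.M * p.GN * f / z)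

lemma measurableSet_DlPass {α : Type*} [MeasurableSpace α] (Γ : ℝ) {D : α → ℕ → Prop}
    (hD : ∀ k, MeasurableSet {a | D a k}) {z : α → ℝ} (hz : Measurable z) {s : α → ℕ}
    (hs : Measurable s) {f : α → ℝ} (hf : Measurable f) {d : α → ℕ → p.DlBS} (hd : Measurable d) :
    MeasurableSet {t | DlPass Γ (D t) (z t) (s t) (f t) (d t)} := by
  have h1 : Measurable fun t => ∑' i, dlTerm (D t) (z t) (s t) (d t i) := Measurable.tsum fun i =>
    measurable_dlTerm hD hz hs ((measurable_pi_apply i).comp hd)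
  have h2 : Measurable fun t => ENNReal.ofReal (p.Pb * p.M * p.GN * f t / z t) :=
    ((hf.const_mul _).div hz).ennreal_ofReal
  exact measurableSet_le ((h1.add_const _).const_mul _) h2

variable {Ω : Type*} [MeasurableSpace Ω] {μ : Measure Ω} [IsProbabilityMeasure μ]

/-- Probability that the preamble is received. -/
lemma lintegral_RaPass {X : ℕ → Ω → ℂ} {mark : ℕ → Ω → ℝ × ℝ × ℝ × Fin p.Npa × Fin p.N}
    (h : IsMarkedPoisson μ X mark p.lamU p.userLaw)
    {z : ℝ} (hz : 0 < z) (ha : p.Phat ∈ Set.Icc (0 : ℝ) 1) (x : ℂ) (k : Fin p.Npa) :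
    ∫⁻ f, ∫⁻ ω, ind (RaPass p.Phat x k z f fun i => (X i ω, mark i ω)) ∂μ ∂(expMeasure 1) =
      ENNReal.ofReal (p.Pra z) := by
  have hMra : (0 : ℝ) < p.Mra := by exact_mod_cast p.Mra_pos
  have hGN := p.GN_pos
  have hG := p.Gra_pos
  have hn := p.noise_pos
  have hP := p.Pu_pos
  have hc : 0 < p.Mra * p.GN / z := by positivity
  have hms : MeasurableSet {q : ℝ × Ω | RaPass p.Phat x k z q.1 fun i => (X i q.2, mark i q.2)} :=
    measurableSet_RaPass p.Phat (x := fun _ => x) (k := fun _ => k) (z := fun _ => z)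
      measurable_const measurable_const measurable_const measurable_fst
      (h.measurable_points.comp measurable_snd)
  have hswap := lintegral_lintegral_swap (μ := expMeasure 1) (ν := μ)
    (f := fun f ω => ind (RaPass p.Phat x k z f fun i => (X i ω, mark i ω)))
    (measurable_ind hms).aemeasurable
  rw [hswap]
  have h1 : ∀ ω, ∫⁻ f, ind (RaPass p.Phat x k z f fun i => (X i ω, mark i ω)) ∂(expMeasure 1) =
      ENNReal.ofReal (Real.exp (-(p.Gra * z * p.noise / (p.Pu * p.Mra * p.GN)))) *
      eN (ENNReal.ofReal p.Gra * ENNReal.ofReal (z / (p.Mra * p.GN)) *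
        ∑' i, raTerm p.Phat x k (X i ω, mark i ω)) := by
    intro ω
    unfold RaPass
    have e0 : ∀ f, f * (p.Mra * p.GN) / z = f * (p.Mra * p.GN / z) := fun f => by ring
    simp_rw [e0]
    rw [lintegral_ind_exp hc, inv_div, ← eN_ofReal (by positivity), ← eN_add]
    congr 1
    have e : ENNReal.ofReal (p.Gra * z * p.noise / (p.Pu * p.Mra * p.GN)) =
        ENNReal.ofReal p.Gra * ENNReal.ofReal (p.noise / p.Pu) *
          ENNReal.ofReal (z / (p.Mra * p.GN)) := by
      rw [← ENNReal.ofReal_mul hG.le, ← ENNReal.ofReal_mul (by positivity)]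
      congr 1; field_simp
    rw [e]
    ring
  simp_rw [h1]
  rw [lintegral_const_mul' _ _ ENNReal.ofReal_ne_top, lintegral_raTerm h hz ha, Pra,
    ENNReal.ofReal_mul (mul_nonneg (Real.exp_pos _).le (p.U_nonneg _ _ _)),
    ENNReal.ofReal_mul (Real.exp_pos _).le]
  ring

open Classical in
/-- Probability that the data signal is received. -/
lemma lintegral_DlPass {X : ℕ → Ω → ℂ} {mark : ℕ → Ω → ℝ × ℝ × Fin p.M}
    (h : IsMarkedPoisson μ X mark p.lam p.dlLaw)
    {Γ z : ℝ} (hΓ : 0 ≤ Γ) (hz : 0 < z) (D : ℕ → Prop) (s : ℕ) :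
    ∫⁻ f, ∫⁻ ω, ind (DlPass Γ D z s f fun i => (X i ω, mark i ω)) ∂μ ∂(expMeasure 1) =
      ENNReal.ofReal (Real.exp (-(Γ * z * p.noise / (p.Pb * p.M * p.GN)))) *
      ∏ k ∈ Finset.range p.Kcs, if D k
        then ENNReal.ofReal (p.V z (p.relT Γ s k) (p.lam / (p.M * p.Kcs)))
        else ENNReal.ofReal (p.U z (p.relT Γ s k) (p.lam / (p.M * p.Kcs))) := by
  have hM : (0 : ℝ) < p.M := by exact_mod_cast p.M_pos
  have hGN := p.GN_pos
  have hn := p.noise_pos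
  have hP := p.Pb_pos
  have hc : 0 < p.Pb * p.M * p.GN / z := by positivity
  have hms : MeasurableSet {q : ℝ × Ω | DlPass Γ D z s q.1 fun i => (X i q.2, mark i q.2)} :=
    measurableSet_DlPass Γ (D := fun _ => D) (fun k => MeasurableSet.const _) (z := fun _ => z)
      measurable_const (s := fun _ => s) measurable_const measurable_fst
      (h.measurable_points.comp measurable_snd)
  have hswap := lintegral_lintegral_swap (μ := expMeasure 1) (ν := μ)
    (f := fun f ω => ind (DlPass Γ D z s f fun i => (X i ω, mark i ω)))
    (measurable_ind hms).aemeasurable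
  rw [hswap]
  have h1 : ∀ ω, ∫⁻ f, ind (DlPass Γ D z s f fun i => (X i ω, mark i ω)) ∂(expMeasure 1) =
      ENNReal.ofReal (Real.exp (-(Γ * z * p.noise / (p.Pb * p.M * p.GN)))) *
      eN (ENNReal.ofReal Γ * ENNReal.ofReal (z / (p.Pb * p.M * p.GN)) *
        ∑' i, dlTerm D z s (X i ω, mark i ω)) := by
    intro ω
    unfold DlPass
    have e0 : ∀ f, p.Pb * p.M * p.GN * f / z = f * (p.Pb * p.M * p.GN / z) := fun f => by ring
    simp_rw [e0]
    rw [lintegral_ind_exp hc, inv_div, ← eN_ofReal (by positivity), ← eN_add]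
    congr 1
    have e : ENNReal.ofReal (Γ * z * p.noise / (p.Pb * p.M * p.GN)) =
        ENNReal.ofReal Γ * ENNReal.ofReal p.noise *
          ENNReal.ofReal (z / (p.Pb * p.M * p.GN)) := by
      rw [← ENNReal.ofReal_mul hΓ, ← ENNReal.ofReal_mul (by positivity)]
      congr 1; field_simp
    rw [e]
    ring
  simp_rw [h1]
  rw [lintegral_const_mul' _ _ ENNReal.ofReal_ne_top, lintegral_dlTerm h hΓ hz]

end Params

lemma comap_pair {Ω α β : Type*} [MeasurableSpace α] [MeasurableSpace β] (f : Ω → α) (g : Ω → β) :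
    MeasurableSpace.comap (fun ω => (f ω, g ω)) inferInstance =
      MeasurableSpace.comap f inferInstance ⊔ MeasurableSpace.comap g inferInstance :=
  MeasurableSpace.comap_prodMk f g

namespace Network

variable {p : Params} {Ω : Type*} (S : Network p Ω) [MeasurableSpace Ω] {μ : Measure Ω}

/-- Joint description of the event that initial access succeeds and that the data signal is received
with an SINR of at least `Γ`. -/
def Pass (Γ a : ℝ) (b : ℕ → ℂ × ℝ × ℝ) (t : ℝ × ℝ × Fin p.Npa) (u : ℕ → p.User) (d : ℕ → p.DlBS)
    (c : ℕ × (ℕ → Fin p.Npa × Fin p.Mra)) : Prop :=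
  b ∈ p.csSet ∧ Params.NoCol t.2.2 (sectorIdx p.Mra (-p.tagPos b)) c ∧
    Params.RaPass a (p.tagPos b) t.2.2 (p.tagLoss b) t.1 u ∧
    Params.DlPass Γ (p.SecDet b) (p.tagLoss b) (sectorIdx p.N (p.tagPos b)) t.2.1 d

lemma le_div_iff_noise {s x y c : ℝ≥0∞} (hc : c ≠ 0) (hx : x ≠ ⊤) :
    s ≤ x / (y + c) ↔ s * (y + c) ≤ x := by
  rw [ENNReal.le_div_iff_mul_le (Or.inl fun h => hc (add_eq_zero.1 h).2) (Or.inr hx)]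

lemma preamble_pass_iff (ω : Ω) : ENNReal.ofReal p.Gra ≤ S.preambleSINR μ ω ↔
    Params.RaPass (S.csSuccessProb μ) (p.tagPos (S.bs ω)) (S.typical ω).2.2 (p.tagLoss (S.bs ω))
      (S.typical ω).1 (S.users ω) := by
  have hn : 0 < p.noise / p.Pu := div_pos p.noise_pos p.Pu_pos
  unfold preambleSINR
  rw [le_div_iff_noise (ENNReal.ofReal_pos.2 hn).ne' ENNReal.ofReal_ne_top]
  rfl

lemma dl_pass_iff (Γ : ℝ) (ω : Ω) : ENNReal.ofReal Γ ≤ S.dlSINR ω ↔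
    Params.DlPass Γ (p.SecDet (S.bs ω)) (p.tagLoss (S.bs ω)) (sectorIdx p.N (p.tagPos (S.bs ω)))
      (S.typical ω).2.1 (S.dl ω) := by
  unfold dlSINR
  rw [le_div_iff_noise (ENNReal.ofReal_pos.2 p.noise_pos).ne' ENNReal.ofReal_ne_top]
  rfl

lemma pass_iff (Γ : ℝ) (ω : Ω) : ω ∈ S.iaSuccess μ ∩ {ω | ENNReal.ofReal Γ ≤ S.dlSINR ω} ↔
    Pass Γ (S.csSuccessProb μ) (S.bs ω) (S.typical ω) (S.users ω) (S.dl ω) (S.cont ω) := by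
  have e : ω ∈ S.iaSuccess μ ∩ {ω | ENNReal.ofReal Γ ≤ S.dlSINR ω} ↔
    (ω ∈ S.csSuccess ∧ S.NoCollision ω ∧ ENNReal.ofReal p.Gra ≤ S.preambleSINR μ ω) ∧
      ENNReal.ofReal Γ ≤ S.dlSINR ω := Iff.rfl
  rw [e, S.preamble_pass_iff, S.dl_pass_iff, and_assoc, and_assoc]
  rfl

lemma measurableSet_Pass {α : Type*} [MeasurableSpace α] (Γ a : ℝ) {b : α → ℕ → ℂ × ℝ × ℝ}
    {t : α → ℝ × ℝ × Fin p.Npa} {u : α → ℕ → p.User} {d : α → ℕ → p.DlBS}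
    {c : α → ℕ × (ℕ → Fin p.Npa × Fin p.Mra)} (hb : Measurable b) (ht : Measurable t)
    (hu : Measurable u) (hd : Measurable d) (hc : Measurable c) :
    MeasurableSet {q | Pass Γ a (b q) (t q) (u q) (d q) (c q)} := by
  have hx : Measurable fun q => p.tagPos (b q) := p.measurable_tagPos.comp hb
  have hz : Measurable fun q => p.tagLoss (b q) := p.measurable_tagLoss.comp hb
  have h1 : MeasurableSet {q | b q ∈ p.csSet} := hb p.measurableSet_csSet
  have h2 : MeasurableSet {q | Params.NoCol (t q).2.2 (sectorIdx p.Mra (-p.tagPos (b q))) (c q)} :=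
    Params.measurableSet_NoCol ht.snd.snd ((measurable_sectorIdx _).comp hx.neg) hc
  have h3 := Params.measurableSet_RaPass a hx ht.snd.snd hz ht.fst hu
  have h4 := Params.measurableSet_DlPass Γ (fun k => hb (p.measurableSet_SecDet k)) hz
    ((measurable_sectorIdx p.N).comp hx) ht.snd.fst hd
  exact h1.inter (h2.inter (h3.inter h4))

/-- The random elements are independent. -/
lemma indep_groups (hS : S.HasLaw μ) (hb : Measurable S.bs) (ht : Measurable S.typical)
    (hu : Measurable S.users) (hd : Measurable S.dl) (hc : Measurable S.cont) :
    IndepFun S.bs (fun ω => (S.typical ω, S.users ω, S.dl ω, S.cont ω)) μ ∧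
    IndepFun S.typical (fun ω => (S.users ω, S.dl ω, S.cont ω)) μ ∧
    IndepFun S.users (fun ω => (S.dl ω, S.cont ω)) μ ∧ IndepFun S.dl S.cont μ := by
  have hle : ∀ i, ![MeasurableSpace.comap S.bs inferInstance,
    MeasurableSpace.comap S.users inferInstance, MeasurableSpace.comap S.dl inferInstance,
    MeasurableSpace.comap S.typical inferInstance, MeasurableSpace.comap S.cont inferInstance] i ≤
      ‹MeasurableSpace Ω› := by
    intro i
    fin_cases i
    · exact hb.comap_le
    · exact hu.comap_le
    · exact hd.comap_le
    · exact ht.comap_le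
    · exact hc.comap_le
  have key := fun (A B : Set (Fin 5)) (h : Disjoint A B) =>
    indep_iSup_of_disjoint hle hS.indep h
  refine ⟨?_, ?_, ?_, ?_⟩
  · have h := key {0} {3, 1, 2, 4} (by simp)
    rw [IndepFun_iff_Indep, comap_pair S.typical, comap_pair S.users, comap_pair S.dl]
    simpa [iSup_or, iSup_sup_eq] using h
  · have h := key {3} {1, 2, 4} (by simp)
    rw [IndepFun_iff_Indep, comap_pair S.users, comap_pair S.dl]
    simpa [iSup_or, iSup_sup_eq] using h
  · have h := key {1} {2, 4} (by simp)
    rw [IndepFun_iff_Indep, comap_pair S.dl]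
    simpa [iSup_or, iSup_sup_eq] using h
  · have h := key {2} {4} (by simp)
    simpa [IndepFun_iff_Indep] using h

end Network

lemma lintegral_prod_unifFin {n : ℕ} (hn : 0 < n) {R : ℝ → Fin n → ℝ≥0∞} {D : ℝ → ℝ≥0∞}
    (hR : Measurable (Function.uncurry R)) (hD : Measurable D) {c : ℝ≥0∞}
    (hc : ∀ k, ∫⁻ f, R f k ∂(expMeasure 1) = c) :
    ∫⁻ t, R t.1 t.2.2 * D t.2.1 ∂((expMeasure 1).prod ((expMeasure 1).prod (unifFin n))) =
      c * ∫⁻ f, D f ∂(expMeasure 1) := by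
  have := isProbabilityMeasure_unifFin hn
  have hm : Measurable fun t : ℝ × ℝ × Fin n => R t.1 t.2.2 * D t.2.1 := by
    have h1 : Measurable fun t : ℝ × ℝ × Fin n => (t.1, t.2.2) := by fun_prop
    have h2 := hR.comp h1
    exact h2.mul (hD.comp (by fun_prop))
  have hn' : (0 : ℝ) < n := by exact_mod_cast hn
  have hm2 : Measurable fun q : ℝ × Fin n => ∫⁻ f, R f q.2 * D q.1 ∂(expMeasure 1) := by
    refine Measurable.lintegral_prod_right' (f := fun r : (ℝ × Fin n) × ℝ => R r.2 r.1.2 * D r.1.1) ?_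
    have h1 : Measurable fun r : (ℝ × Fin n) × ℝ => (r.2, r.1) := by fun_prop
    exact hm.comp h1
  have hRk : ∀ k, Measurable fun f => R f k := fun k => hR.comp (by fun_prop : Measurable fun f => (f, k))
  rw [lintegral_prod_symm' _ hm, lintegral_prod _ hm2.aemeasurable]
  have h3 : ∀ f k, ∫⁻ f', R f' k * D f ∂(expMeasure 1) = c * D f := fun f k => by
    rw [lintegral_mul_const _ (hRk k), hc k]
  simp only [h3, lintegral_const, measure_univ, mul_one]
  rw [lintegral_const_mul _ hD]

namespace Network

variable {p : Params} {Ω : Type*} {S : Network p Ω} [MeasurableSpace Ω] {μ : Measure Ω}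
  [IsProbabilityMeasure μ]

lemma HasLaw.measurable_bs (hS : S.HasLaw μ) : Measurable S.bs := hS.bs_law.measurable_points

lemma HasLaw.measurable_users (hS : S.HasLaw μ) : Measurable S.users :=
  hS.user_law.measurable_points

lemma HasLaw.measurable_dl (hS : S.HasLaw μ) : Measurable S.dl := hS.dl_law.measurable_points

lemma HasLaw.measurable_cont (hS : S.HasLaw μ) : Measurable S.cont :=
  hS.contenders_measurable.prodMk (measurable_pi_lambda _ hS.cont_marks.measurable)

lemma Phat_mem (h : S.HasLaw μ) : p.Phat ∈ Set.Icc (0 : ℝ) 1 := by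
  rw [← csSuccessProb_eq h.bs_law]
  exact ⟨measureReal_nonneg, measureReal_le_one⟩

lemma lintegral_NoCol_cont (hS : S.HasLaw μ) (k : Fin p.Npa) {s : ℕ} (hs : s < p.Mra) :
    ∫⁻ ω, ind (Params.NoCol k s (S.cont ω)) ∂μ = ENNReal.ofReal p.Pco := by
  have hP := csSuccessProb_eq hS.bs_law
  have hPm := Phat_mem hS
  have h := Params.lintegral_NoCol (m := p.lamU * S.csSuccessProb μ * p.cellArea)
    (by rw [hP]; exact mul_nonneg (mul_nonneg p.lamU_pos.le hPm.1)
          (div_nonneg (by norm_num) p.lam_pos.le))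
    hS.contenders_measurable hS.contenders_law hS.cont_marks hS.cont_indep k hs
  have e : p.Pco = Real.exp (-(p.lamU * S.csSuccessProb μ * p.cellArea * (1 / (p.Npa * p.Mra)))) := by
    rw [hP, Params.Pco, Params.cellArea]
    congr 2
    have h1 := p.lam_pos
    have h2 : (0 : ℝ) < p.Npa := by exact_mod_cast p.Npa_pos
    have h3 : (0 : ℝ) < p.Mra := by exact_mod_cast p.Mra_pos
    field_simp
  rw [e, ← h]
  refine lintegral_congr fun ω => ?_
  by_cases hc : Params.NoCol k s (S.cont ω)
  · rw [ind_of hc]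
    exact (Set.indicator_of_mem (show S.cont ω ∈ {c | Params.NoCol k s c} from hc)
      (1 : ℕ × (ℕ → Fin p.Npa × Fin p.Mra) → ℝ≥0∞)).symm
  · rw [ind_of_not hc]
    exact (Set.indicator_of_notMem (show S.cont ω ∉ {c | Params.NoCol k s c} from hc)
      (1 : ℕ × (ℕ → Fin p.Npa × Fin p.Mra) → ℝ≥0∞)).symm

open Classical in
set_option maxHeartbeats 1000000 in
/-- Conditional probability of the event `Pass`, given the base stations. -/
lemma lintegral_Pass (hS : S.HasLaw μ) {Γ : ℝ} (hΓ : 0 ≤ Γ) {b : ℕ → ℂ × ℝ × ℝ}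
    (hb : p.Generic b) :
    ∫⁻ ω, ind (Pass Γ p.Phat b (S.typical ω) (S.users ω) (S.dl ω) (S.cont ω)) ∂μ =
      if b ∈ p.csSet then ENNReal.ofReal p.Pco * ENNReal.ofReal (p.Pra (p.tagLoss b)) *
        (ENNReal.ofReal (Real.exp (-(Γ * p.tagLoss b * p.noise / (p.Pb * p.M * p.GN)))) *
          ∏ k ∈ Finset.range p.Kcs, if p.SecDet b k
            then ENNReal.ofReal (p.V (p.tagLoss b) (p.relT Γ (p.tagSec b / p.q) k)
              (p.lam / (p.M * p.Kcs)))
            else ENNReal.ofReal (p.U (p.tagLoss b) (p.relT Γ (p.tagSec b / p.q) k)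
              (p.lam / (p.M * p.Kcs)))) else 0 := by
  have hmb := hS.measurable_bs
  have hmt := hS.typical_measurable
  have hmu := hS.measurable_users
  have hmd := hS.measurable_dl
  have hmc := hS.measurable_cont
  obtain ⟨-, i1, i2, i3⟩ := S.indep_groups hS hmb hmt hmu hmd hmc
  by_cases hcs : b ∈ p.csSet
  swap
  · rw [if_neg hcs, lintegral_eq_zero_of_ae_eq_zero]
    exact Eventually.of_forall fun ω => ind_of_not fun h => hcs h.1
  rw [if_pos hcs, lintegral_indepFun i1 hmt (hmu.prodMk (hmd.prodMk hmc))
    (F := fun t r => ind (Pass Γ p.Phat b t r.1 r.2.1 r.2.2))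
    (measurable_ind (measurableSet_Pass Γ p.Phat measurable_const measurable_fst
      measurable_snd.fst measurable_snd.snd.fst measurable_snd.snd.snd))]
  set x := p.tagPos b with hx
  set z := p.tagLoss b with hz
  have hzpos : 0 < z := hb.tagLoss_pos
  set R : ℝ → Fin p.Npa → ℝ≥0∞ := fun f k => ∫⁻ ω, ind (Params.RaPass p.Phat x k z f (S.users ω)) ∂μ
    with hR
  set D : ℝ → ℝ≥0∞ := fun f => ∫⁻ ω, ind (Params.DlPass Γ (p.SecDet b) z (sectorIdx p.N x) f (S.dl ω)) ∂μ
    with hD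
  have hmR : Measurable (Function.uncurry R) := by
    refine Measurable.lintegral_prod_right' (f := fun q : (ℝ × Fin p.Npa) × Ω =>
      ind (Params.RaPass p.Phat x q.1.2 z q.1.1 (S.users q.2))) (measurable_ind ?_)
    exact Params.measurableSet_RaPass p.Phat measurable_const measurable_fst.snd measurable_const
      measurable_fst.fst (hmu.comp measurable_snd)
  have hmD : Measurable D := by
    refine Measurable.lintegral_prod_right' (f := fun q : ℝ × Ω =>
      ind (Params.DlPass Γ (p.SecDet b) z (sectorIdx p.N x) q.1 (S.dl q.2))) (measurable_ind ?_)
    exact Params.measurableSet_DlPass Γ (D := fun _ => p.SecDet b) (fun k => MeasurableSet.const _)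
      measurable_const measurable_const measurable_fst (hmd.comp measurable_snd)
  have hin : ∀ t : ℝ × ℝ × Fin p.Npa,
      ∫⁻ ω, ind (Pass Γ p.Phat b t (S.users ω) (S.dl ω) (S.cont ω)) ∂μ =
        ENNReal.ofReal p.Pco * (R t.1 t.2.2 * D t.2.1) := by
    intro t
    rw [lintegral_indepFun i2 hmu (hmd.prodMk hmc)
      (F := fun u r => ind (Pass Γ p.Phat b t u r.1 r.2))
      (measurable_ind (measurableSet_Pass Γ p.Phat measurable_const measurable_const
        measurable_fst measurable_snd.fst measurable_snd.snd))]
    have h3 : ∀ u : ℕ → p.User, ∫⁻ ω, ind (Pass Γ p.Phat b t u (S.dl ω) (S.cont ω)) ∂μ =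
        ENNReal.ofReal p.Pco * (ind (Params.RaPass p.Phat x t.2.2 z t.1 u) * D t.2.1) := by
      intro u
      rw [lintegral_indepFun i3 hmd hmc
        (F := fun d c => ind (Pass Γ p.Phat b t u d c))
        (measurable_ind (measurableSet_Pass Γ p.Phat measurable_const measurable_const
          measurable_const measurable_fst measurable_snd))]
      have h4 : ∀ d : ℕ → p.DlBS, ∫⁻ ω, ind (Pass Γ p.Phat b t u d (S.cont ω)) ∂μ =
          ENNReal.ofReal p.Pco * (ind (Params.RaPass p.Phat x t.2.2 z t.1 u) *
            ind (Params.DlPass Γ (p.SecDet b) z (sectorIdx p.N x) t.2.1 d)) := by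
        intro d
        rw [← lintegral_NoCol_cont hS t.2.2 (s := sectorIdx p.Mra (-x))
          (sectorIdx_lt p.Mra_pos _), ← lintegral_mul_const]
        · refine lintegral_congr fun ω => ?_
          unfold Pass
          rw [ind_and, ind_of hcs, one_mul, ind_and, ind_and]
        · exact measurable_ind (Params.measurableSet_NoCol measurable_const measurable_const hmc)
      simp_rw [h4]
      have hmq : Measurable fun ω => ind (Params.DlPass Γ (p.SecDet b) z (sectorIdx p.N x) t.2.1 (S.dl ω)) :=
        measurable_ind (Params.measurableSet_DlPass Γ (D := fun _ => p.SecDet b)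
          (fun k => MeasurableSet.const _) measurable_const measurable_const measurable_const hmd)
      rw [lintegral_const_mul _ (hmq.const_mul _), lintegral_const_mul _ hmq]
    simp_rw [h3]
    have hmr : Measurable fun ω => ind (Params.RaPass p.Phat x t.2.2 z t.1 (S.users ω)) :=
      measurable_ind (Params.measurableSet_RaPass p.Phat measurable_const measurable_const
        measurable_const measurable_const hmu)
    rw [lintegral_const_mul _ (hmr.mul_const _), lintegral_mul_const _ hmr]
  simp_rw [hin]
  have hmRD : Measurable fun t : ℝ × ℝ × Fin p.Npa => R t.1 t.2.2 * D t.2.1 := by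
    have h1 : Measurable fun t : ℝ × ℝ × Fin p.Npa => (t.1, t.2.2) := by fun_prop
    have h2 := hmR.comp h1
    exact h2.mul (hmD.comp (by fun_prop))
  have hmRDt : Measurable fun ω => R (S.typical ω).1 (S.typical ω).2.2 * D (S.typical ω).2.1 :=
    hmRD.comp hmt
  rw [lintegral_const_mul _ hmRDt, mul_assoc,
    ← lintegral_map (f := fun t : ℝ × ℝ × Fin p.Npa => R t.1 t.2.2 * D t.2.1) hmRD hmt,
    hS.typical_law,
    lintegral_prod_unifFin p.Npa_pos hmR hmD (c := ENNReal.ofReal (p.Pra z)) fun k =>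
      Params.lintegral_RaPass hS.user_law hzpos (Phat_mem hS) x k]
  have hDl := Params.lintegral_DlPass hS.dl_law hΓ hzpos (p.SecDet b) (sectorIdx p.N x)
  rw [← hb.sectorIdx_tagPos, ← hDl]
  rfl

open Classical in
/-- Probability that initial access succeeds and the data signal has an SINR of at least `Γ`. -/
theorem measure_iaSuccess_inter (hS : S.HasLaw μ) {Γ : ℝ} (hΓ : 0 ≤ Γ) :
    μ (S.iaSuccess μ ∩ {ω | ENNReal.ofReal Γ ≤ S.dlSINR ω}) =
      ∫⁻ ω, if S.bs ω ∈ p.csSet then ENNReal.ofReal p.Pco *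
          ENNReal.ofReal (p.Pra (p.tagLoss (S.bs ω))) *
        (ENNReal.ofReal (Real.exp (-(Γ * p.tagLoss (S.bs ω) * p.noise / (p.Pb * p.M * p.GN)))) *
          ∏ k ∈ Finset.range p.Kcs, if p.SecDet (S.bs ω) k
            then ENNReal.ofReal (p.V (p.tagLoss (S.bs ω)) (p.relT Γ (p.tagSec (S.bs ω) / p.q) k)
              (p.lam / (p.M * p.Kcs)))
            else ENNReal.ofReal (p.U (p.tagLoss (S.bs ω)) (p.relT Γ (p.tagSec (S.bs ω) / p.q) k)
              (p.lam / (p.M * p.Kcs)))) else 0 ∂μ := by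
  have hmb := hS.measurable_bs
  have hmt := hS.typical_measurable
  have hmu := hS.measurable_users
  have hmd := hS.measurable_dl
  have hmc := hS.measurable_cont
  obtain ⟨i0, -, -, -⟩ := S.indep_groups hS hmb hmt hmu hmd hmc
  have hset : S.iaSuccess μ ∩ {ω | ENNReal.ofReal Γ ≤ S.dlSINR ω} =
      {ω | Pass Γ p.Phat (S.bs ω) (S.typical ω) (S.users ω) (S.dl ω) (S.cont ω)} := by
    ext ω
    rw [S.pass_iff, csSuccessProb_eq hS.bs_law]; rfl
  rw [hset, ← lintegral_ind (measurableSet_Pass Γ p.Phat hmb hmt hmu hmd hmc),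
    lintegral_indepFun i0 hmb (hmt.prodMk (hmu.prodMk (hmd.prodMk hmc)))
    (F := fun b r => ind (Pass Γ p.Phat b r.1 r.2.1 r.2.2.1 r.2.2.2))
    (measurable_ind (measurableSet_Pass Γ p.Phat measurable_fst measurable_snd.fst
      measurable_snd.snd.fst measurable_snd.snd.snd.fst measurable_snd.snd.snd.snd))]
  refine lintegral_congr_ae ?_
  filter_upwards [ae_generic p hS.bs_law] with ω hω
  exact lintegral_Pass hS hΓ hω

lemma measurableSet_iaSuccess_inter (hS : S.HasLaw μ) (Γ : ℝ) :
    MeasurableSet (S.iaSuccess μ ∩ {ω | ENNReal.ofReal Γ ≤ S.dlSINR ω}) := by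
  have hset : S.iaSuccess μ ∩ {ω | ENNReal.ofReal Γ ≤ S.dlSINR ω} =
      {ω | Pass Γ (S.csSuccessProb μ) (S.bs ω) (S.typical ω) (S.users ω) (S.dl ω) (S.cont ω)} := by
    ext ω
    rw [S.pass_iff]; rfl
  rw [hset]
  exact measurableSet_Pass Γ _ hS.measurable_bs hS.typical_measurable hS.measurable_users
    hS.measurable_dl hS.measurable_cont

end Network

namespace Params

variable (p : Params)

/-- Measurable version of `V`. -/
def VE (T l z : ℝ) : ℝ≥0∞ :=
  eN (ENNReal.ofReal (2 * Real.pi * l) * p.rad (fun y => if z < y then kern z T y else 0))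

/-- Measurable version of `U`. -/
def UE (T l z : ℝ) : ℝ≥0∞ := eN (ENNReal.ofReal (2 * Real.pi * l) * p.rad (kern z T))

lemma measurable_VE (T l : ℝ) : Measurable (p.VE T l) :=
  measurable_eN.comp (measurable_const.mul
    (p.measurable_rad (φ := fun z l => if z < l then kern z T l else 0)
      (Measurable.ite (measurableSet_lt measurable_fst measurable_snd) (measurable_kern₂ T)
        measurable_const)))

lemma measurable_UE (T l : ℝ) : Measurable (p.UE T l) :=
  measurable_eN.comp (measurable_const.mul
    (p.measurable_rad (φ := fun z l => kern z T l) (measurable_kern₂ T)))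

lemma q_mul_N : p.q * p.N = p.Kcs := Nat.div_mul_cancel p.N_dvd_Kcs

lemma q_pos : 0 < p.q := Nat.div_pos (Nat.le_of_dvd p.Kcs_pos p.N_dvd_Kcs) p.N_pos

lemma q_le : p.q ≤ p.Kcs := Nat.div_le_self _ _

lemma card_main_lobe {j : ℕ} (hj : j < p.Kcs) :
    ((Finset.range p.Kcs).filter fun k => k / p.q = j / p.q).card = p.q := by
  have hq := p.q_pos
  have e : ((Finset.range p.Kcs).filter fun k => k / p.q = j / p.q) =
      Finset.Ico (j / p.q * p.q) (j / p.q * p.q + p.q) := by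
    ext k
    rw [Finset.mem_filter, Finset.mem_range, Finset.mem_Ico, Nat.div_eq_iff hq]
    have h1 : j / p.q < p.N := by
      rw [Nat.div_lt_iff_lt_mul hq, mul_comm, p.q_mul_N]; exact hj
    have h2 : j / p.q * p.q + p.q ≤ p.Kcs := by
      rw [← Nat.succ_mul, mul_comm, ← p.q_mul_N]
      exact Nat.mul_le_mul_left _ h1
    constructor
    · rintro ⟨-, h⟩; omega
    · rintro ⟨h3, h4⟩; omega
  rw [e, Nat.card_Ico]; omega

lemma prod_relT {M : Type*} [CommMonoid M] (Γ : ℝ) (F : ℝ → M) {j : ℕ} (hj : j < p.Kcs) :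
    ∏ k ∈ (Finset.range p.Kcs).erase j, F (p.relT Γ (j / p.q) k) =
      F Γ ^ (p.q - 1) * F (p.gN / p.GN * Γ) ^ (p.Kcs - p.q) := by
  classical
  have hjm : j ∈ (Finset.range p.Kcs).filter fun k => k / p.q = j / p.q :=
    Finset.mem_filter.2 ⟨Finset.mem_range.2 hj, rfl⟩
  have hcard := p.card_main_lobe hj
  have h1 : ∀ k, F (p.relT Γ (j / p.q) k) = if k / p.q = j / p.q then F Γ else F (p.gN / p.GN * Γ) := by
    intro k; unfold relT; split_ifs <;> rfl
  simp_rw [h1]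
  rw [Finset.prod_ite, Finset.prod_const, Finset.prod_const]
  have h2 : ((Finset.range p.Kcs).erase j).filter (fun k => k / p.q = j / p.q) =
      ((Finset.range p.Kcs).filter fun k => k / p.q = j / p.q).erase j := by
    ext k; simp only [Finset.mem_filter, Finset.mem_erase]; tauto
  have h3 : ((Finset.range p.Kcs).erase j).filter (fun k => ¬ k / p.q = j / p.q) =
      (Finset.range p.Kcs).filter fun k => ¬ k / p.q = j / p.q := by
    ext k; simp only [Finset.mem_filter, Finset.mem_erase]
    constructor
    · tauto
    · rintro ⟨h4, h5⟩; exact ⟨⟨fun h => h5 (by rw [h]), h4⟩, h5⟩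
  have h4 := Finset.card_filter_add_card_filter_not (s := Finset.range p.Kcs)
    (fun k => k / p.q = j / p.q)
  rw [h2, h3, Finset.card_erase_of_mem hjm, hcard]
  rw [hcard, Finset.card_range] at h4
  congr 2; omega

/-- The integrand of the closed form of the SINR distribution in the data phase. -/
def PdlDensity (Γ z : ℝ) : ℝ :=
  Real.exp (-(Γ * z * p.noise / (p.Pb * p.M * p.GN))) * p.Kcs *
      (p.V z Γ (p.lam / (p.M * p.Kcs)) * p.Pbeyond z +
        p.U z Γ (p.lam / (p.M * p.Kcs)) * (1 - p.Pdet)) ^ (p.q - 1) *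
      (p.Pbeyond z * p.V z (p.gN / p.GN * Γ) (p.lam / (p.M * p.Kcs)) +
        (1 - p.Pdet) * p.U z (p.gN / p.GN * Γ) (p.lam / (p.M * p.Kcs))) ^ (p.Kcs - p.q) *
      p.V z Γ (p.lam / (p.M * p.Kcs)) * p.Ptilde z * p.Pra z * p.Pco * p.fZ1 z

lemma PDLFormula_eq (Γ : ℝ) :
    p.PDLFormula Γ = 1 / p.etaIAFormula * ∫ z in Set.Ioi (0 : ℝ), p.PdlDensity Γ z := rfl

lemma V_zero (z l : ℝ) : p.V z 0 l = 1 := by simp [V, interf, expNeg]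

lemma U_zero (z l : ℝ) : p.U z 0 l = 1 := by simp [U, interf, expNeg]

lemma etaIAFormula_eq : p.etaIAFormula = ∫ z in Set.Ioi (0 : ℝ), p.PdlDensity 0 z := by
  unfold etaIAFormula
  congr 1
  funext z
  have e : p.Kcs - 1 = (p.q - 1) + (p.Kcs - p.q) := by
    have := p.q_pos; have := p.q_le; omega
  rw [e, pow_add, PdlDensity]
  simp only [mul_zero, V_zero, U_zero, zero_mul, zero_div, neg_zero, Real.exp_zero]
  ring

lemma aemeasurable_Pbeyond {Ω : Type*} [MeasurableSpace Ω] {μ : Measure Ω} [IsProbabilityMeasure μ]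
    {X : ℕ → Ω → ℂ} {mark : ℕ → Ω → ℝ × ℝ}
    (h : IsMarkedPoisson μ X mark p.lam (unifLaw.prod (expMeasure 1))) :
    AEMeasurable p.Pbeyond (volume.restrict (Set.Ioi 0)) := by
  refine aemeasurable_of_ofReal (g := fun z => ∫⁻ w in Set.Ioi z, p.detDensity w) ?_
    (fun z hz => ofReal_Pbeyond p h hz.le) fun z hz => p.Pbeyond_nonneg hz.le
  refine Antitone.measurable fun a b hab => lintegral_mono_set (Set.Ioi_subset_Ioi hab)

lemma Pra_nonneg (z : ℝ) : 0 ≤ p.Pra z :=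
  mul_nonneg (mul_nonneg (Real.exp_pos _).le (p.U_nonneg _ _ _)) (p.U_nonneg _ _ _)

lemma rel_nonneg {Γ : ℝ} (hΓ : 0 ≤ Γ) : 0 ≤ p.gN / p.GN * Γ :=
  mul_nonneg (div_nonneg p.gN_nonneg p.GN_pos.le) hΓ

lemma aemeasurable_Pra : AEMeasurable p.Pra (volume.restrict (Set.Ioi 0)) := by
  unfold Pra
  exact ((Measurable.aemeasurable (by fun_prop)).mul (p.aemeasurable_U p.Gra_pos.le _)).mul
    (p.aemeasurable_U (p.rel_nonneg p.Gra_pos.le) _)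

variable {p} {Ω : Type*} [MeasurableSpace Ω] {μ : Measure Ω} [IsProbabilityMeasure μ]
  {X : ℕ → Ω → ℂ} {mark : ℕ → Ω → ℝ × ℝ}

lemma PdlDensity_nonneg (h : IsMarkedPoisson μ X mark p.lam (unifLaw.prod (expMeasure 1)))
    (Γ : ℝ) {z : ℝ} (hz : 0 < z) : 0 ≤ p.PdlDensity Γ z := by
  have h1 : 0 ≤ 1 - p.Pdet := sub_nonneg.2 (Pdet_le_one p h)
  have h2 := p.Pbeyond_nonneg hz.le
  have h3 := p.fZ1_nonneg hz
  have h4 := p.Pra_nonneg z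
  have h5 := p.Ptilde_nonneg z
  have h6 := fun T l => p.V_nonneg z T l
  have h7 := fun T l => p.U_nonneg z T l
  have h8 : 0 ≤ p.Pco := (Real.exp_pos _).le
  unfold PdlDensity
  have h9 := add_nonneg (mul_nonneg (h6 Γ (p.lam / (p.M * p.Kcs))) h2)
    (mul_nonneg (h7 Γ (p.lam / (p.M * p.Kcs))) h1)
  have h10 := add_nonneg (mul_nonneg h2 (h6 (p.gN / p.GN * Γ) (p.lam / (p.M * p.Kcs))))
    (mul_nonneg h1 (h7 (p.gN / p.GN * Γ) (p.lam / (p.M * p.Kcs))))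
  have h11 := h6 Γ (p.lam / (p.M * p.Kcs))
  exact mul_nonneg (mul_nonneg (mul_nonneg (mul_nonneg (mul_nonneg (mul_nonneg (mul_nonneg
    (mul_nonneg (Real.exp_pos _).le (Nat.cast_nonneg _)) (pow_nonneg h9 _)) (pow_nonneg h10 _)) h11)
    h5) h4) h8) h3

lemma aemeasurable_PdlDensity (h : IsMarkedPoisson μ X mark p.lam (unifLaw.prod (expMeasure 1)))
    {Γ : ℝ} (hΓ : 0 ≤ Γ) : AEMeasurable (p.PdlDensity Γ) (volume.restrict (Set.Ioi 0)) := by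
  have h2 := p.aemeasurable_Pbeyond h
  have h3 := p.aemeasurable_fZ1
  have h4 := p.aemeasurable_Pra
  have h5 := p.aemeasurable_Ptilde
  have h6 := fun {T : ℝ} (hT : 0 ≤ T) l => p.aemeasurable_V hT l
  have h7 := fun {T : ℝ} (hT : 0 ≤ T) l => p.aemeasurable_U hT l
  have hr := p.rel_nonneg hΓ
  unfold PdlDensity
  have h0 : AEMeasurable (fun z => Real.exp (-(Γ * z * p.noise / (p.Pb * p.M * p.GN))))
    (volume.restrict (Set.Ioi (0 : ℝ))) := Measurable.aemeasurable (by fun_prop)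
  exact ((((((((h0.mul_const _).mul ((((h6 hΓ _).mul h2).add ((h7 hΓ _).mul_const _)).pow_const _)).mul
    (((h2.mul (h6 hr _)).add ((h7 hr _).const_mul _)).pow_const _)).mul (h6 hΓ _)).mul h5).mul
    h4).mul_const _).mul h3)

/-- A functional of the tagged base station and of the detected sectors, as an integral over the
path loss of the tagged base station. -/
lemma lintegral_tagged (h : IsMarkedPoisson μ X mark p.lam (unifLaw.prod (expMeasure 1)))
    {b : Ω → ℕ → ℂ × ℝ × ℝ} (hb : b = fun ω k => (X k ω, mark k ω))
    [∀ ω k, Decidable (p.SecDet (b ω) k)] [∀ ω, Decidable (b ω ∈ p.csSet)]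
    {u v : ℕ → ℕ → ℝ → ℝ≥0∞} {B : ℝ → ℝ≥0∞} (hu : ∀ j k, Measurable (u j k))
    (hv : ∀ j k, Measurable (v j k)) (hB : Measurable B) :
    ∫⁻ ω, (if b ω ∈ p.csSet then B (p.tagLoss (b ω)) * ∏ k ∈ Finset.range p.Kcs,
        (if p.SecDet (b ω) k then v (p.tagSec (b ω)) k (p.tagLoss (b ω))
          else u (p.tagSec (b ω)) k (p.tagLoss (b ω))) else 0) ∂μ =
      ∑ j ∈ Finset.range p.Kcs, ∫⁻ z in Set.Ioi 0, B z * v j j z *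
        (∏ k ∈ (Finset.range p.Kcs).erase j, (ENNReal.ofReal (1 - p.Pdet) * u j k z +
          ENNReal.ofReal (p.Pbeyond z) * v j k z)) * p.detDensity z := by
  subst hb
  have hW := measurable_W0_points p h
  have hBv : ∀ j, Measurable fun z => B z * v j j z := fun j => hB.mul (hv j j)
  rw [← Finset.sum_congr rfl fun j hj => lintegral_sectors p h (hBv j) (hu j) (hv j)
    (Finset.mem_range.1 hj), ← lintegral_finsetSum]
  · refine lintegral_congr_ae ?_
    filter_upwards [ae_generic p h] with ω hω
    exact (hω.sum_sectors u v fun _ => B).symm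
  · intro j _
    refine (((hBv j).indicator measurableSet_Ioi).comp (hW j)).mul
      (Finset.measurable_prod _ fun k _ => ?_)
    exact (Measurable.ite (hW k (measurableSet_singleton 0)) ((hu j k).comp (hW j))
      measurable_const).add (Measurable.ite (measurableSet_lt (hW j) (hW k))
        ((hv j k).comp (hW j)) measurable_const)

end Params

namespace Network

variable {p : Params} {Ω : Type*} {S : Network p Ω} [MeasurableSpace Ω] {μ : Measure Ω}
  [IsProbabilityMeasure μ]

theorem lintegral_PdlDensity (hS : S.HasLaw μ) {Γ : ℝ} (hΓ : 0 ≤ Γ) :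
    μ (S.iaSuccess μ ∩ {ω | ENNReal.ofReal Γ ≤ S.dlSINR ω}) =
      ∫⁻ z in Set.Ioi 0, ENNReal.ofReal (p.PdlDensity Γ z) := by
  classical
  set l : ℝ := p.lam / (p.M * p.Kcs) with hl
  set B : ℝ → ℝ≥0∞ := fun z => ENNReal.ofReal p.Pco *
    (ENNReal.ofReal (Real.exp (-(p.Gra * z * p.noise / (p.Pu * p.Mra * p.GN)))) *
      p.UE p.Gra (p.lamU * p.Phat / (p.N * p.Mra * p.Npa)) z *
      p.UE (p.gN / p.GN * p.Gra) ((1 - 1 / p.N) * (p.lamU * p.Phat / (p.Mra * p.Npa))) z) *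
    ENNReal.ofReal (Real.exp (-(Γ * z * p.noise / (p.Pb * p.M * p.GN)))) with hB
  have hBm : Measurable B := by
    have h1 := p.measurable_UE p.Gra (p.lamU * p.Phat / (p.N * p.Mra * p.Npa))
    have h2 := p.measurable_UE (p.gN / p.GN * p.Gra)
      ((1 - 1 / p.N) * (p.lamU * p.Phat / (p.Mra * p.Npa)))
    have h3 : Measurable fun z =>
        ENNReal.ofReal (Real.exp (-(p.Gra * z * p.noise / (p.Pu * p.Mra * p.GN)))) := by fun_prop
    have h4 : Measurable fun z =>
        ENNReal.ofReal (Real.exp (-(Γ * z * p.noise / (p.Pb * p.M * p.GN)))) := by fun_prop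
    exact (((h3.mul h1).mul h2).const_mul _).mul h4
  have hBz : ∀ z, 0 < z → B z = ENNReal.ofReal p.Pco * ENNReal.ofReal (p.Pra z) *
      ENNReal.ofReal (Real.exp (-(Γ * z * p.noise / (p.Pb * p.M * p.GN)))) := by
    intro z hz
    rw [hB, Params.Pra, ENNReal.ofReal_mul (mul_nonneg (Real.exp_pos _).le (p.U_nonneg _ _ _)),
      ENNReal.ofReal_mul (Real.exp_pos _).le, p.ofReal_U hz p.Gra_pos.le,
      p.ofReal_U hz (p.rel_nonneg p.Gra_pos.le)]
    rfl
  have hVz : ∀ z, 0 < z → ∀ T, 0 ≤ T → p.VE T l z = ENNReal.ofReal (p.V z T l) :=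
    fun z hz T hT => (p.ofReal_V hz hT l).symm
  have hUz : ∀ z, 0 < z → ∀ T, 0 ≤ T → p.UE T l z = ENNReal.ofReal (p.U z T l) :=
    fun z hz T hT => (p.ofReal_U hz hT l).symm
  have hrel := fun j k => p.relT_nonneg hΓ j k
  have h1 := Params.lintegral_tagged hS.bs_law (b := S.bs) rfl
    (u := fun j k => p.UE (p.relT Γ (j / p.q) k) l) (v := fun j k => p.VE (p.relT Γ (j / p.q) k) l)
    (B := B) (fun _ _ => p.measurable_UE _ _) (fun _ _ => p.measurable_VE _ _) hBm
  rw [measure_iaSuccess_inter hS hΓ]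
  have h2 : ∀ᵐ ω ∂μ, (if S.bs ω ∈ p.csSet then ENNReal.ofReal p.Pco *
          ENNReal.ofReal (p.Pra (p.tagLoss (S.bs ω))) *
        (ENNReal.ofReal (Real.exp (-(Γ * p.tagLoss (S.bs ω) * p.noise / (p.Pb * p.M * p.GN)))) *
          ∏ k ∈ Finset.range p.Kcs, if p.SecDet (S.bs ω) k
            then ENNReal.ofReal (p.V (p.tagLoss (S.bs ω)) (p.relT Γ (p.tagSec (S.bs ω) / p.q) k) l)
            else ENNReal.ofReal (p.U (p.tagLoss (S.bs ω)) (p.relT Γ (p.tagSec (S.bs ω) / p.q) k) l))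
        else 0) =
      if S.bs ω ∈ p.csSet then B (p.tagLoss (S.bs ω)) * ∏ k ∈ Finset.range p.Kcs,
        (if p.SecDet (S.bs ω) k then p.VE (p.relT Γ (p.tagSec (S.bs ω) / p.q) k) l (p.tagLoss (S.bs ω))
          else p.UE (p.relT Γ (p.tagSec (S.bs ω) / p.q) k) l (p.tagLoss (S.bs ω))) else 0 := by
    filter_upwards [ae_generic p hS.bs_law] with ω hω
    have hz : 0 < p.tagLoss (S.bs ω) := Params.Generic.tagLoss_pos hω
    by_cases hc : S.bs ω ∈ p.csSet
    · simp_rw [hVz _ hz _ (hrel _ _), hUz _ hz _ (hrel _ _)]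
      rw [if_pos hc, if_pos hc, hBz _ hz]
      ring
    · rw [if_neg hc, if_neg hc]
  have h3 := (lintegral_congr_ae h2).trans h1
  refine (Eq.trans ?_ h3).trans ?_
  · refine lintegral_congr fun ω => ?_
    congr
  have hterm : ∀ j ∈ Finset.range p.Kcs, (∫⁻ z in Set.Ioi 0, B z * p.VE (p.relT Γ (j / p.q) j) l z *
        (∏ k ∈ (Finset.range p.Kcs).erase j, (ENNReal.ofReal (1 - p.Pdet) *
          p.UE (p.relT Γ (j / p.q) k) l z + ENNReal.ofReal (p.Pbeyond z) *
          p.VE (p.relT Γ (j / p.q) k) l z)) * p.detDensity z) =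
      ∫⁻ z in Set.Ioi 0, ENNReal.ofReal (p.PdlDensity Γ z / p.Kcs) := by
    intro j hj
    refine setLIntegral_congr_fun measurableSet_Ioi fun z hz => ?_
    have hz' : 0 < z := hz
    have hK : (0 : ℝ) < p.Kcs := by exact_mod_cast p.Kcs_pos
    have hP1 : 0 ≤ 1 - p.Pdet := sub_nonneg.2 (Pdet_le_one p hS.bs_law)
    have hPb := p.Pbeyond_nonneg hz'.le
    have hr : p.relT Γ (j / p.q) j = Γ := if_pos rfl
    have hF : ∀ T, 0 ≤ T → ENNReal.ofReal (1 - p.Pdet) * p.UE T l z +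
        ENNReal.ofReal (p.Pbeyond z) * p.VE T l z =
        ENNReal.ofReal (p.V z T l * p.Pbeyond z + p.U z T l * (1 - p.Pdet)) := by
      intro T hT
      rw [hUz z hz' T hT, hVz z hz' T hT, ← ENNReal.ofReal_mul hP1, ← ENNReal.ofReal_mul hPb,
        ← ENNReal.ofReal_add (mul_nonneg hP1 (p.U_nonneg _ _ _)) (mul_nonneg hPb (p.V_nonneg _ _ _))]
      congr 1; ring
    have hFn : ∀ T, 0 ≤ p.V z T l * p.Pbeyond z + p.U z T l * (1 - p.Pdet) := fun T =>
      add_nonneg (mul_nonneg (p.V_nonneg _ _ _) hPb) (mul_nonneg (p.U_nonneg _ _ _) hP1)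
    have hprod : ∏ k ∈ (Finset.range p.Kcs).erase j, (ENNReal.ofReal (1 - p.Pdet) *
          p.UE (p.relT Γ (j / p.q) k) l z + ENNReal.ofReal (p.Pbeyond z) *
          p.VE (p.relT Γ (j / p.q) k) l z) =
        ENNReal.ofReal ((p.V z Γ l * p.Pbeyond z + p.U z Γ l * (1 - p.Pdet)) ^ (p.q - 1) *
          (p.V z (p.gN / p.GN * Γ) l * p.Pbeyond z +
            p.U z (p.gN / p.GN * Γ) l * (1 - p.Pdet)) ^ (p.Kcs - p.q)) := by
      rw [Finset.prod_congr rfl fun k _ => hF _ (hrel _ _),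
        p.prod_relT Γ (fun T => ENNReal.ofReal (p.V z T l * p.Pbeyond z + p.U z T l * (1 - p.Pdet)))
          (Finset.mem_range.1 hj), ENNReal.ofReal_mul (pow_nonneg (hFn _) _),
        ENNReal.ofReal_pow (hFn _), ENNReal.ofReal_pow (hFn _)]
    have hPco : 0 ≤ p.Pco := (Real.exp_pos _).le
    have hPra := p.Pra_nonneg z
    have hPt := p.Ptilde_nonneg z
    have hV := p.V_nonneg z Γ l
    have hE := (Real.exp_pos (-(Γ * z * p.noise / (p.Pb * p.M * p.GN)))).le
    show B z * p.VE (p.relT Γ (j / p.q) j) l z * _ * p.detDensity z = _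
    rw [hprod, hr, hVz z hz' Γ hΓ, hBz z hz', Params.detDensity, ← ENNReal.ofReal_mul hPco,
      ← ENNReal.ofReal_mul (mul_nonneg hPco hPra),
      ← ENNReal.ofReal_mul (mul_nonneg (mul_nonneg hPco hPra) hE),
      ← ENNReal.ofReal_mul (mul_nonneg (mul_nonneg (mul_nonneg hPco hPra) hE) hV),
      ← ENNReal.ofReal_mul hPt, ← ENNReal.ofReal_mul (mul_nonneg (mul_nonneg (mul_nonneg
        (mul_nonneg hPco hPra) hE) hV) (mul_nonneg (pow_nonneg (hFn _) _) (pow_nonneg (hFn _) _)))]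
    congr 1
    rw [Params.PdlDensity, ← hl, mul_comm (p.Pbeyond z) (p.V z (p.gN / p.GN * Γ) l),
      mul_comm (1 - p.Pdet) (p.U z (p.gN / p.GN * Γ) l)]
    field_simp
  rw [Finset.sum_congr rfl hterm, Finset.sum_const, Finset.card_range, nsmul_eq_mul,
    ← lintegral_const_mul' _ _ (ENNReal.natCast_ne_top _)]
  refine setLIntegral_congr_fun measurableSet_Ioi fun z hz => ?_
  have hK : (0 : ℝ) < p.Kcs := by exact_mod_cast p.Kcs_pos
  show (p.Kcs : ℝ≥0∞) * ENNReal.ofReal (p.PdlDensity Γ z / p.Kcs) = _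
  rw [← ENNReal.ofReal_natCast, ← ENNReal.ofReal_mul hK.le, mul_div_cancel₀ _ hK.ne']

/-- Probability that initial access succeeds and the data signal has an SINR of at least `Γ`, in
closed form. -/
theorem measureReal_iaSuccess_inter (hS : S.HasLaw μ) {Γ : ℝ} (hΓ : 0 ≤ Γ) :
    μ.real (S.iaSuccess μ ∩ {ω | ENNReal.ofReal Γ ≤ S.dlSINR ω}) =
      ∫ z in Set.Ioi 0, p.PdlDensity Γ z := by
  rw [integral_eq_lintegral_of_nonneg_ae, ← lintegral_PdlDensity hS hΓ]
  · rfl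
  · filter_upwards [ae_restrict_mem measurableSet_Ioi] with z hz
    exact Params.PdlDensity_nonneg hS.bs_law Γ hz
  · exact (Params.aemeasurable_PdlDensity hS.bs_law hΓ).aestronglyMeasurable

lemma iaSuccess_inter_zero : S.iaSuccess μ ∩ {ω | ENNReal.ofReal 0 ≤ S.dlSINR ω} = S.iaSuccess μ := by
  simp

lemma measurableSet_iaSuccess (hS : S.HasLaw μ) : MeasurableSet (S.iaSuccess μ) := by
  rw [← iaSuccess_inter_zero]
  exact measurableSet_iaSuccess_inter hS 0

theorem etaIA_eq (hS : S.HasLaw μ) : S.etaIA μ = p.etaIAFormula := by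
  rw [p.etaIAFormula_eq, ← measureReal_iaSuccess_inter hS le_rfl, iaSuccess_inter_zero, etaIA]

theorem PDL_eq (hS : S.HasLaw μ) {Γ : ℝ} (hΓ : 0 ≤ Γ) : S.PDL μ Γ = p.PDLFormula Γ := by
  rw [p.PDLFormula_eq, ← measureReal_iaSuccess_inter hS hΓ, ← etaIA_eq hS, PDL,
    Measure.real, cond_apply (measurableSet_iaSuccess hS), ENNReal.toReal_mul, ENNReal.toReal_inv,
    one_div, etaIA]
  rfl

end Network

lemma integral_one_add_poissonLaw {m : ℝ} (hm : 0 ≤ m) :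
    ∫ n : ℕ, (1 + (n : ℝ)) ∂(poissonLaw m) = 1 + m := by
  have h1 := hasSum_one_poissonMeasure m.toNNReal
  rw [Real.coe_toNNReal m hm] at h1
  have h2 : HasSum (fun n : ℕ => Real.exp (-m) * m ^ n / n.factorial * n) m := by
    rw [← hasSum_nat_add_iff' 1]
    have h3 := h1.mul_left m
    simp only [Finset.range_one, Finset.sum_singleton, Nat.cast_zero, mul_zero, sub_zero]
    rw [mul_one] at h3
    refine (congrArg (fun f => HasSum f m) (funext fun n => ?_)).mpr h3
    rw [Nat.factorial_succ]
    push_cast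
    have := Nat.cast_ne_zero (R := ℝ).2 n.factorial_ne_zero
    have h4 : (n : ℝ) + 1 ≠ 0 := by positivity
    field_simp
    ring
  have h3 := (h1.add h2).tsum_eq
  rw [poissonLaw, integral_poissonMeasure, Real.coe_toNNReal m hm, ← h3]
  refine tsum_congr fun n => ?_
  rw [smul_eq_mul]; ring

lemma lintegral_exp_mul_rpow {s b : ℝ} (hs : 0 < s) (hb : 0 < b) :
    ∫⁻ z in Set.Ioi 0, ENNReal.ofReal (z ^ (s - 1) * Real.exp (-b * z)) =
      ENNReal.ofReal (Real.Gamma s * b ^ (-s)) := by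
  have h1 := integrableOn_rpow_mul_exp_neg_mul_rpow (p := 1) (s := s - 1) (by linarith) one_pos hb
  have h2 := integral_rpow_mul_exp_neg_mul_rpow (p := 1) (q := s - 1) one_pos (by linarith) hb
  simp only [Real.rpow_one, div_one, sub_add_cancel, mul_one] at h1 h2
  rw [← ofReal_integral_eq_lintegral_ofReal h1, h2, mul_comm]
  filter_upwards [ae_restrict_mem measurableSet_Ioi] with z hz
  exact mul_nonneg (Real.rpow_nonneg (le_of_lt hz) _) (Real.exp_pos _).le

lemma lintegral_rpow_neg_div_lt_top {s C : ℝ} (hs : 0 < s) :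
    ∫⁻ t in Set.Ioi 1, ENNReal.ofReal (C * t ^ (-s)) * ENNReal.ofReal (1 / (1 + t)) < ⊤ := by
  have h1 : IntegrableOn (fun t : ℝ => |C| * t ^ (-s - 1)) (Set.Ioi 1) :=
    (integrableOn_Ioi_rpow_of_lt (by linarith) one_pos).const_mul _
  refine lt_of_le_of_lt (setLIntegral_mono_ae' measurableSet_Ioi ?_)
    ((hasFiniteIntegral_iff_ofReal ?_).1 h1.2)
  · refine Eventually.of_forall fun t ht => ?_
    have ht' : (1 : ℝ) < t := ht
    rw [← ENNReal.ofReal_mul' (by positivity)]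
    refine ENNReal.ofReal_le_ofReal ?_
    rw [Real.rpow_sub_one (by positivity)]
    have h2 : 0 ≤ t ^ (-s) := Real.rpow_nonneg (by positivity) _
    calc C * t ^ (-s) * (1 / (1 + t)) ≤ |C| * t ^ (-s) * (1 / (1 + t)) := by
          have := le_abs_self C
          have h3 : (0 : ℝ) ≤ 1 / (1 + t) := by positivity
          gcongr
      _ ≤ |C| * t ^ (-s) * (1 / t) := by
          have h3 : 1 / (1 + t) ≤ 1 / t := one_div_le_one_div_of_le (by positivity) (by linarith)
          gcongr
      _ = |C| * (t ^ (-s) / t) := by ring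
  · filter_upwards [ae_restrict_mem measurableSet_Ioi] with t ht
    have ht' : (1 : ℝ) < t := ht
    positivity

namespace Params

variable {p : Params} {Ω : Type*} [MeasurableSpace Ω] {μ : Measure Ω} [IsProbabilityMeasure μ]
  {X : ℕ → Ω → ℂ} {mark : ℕ → Ω → ℝ × ℝ}

lemma fZ1_le (p : Params) : ∃ A B : ℝ, 0 ≤ A ∧ 0 ≤ B ∧ ∀ z, 0 < z → p.fZ1 z ≤
    A * z ^ (2 / p.alphaL - 1) + B * z ^ (2 / p.alphaN - 1) := by
  have h1 := p.lam_pos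
  have h2 := p.alphaL_pos
  have h3 := p.alphaN_pos
  have h4 := p.beta_pos
  have hK : (0 : ℝ) < p.Kcs := by exact_mod_cast p.Kcs_pos
  refine ⟨2 * Real.pi * p.lam / p.Kcs * (1 / p.alphaL) * (1 / p.beta) ^ (2 / p.alphaL),
    2 * Real.pi * p.lam / p.Kcs * (1 / p.alphaN) * (1 / p.beta) ^ (2 / p.alphaN), by positivity,
    by positivity, fun z hz => ?_⟩
  have hL := p.h_mem _ (p.invL_pos hz).le
  have hN := p.h_mem _ (p.invN_pos hz).le
  have h5 : 0 ≤ 1 - p.h (p.invN z) := by linarith [hN.2]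
  have h6 : 1 - p.h (p.invN z) ≤ 1 := by linarith [hN.1]
  have hc : 0 ≤ 2 * Real.pi * p.lam / p.Kcs := by positivity
  have hexp : ∀ (x : ℝ) (g : ℝ → ℝ), (∀ r, 0 < r → 0 ≤ g r) →
      Real.exp (-(2 * Real.pi * p.lam / p.Kcs) * ∫ r in Set.Ioc 0 x, g r) ≤ 1 := by
    intro x g hg
    rw [Real.exp_le_one_iff, neg_mul, neg_nonpos]
    exact mul_nonneg hc (setIntegral_nonneg measurableSet_Ioc fun r hr => hg r hr.1)
  have e1 := hexp (p.invL z) (fun r => p.h r * r) fun r hr => mul_nonneg (p.h_mem r hr.le).1 hr.le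
  have e2 := hexp (p.invN z) (fun r => (1 - p.h r) * r) fun r hr =>
    mul_nonneg (sub_nonneg.2 (p.h_mem r hr.le).2) hr.le
  have hz1 : 0 ≤ z ^ (2 / p.alphaL - 1) := Real.rpow_nonneg hz.le _
  have hz2 : 0 ≤ z ^ (2 / p.alphaN - 1) := Real.rpow_nonneg hz.le _
  have p1 := (Real.exp_pos (-(2 * Real.pi * p.lam / p.Kcs) * ∫ r in Set.Ioc 0 (p.invL z), p.h r * r)).le
  have p2 := (Real.exp_pos
    (-(2 * Real.pi * p.lam / p.Kcs) * ∫ r in Set.Ioc 0 (p.invN z), (1 - p.h r) * r)).le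
  unfold fZ1
  refine add_le_add ?_ ?_
  · rw [mul_assoc, mul_assoc]
    refine mul_le_of_le_one_right (by positivity) ?_
    exact mul_le_one₀ hL.2 (mul_nonneg p1 p2) (mul_le_one₀ e1 p2 e2)
  · rw [mul_assoc, mul_assoc]
    refine mul_le_of_le_one_right (by positivity) ?_
    exact mul_le_one₀ h6 (mul_nonneg p2 p1) (mul_le_one₀ e2 p1 e1)

lemma Pra_le_one {z : ℝ} (hz : 0 ≤ z) : p.Pra z ≤ 1 := by
  have h1 := p.Gra_pos
  have h2 := p.noise_pos
  have h3 := p.Pu_pos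
  have h4 := p.GN_pos
  refine mul_le_one₀ (mul_le_one₀ ?_ (p.U_nonneg _ _ _) (p.U_le_one _ _ _)) (p.U_nonneg _ _ _)
    (p.U_le_one _ _ _)
  rw [Real.exp_le_one_iff, neg_nonpos]
  positivity

lemma Phat_nonneg (h : IsMarkedPoisson μ X mark p.lam (unifLaw.prod (expMeasure 1))) :
    0 ≤ p.Phat := by
  have h1 : 0 ≤ 1 - p.Pdet := sub_nonneg.2 (Pdet_le_one p h)
  have h2 : 0 ≤ p.Pdet := p.Pbeyond_nonneg le_rfl
  exact sub_nonneg.2 (pow_le_one₀ h1 (by linarith))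

lemma Pbeyond_le (h : IsMarkedPoisson μ X mark p.lam (unifLaw.prod (expMeasure 1))) {z : ℝ}
    (hz : 0 ≤ z) : p.Pbeyond z ≤ p.Pdet := by
  have h2 : 0 ≤ p.Pdet := p.Pbeyond_nonneg le_rfl
  rw [← ENNReal.ofReal_le_ofReal_iff h2, ← p.Pbeyond_zero, ofReal_Pbeyond p h hz,
    ofReal_Pbeyond p h le_rfl]
  exact lintegral_mono_set (Set.Ioi_subset_Ioi hz)

lemma PdlDensity_le (h : IsMarkedPoisson μ X mark p.lam (unifLaw.prod (expMeasure 1)))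
    {Γ z : ℝ} (hz : 0 < z) : p.PdlDensity Γ z ≤
      p.Kcs * Real.exp (-(p.noise / (p.Pb * p.M * p.GN) * Γ) * z) * p.fZ1 z := by
  have h1 : 0 ≤ 1 - p.Pdet := sub_nonneg.2 (Pdet_le_one p h)
  have h2 := p.Pbeyond_nonneg hz.le
  have h3 := p.fZ1_nonneg hz
  have h4 := p.Pra_nonneg z
  have h5 := p.Ptilde_nonneg z
  have h6 := fun T => p.V_nonneg z T (p.lam / (p.M * p.Kcs))
  have h7 := fun T => p.U_nonneg z T (p.lam / (p.M * p.Kcs))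
  have h6' := fun T => p.V_le_one z T (p.lam / (p.M * p.Kcs))
  have h7' := fun T => p.U_le_one z T (p.lam / (p.M * p.Kcs))
  have h8 : 0 ≤ p.Pco := (Real.exp_pos _).le
  have h9 : p.Pco ≤ 1 := by
    rw [Pco, Real.exp_le_one_iff, neg_nonpos]
    have := p.lam_pos
    have := p.lamU_pos
    have := Phat_nonneg h
    positivity
  have h10 : p.Pbeyond z ≤ p.Pdet := Pbeyond_le h hz.le
  have hF : ∀ T, 0 ≤ p.V z T (p.lam / (p.M * p.Kcs)) * p.Pbeyond z +
      p.U z T (p.lam / (p.M * p.Kcs)) * (1 - p.Pdet) := fun T =>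
    add_nonneg (mul_nonneg (h6 T) h2) (mul_nonneg (h7 T) h1)
  have hF1 : ∀ T, p.V z T (p.lam / (p.M * p.Kcs)) * p.Pbeyond z +
      p.U z T (p.lam / (p.M * p.Kcs)) * (1 - p.Pdet) ≤ 1 := fun T => by
    have a1 := mul_le_of_le_one_left h2 (h6' T)
    have a2 := mul_le_of_le_one_left h1 (h7' T)
    linarith
  unfold PdlDensity
  rw [mul_comm (p.Pbeyond z) (p.V z (p.gN / p.GN * Γ) _),
    mul_comm (1 - p.Pdet) (p.U z (p.gN / p.GN * Γ) _)]
  have e : Real.exp (-(Γ * z * p.noise / (p.Pb * p.M * p.GN))) =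
      Real.exp (-(p.noise / (p.Pb * p.M * p.GN) * Γ) * z) := by
    congr 1; ring
  rw [e, mul_comm _ (p.Kcs : ℝ)]
  have hE : 0 ≤ (p.Kcs : ℝ) * Real.exp (-(p.noise / (p.Pb * p.M * p.GN) * Γ) * z) := by positivity
  refine mul_le_mul_of_nonneg_right ?_ h3
  have m1 := mul_le_of_le_one_right hE (pow_le_one₀ (n := p.q - 1) (hF Γ) (hF1 Γ))
  have n1 := mul_nonneg hE (pow_nonneg (hF Γ) (p.q - 1))
  have m2 := mul_le_of_le_one_right n1
    (pow_le_one₀ (n := p.Kcs - p.q) (hF (p.gN / p.GN * Γ)) (hF1 (p.gN / p.GN * Γ)))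
  have n2 := mul_nonneg n1 (pow_nonneg (hF (p.gN / p.GN * Γ)) (p.Kcs - p.q))
  have m3 := mul_le_of_le_one_right n2 (h6' Γ)
  have n3 := mul_nonneg n2 (h6 Γ)
  have m4 := mul_le_of_le_one_right n3 (p.Ptilde_le_one hz.le)
  have n4 := mul_nonneg n3 h5
  have m5 := mul_le_of_le_one_right n4 (Pra_le_one (p := p) hz.le)
  have n5 := mul_nonneg n4 h4
  have m6 := mul_le_of_le_one_right n5 h9
  exact m6.trans (m5.trans (m4.trans (m3.trans (m2.trans m1))))

/-- Power decay of the tail of the SINR in the data phase. -/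
lemma lintegral_PdlDensity_le (h : IsMarkedPoisson μ X mark p.lam (unifLaw.prod (expMeasure 1))) :
    ∃ A B : ℝ, ∀ Γ, 0 < Γ → ∫⁻ z in Set.Ioi 0, ENNReal.ofReal (p.PdlDensity Γ z) ≤
      ENNReal.ofReal (A * Γ ^ (-(2 / p.alphaL))) + ENNReal.ofReal (B * Γ ^ (-(2 / p.alphaN))) := by
  obtain ⟨A, B, hA, hB, hAB⟩ := p.fZ1_le
  have h2 := p.alphaL_pos
  have h3 := p.alphaN_pos
  have hn := p.noise_pos
  have hPb := p.Pb_pos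
  have hG := p.GN_pos
  have hM : (0 : ℝ) < p.M := by exact_mod_cast p.M_pos
  set κ : ℝ := p.noise / (p.Pb * p.M * p.GN) with hκ
  have hκ0 : 0 < κ := by positivity
  refine ⟨p.Kcs * A * (Real.Gamma (2 / p.alphaL) * κ ^ (-(2 / p.alphaL))),
    p.Kcs * B * (Real.Gamma (2 / p.alphaN) * κ ^ (-(2 / p.alphaN))), fun Γ hΓ => ?_⟩
  have hb : 0 < κ * Γ := by positivity
  calc ∫⁻ z in Set.Ioi 0, ENNReal.ofReal (p.PdlDensity Γ z)
      ≤ ∫⁻ z in Set.Ioi 0, (ENNReal.ofReal (p.Kcs * A) *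
          ENNReal.ofReal (z ^ (2 / p.alphaL - 1) * Real.exp (-(κ * Γ) * z)) +
          ENNReal.ofReal (p.Kcs * B) *
          ENNReal.ofReal (z ^ (2 / p.alphaN - 1) * Real.exp (-(κ * Γ) * z))) := by
        refine setLIntegral_mono_ae' measurableSet_Ioi (Eventually.of_forall fun z hz => ?_)
        have hz' : 0 < z := hz
        have hz1 : 0 ≤ z ^ (2 / p.alphaL - 1) := Real.rpow_nonneg hz'.le _
        have hz2 : 0 ≤ z ^ (2 / p.alphaN - 1) := Real.rpow_nonneg hz'.le _
        rw [← ENNReal.ofReal_mul (by positivity), ← ENNReal.ofReal_mul (by positivity),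
          ← ENNReal.ofReal_add (by positivity) (by positivity)]
        refine ENNReal.ofReal_le_ofReal ((PdlDensity_le h hz').trans ?_)
        refine (mul_le_mul_of_nonneg_left (hAB z hz') (by positivity)).trans_eq ?_
        ring
    _ = _ := by
        rw [lintegral_add_left (by fun_prop), lintegral_const_mul _ (by fun_prop),
          lintegral_const_mul _ (by fun_prop), lintegral_exp_mul_rpow (by positivity) hb,
          lintegral_exp_mul_rpow (by positivity) hb, ← ENNReal.ofReal_mul (by positivity),
          ← ENNReal.ofReal_mul (by positivity), Real.mul_rpow hκ0.le hΓ.le,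
          Real.mul_rpow hκ0.le hΓ.le]
        congr 2 <;> ring

end Params

lemma log_one_add_eq_integral {x : ℝ} (hx : 0 ≤ x) :
    ∫ t in (0 : ℝ)..x, 1 / (1 + t) = Real.log (1 + x) := by
  have h := intervalIntegral.integral_comp_add_left (fun t : ℝ => 1 / t) (a := 0) (b := x) 1
  rw [h, integral_one_div_of_pos (by linarith) (by linarith)]
  simp

namespace Network

variable {p : Params} {Ω : Type*} {S : Network p Ω} [MeasurableSpace Ω] {μ : Measure Ω}
  [IsProbabilityMeasure μ]

lemma dlSINR_lt_top (ω : Ω) : S.dlSINR ω < ⊤ := by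
  refine ENNReal.div_lt_top ENNReal.ofReal_ne_top ?_
  exact (lt_of_lt_of_le (ENNReal.ofReal_pos.2 p.noise_pos) le_add_self).ne'

lemma measurable_dlSINR (hS : S.HasLaw μ) : Measurable fun ω => (S.dlSINR ω).toReal := by
  refine measurable_of_Ici fun t => ?_
  have e : (fun ω => (S.dlSINR ω).toReal) ⁻¹' Set.Ici t = {ω | ENNReal.ofReal t ≤ S.dlSINR ω} := by
    ext ω
    exact (ENNReal.ofReal_le_iff_le_toReal (dlSINR_lt_top ω).ne).symm
  rw [e]
  have hx : Measurable fun ω => p.tagPos (S.bs ω) := p.measurable_tagPos.comp hS.measurable_bs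
  have hz : Measurable fun ω => p.tagLoss (S.bs ω) := p.measurable_tagLoss.comp hS.measurable_bs
  have h4 := Params.measurableSet_DlPass t
    (fun k => hS.measurable_bs (p.measurableSet_SecDet k)) hz
    ((measurable_sectorIdx p.N).comp hx) hS.typical_measurable.snd.fst hS.measurable_dl
  have e2 : {ω | ENNReal.ofReal t ≤ S.dlSINR ω} = {ω | Params.DlPass t (p.SecDet (S.bs ω))
      (p.tagLoss (S.bs ω)) (sectorIdx p.N (p.tagPos (S.bs ω))) (S.typical ω).2.1 (S.dl ω)} := by
    ext ω
    exact S.dl_pass_iff t ω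
  rw [e2]
  exact h4

lemma etaS_eq (hS : S.HasLaw μ) :
    S.etaS μ = 1 / (1 + 1.28 * p.lamU * p.etaIAFormula / p.lam) := by
  have h0 : 0 ≤ p.lamU * S.etaIA μ * p.cellArea :=
    mul_nonneg (mul_nonneg p.lamU_pos.le measureReal_nonneg) (div_nonneg (by norm_num) p.lam_pos.le)
  have h1 : ∫ ω, (1 + (S.load ω : ℝ)) ∂μ = 1 + p.lamU * S.etaIA μ * p.cellArea := by
    rw [← integral_one_add_poissonLaw h0, ← hS.load_law,
      integral_map hS.load_measurable.aemeasurable (by fun_prop)]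
  rw [etaS, h1, ← etaIA_eq hS, Params.cellArea]
  congr 2
  ring

/-- Layer cake formula for the spectral efficiency. -/
lemma lintegral_log (hS : S.HasLaw μ) :
    ∫⁻ ω, ENNReal.ofReal (Real.log (1 + (S.dlSINR ω).toReal)) ∂(μ[|S.iaSuccess μ]) =
      ∫⁻ Γ in Set.Ioi 0, ENNReal.ofReal (p.PDLFormula Γ) * ENNReal.ofReal (1 / (1 + Γ)) := by
  have hlc := lintegral_comp_eq_lintegral_meas_le_mul (μ[|S.iaSuccess μ])
    (f := fun ω => (S.dlSINR ω).toReal) (g := fun t => 1 / (1 + t))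
    (Eventually.of_forall fun ω => ENNReal.toReal_nonneg)
    (measurable_dlSINR hS).aemeasurable (fun t ht => ?_) ?_
  · simp_rw [log_one_add_eq_integral ENNReal.toReal_nonneg] at hlc
    rw [hlc]
    refine setLIntegral_congr_fun measurableSet_Ioi fun t ht => ?_
    have ht' : 0 < t := ht
    show _ * _ = _ * _
    congr 1
    rw [← PDL_eq hS ht'.le, PDL, ofReal_measureReal]
    congr 1
    ext ω
    exact (ENNReal.ofReal_le_iff_le_toReal (dlSINR_lt_top ω).ne).symm
  · refine ContinuousOn.intervalIntegrable_of_Icc (le_of_lt ht) ?_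
    refine continuousOn_const.div (by fun_prop) fun x hx => ?_
    have := hx.1
    positivity
  · filter_upwards [ae_restrict_mem measurableSet_Ioi] with t ht
    have ht' : (0 : ℝ) < t := ht
    show (0 : ℝ) ≤ 1 / (1 + t)
    positivity

lemma PDLFormula_nonneg (hS : S.HasLaw μ) {Γ : ℝ} (hΓ : 0 ≤ Γ) : 0 ≤ p.PDLFormula Γ := by
  rw [← PDL_eq hS hΓ]; exact measureReal_nonneg

lemma aemeasurable_PDLFormula (hS : S.HasLaw μ) :
    AEMeasurable p.PDLFormula (volume.restrict (Set.Ioi 0)) := by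
  have h : Antitone (S.PDL μ) := fun a b hab =>
    measureReal_mono fun ω hω => (ENNReal.ofReal_le_ofReal hab).trans hω
  refine h.measurable.aemeasurable.congr ?_
  filter_upwards [ae_restrict_mem measurableSet_Ioi] with t ht
  exact PDL_eq hS (le_of_lt ht)

lemma lintegral_PDLFormula_lt_top (hS : S.HasLaw μ) :
    ∫⁻ Γ in Set.Ioi 0, ENNReal.ofReal (p.PDLFormula Γ) * ENNReal.ofReal (1 / (1 + Γ)) < ⊤ := by
  have hle1 : ∀ Γ, 0 ≤ Γ → p.PDLFormula Γ ≤ 1 := fun Γ hΓ => by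
    rw [← PDL_eq hS hΓ]
    exact ENNReal.toReal_le_of_le_ofReal zero_le_one (by simpa using prob_le_one)
  obtain ⟨A, B, hAB⟩ := Params.lintegral_PdlDensity_le hS.bs_law
  have hη : 0 ≤ 1 / p.etaIAFormula := by
    rw [← etaIA_eq hS]; exact one_div_nonneg.2 measureReal_nonneg
  rw [← Set.Ioc_union_Ioi_eq_Ioi (zero_le_one (α := ℝ)),
    lintegral_union measurableSet_Ioi (Set.Ioc_disjoint_Ioi le_rfl)]
  refine ENNReal.add_lt_top.2 ⟨?_, ?_⟩
  · refine lt_of_le_of_lt (setLIntegral_mono_ae' (g := fun _ => 1) measurableSet_Ioc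
      (Eventually.of_forall fun t ht => ?_)) (by simp)
    have ht0 := ht.1
    refine mul_le_one' (ENNReal.ofReal_le_one.2 (hle1 t ht0.le)) (ENNReal.ofReal_le_one.2 ?_)
    rw [div_le_one (by positivity)]
    linarith
  · have h1 := lintegral_rpow_neg_div_lt_top (s := 2 / p.alphaL) (C := A)
      (div_pos two_pos p.alphaL_pos)
    have h2 := lintegral_rpow_neg_div_lt_top (s := 2 / p.alphaN) (C := B)
      (div_pos two_pos p.alphaN_pos)
    have h3 := ENNReal.mul_lt_top (ENNReal.ofReal_lt_top (r := 1 / p.etaIAFormula))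
      (ENNReal.add_lt_top.2 ⟨h1, h2⟩)
    refine lt_of_le_of_lt ?_ h3
    rw [← lintegral_add_left (by fun_prop), ← lintegral_const_mul _ (by fun_prop)]
    refine setLIntegral_mono_ae' measurableSet_Ioi (Eventually.of_forall fun t ht => ?_)
    have ht0 : (0 : ℝ) < t := lt_trans one_pos ht
    rw [← add_mul, ← mul_assoc]
    gcongr
    rw [p.PDLFormula_eq, ENNReal.ofReal_mul hη]
    gcongr
    rw [← measureReal_iaSuccess_inter hS ht0.le, ofReal_measureReal, lintegral_PdlDensity hS ht0.le]
    exact hAB t ht0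

lemma integrableOn_PDLFormula (hS : S.HasLaw μ) :
    IntegrableOn (fun Γ => p.PDLFormula Γ / (1 + Γ)) (Set.Ioi 0) := by
  have hm : AEMeasurable (fun Γ => p.PDLFormula Γ / (1 + Γ)) (volume.restrict (Set.Ioi 0)) :=
    (aemeasurable_PDLFormula hS).div (by fun_prop)
  refine ⟨hm.aestronglyMeasurable, (hasFiniteIntegral_iff_ofReal ?_).2 ?_⟩
  · filter_upwards [ae_restrict_mem measurableSet_Ioi] with t ht
    have ht' : (0 : ℝ) < t := ht
    exact div_nonneg (PDLFormula_nonneg hS ht'.le) (by positivity)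
  · refine lt_of_le_of_lt (le_of_eq ?_) (lintegral_PDLFormula_lt_top hS)
    refine setLIntegral_congr_fun measurableSet_Ioi fun t ht => ?_
    have ht' : (0 : ℝ) < t := ht
    show ENNReal.ofReal (p.PDLFormula t / (1 + t)) = _
    rw [← ENNReal.ofReal_mul (PDLFormula_nonneg hS ht'.le), mul_one_div]

lemma log_nonneg_dlSINR (ω : Ω) : 0 ≤ Real.log (1 + (S.dlSINR ω).toReal) :=
  Real.log_nonneg (le_add_of_nonneg_right ENNReal.toReal_nonneg)

lemma integrable_log (hS : S.HasLaw μ) :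
    Integrable (fun ω => Real.log (1 + (S.dlSINR ω).toReal)) (μ[|S.iaSuccess μ]) := by
  have hm : Measurable fun ω => Real.log (1 + (S.dlSINR ω).toReal) :=
    ((measurable_dlSINR hS).const_add 1).log
  refine ⟨hm.aestronglyMeasurable, (hasFiniteIntegral_iff_ofReal
    (Eventually.of_forall log_nonneg_dlSINR)).2 ?_⟩
  rw [lintegral_log hS]
  exact lintegral_PDLFormula_lt_top hS

lemma integral_log (hS : S.HasLaw μ) :
    ∫ ω, Real.log (1 + (S.dlSINR ω).toReal) ∂(μ[|S.iaSuccess μ]) =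
      ∫ Γ in Set.Ioi 0, p.PDLFormula Γ / (1 + Γ) := by
  rw [integral_eq_lintegral_of_nonneg_ae (Eventually.of_forall log_nonneg_dlSINR)
    (integrable_log hS).1, lintegral_log hS, integral_eq_lintegral_of_nonneg_ae _
    (integrableOn_PDLFormula hS).1]
  · congr 1
    refine setLIntegral_congr_fun measurableSet_Ioi fun t ht => ?_
    have ht' : (0 : ℝ) < t := ht
    show _ = ENNReal.ofReal (p.PDLFormula t / (1 + t))
    rw [← ENNReal.ofReal_mul (PDLFormula_nonneg hS ht'.le), mul_one_div]
  · filter_upwards [ae_restrict_mem measurableSet_Ioi] with t ht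
    have ht' : (0 : ℝ) < t := ht
    exact div_nonneg (PDLFormula_nonneg hS ht'.le) (by positivity)

lemma rate_eq : S.rate μ =
    fun ω => S.etaS μ * (p.W / Real.log 2) * Real.log (1 + (S.dlSINR ω).toReal) := by
  funext ω
  rw [rate, Real.logb]
  ring

theorem integrable_rate (hS : S.HasLaw μ) : Integrable (S.rate μ) (μ[|S.iaSuccess μ]) := by
  rw [rate_eq]
  exact (integrable_log hS).const_mul _

theorem avgUPT_eq (hS : S.HasLaw μ) : S.avgUPT μ =
    max 0 (1 - (p.Mcs * p.Ncs * p.tauCs + p.Mra * p.Nra * p.tauRa) / p.T) *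
      (p.etaIAFormula / (1 + 1.28 * p.lamU * p.etaIAFormula / p.lam)) *
      ∫ Γ in Set.Ioi (0 : ℝ), p.W / Real.log 2 * (p.PDLFormula Γ / (1 + Γ)) := by
  have h1 : 1 - p.etaTO =
      max 0 (1 - (p.Mcs * p.Ncs * p.tauCs + p.Mra * p.Nra * p.tauRa) / p.T) := by
    rw [Params.etaTO, Params.overhead, ← max_sub_sub_left, sub_self, max_comm]
  rw [avgUPT, rate_eq, integral_const_mul, integral_log hS, integral_const_mul, etaS_eq hS, h1,
    etaIA_eq hS]
  ring

end Network

end InitialAccess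
end

theorem theorem3 (p : InitialAccess.Params) {Ω : Type*} [MeasurableSpace Ω]
    (μ : MeasureTheory.Measure Ω) [MeasureTheory.IsProbabilityMeasure μ]
    (S : InitialAccess.Network p Ω) (hS : S.HasLaw μ) :
    S.etaIA μ = p.etaIAFormula ∧
    (∀ Γ : ℝ, 0 ≤ Γ → S.PDL μ Γ = p.PDLFormula Γ) ∧
    MeasureTheory.Integrable (S.rate μ) (ProbabilityTheory.cond μ (S.iaSuccess μ)) ∧
    MeasureTheory.IntegrableOn (fun Γ : ℝ => p.W / Real.log 2 * (p.PDLFormula Γ / (1 + Γ)))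
      (Set.Ioi 0) ∧
    S.avgUPT μ =
      max 0 (1 - (p.Mcs * p.Ncs * p.tauCs + p.Mra * p.Nra * p.tauRa) / p.T) *
        (p.etaIAFormula / (1 + 1.28 * p.lamU * p.etaIAFormula / p.lam)) *
        ∫ Γ in Set.Ioi (0 : ℝ), p.W / Real.log 2 * (p.PDLFormula Γ / (1 + Γ)) := by
  exact ⟨InitialAccess.Network.etaIA_eq hS, fun Γ hΓ => InitialAccess.Network.PDL_eq hS hΓ,
    InitialAccess.Network.integrable_rate hS,
    (InitialAccess.Network.integrableOn_PDLFormula hS).const_mul _,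
    InitialAccess.Network.avgUPT_eq hS⟩
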